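/- Let $(M^n,g)$, $n\ge 2$, be a closed (compact, without boundary) smooth Riemannian manifold with a fixed spin structure, let $\Sigma_gM$ be its spinor bundle, with its fibre inner product $\langle\cdot,\cdot\rangle$, the spin connection $\nabla$ and Clifford multiplication $\gamma$ (with $\gamma(X)\gamma(Y)+\gamma(Y)\gamma(X)=-2g(X,Y)$), and let $\slashed D=\sum_l\gamma(e_l)\nabla_{e_l}$ be the Dirac operator. More generally, $\Sigma_gM$ may be the bundle associated with the spin structure and any finite-dimensional real or complex Clifford module with an inner product for which Clifford multiplication by vectors is skew-adjoint. Fix $n<p<\infty$ and $0<\Lambda_1\le\Lambda_2$. Write $L^2=L^2(M,\Sigma_gM)$ and let $H^1=W^{1,2}(M,\Sigma_gM)$ carry the norm $(\|\psi\|_{L^2}^2+\|\nabla\psi\|_{L^2}^2)^{1/2}$. Let $\mathcal A=W^{1,p}(M,\operatorname{End}(\Sigma_gM))$ with the norm $\|F\|_{\mathcal A}=\|F\|_{L^p}+\|\nabla F\|_{L^p}$, and let $$\mathcal P_{\Lambda_1,\Lambda_2}=\{A\in\mathcal A:\ A(x)=A(x)^*,\ \Lambda_1\mathrm{Id}\le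 A(x)\le\Lambda_2\mathrm{Id}\ \text{for a.e. } x\},$$ with the topology of $\|\cdot\|_{\mathcal A}$. For $A\in\mathcal P_{\Lambda_1,\Lambda_2}$ let $A^{1/2}$ be the pointwise positive square root and $A^{-1/2}$ its inverse, let $\mathcal H_A$ be the space $L^2$ with the inner product $(\psi,\phi)_A=\int_M\langle A\psi,\phi\rangle\,dv_g$, let $B(A)=A^{-1}\slashed D$ as an operator on $\mathcal H_A$ with domain $H^1$, and let $\widetilde D(A)=A^{-1/2}\slashed D A^{-1/2}$ as an operator on $L^2$. 1. For every $A\in\mathcal P_{\Lambda_1,\Lambda_2}$ the map $U_A:\mathcal H_A\to L^2$, $U_A\psi=A^{1/2}\psi$, is a linear isometric isomorphism with inverse $\phi\mapsto A^{-1/2}\phi$; the operator $\widetilde D(A)$ has domain $\{\psi\in L^2: A^{-1/2}\psi\in H^1\}=H^1$, and $\widetilde D(A)=U_A\,B(A)\,U_A^{-1}$, domains included. 2. For every $A\in\mathcal P_{\Lambda_1,\Lambda_2}$ the operator $\widetilde D(A)$ with domain $H^1$ is self-adjoint on $L^2$, hence closed and densely defined; $B(A)$ with domain $H^1$ is self-adjoint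 on $\mathcal H_A$; and $B(A)$ and $\widetilde D(A)$ are isospectral: they have the same spectrum and, for every $\lambda$, $\dim\ker(B(A)-\lambda)=\dim\ker(\widetilde D(A)-\lambda)$. 3. For every $A\in\mathcal P_{\Lambda_1,\Lambda_2}$ the operator $\widetilde D(A)$ is bounded from $H^1$ to $L^2$. If $I\subset\mathbb R$ is an interval and $I\ni t\mapsto A_t\in\mathcal P_{\Lambda_1,\Lambda_2}$ is continuous, then $I\to\mathcal B(H^1,L^2)$, $t\mapsto\widetilde D(A_t)$, is continuous for the operator norm. In particular, $\mathcal P_{\Lambda_1,\Lambda_2}\to\mathcal B(H^1,L^2)$, $A\mapsto\widetilde D(A)$, is continuous. -/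

import Mathlib

open MeasureTheory Bundle
open scoped Manifold ContDiff ENNReal

universe u

set_option linter.unusedSectionVars false

namespace WeightedDirac

noncomputable section

/-! ### Closed Riemannian manifolds and their volume -/

/-- Smooth Riemannian metrics on an `n`-dimensional manifold without boundary. -/
abbrev RMetric (n : ℕ) (M : Type*) [TopologicalSpace M]
    [ChartedSpace (EuclideanSpace ℝ (Fin n)) M] [IsManifold (𝓡 n) ∞ M] :=
  ContMDiffRiemannianMetric (𝓡 n) ∞ (EuclideanSpace ℝ (Fin n))
    (fun x : M => TangentSpace (𝓡 n) x)

section Riemannian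

variable {n : ℕ} {M : Type*} [TopologicalSpace M] [ChartedSpace (EuclideanSpace ℝ (Fin n)) M]
  [IsManifold (𝓡 n) ∞ M]

/-- The `a`-th coordinate vector field `∂_a` of the chart `φ` at `x₀`, at the point `φ⁻¹(y)`. -/
def coordVector (x₀ : M) (a : Fin n) (y : EuclideanSpace ℝ (Fin n)) :
    TangentSpace (𝓡 n) ((chartAt (EuclideanSpace ℝ (Fin n)) x₀).symm y) :=
  mfderiv (𝓡 n) (𝓡 n) (chartAt (EuclideanSpace ℝ (Fin n)) x₀).symm y
    (EuclideanSpace.single a (1 : ℝ))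

/-- The matrix `g(∂_a, ∂_b)` of the metric in the chart at `x₀`. -/
def gramMatrix (g : RMetric n M) (x₀ : M) (y : EuclideanSpace ℝ (Fin n)) :
    Matrix (Fin n) (Fin n) ℝ :=
  Matrix.of fun a b => g.inner _ (coordVector x₀ a y) (coordVector x₀ b y)

/-- The measure `√det(g_{ab}) dy¹ … dyⁿ` of the chart at `x₀`, as a measure on `M` that is carried
by the domain of the chart. -/
def chartVolume [MeasurableSpace M] (g : RMetric n M) (x₀ : M) : Measure M :=
  Measure.map (chartAt (EuclideanSpace ℝ (Fin n)) x₀).symm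
    ((volume.restrict (chartAt (EuclideanSpace ℝ (Fin n)) x₀).target).withDensity
      fun y => ENNReal.ofReal (Real.sqrt (gramMatrix g x₀ y).det))

/-- The Riemannian volume measure `dv_g`. The measures `chartVolume g x₀` agree on the overlaps of
the charts, and their supremum is the measure that restricts to each of them. -/
def riemannianVolume [MeasurableSpace M] (g : RMetric n M) : Measure M :=
  ⨆ x₀ : M, chartVolume g x₀

end Riemannian

/-! ### The spin group and Clifford modules -/

/-- The quadratic form `v ↦ -‖v‖²` on `ℝⁿ`, so that `v · v = -‖v‖²` in the Clifford algebra. -/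
def cliffordForm (n : ℕ) : QuadraticForm ℝ (EuclideanSpace ℝ (Fin n)) :=
  -(LinearMap.BilinMap.toQuadraticMap (innerₗ (EuclideanSpace ℝ (Fin n))))

/-- The `k`-th standard basis vector of `ℝⁿ`. -/
abbrev stdVec (n : ℕ) (k : Fin n) : EuclideanSpace ℝ (Fin n) := EuclideanSpace.single k (1 : ℝ)

/-- A Clifford module structure over `𝕜 = ℝ` or `ℂ` on the inner product space `S`: a linear map
`γ` with `γ(v)γ(w) + γ(w)γ(v) = -2⟨v,w⟩` for which every `γ(v)` is skew-adjoint. The spinor module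
is the irreducible one; it is not singled out, so that all (real or complex) spinor modules are
covered. -/
structure CliffordModule (𝕜 : Type*) [RCLike 𝕜] (n : ℕ) (S : Type*) [NormedAddCommGroup S]
    [InnerProductSpace 𝕜 S] [NormedSpace ℝ S] [IsScalarTower ℝ 𝕜 S] where
  γ : EuclideanSpace ℝ (Fin n) →ₗ[ℝ] Module.End 𝕜 S
  clifford : ∀ v w, γ v * γ w + γ w * γ v = (-2 * inner ℝ v w) • (1 : Module.End 𝕜 S)
  skew : ∀ v s t, inner 𝕜 (γ v s) t = -inner 𝕜 s (γ v t)

section Clifford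

variable {𝕜 : Type*} [RCLike 𝕜] {n : ℕ} {S : Type*} [NormedAddCommGroup S]
  [InnerProductSpace 𝕜 S] [NormedSpace ℝ S] [IsScalarTower ℝ 𝕜 S]

theorem CliffordModule.sq (c : CliffordModule 𝕜 n S) (v : EuclideanSpace ℝ (Fin n)) :
    c.γ v * c.γ v = algebraMap ℝ (Module.End 𝕜 S) (cliffordForm n v) := by
  have h := c.clifford v v
  rw [← two_smul ℝ, mul_smul] at h
  have h2 := congrArg (fun T => (2⁻¹ : ℝ) • T) h
  simp only [smul_smul] at h2
  norm_num at h2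
  rw [h2, Algebra.algebraMap_eq_smul_one]
  simp [cliffordForm]

/-- The representation of the Clifford algebra on the Clifford module. -/
def CliffordModule.rep (c : CliffordModule 𝕜 n S) :
    CliffordAlgebra (cliffordForm n) →ₐ[ℝ] Module.End 𝕜 S :=
  CliffordAlgebra.lift (cliffordForm n) ⟨c.γ, c.sq⟩

/-- The representation as a linear map into the continuous endomorphisms. -/
def CliffordModule.repCLM [FiniteDimensional 𝕜 S] (c : CliffordModule 𝕜 n S)
    (a : CliffordAlgebra (cliffordForm n)) : S →L[𝕜] S :=
  LinearMap.toContinuousLinearMap (c.rep a)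

/-- Clifford multiplication by the `k`-th vector of an orthonormal frame. -/
def CliffordModule.γ' [FiniteDimensional 𝕜 S] (c : CliffordModule 𝕜 n S) (k : Fin n) : S →L[𝕜] S :=
  LinearMap.toContinuousLinearMap (c.γ (stdVec n k))

/-- The contraction `T*M ⊗ Σ ≅ TM ⊗ Σ → Σ`, `(Ψ_l)_l ↦ ∑_l γ(e_l) Ψ_l`, in an orthonormal frame. -/
def CliffordModule.contract [FiniteDimensional 𝕜 S] (c : CliffordModule 𝕜 n S) :
    PiLp 2 (fun _ : Fin n => S) →L[𝕜] S :=
  ∑ l, (c.γ' l).comp (PiLp.proj 2 (fun _ : Fin n => S) l)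

end Clifford

/-! ### Spin structures -/

/-- A spin structure on a compact manifold `(M, g)`, by cocycles: a finite open cover with smooth
orthonormal frames, and a smooth `Spin(n)`-valued cocycle that covers the changes of frame. The
value `lift i j x` matters only for `x ∈ U i ∩ U j`. -/
structure SpinStructure {n : ℕ} {M : Type*} [TopologicalSpace M]
    [ChartedSpace (EuclideanSpace ℝ (Fin n)) M] [IsManifold (𝓡 n) ∞ M] (g : RMetric n M) where
  /-- The number of sets of the cover. -/
  N : ℕ
  U : Fin N → Set M
  isOpen : ∀ i, IsOpen (U i)
  cover : ∀ x, ∃ i, x ∈ U i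
  frame : Fin N → Fin n → (x : M) → TangentSpace (𝓡 n) x
  frame_smooth : ∀ i k, ContMDiffOn (𝓡 n) (𝓡 n).tangent ∞
    (fun x => (⟨x, frame i k x⟩ : TangentBundle (𝓡 n) M)) (U i)
  frame_orthonormal : ∀ i, ∀ x ∈ U i, ∀ k l,
    g.inner x (frame i k x) (frame i l x) = if k = l then 1 else 0
  lift : Fin N → Fin N → M → spinGroup (cliffordForm n)
  /-- Smoothness as a map into the finite-dimensional vector space underlying the Clifford
  algebra, tested with all linear functionals. -/
  lift_smooth : ∀ i j, ∀ f : CliffordAlgebra (cliffordForm n) →ₗ[ℝ] ℝ,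
    ContMDiffOn (𝓡 n) 𝓘(ℝ, ℝ) ∞
      (fun x => f (lift i j x : CliffordAlgebra (cliffordForm n))) (U i ∩ U j)
  cocycle : ∀ i j k, ∀ x ∈ U i ∩ U j ∩ U k, lift i j x * lift j k x = lift i k x
  /-- `lift i j x` acts on `ℝⁿ` as the orthogonal matrix that turns coordinates with respect to the
  frame `j` into coordinates with respect to the frame `i`. -/
  covers : ∀ i j, ∀ x ∈ U i ∩ U j, ∀ k,
    (lift i j x : CliffordAlgebra (cliffordForm n)) *
        CliffordAlgebra.ι (cliffordForm n) (stdVec n k) *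
        star (lift i j x : CliffordAlgebra (cliffordForm n)) =
      ∑ l, g.inner x (frame i l x) (frame j k x) •
        CliffordAlgebra.ι (cliffordForm n) (stdVec n l)

section Spin

variable {n : ℕ} {M : Type*} [TopologicalSpace M] [ChartedSpace (EuclideanSpace ℝ (Fin n)) M]
  [IsManifold (𝓡 n) ∞ M] {g : RMetric n M}

open Classical in
/-- The first index `i` with `x ∈ U i`. -/
def SpinStructure.idx (θ : SpinStructure g) (x : M) : Fin θ.N :=
  Fin.find (fun i => x ∈ θ.U i) (θ.cover x)

open Classical in
theorem SpinStructure.mem_idx (θ : SpinStructure g) (x : M) : x ∈ θ.U (θ.idx x) :=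
  Fin.find_spec (θ.cover x)

/-- The coefficients `g(∇_{e_l} e_j, e_k)` of the Levi-Civita connection in the orthonormal frame
`i`, by the Koszul formula (the derivatives of the constants `g(e_j, e_k)` drop out). -/
def SpinStructure.christoffel (θ : SpinStructure g) (i : Fin θ.N) (l j k : Fin n) (x : M) : ℝ :=
  (1 / 2) *
    (g.inner x (VectorField.mlieBracket (𝓡 n) (θ.frame i l) (θ.frame i j) x) (θ.frame i k x)
      - g.inner x (VectorField.mlieBracket (𝓡 n) (θ.frame i l) (θ.frame i k) x) (θ.frame i j x)
      - g.inner x (VectorField.mlieBracket (𝓡 n) (θ.frame i j) (θ.frame i k) x) (θ.frame i l x))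

end Spin

/-! ### The spinor bundle and its connection -/

section Spinor

variable {𝕜 : Type*} [RCLike 𝕜] {n : ℕ} {M : Type*} [TopologicalSpace M]
  [ChartedSpace (EuclideanSpace ℝ (Fin n)) M] [IsManifold (𝓡 n) ∞ M] {g : RMetric n M}
  {S : Type*} [NormedAddCommGroup S] [InnerProductSpace 𝕜 S] [NormedSpace ℝ S]
  [IsScalarTower ℝ 𝕜 S] [FiniteDimensional 𝕜 S]

theorem repCLM_mul (c : CliffordModule 𝕜 n S) (a b : CliffordAlgebra (cliffordForm n)) (s : S) :
    c.repCLM a (c.repCLM b s) = c.repCLM (a * b) s := by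
  simp [CliffordModule.repCLM]

theorem continuousOn_repCLM (θ : SpinStructure g) (c : CliffordModule 𝕜 n S) (i j : Fin θ.N) :
    ContinuousOn (fun x => c.repCLM (θ.lift j i x : CliffordAlgebra (cliffordForm n)))
      (θ.U i ∩ θ.U j) := by
  have hfin : FiniteDimensional ℝ S := FiniteDimensional.trans ℝ 𝕜 S
  rw [Set.inter_comm]
  refine (continuousOn_clm_apply (𝕜 := 𝕜)).2 fun s => ?_
  let b := Module.finBasis ℝ S
  have hb : ContinuousOn (fun x => b.equivFun.toContinuousLinearEquiv
      (c.repCLM (θ.lift j i x : CliffordAlgebra (cliffordForm n)) s)) (θ.U j ∩ θ.U i) := by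
    refine continuousOn_pi.2 fun k => ?_
    let f : CliffordAlgebra (cliffordForm n) →ₗ[ℝ] ℝ :=
      { toFun := fun a => b.equivFun (c.rep a s) k
        map_add' := by intro x y; simp
        map_smul' := by intro r x; simp }
    exact (θ.lift_smooth j i f).continuousOn
  have := b.equivFun.toContinuousLinearEquiv.symm.continuous.comp_continuousOn hb
  refine this.congr fun x _ => ?_
  simp

/-- The spinor bundle `Σ_g M`, glued from the trivial bundles `U i × S` by the action of the
spin cocycle on the Clifford module `S`. Its fibre at `x` is `S`, by means of the frame with index
`idx x`; as `Spin(n)` acts isometrically, the inner product of `S` is the fibre metric. -/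
def spinorBundle (θ : SpinStructure g) (c : CliffordModule 𝕜 n S) :
    VectorBundleCore 𝕜 M S (Fin θ.N) where
  baseSet := θ.U
  isOpen_baseSet := θ.isOpen
  indexAt := θ.idx
  mem_baseSet_at := θ.mem_idx
  coordChange i j x := c.repCLM (θ.lift j i x)
  coordChange_self i x hx s := by
    have h : θ.lift i i x = 1 := by
      have := θ.cocycle i i i x ⟨⟨hx, hx⟩, hx⟩
      exact mul_eq_left.1 this
    simp [h, CliffordModule.repCLM]
  continuousOn_coordChange i j := continuousOn_repCLM θ c i j
  coordChange_comp i j k x hx s := by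
    have := θ.cocycle k j i x ⟨⟨hx.2, hx.1.2⟩, hx.1.1⟩
    rw [repCLM_mul, ← this]
    rfl

/-- The connection form of the spin connection in the frame `i`, applied to `e_l`:
`¼ ∑_{j,k} g(∇_{e_l} e_j, e_k) γ(e_j) γ(e_k)`. -/
def spinConnection (θ : SpinStructure g) (c : CliffordModule 𝕜 n S) (i : Fin θ.N) (l : Fin n)
    (x : M) : S →L[𝕜] S :=
  (1 / 4 : ℝ) • ∑ j, ∑ k, θ.christoffel i l j k x • (c.γ' j).comp (c.γ' k)

/-- A vector bundle with fibre `V` and connection, described in the frames of a spin structure. A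
section is a map `σ : M → V`, where `σ x` is the value in the frame `idx x`; then `trans i x (σ x)`
is the value in the frame `i`, and `conn i l x` is the connection form of the frame `i`, applied to
the vector `e_l` of that frame. -/
structure FramedBundle (𝕜 : Type*) [RCLike 𝕜] (θ : SpinStructure g) (V : Type*)
    [NormedAddCommGroup V] [NormedSpace 𝕜 V] where
  trans : Fin θ.N → M → V →L[𝕜] V
  conn : Fin θ.N → Fin n → M → V →L[𝕜] V

/-- The spinor bundle with the spin connection. -/
def spinorFramed (θ : SpinStructure g) (c : CliffordModule 𝕜 n S) : FramedBundle 𝕜 θ S where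
  trans i x := (spinorBundle θ c).coordChange ((spinorBundle θ c).indexAt x) i x
  conn i l x := spinConnection θ c i l x

/-- The bundle `End(Σ_g M)` with the induced connection `(∇_{e_l} F) = ∂_{e_l} F + [ω_l, F]`. -/
def endFramed (θ : SpinStructure g) (c : CliffordModule 𝕜 n S) :
    FramedBundle 𝕜 θ (S →L[𝕜] S) where
  trans i x :=
    (ContinuousLinearMap.compL 𝕜 S S S
      ((spinorBundle θ c).coordChange ((spinorBundle θ c).indexAt x) i x)).comp
    ((ContinuousLinearMap.compL 𝕜 S S S).flip
      ((spinorBundle θ c).coordChange i ((spinorBundle θ c).indexAt x) x))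
  conn i l x :=
    ContinuousLinearMap.compL 𝕜 S S S (spinConnection θ c i l x) -
      (ContinuousLinearMap.compL 𝕜 S S S).flip (spinConnection θ c i l x)

end Spinor

/-! ### Sobolev spaces of sections -/

section Sobolev

variable {𝕜 : Type*} [RCLike 𝕜] {n : ℕ} {M : Type*} [TopologicalSpace M]
  [ChartedSpace (EuclideanSpace ℝ (Fin n)) M] [IsManifold (𝓡 n) ∞ M]
  {g : RMetric n M} {θ : SpinStructure g}
  {V : Type*} [NormedAddCommGroup V] [NormedSpace 𝕜 V] [NormedSpace ℝ V] [IsScalarTower ℝ 𝕜 V]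

/-- Smooth sections: the representation in every frame `i` is smooth on `U i`. -/
def FramedBundle.IsSmooth (E : FramedBundle 𝕜 θ V) (σ : M → V) : Prop :=
  ∀ i, ContMDiffOn (𝓡 n) 𝓘(ℝ, V) ∞ (fun x => E.trans i x (σ x)) (θ.U i)

/-- The covariant derivative of a section; its components are `∇_{e_l} σ`, where `(e_l)` is the
frame `idx x`, so that its norm is the pointwise norm `|∇σ| = (∑_l |∇_{e_l} σ|²)^{1/2}`. -/
def FramedBundle.covDeriv (E : FramedBundle 𝕜 θ V) (σ : M → V) (x : M) :
    PiLp 2 (fun _ : Fin n => V) :=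
  WithLp.toLp 2 fun l =>
    (show V from mfderiv (𝓡 n) 𝓘(ℝ, V) (fun y => E.trans (θ.idx x) y (σ y)) x
      (θ.frame (θ.idx x) l x)) + E.conn (θ.idx x) l x (E.trans (θ.idx x) x (σ x))

theorem FramedBundle.IsSmooth.mdifferentiableAt {E : FramedBundle 𝕜 θ V} {σ : M → V}
    (h : E.IsSmooth σ) (x : M) :
    MDifferentiableAt (𝓡 n) 𝓘(ℝ, V) (fun y => E.trans (θ.idx x) y (σ y)) x :=
  ((h (θ.idx x)).contMDiffAt ((θ.isOpen _).mem_nhds (θ.mem_idx x))).mdifferentiableAt (by simp)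

theorem FramedBundle.covDeriv_add {E : FramedBundle 𝕜 θ V} {σ τ : M → V}
    (h : E.IsSmooth σ) (h' : E.IsSmooth τ) (x : M) :
    E.covDeriv (σ + τ) x = E.covDeriv σ x + E.covDeriv τ x := by
  have key := ((h.mdifferentiableAt x).hasMFDerivAt.add (h'.mdifferentiableAt x).hasMFDerivAt).mfderiv
  have e : (fun y => E.trans (θ.idx x) y ((σ + τ) y)) =
      (fun y => E.trans (θ.idx x) y (σ y)) + fun y => E.trans (θ.idx x) y (τ y) := by
    ext y; simp
  ext l
  simp only [FramedBundle.covDeriv, PiLp.add_apply]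
  rw [e, key]
  simp only [Pi.add_apply, map_add]
  exact add_add_add_comm _ _ _ _

theorem FramedBundle.covDeriv_smul {E : FramedBundle 𝕜 θ V} {σ : M → V}
    (h : E.IsSmooth σ) (a : 𝕜) (x : M) :
    E.covDeriv (a • σ) x = a • E.covDeriv σ x := by
  let L : V →L[ℝ] V := (a • ContinuousLinearMap.id 𝕜 V).restrictScalars ℝ
  have key := (L.hasMFDerivAt.comp x (h.mdifferentiableAt x).hasMFDerivAt).mfderiv
  have e : (fun y => E.trans (θ.idx x) y ((a • σ) y)) =
      L ∘ fun y => E.trans (θ.idx x) y (σ y) := by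
    ext y; simp [L]
  ext l
  simp only [FramedBundle.covDeriv, PiLp.smul_apply]
  rw [e, key]
  simp only [Pi.smul_apply, map_smul]
  exact (smul_add a _ _).symm

/-- The pairs `(σ, ∇σ)`, for smooth sections `σ`, in `L^q × L^q`; the product carries the norm
`(‖σ‖^r + ‖∇σ‖^r)^{1/r}`. -/
def smoothGraph [MeasurableSpace M] (E : FramedBundle 𝕜 θ V) (r q : ℝ≥0∞)
    [Fact (1 ≤ r)] [Fact (1 ≤ q)] :
    Submodule 𝕜 (WithLp r (Lp V q (riemannianVolume g) ×
      Lp (PiLp 2 (fun _ : Fin n => V)) q (riemannianVolume g))) where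
  carrier := {P | ∃ σ : M → V, E.IsSmooth σ ∧ P.fst =ᵐ[riemannianVolume g] σ ∧
    P.snd =ᵐ[riemannianVolume g] E.covDeriv σ}
  zero_mem' := by
    refine ⟨0, fun i => ?_, Lp.coeFn_zero _ _ _, ?_⟩
    · simpa using contMDiffOn_const
    · refine (Lp.coeFn_zero _ _ _).trans (Filter.Eventually.of_forall fun x => ?_)
      have h0 : E.IsSmooth (0 : M → V) := fun i => by simpa using contMDiffOn_const
      have := FramedBundle.covDeriv_smul h0 (0 : 𝕜) x
      simpa using this.symm
  add_mem' := by
    rintro P Q ⟨σ, hσ, h1, h2⟩ ⟨τ, hτ, k1, k2⟩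
    refine ⟨σ + τ, fun i => ?_, (Lp.coeFn_add _ _).trans (h1.add k1), ?_⟩
    · refine ((hσ i).add (hτ i)).congr fun x _ => by simp
    · refine (Lp.coeFn_add _ _).trans ((h2.add k2).trans ?_)
      exact Filter.Eventually.of_forall fun x => (FramedBundle.covDeriv_add hσ hτ x).symm
  smul_mem' := by
    rintro a P ⟨σ, hσ, h1, h2⟩
    refine ⟨a • σ, fun i => ?_, (Lp.coeFn_smul _ _).trans (h1.const_smul a), ?_⟩
    · let L : V →L[ℝ] V := (a • ContinuousLinearMap.id 𝕜 V).restrictScalars ℝ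
      refine (L.contMDiff.comp_contMDiffOn (hσ i)).congr fun x _ => by simp [L]
    · refine (Lp.coeFn_smul _ _).trans ((h2.const_smul a).trans ?_)
      exact Filter.Eventually.of_forall fun x => (FramedBundle.covDeriv_smul hσ a x).symm

/-- The Sobolev space `W^{1,q}` of sections, for `q < ∞`: the closure of the smooth sections in the
norm `(‖σ‖_{L^q}^r + ‖∇σ‖_{L^q}^r)^{1/r}`. An element is recorded as the pair `(σ, ∇σ)` of the
section and its covariant derivative, which the section determines. -/
abbrev sobolevSpace [MeasurableSpace M] (E : FramedBundle 𝕜 θ V) (r q : ℝ≥0∞)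
    [Fact (1 ≤ r)] [Fact (1 ≤ q)] :
    Submodule 𝕜 (WithLp r (Lp V q (riemannianVolume g) ×
      Lp (PiLp 2 (fun _ : Fin n => V)) q (riemannianVolume g))) :=
  (smoothGraph E r q).topologicalClosure

end Sobolev

/-! ### Spectral notions for unbounded operators -/

section Unbounded

variable {𝕜 : Type*} [RCLike 𝕜] {H : Type*} [NormedAddCommGroup H] [InnerProductSpace 𝕜 H]

/-- The resolvent set: `T - z` is a bijection from the domain onto `H` with bounded inverse `R`. -/
def resolventSet (T : H →ₗ.[𝕜] H) : Set 𝕜 :=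
  {z | ∃ R : H →L[𝕜] H, (∀ x : T.domain, R (T x - z • (x : H)) = x) ∧
    ∀ y, ∃ x : T.domain, (x : H) = R y ∧ T x - z • (x : H) = y}

/-- The spectrum of an unbounded operator. -/
def pmapSpectrum (T : H →ₗ.[𝕜] H) : Set 𝕜 := (resolventSet T)ᶜ

/-- The kernel of `T - z`. -/
def pmapEigenspace (T : H →ₗ.[𝕜] H) (z : 𝕜) : Submodule 𝕜 T.domain :=
  LinearMap.ker (T.toFun - z • T.domain.subtype)

end Unbounded

/-- Isospectral operators: they have the same spectrum and the same eigenvalues with the same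
multiplicities. -/
def Isospectral {𝕜 : Type*} [RCLike 𝕜] {H H' : Type u} [NormedAddCommGroup H]
    [InnerProductSpace 𝕜 H] [NormedAddCommGroup H'] [InnerProductSpace 𝕜 H']
    (T : H →ₗ.[𝕜] H) (T' : H' →ₗ.[𝕜] H') : Prop :=
  pmapSpectrum T = pmapSpectrum T' ∧
    ∀ z, Module.rank 𝕜 (pmapEigenspace T z) = Module.rank 𝕜 (pmapEigenspace T' z)

/-! ### Square roots -/

open Classical in
/-- The positive square root of a positive endomorphism (and `0` if there is none). -/
def posSqrt {𝕜 : Type*} [RCLike 𝕜] {S : Type*} [NormedAddCommGroup S] [InnerProductSpace 𝕜 S]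
    (T : S →L[𝕜] S) : S →L[𝕜] S :=
  if h : ∃ R : S →L[𝕜] S, R.IsPositive ∧ R.comp R = T then h.choose else 0

/-! ### The weighted Dirac operators -/

section Weighted

variable {𝕜 : Type*} [RCLike 𝕜] {n : ℕ} {M : Type*} [TopologicalSpace M]
  [ChartedSpace (EuclideanSpace ℝ (Fin n)) M] [IsManifold (𝓡 n) ∞ M]
  [MeasurableSpace M] {g : RMetric n M}
  {S : Type*} [NormedAddCommGroup S] [InnerProductSpace 𝕜 S] [NormedSpace ℝ S]
  [IsScalarTower ℝ 𝕜 S] [FiniteDimensional 𝕜 S]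

/-- `L²(M, Σ_g M)`. -/
abbrev L2 (_ : SpinStructure g) (_ : CliffordModule 𝕜 n S) : Type _ :=
  Lp S 2 (riemannianVolume g)

/-- `H¹(M, Σ_g M)` with the norm `(‖ψ‖² + ‖∇ψ‖²)^{1/2}`; its elements are the pairs `(ψ, ∇ψ)`. -/
abbrev H1 (θ : SpinStructure g) (c : CliffordModule 𝕜 n S) :
    Submodule 𝕜 (WithLp 2 (Lp S 2 (riemannianVolume g) ×
      Lp (PiLp 2 (fun _ : Fin n => S)) 2 (riemannianVolume g))) :=
  sobolevSpace (spinorFramed θ c) 2 2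

/-- `H¹` as a subspace of `L²`. -/
def H1inL2 (θ : SpinStructure g) (c : CliffordModule 𝕜 n S) : Submodule 𝕜 (L2 θ c) :=
  (H1 θ c).map (WithLp.fstL 2 𝕜 (Lp S 2 (riemannianVolume g))
    (Lp (PiLp 2 (fun _ : Fin n => S)) 2 (riemannianVolume g))).toLinearMap

/-- The inclusion of `H¹` in `L²`. -/
def H1.incl (θ : SpinStructure g) (c : CliffordModule 𝕜 n S) : H1 θ c →L[𝕜] L2 θ c :=
  (WithLp.fstL 2 𝕜 (Lp S 2 (riemannianVolume g))
    (Lp (PiLp 2 (fun _ : Fin n => S)) 2 (riemannianVolume g))).comp (H1 θ c).subtypeL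

/-- The Dirac operator `H¹ → L²`, `ψ ↦ ∑_l γ(e_l) ∇_{e_l} ψ`. -/
def dirac (θ : SpinStructure g) (c : CliffordModule 𝕜 n S) : H1 θ c →L[𝕜] L2 θ c :=
  (c.contract.compLpL 2 (riemannianVolume g)).comp
    ((WithLp.sndL 2 𝕜 (Lp S 2 (riemannianVolume g))
      (Lp (PiLp 2 (fun _ : Fin n => S)) 2 (riemannianVolume g))).comp (H1 θ c).subtypeL)

/-- The space `𝒜 = W^{1,p}(M, End(Σ_g M))` with the norm `‖F‖_{L^p} + ‖∇F‖_{L^p}`. -/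
abbrev WeightSpace (θ : SpinStructure g) (c : CliffordModule 𝕜 n S) (p : ℝ≥0∞) [Fact (1 ≤ p)] :
    Submodule 𝕜 (WithLp 1 (Lp (S →L[𝕜] S) p (riemannianVolume g) ×
      Lp (PiLp 2 (fun _ : Fin n => S →L[𝕜] S)) p (riemannianVolume g))) :=
  sobolevSpace (endFramed θ c) 1 p

/-- The underlying section of `End(Σ_g M)`. -/
def weightField {θ : SpinStructure g} {c : CliffordModule 𝕜 n S} {p : ℝ≥0∞} [Fact (1 ≤ p)]
    (F : WeightSpace θ c p) : M → S →L[𝕜] S :=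
  (F : WithLp 1 (Lp (S →L[𝕜] S) p (riemannianVolume g) ×
      Lp (PiLp 2 (fun _ : Fin n => S →L[𝕜] S)) p (riemannianVolume g))).fst

/-- The admissible weights `𝒫_{Λ₁,Λ₂}`: `A = A*` and `Λ₁ Id ≤ A ≤ Λ₂ Id` almost everywhere. -/
def admissible (θ : SpinStructure g) (c : CliffordModule 𝕜 n S) (p : ℝ≥0∞) [Fact (1 ≤ p)]
    (Λ₁ Λ₂ : ℝ) : Set (WeightSpace θ c p) :=
  {A | ∀ᵐ x ∂(riemannianVolume g),
    (∀ s t, inner 𝕜 (weightField A x s) t = inner 𝕜 s (weightField A x t)) ∧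
    ∀ s, Λ₁ * ‖s‖ ^ 2 ≤ RCLike.re (inner 𝕜 (weightField A x s) s) ∧
      RCLike.re (inner 𝕜 (weightField A x s) s) ≤ Λ₂ * ‖s‖ ^ 2}

variable {θ : SpinStructure g} {c : CliffordModule 𝕜 n S} {p : ℝ≥0∞} [Fact (1 ≤ p)] {Λ₁ Λ₂ : ℝ}

/-- The pointwise inverse `A⁻¹`. -/
def invField (A : admissible θ c p Λ₁ Λ₂) (x : M) : S →L[𝕜] S := Ring.inverse (weightField A.1 x)

/-- The pointwise positive square root `A^{1/2}`. -/
def sqrtField (A : admissible θ c p Λ₁ Λ₂) (x : M) : S →L[𝕜] S := posSqrt (weightField A.1 x)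

/-- `A^{-1/2} = (A^{1/2})⁻¹`. -/
def invSqrtField (A : admissible θ c p Λ₁ Λ₂) (x : M) : S →L[𝕜] S := Ring.inverse (sqrtField A x)

/-- The underlying vector space of `ℋ_A`, a copy of `L²`. -/
def WeightedL2 (_ : admissible θ c p Λ₁ Λ₂) : Type _ := L2 θ c

instance (A : admissible θ c p Λ₁ Λ₂) : AddCommGroup (WeightedL2 A) :=
  inferInstanceAs (AddCommGroup (L2 θ c))

instance (A : admissible θ c p Λ₁ Λ₂) : Module 𝕜 (WeightedL2 A) :=
  inferInstanceAs (Module 𝕜 (L2 θ c))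

/-- The identity map from `ℋ_A` to `L²`. -/
def WeightedL2.toL2 (A : admissible θ c p Λ₁ Λ₂) : WeightedL2 A ≃ₗ[𝕜] L2 θ c :=
  LinearEquiv.refl 𝕜 (L2 θ c)

/-- The weighted inner product `(ψ, φ)_A = ∫ ⟨Aψ, φ⟩ dv_g`. -/
def weightedInner (A : admissible θ c p Λ₁ Λ₂) (ψ φ : L2 θ c) : 𝕜 :=
  ∫ x, inner 𝕜 (weightField A.1 x (ψ x)) (φ x) ∂(riemannianVolume g)

theorem norm_le_of_bounds {T : S →L[𝕜] S} (hΛ : 0 < Λ₁)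
    (hs : ∀ s t, inner 𝕜 (T s) t = inner 𝕜 s (T t))
    (hb : ∀ s, Λ₁ * ‖s‖ ^ 2 ≤ RCLike.re (inner 𝕜 (T s) s) ∧
      RCLike.re (inner 𝕜 (T s) s) ≤ Λ₂ * ‖s‖ ^ 2) (s : S) : ‖T s‖ ≤ max Λ₂ 1 * ‖s‖ := by
  set K := max Λ₂ 1 with hK
  have hK0 : 0 < K := lt_of_lt_of_le one_pos (le_max_right _ _)
  have hub : ∀ u, RCLike.re (inner 𝕜 (T u) u) ≤ K * ‖u‖ ^ 2 := fun u =>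
    (hb u).2.trans (mul_le_mul_of_nonneg_right (le_max_left _ _) (sq_nonneg _))
  set t : S := ((K⁻¹ : ℝ) : 𝕜) • T s with ht
  have h0 : 0 ≤ RCLike.re (inner 𝕜 (T (s - t)) (s - t)) :=
    le_trans (mul_nonneg hΛ.le (sq_nonneg _)) (hb _).1
  have h1 : RCLike.re (inner 𝕜 (T t) s) = RCLike.re (inner 𝕜 (T s) t) := by
    rw [hs t s, ← inner_conj_symm, RCLike.conj_re]
  have h2 : RCLike.re (inner 𝕜 (T s) t) = K⁻¹ * ‖T s‖ ^ 2 := by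
    rw [ht, inner_smul_right, RCLike.re_ofReal_mul, inner_self_eq_norm_sq]
  have h3 : ‖t‖ = K⁻¹ * ‖T s‖ := by
    rw [ht, norm_smul, RCLike.norm_ofReal, abs_of_pos (inv_pos.2 hK0)]
  have h4 := hub s
  have h5 := hub t
  simp only [map_sub, inner_sub_left, inner_sub_right] at h0
  rw [h1, h2] at h0
  rw [h3] at h5
  have h6 : K * (K⁻¹ * ‖T s‖) ^ 2 = K⁻¹ * ‖T s‖ ^ 2 := by field_simp
  rw [h6] at h5
  have h7 : K⁻¹ * ‖T s‖ ^ 2 ≤ K * ‖s‖ ^ 2 := by linarith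
  have h8 : ‖T s‖ ^ 2 ≤ (K * ‖s‖) ^ 2 := by
    have := mul_le_mul_of_nonneg_left h7 hK0.le
    rw [← mul_assoc, mul_inv_cancel₀ hK0.ne', one_mul] at this
    nlinarith
  exact (sq_le_sq₀ (norm_nonneg _) (by positivity)).1 h8

theorem integrable_weighted [h : Fact (0 < Λ₁)] (A : admissible θ c p Λ₁ Λ₂) (ψ φ : L2 θ c) :
    Integrable (fun x => inner 𝕜 (weightField A.1 x (ψ x)) (φ x)) (riemannianVolume g) := by
  have hm : AEStronglyMeasurable (fun x => weightField A.1 x (ψ x)) (riemannianVolume g) := by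
    have h1 : AEStronglyMeasurable (weightField A.1) (riemannianVolume g) := Lp.aestronglyMeasurable _
    exact (ContinuousLinearMap.id 𝕜 (S →L[𝕜] S)).aestronglyMeasurable_comp₂ h1
      (Lp.aestronglyMeasurable ψ)
  have hL : MemLp (fun x => weightField A.1 x (ψ x)) 2 (riemannianVolume g) := by
    refine (Lp.memLp ψ).of_le_mul (c := max Λ₂ 1) hm ?_
    filter_upwards [A.2] with x hx
    exact norm_le_of_bounds h.out hx.1 hx.2 (ψ x)
  have hi := L2.integrable_inner (𝕜 := 𝕜) hL.toLp φ
  refine hi.congr ?_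
  filter_upwards [hL.coeFn_toLp] with x hx
  rw [hx]

theorem weightedInner_bounds [h : Fact (0 < Λ₁)] (A : admissible θ c p Λ₁ Λ₂) (ψ : L2 θ c) :
    Λ₁ * ‖ψ‖ ^ 2 ≤ RCLike.re (weightedInner A ψ ψ) ∧
      RCLike.re (weightedInner A ψ ψ) ≤ Λ₂ * ‖ψ‖ ^ 2 := by
  have hn : ‖ψ‖ ^ 2 = ∫ x, ‖ψ x‖ ^ 2 ∂(riemannianVolume g) := by
    rw [← inner_self_eq_norm_sq (𝕜 := 𝕜) ψ, L2.inner_def, ← integral_re (L2.integrable_inner ψ ψ)]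
    simp only [inner_self_eq_norm_sq]
  have hI : Integrable (fun x => ‖ψ x‖ ^ 2) (riemannianVolume g) := by
    have := (L2.integrable_inner (𝕜 := 𝕜) ψ ψ).re
    simpa only [inner_self_eq_norm_sq] using this
  have hw := integrable_weighted A ψ ψ
  rw [weightedInner, ← integral_re hw, hn, ← integral_const_mul, ← integral_const_mul]
  constructor
  · refine integral_mono_ae (hI.const_mul _) hw.re ?_
    filter_upwards [A.2] with x hx using (hx.2 _).1
  · refine integral_mono_ae hw.re (hI.const_mul _) ?_
    filter_upwards [A.2] with x hx using (hx.2 _).2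

theorem weightedInner_conj (A : admissible θ c p Λ₁ Λ₂) (ψ φ : L2 θ c) :
    starRingEnd 𝕜 (weightedInner A φ ψ) = weightedInner A ψ φ := by
  rw [weightedInner, weightedInner, ← integral_conj]
  refine integral_congr_ae ?_
  filter_upwards [A.2] with x hx
  rw [inner_conj_symm, hx.1]

theorem weightedInner_add [Fact (0 < Λ₁)] (A : admissible θ c p Λ₁ Λ₂) (ψ φ χ : L2 θ c) :
    weightedInner A (ψ + φ) χ = weightedInner A ψ χ + weightedInner A φ χ := by
  refine Eq.trans (integral_congr_ae ?_)
    (integral_add (integrable_weighted A ψ χ) (integrable_weighted A φ χ))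
  filter_upwards [Lp.coeFn_add ψ φ] with x hx
  rw [hx, Pi.add_apply, map_add, inner_add_left]

theorem weightedInner_smul (A : admissible θ c p Λ₁ Λ₂) (ψ φ : L2 θ c) (a : 𝕜) :
    weightedInner A (a • ψ) φ = starRingEnd 𝕜 a * weightedInner A ψ φ := by
  rw [weightedInner, weightedInner, ← integral_const_mul]
  refine integral_congr_ae ?_
  filter_upwards [Lp.coeFn_smul a ψ] with x hx
  rw [hx, Pi.smul_apply, map_smul, inner_smul_left]

theorem weightedInner_definite [h : Fact (0 < Λ₁)] (A : admissible θ c p Λ₁ Λ₂) (ψ : L2 θ c)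
    (hψ : weightedInner A ψ ψ = 0) : ψ = 0 := by
  have h1 := (weightedInner_bounds A ψ).1
  rw [hψ, map_zero] at h1
  have h3 : Λ₁ * ‖ψ‖ ^ 2 = 0 := le_antisymm h1 (mul_nonneg h.out.le (sq_nonneg _))
  rcases mul_eq_zero.1 h3 with h4 | h4
  · exact absurd h4 h.out.ne'
  · exact norm_eq_zero.1 ((pow_eq_zero_iff two_ne_zero).1 h4)

/-- `(·, ·)_A` is an inner product. -/
@[reducible]
def weightedCore [h : Fact (0 < Λ₁)] (A : admissible θ c p Λ₁ Λ₂) :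
    InnerProductSpace.Core 𝕜 (WeightedL2 A) where
  inner ψ φ := weightedInner A (WeightedL2.toL2 A ψ) (WeightedL2.toL2 A φ)
  conj_inner_symm _ _ := weightedInner_conj A _ _
  re_inner_nonneg ψ :=
    le_trans (mul_nonneg h.out.le (sq_nonneg _)) (weightedInner_bounds A (WeightedL2.toL2 A ψ)).1
  add_left _ _ _ := weightedInner_add A _ _ _
  smul_left _ _ a := weightedInner_smul A _ _ a
  definite _ hψ := weightedInner_definite A _ hψ

instance [Fact (0 < Λ₁)] (A : admissible θ c p Λ₁ Λ₂) : NormedAddCommGroup (WeightedL2 A) :=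
  (weightedCore A).toNormedAddCommGroup

/-- The Hilbert space `ℋ_A = (L²(M, Σ_g M), (·, ·)_A)`. -/
instance [Fact (0 < Λ₁)] (A : admissible θ c p Λ₁ Λ₂) : InnerProductSpace 𝕜 (WeightedL2 A) :=
  InnerProductSpace.ofCore (weightedCore A).toCore

theorem WeightedL2.inner_def [Fact (0 < Λ₁)] (A : admissible θ c p Λ₁ Λ₂) (ψ φ : WeightedL2 A) :
    inner 𝕜 ψ φ = weightedInner A (WeightedL2.toL2 A ψ) (WeightedL2.toL2 A φ) := rfl

instance [CompleteSpace S] [h : Fact (0 < Λ₁)] (A : admissible θ c p Λ₁ Λ₂) :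
    CompleteSpace (WeightedL2 A) := by
  have key : ∀ ψ : WeightedL2 A, Λ₁ * ‖WeightedL2.toL2 A ψ‖ ^ 2 ≤ ‖ψ‖ ^ 2 ∧
      ‖ψ‖ ^ 2 ≤ Λ₂ * ‖WeightedL2.toL2 A ψ‖ ^ 2 := fun ψ => by
    rw [← inner_self_eq_norm_sq (𝕜 := 𝕜) ψ, WeightedL2.inner_def]
    exact weightedInner_bounds A _
  let f : WeightedL2 A →L[𝕜] L2 θ c :=
    (WeightedL2.toL2 A).toLinearMap.mkContinuous (Real.sqrt Λ₁)⁻¹ fun ψ => by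
      have hs : 0 < Real.sqrt Λ₁ := Real.sqrt_pos.2 h.out
      rw [inv_mul_eq_div, le_div_iff₀ hs]
      refine (sq_le_sq₀ (by positivity) (norm_nonneg _)).1 ?_
      rw [mul_pow, Real.sq_sqrt h.out.le, mul_comm]
      exact (key ψ).1
  let f' : L2 θ c →L[𝕜] WeightedL2 A :=
    (WeightedL2.toL2 A).symm.toLinearMap.mkContinuous (Real.sqrt (max Λ₂ 0)) fun ψ => by
      refine (sq_le_sq₀ (norm_nonneg _) (by positivity)).1 ?_
      rw [mul_pow, Real.sq_sqrt (le_max_right _ _)]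
      refine ((key ((WeightedL2.toL2 A).symm ψ)).2).trans ?_
      rw [LinearEquiv.apply_symm_apply]
      exact mul_le_mul_of_nonneg_right (le_max_left _ _) (sq_nonneg _)
  let e : WeightedL2 A ≃L[𝕜] L2 θ c :=
    { WeightedL2.toL2 A with
      continuous_toFun := f.continuous
      continuous_invFun := f'.continuous }
  exact (completeSpace_congr (e := e.toEquiv) e.isUniformEmbedding).2 inferInstance

/-- The graph of `B(A) = A⁻¹ D` on the domain `H¹`. -/
def graphB [Fact (0 < Λ₁)] (A : admissible θ c p Λ₁ Λ₂) :
    Submodule 𝕜 (WeightedL2 A × WeightedL2 A) where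
  carrier := {P | ∃ η : H1 θ c, H1.incl θ c η = WeightedL2.toL2 A P.1 ∧
    WeightedL2.toL2 A P.2 =ᵐ[riemannianVolume g] fun x => invField A x (dirac θ c η x)}
  zero_mem' := by
    refine ⟨0, by simp, ?_⟩
    rw [Prod.snd_zero, map_zero, map_zero]
    filter_upwards [Lp.coeFn_zero S 2 (riemannianVolume g)] with x hx
    rw [hx, Pi.zero_apply, map_zero]
  add_mem' := by
    rintro P Q ⟨η, h1, h2⟩ ⟨η', k1, k2⟩
    refine ⟨η + η', by simp [h1, k1], ?_⟩
    rw [Prod.snd_add, map_add, map_add]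
    filter_upwards [h2, k2, Lp.coeFn_add (WeightedL2.toL2 A P.2) (WeightedL2.toL2 A Q.2),
      Lp.coeFn_add (dirac θ c η) (dirac θ c η')] with x a1 a2 a3 a4
    rw [a3, a4, Pi.add_apply, Pi.add_apply, a1, a2, map_add]
  smul_mem' := by
    rintro a P ⟨η, h1, h2⟩
    refine ⟨a • η, by simp [h1], ?_⟩
    rw [Prod.smul_snd, map_smul, map_smul]
    filter_upwards [h2, Lp.coeFn_smul a (WeightedL2.toL2 A P.2),
      Lp.coeFn_smul a (dirac θ c η)] with x a1 a2 a3
    rw [a2, a3, Pi.smul_apply, Pi.smul_apply, a1, map_smul]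

/-- The weighted Dirac operator `B(A) = A⁻¹ D` on `ℋ_A`, with domain `H¹`. -/
def opB [Fact (0 < Λ₁)] (A : admissible θ c p Λ₁ Λ₂) : WeightedL2 A →ₗ.[𝕜] WeightedL2 A :=
  (graphB A).toLinearPMap

/-- The graph of the composition `A^{-1/2} D A^{-1/2}`: the pairs `(ψ, χ)` for which `A^{-1/2} ψ` is
an element `η` of `H¹` and `χ = A^{-1/2} D η`. -/
def graphDTilde (A : admissible θ c p Λ₁ Λ₂) : Submodule 𝕜 (L2 θ c × L2 θ c) where
  carrier := {P | ∃ η : H1 θ c,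
    (H1.incl θ c η =ᵐ[riemannianVolume g] fun x => invSqrtField A x (P.1 x)) ∧
    P.2 =ᵐ[riemannianVolume g] fun x => invSqrtField A x (dirac θ c η x)}
  zero_mem' := by
    refine ⟨0, ?_, ?_⟩ <;> rw [map_zero]
    all_goals
      filter_upwards [Lp.coeFn_zero S 2 (riemannianVolume g)] with x hx
      simp only [Prod.fst_zero, Prod.snd_zero, hx, Pi.zero_apply, map_zero]
  add_mem' := by
    rintro P Q ⟨η, h1, h2⟩ ⟨η', k1, k2⟩
    refine ⟨η + η', ?_, ?_⟩ <;> rw [map_add]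
    · filter_upwards [h1, k1, Lp.coeFn_add P.1 Q.1,
        Lp.coeFn_add (H1.incl θ c η) (H1.incl θ c η')] with x a1 a2 a3 a4
      rw [Prod.fst_add, a3, a4, Pi.add_apply, Pi.add_apply, a1, a2, map_add]
    · filter_upwards [h2, k2, Lp.coeFn_add P.2 Q.2,
        Lp.coeFn_add (dirac θ c η) (dirac θ c η')] with x a1 a2 a3 a4
      rw [Prod.snd_add, a3, a4, Pi.add_apply, Pi.add_apply, a1, a2, map_add]
  smul_mem' := by
    rintro a P ⟨η, h1, h2⟩
    refine ⟨a • η, ?_, ?_⟩ <;> rw [map_smul]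
    · filter_upwards [h1, Lp.coeFn_smul a P.1, Lp.coeFn_smul a (H1.incl θ c η)] with x a1 a2 a3
      rw [Prod.smul_fst, a2, a3, Pi.smul_apply, Pi.smul_apply, a1, map_smul]
    · filter_upwards [h2, Lp.coeFn_smul a P.2, Lp.coeFn_smul a (dirac θ c η)] with x a1 a2 a3
      rw [Prod.smul_snd, a2, a3, Pi.smul_apply, Pi.smul_apply, a1, map_smul]

/-- The conjugated operator `A^{-1/2} D A^{-1/2}` on `L²`. -/
def opDTilde (A : admissible θ c p Λ₁ Λ₂) : L2 θ c →ₗ.[𝕜] L2 θ c :=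
  (graphDTilde A).toLinearPMap

end Weighted

end

end WeightedDirac

open WeightedDirac

/-! The weighted statements follow from three facts. (a) The unweighted Dirac operator `D` is
symmetric on `H¹`, and `H¹` is dense in `L²` (`inner_dirac`, `dense_range_incl`). (b) Weak solutions
are regular: if `⟨ψ, Dη⟩ = ⟨χ, η⟩` for all `η` in `H¹`, then `ψ` lies in `H¹`
(`mem_range_incl_of_weak`). (c) Multiplication by `A` and by `A^{-1/2}` preserves `H¹`, and the
latter depends continuously on `A` in operator norm (`Embeddings.mulH1`, `Embeddings.rootH1`,
`Embeddings.continuous_rootH1`).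

Given these, let `K` be multiplication by `A` on `L²` and `L` multiplication by `A^{-1/2}`. The
unitary map is `K L = A^{1/2}`. By (c), the condition `A^{-1/2} ψ ∈ H¹` is the same as `ψ ∈ H¹`. A
pair `(a', b')` in the graph of the adjoint of `L D L` says that `L a'` is a weak solution of `D (L
a') = K L b'`. By (b) it lies in `H¹`, so that the domain of the adjoint is no larger, and symmetry
gives self-adjointness. The operator `B(A)` is treated in the same way with the weighted inner
product. On `H¹` the conjugated operator is the product of `L`, `D` and `L` on `H¹`, each bounded
and norm continuous in `A`.

For (c), `A^{-1/2} = Λ₂^{-1/2} ∑ c_k (1 - A/Λ₂)^k` with `0 ≤ c_k ≤ 1`. On `L²` the factor `N = 1 -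
A/Λ₂` is a contraction by some `ρ < 1`. On `H¹` the derivative of `N^k ψ` contains `k` terms with
`∇A`. Hölder's inequality with `1/2 = 1/p + 1/q` and the embedding `H¹ ⊂ L^q` bound them, which
gives `‖N^k‖ ≤ ρ^k (2 + k r)` with `r` proportional to `‖A‖` (`Embeddings.norm_defect_pow_le`). The
series therefore converges in the bounded operators on `H¹`, locally uniformly in `A`, and no chain
rule for the square root is needed. The condition `p > n` enters through Morrey's inequality for `A`
and the Sobolev inequality for spinors (`exists_embeddings`).

For (a), in a frame and a chart `⟨σ, Dτ⟩ - ⟨Dσ, τ⟩` times the volume density is a coordinate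
divergence. To glue such computations, the spin connection has to be independent of the frame
(`covDerivIn_change`). This rests on `spin_change_of_frame`, hence on the algebraic fact that an
even skew element of the Clifford algebra that commutes with all vectors vanishes.

For (b), a weak solution is localised to a ball so small that the frame hardly varies, and is
mollified. The identity `∑ ‖∂_{v_l} u‖² = ‖D u‖²` for constant coefficients
(`sum_integral_norm_sq`), a Friedrichs commutator estimate and absorption of the small variation
bound the mollifications in `H¹` uniformly (`eLpNorm_fderiv_mollify_le`). Their limit in `L²` then
lies in `H¹` (`mem_range_of_bounded`). -/

namespace WeightedDirac

noncomputable section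

/-! ### The Clifford algebra: words in the standard generators -/

section CliffordWords

variable {n : ℕ}

/-- The real Clifford algebra of `ℝⁿ`. -/
abbrev Cl (n : ℕ) := CliffordAlgebra (cliffordForm n)

/-- The `k`-th generator of the Clifford algebra. -/
def gen (k : Fin n) : Cl n := CliffordAlgebra.ι (cliffordForm n) (stdVec n k)

theorem cliffordForm_apply (v : EuclideanSpace ℝ (Fin n)) :
    cliffordForm n v = -inner ℝ v v := by
  simp [cliffordForm]

theorem cliffordForm_polar (v w : EuclideanSpace ℝ (Fin n)) :
    QuadraticMap.polar (cliffordForm n) v w = -2 * inner ℝ v w := by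
  simp only [QuadraticMap.polar, cliffordForm_apply, inner_add_left, inner_add_right]
  rw [real_inner_comm v w]
  ring

theorem inner_stdVec (k l : Fin n) :
    inner ℝ (stdVec n k) (stdVec n l) = if k = l then (1 : ℝ) else 0 := by
  rw [EuclideanSpace.inner_single_left]
  simp [PiLp.single_apply]

theorem gen_mul_self (k : Fin n) : gen k * gen k = (-1 : Cl n) := by
  rw [gen, CliffordAlgebra.ι_sq_scalar, cliffordForm_apply, inner_stdVec]
  simp

theorem gen_mul_gen (k l : Fin n) :
    gen k * gen l + gen l * gen k = algebraMap ℝ (Cl n) (if k = l then -2 else 0) := by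
  rw [gen, gen, CliffordAlgebra.ι_mul_ι_add_swap, cliffordForm_polar, inner_stdVec]
  split_ifs <;> simp

theorem gen_anticomm {k l : Fin n} (h : k ≠ l) : gen k * gen l = -(gen l * gen k) := by
  have := gen_mul_gen k l
  rw [if_neg h, map_zero] at this
  exact eq_neg_of_add_eq_zero_left this

theorem star_gen (k : Fin n) : star (gen k) = -gen k := CliffordAlgebra.star_ι _

theorem ι_eq_sum (v : EuclideanSpace ℝ (Fin n)) :
    CliffordAlgebra.ι (cliffordForm n) v = ∑ k, v k • gen k := by
  have h : v = ∑ k, v k • stdVec n k := by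
    ext j
    simp [Pi.single_apply]
  conv_lhs => rw [h]
  simp [gen]

/-- The product of the generators in a list. -/
def word (L : List (Fin n)) : Cl n := (L.map gen).prod

theorem word_cons (k : Fin n) (L : List (Fin n)) : word (k :: L) = gen k * word L := by
  simp [word]

theorem word_append (L L' : List (Fin n)) : word (L ++ L') = word L * word L' := by
  simp [word]

theorem gen_mul_word {k : Fin n} {L : List (Fin n)} (h : k ∉ L) :
    gen k * word L = (-1 : ℝ) ^ L.length • (word L * gen k) := by
  induction L with
  | nil => simp [word]
  | cons j L ih =>
    rw [List.mem_cons, not_or] at h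
    rw [word_cons, ← mul_assoc, gen_anticomm h.1, neg_mul, mul_assoc, ih h.2, List.length_cons,
      pow_succ]
    simp [mul_assoc]

/-- The generator changes sign at each of the other letters and commutes with itself, which gives
length minus one signs; the exponent `L.length + 1` has the same parity without a subtraction. -/
theorem gen_mul_word_of_mem {k : Fin n} {L : List (Fin n)} (h : k ∈ L) (hL : L.Nodup) :
    gen k * word L = (-1 : ℝ) ^ (L.length + 1) • (word L * gen k) := by
  obtain ⟨s, t, rfl⟩ := List.append_of_mem h
  have hn := List.nodup_middle.1 hL
  rw [List.nodup_cons, List.mem_append, not_or] at hn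
  obtain ⟨⟨hs, ht⟩, -⟩ := hn
  have h2 := gen_mul_word ht
  rw [word_append, word_cons, ← mul_assoc, gen_mul_word hs, mul_assoc, mul_assoc, h2]
  simp only [List.length_append, List.length_cons, smul_mul_assoc, mul_smul_comm, smul_smul,
    ← mul_assoc]
  have : ((-1 : ℝ)) ^ (s.length + (t.length + 1) + 1) * (-1) ^ t.length = (-1) ^ s.length := by
    rw [← pow_add, show s.length + (t.length + 1) + 1 + t.length
      = s.length + 2 * (t.length + 1) by ring, pow_add, pow_mul]
    simp
  rw [← this, mul_left_comm, ← mul_pow]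
  simp

/-- A letter that already occurs is cancelled against `gen k` by its square `-1`, and a new letter
is prepended. Either way the word stays free of repetitions and the parity of its length flips. -/
theorem exists_gen_mul_word (k : Fin n) {L : List (Fin n)} (hL : L.Nodup) :
    ∃ (r : ℝ) (L' : List (Fin n)), L'.Nodup ∧ (Even L'.length ↔ ¬ Even L.length) ∧
      gen k * word L = r • word L' := by
  by_cases h : k ∈ L
  · obtain ⟨s, t, rfl⟩ := List.append_of_mem h
    have hn := List.nodup_middle.1 hL
    rw [List.nodup_cons, List.mem_append, not_or] at hn
    refine ⟨(-1) ^ s.length * (-1), s ++ t, hn.2, ?_, ?_⟩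
    · simp only [List.length_append, List.length_cons]
      rw [← add_assoc, Nat.even_add_one, not_not]
    · rw [word_append, word_cons, ← mul_assoc, gen_mul_word hn.1.1, smul_mul_assoc, mul_assoc,
        ← mul_assoc (gen k), gen_mul_self, word_append]
      simp
  · exact ⟨1, k :: L, List.nodup_cons.2 ⟨h, hL⟩, by simp [Nat.even_add_one], by simp [word_cons]⟩

/-- The span of the words without repetitions whose length has the given parity. -/
def wordSpan (n : ℕ) (b : Prop) : Submodule ℝ (Cl n) :=
  Submodule.span ℝ {z | ∃ L : List (Fin n), L.Nodup ∧ (Even L.length ↔ b) ∧ z = word L}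

theorem ι_mul_mem_wordSpan {b : Prop} (v : EuclideanSpace ℝ (Fin n)) {z : Cl n}
    (hz : z ∈ wordSpan n b) : CliffordAlgebra.ι (cliffordForm n) v * z ∈ wordSpan n (¬ b) := by
  rw [ι_eq_sum, Finset.sum_mul]
  refine Submodule.sum_mem _ fun k _ => ?_
  rw [smul_mul_assoc]
  refine Submodule.smul_mem _ _ ?_
  refine Submodule.span_induction ?_ (by simp) (fun x y _ _ hx hy => ?_) (fun r x _ hx => ?_) hz
  · rintro z ⟨L, hL, hb, rfl⟩
    obtain ⟨r, L', h1, h2, h3⟩ := exists_gen_mul_word k hL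
    rw [h3]
    exact Submodule.smul_mem _ _ (Submodule.subset_span ⟨L', h1, h2.trans (not_congr hb), rfl⟩)
  · rw [mul_add]; exact Submodule.add_mem _ hx hy
  · rw [mul_smul_comm]; exact Submodule.smul_mem _ _ hx

theorem algebraMap_mem_wordSpan (r : ℝ) : algebraMap ℝ (Cl n) r ∈ wordSpan n True := by
  rw [Algebra.algebraMap_eq_smul_one]
  exact Submodule.smul_mem _ _ (Submodule.subset_span ⟨[], List.nodup_nil, by simp, rfl⟩)

theorem even_le_wordSpan {z : Cl n} (hz : z ∈ CliffordAlgebra.even (cliffordForm n)) :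
    z ∈ wordSpan n True := by
  refine CliffordAlgebra.even_induction (cliffordForm n) (motive := fun z _ => z ∈ wordSpan n True)
    algebraMap_mem_wordSpan (fun x y _ _ hx hy => Submodule.add_mem _ hx hy)
    (fun v w x _ hx => ?_) z hz
  have := ι_mul_mem_wordSpan v (ι_mul_mem_wordSpan w hx)
  rwa [not_not, ← mul_assoc] at this

theorem span_nodup_words :
    Submodule.span ℝ {z | ∃ L : List (Fin n), L.Nodup ∧ z = word L} = ⊤ := by
  rw [eq_top_iff]
  rintro z -
  have hle : ∀ b : Prop, wordSpan n b ≤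
      Submodule.span ℝ {z | ∃ L : List (Fin n), L.Nodup ∧ z = word L} := fun b =>
    Submodule.span_mono fun z ⟨L, h, _, h'⟩ => ⟨L, h, h'⟩
  have hmul : ∀ v, ∀ x ∈ wordSpan n True ⊔ wordSpan n False,
      CliffordAlgebra.ι (cliffordForm n) v * x ∈ wordSpan n True ⊔ wordSpan n False := by
    intro v x hx
    obtain ⟨y, hy, y', hy', rfl⟩ := Submodule.mem_sup.1 hx
    have h1 := ι_mul_mem_wordSpan v hy
    have h2 := ι_mul_mem_wordSpan v hy'
    rw [not_true] at h1
    rw [not_false_iff] at h2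
    rw [mul_add, add_comm]
    exact Submodule.add_mem_sup h2 h1
  refine sup_le (hle True) (hle False) ?_
  refine CliffordAlgebra.left_induction (P := fun z =>
    z ∈ wordSpan n True ⊔ wordSpan n False) (cliffordForm n) ?_ ?_ ?_ z
  · exact fun r => Submodule.mem_sup_left (algebraMap_mem_wordSpan r)
  · exact fun x y hx hy => Submodule.add_mem _ hx hy
  · exact fun x v hx => hmul v x hx

/-- There are only finitely many words without repetitions. Finite dimension is what allows curves
in the Clifford algebra to be differentiated through linear functionals. -/
instance : FiniteDimensional ℝ (Cl n) := by
  have hfin : {L : List (Fin n) | L.Nodup}.Finite :=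
    (List.finite_length_le (Fin n) n).subset fun L hL => by
      simpa using List.Nodup.length_le_card hL
  refine Module.finite_def.2 ?_
  rw [← span_nodup_words]
  refine Submodule.fg_span ((hfin.image word).subset ?_)
  rintro z ⟨L, hL, rfl⟩
  exact ⟨L, hL, rfl⟩

/-- An even element that commutes with all vectors is a scalar. -/
theorem exists_scalar_of_even_of_commute {z : Cl n}
    (hz : z ∈ CliffordAlgebra.even (cliffordForm n)) (hc : ∀ k, gen k * z = z * gen k) :
    ∃ r : ℝ, z = algebraMap ℝ (Cl n) r := by
  -- Letters are removed one at a time by the map `w ↦ ½(w - e_k w e_k)`. It fixes `z` because `z`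
  -- commutes with `e_k`; it kills the even words that contain `k` and fixes those that do not.
  have key : ∀ s : Finset (Fin n), z ∈ Submodule.span ℝ
      {w | ∃ L : List (Fin n), (L.Nodup ∧ Even L.length ∧ ∀ k ∈ s, k ∉ L) ∧ w = word L} := by
    intro s
    induction s using Finset.induction_on with
    | empty =>
      refine Submodule.span_mono ?_ (even_le_wordSpan hz)
      rintro w ⟨L, h1, h2, h3⟩
      exact ⟨L, ⟨h1, h2.2 trivial, by simp⟩, h3⟩
    | insert k s _ ih =>
      have hP : z = (1 / 2 : ℝ) • (z - gen k * z * gen k) := by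
        rw [hc, mul_assoc, gen_mul_self, mul_neg, mul_one, sub_neg_eq_add, ← two_smul ℝ, smul_smul]
        norm_num
      rw [hP]
      refine Submodule.smul_mem _ _ ?_
      refine Submodule.span_induction (p := fun w _ => w - gen k * w * gen k ∈ Submodule.span ℝ
        {w | ∃ L : List (Fin n), (L.Nodup ∧ Even L.length ∧ ∀ j ∈ insert k s, j ∉ L) ∧ w = word L})
        ?_ (by simp) (fun x y _ _ hx hy => ?_) (fun r x _ hx => ?_) ih
      · rintro w ⟨L, ⟨h1, h2, h3⟩, rfl⟩
        by_cases hk : k ∈ L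
        · rw [gen_mul_word_of_mem hk h1, pow_succ, h2.neg_one_pow]
          simp [mul_assoc, gen_mul_self]
        · refine Submodule.sub_mem _ ?_ ?_
          · refine Submodule.subset_span ⟨L, ⟨h1, h2, ?_⟩, rfl⟩
            simpa [hk] using h3
          · rw [gen_mul_word hk, h2.neg_one_pow, one_smul, mul_assoc, gen_mul_self, mul_neg,
              mul_one]
            refine Submodule.neg_mem _ (Submodule.subset_span ⟨L, ⟨h1, h2, ?_⟩, rfl⟩)
            simpa [hk] using h3
      · rw [mul_add, add_mul, add_sub_add_comm]; exact Submodule.add_mem _ hx hy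
      · rw [mul_smul_comm, smul_mul_assoc, ← smul_sub]; exact Submodule.smul_mem _ _ hx
  have h := key Finset.univ
  have h1 : {w : Cl n | ∃ L : List (Fin n),
      (L.Nodup ∧ Even L.length ∧ ∀ k ∈ Finset.univ, k ∉ L) ∧ w = word L} ⊆ {1} := by
    rintro w ⟨L, ⟨-, -, h3⟩, rfl⟩
    have : L = [] := List.eq_nil_iff_forall_not_mem.2 fun k => h3 k (Finset.mem_univ _)
    rw [this]; rfl
  obtain ⟨r, hr⟩ := Submodule.mem_span_singleton.1 (Submodule.span_mono h1 h)
  exact ⟨r, by rw [← hr, Algebra.algebraMap_eq_smul_one]⟩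

/-- Scalars are fixed by `star`, so a skew scalar vanishes. This is injectivity of the map from the
Lie algebra of the spin group to rotations, in the form used for connection forms. -/
theorem eq_zero_of_even_of_commute {z : Cl n}
    (hz : z ∈ CliffordAlgebra.even (cliffordForm n)) (hc : ∀ k, gen k * z = z * gen k)
    (hs : star z = -z) : z = 0 := by
  obtain ⟨r, rfl⟩ := exists_scalar_of_even_of_commute hz hc
  rw [CliffordAlgebra.star_algebraMap] at hs
  have h : algebraMap ℝ (Cl n) r + algebraMap ℝ (Cl n) r = 0 := by
    nth_rewrite 1 [hs]; simp
  rw [← two_smul ℝ] at h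
  exact (smul_eq_zero.1 h).resolve_left two_ne_zero

end CliffordWords

/-! ### Weak derivatives of curves in finite-dimensional spaces -/

section WeakDeriv

variable {A A₂ A₃ W : Type*} [AddCommGroup A] [Module ℝ A] [AddCommGroup A₂] [Module ℝ A₂]
  [AddCommGroup A₃] [Module ℝ A₃] [NormedAddCommGroup W] [NormedSpace ℝ W]

/-- `a'` is the derivative of the curve `a` at `t`, tested with all linear functionals. -/
def HasWeakDeriv (a : ℝ → A) (a' : A) (t : ℝ) : Prop :=
  ∀ f : A →ₗ[ℝ] ℝ, HasDerivAt (fun s => f (a s)) (f a') t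

/-- Differentiating coordinates replaces a norm on the Clifford algebra: the smoothness of the spin
cocycle is given only through linear functionals. -/
theorem exists_hasWeakDeriv [FiniteDimensional ℝ A] {a : ℝ → A} {t : ℝ}
    (h : ∀ f : A →ₗ[ℝ] ℝ, DifferentiableAt ℝ (fun s => f (a s)) t) :
    ∃ a', HasWeakDeriv a a' t := by
  let b := Module.finBasis ℝ A
  refine ⟨∑ k, deriv (fun s => b.coord k (a s)) t • b k, fun f => ?_⟩
  have e : ∀ x, f x = ∑ k, b.coord k x * f (b k) := fun x => by
    conv_lhs => rw [← b.sum_repr x, map_sum]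
    simp only [map_smul, smul_eq_mul, Module.Basis.coord_apply]
  have h1 : HasDerivAt (fun s => ∑ k, b.coord k (a s) * f (b k))
      (∑ k, deriv (fun s => b.coord k (a s)) t * f (b k)) t :=
    HasDerivAt.fun_sum fun k _ => (h (b.coord k)).hasDerivAt.mul_const _
  have h2 : f (∑ k, deriv (fun s => b.coord k (a s)) t • b k) =
      ∑ k, deriv (fun s => b.coord k (a s)) t * f (b k) := by simp
  rw [h2]
  exact h1.congr_of_eventuallyEq (Filter.Eventually.of_forall fun s => e _)

theorem HasWeakDeriv.hasDerivAt [FiniteDimensional ℝ A] {a : ℝ → A} {a' : A} {t : ℝ}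
    (h : HasWeakDeriv a a' t) (F : A →ₗ[ℝ] W) : HasDerivAt (fun s => F (a s)) (F a') t := by
  let b := Module.finBasis ℝ A
  have e : ∀ x, F x = ∑ k, b.coord k x • F (b k) := fun x => by
    conv_lhs => rw [← b.sum_repr x, map_sum]
    simp only [map_smul, Module.Basis.coord_apply]
  rw [e a']
  exact (HasDerivAt.fun_sum fun k _ => (h (b.coord k)).smul_const (F (b k))).congr_of_eventuallyEq
    (Filter.Eventually.of_forall fun s => e _)

theorem HasWeakDeriv.map {a : ℝ → A} {a' : A} {t : ℝ}
    (h : HasWeakDeriv a a' t) (F : A →ₗ[ℝ] A₂) : HasWeakDeriv (fun s => F (a s)) (F a') t :=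
  fun f => h (f.comp F)

/-- Only the first factor is expanded in a basis; the second one is then tested by the functionals
`f ∘ B (β k)`. -/
theorem HasWeakDeriv.bilin [FiniteDimensional ℝ A] {a : ℝ → A} {a' : A} {b : ℝ → A₂} {b' : A₂}
    {t : ℝ} (ha : HasWeakDeriv a a' t) (hb : HasWeakDeriv b b' t) (B : A →ₗ[ℝ] A₂ →ₗ[ℝ] A₃) :
    HasWeakDeriv (fun s => B (a s) (b s)) (B a' (b t) + B (a t) b') t := by
  intro f
  let β := Module.finBasis ℝ A
  have e : ∀ x y, f (B x y) = ∑ k, β.coord k x * f (B (β k) y) := fun x y => by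
    conv_lhs => rw [← β.sum_repr x, map_sum, LinearMap.sum_apply, map_sum]
    simp only [map_smul, LinearMap.smul_apply, smul_eq_mul, Module.Basis.coord_apply]
  rw [map_add, e a', e (a t), ← Finset.sum_add_distrib]
  exact (HasDerivAt.fun_sum fun k _ =>
    (ha (β.coord k)).mul (hb (f.comp (B (β k))))).congr_of_eventuallyEq
      (Filter.Eventually.of_forall fun s => e _ _)

theorem HasWeakDeriv.unique {a : ℝ → A} {a' a'' : A} {t : ℝ}
    (h : HasWeakDeriv a a' t) (h' : HasWeakDeriv a a'' t) : a' = a'' := by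
  rw [← sub_eq_zero, ← Module.forall_dual_apply_eq_zero_iff ℝ]
  intro f
  rw [map_sub, sub_eq_zero]
  exact (h f).unique (h' f)

theorem HasWeakDeriv.congr {a b : ℝ → A} {a' : A} {t : ℝ}
    (h : HasWeakDeriv a a' t) (hab : ∀ᶠ s in nhds t, b s = a s) : HasWeakDeriv b a' t :=
  fun f => (h f).congr_of_eventuallyEq (hab.mono fun _ hs => congrArg f hs)

theorem hasWeakDeriv_const (x : A) (t : ℝ) : HasWeakDeriv (fun _ => x) 0 t := fun f => by
  simpa using hasDerivAt_const t (f x)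

/-- A functional that vanishes on `p` is constant along the curve, so it vanishes on the derivative.
The lemma serves to show that the derivative of a curve in the spin group is even. -/
theorem HasWeakDeriv.mem {a : ℝ → A} {a' : A} {t : ℝ} (h : HasWeakDeriv a a' t)
    (p : Submodule ℝ A) (hp : ∀ᶠ s in nhds t, a s ∈ p) : a' ∈ p := by
  by_contra hn
  obtain ⟨f, hf, hp'⟩ := Submodule.exists_le_ker_of_notMem hn
  refine hf ((h f).unique ((hasDerivAt_const t (0 : ℝ)).congr_of_eventuallyEq ?_))
  exact hp.mono fun s hs => LinearMap.mem_ker.1 (hp' hs)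

theorem HasWeakDeriv.mul {R : Type*} [Ring R] [Algebra ℝ R] [FiniteDimensional ℝ R]
    {a b : ℝ → R} {a' b' : R} {t : ℝ} (ha : HasWeakDeriv a a' t) (hb : HasWeakDeriv b b' t) :
    HasWeakDeriv (fun s => a s * b s) (a' * b t + a t * b') t :=
  ha.bilin hb (LinearMap.mul ℝ R)

theorem hasWeakDeriv_sum_smul {ι : Type*} [Fintype ι] {q : ℝ → ι → ℝ} {q' : ι → ℝ} {t : ℝ}
    (h : ∀ i, HasDerivAt (fun s => q s i) (q' i) t) (x : ι → A) :
    HasWeakDeriv (fun s => ∑ i, q s i • x i) (∑ i, q' i • x i) t := fun f => by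
  simp only [map_sum, map_smul, smul_eq_mul]
  exact HasDerivAt.fun_sum fun i _ => (h i).mul_const _

end WeakDeriv

/-! ### The change of frame for the spin connection, in the Clifford algebra -/

section SpinCovariance

variable {n : ℕ}

/-- The element `¼ ∑_{j,k} Γ_{jk} e_j e_k`. -/
def connElt (Γ : Fin n → Fin n → ℝ) : Cl n := (1 / 4 : ℝ) • ∑ j, ∑ k, Γ j k • (gen j * gen k)

theorem star_connElt {Γ : Fin n → Fin n → ℝ} (h : ∀ j k, Γ j k = -Γ k j) :
    star (connElt Γ) = -connElt Γ := by
  simp only [connElt, CliffordAlgebra.star_smul, star_sum, star_mul, star_gen, neg_mul_neg]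
  rw [Finset.sum_comm, ← smul_neg]
  congr 1
  rw [← Finset.sum_neg_distrib]
  refine Finset.sum_congr rfl fun j _ => ?_
  rw [← Finset.sum_neg_distrib]
  refine Finset.sum_congr rfl fun k _ => ?_
  rw [h k j, neg_smul]

theorem connElt_mem_even (Γ : Fin n → Fin n → ℝ) :
    connElt Γ ∈ CliffordAlgebra.even (cliffordForm n) := by
  refine Subalgebra.smul_mem _ (Subalgebra.sum_mem _ fun j _ => Subalgebra.sum_mem _ fun k _ =>
    Subalgebra.smul_mem _ ?_ _) _
  exact CliffordAlgebra.ι_mul_ι_mem_evenOdd_zero _ _ _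

/-- In an associative algebra with generators satisfying the Clifford relations, the commutator of
`¼ ∑ Γ_{jk} e_j e_k` with a generator is the action of `Γ` on it. -/
theorem commutator_quarter_sum {R : Type*} [Ring R] [Algebra ℝ R] (e : Fin n → R)
    (he : ∀ k l, e k * e l + e l * e k = algebraMap ℝ R (if k = l then -2 else 0))
    {Γ : Fin n → Fin n → ℝ} (h : ∀ j k, Γ j k = -Γ k j) (m : Fin n) :
    ((1 / 4 : ℝ) • ∑ j, ∑ k, Γ j k • (e j * e k)) * e m -
      e m * ((1 / 4 : ℝ) • ∑ j, ∑ k, Γ j k • (e j * e k)) = ∑ k, Γ m k • e k := by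
  have h1 : ∀ j k, e j * e k * e m - e m * (e j * e k) =
      (if k = m then (-2 : ℝ) else 0) • e j - (if j = m then (-2 : ℝ) else 0) • e k := by
    intro j k
    -- The commutator of a product is rewritten through anticommutators, which are scalars by the
    -- Clifford relations.
    have h2 : e j * e k * e m - e m * (e j * e k) =
        e j * (e k * e m + e m * e k) - (e j * e m + e m * e j) * e k := by noncomm_ring
    rw [h2, he, he, Algebra.algebraMap_eq_smul_one, Algebra.algebraMap_eq_smul_one]
    simp
  have h3 : ((1 / 4 : ℝ) • ∑ j, ∑ k, Γ j k • (e j * e k)) * e m -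
      e m * ((1 / 4 : ℝ) • ∑ j, ∑ k, Γ j k • (e j * e k)) =
      (1 / 4 : ℝ) • ∑ j, ∑ k, Γ j k • (e j * e k * e m - e m * (e j * e k)) := by
    simp only [smul_mul_assoc, mul_smul_comm, Finset.sum_mul, Finset.mul_sum, ← smul_sub,
      ← Finset.sum_sub_distrib]
  rw [h3]
  simp only [h1, smul_sub, Finset.sum_sub_distrib, smul_smul]
  have h4 : ∑ j, ∑ k, (Γ j k * if k = m then (-2 : ℝ) else 0) • e j = ∑ k, (2 * Γ m k) • e k := by
    refine Finset.sum_congr rfl fun j _ => ?_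
    rw [Finset.sum_eq_single m (fun k _ hk => by simp [hk]) (by simp), if_pos rfl, h j m]
    congr 1; ring
  have h5 : ∑ j, ∑ k, (Γ j k * if j = m then (-2 : ℝ) else 0) • e k =
      ∑ k, (-2 * Γ m k) • e k := by
    rw [Finset.sum_comm]
    refine Finset.sum_congr rfl fun k _ => ?_
    rw [Finset.sum_eq_single m (fun j _ hj => by simp [hj]) (by simp), if_pos rfl, mul_comm]
  rw [h4, h5, ← smul_sub, ← Finset.sum_sub_distrib, Finset.smul_sum]
  refine Finset.sum_congr rfl fun k _ => ?_
  rw [← sub_smul, smul_smul]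
  congr 1; ring

theorem commutator_connElt {Γ : Fin n → Fin n → ℝ} (h : ∀ j k, Γ j k = -Γ k j) (m : Fin n) :
    connElt Γ * gen m - gen m * connElt Γ = ∑ k, Γ m k • gen k :=
  commutator_quarter_sum gen gen_mul_gen h m

/-- The change of the connection form under a change of frame that is covered by the curve `a` in
the spin group. -/
theorem spin_change_of_frame {a : ℝ → Cl n} {a' : Cl n} {Q : ℝ → Fin n → Fin n → ℝ}
    {Q' : Fin n → Fin n → ℝ} (ha : ∀ᶠ t in nhds 0, a t ∈ spinGroup (cliffordForm n))
    (hcov : ∀ᶠ t in nhds 0, ∀ k, a t * gen k * star (a t) = ∑ l, Q t l k • gen l)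
    (hQ : ∀ l k, HasDerivAt (fun t => Q t l k) (Q' l k) 0)
    (horth : ∀ l m, ∑ p, Q 0 l p * Q 0 m p = if l = m then 1 else 0)
    {Γ Γ' : Fin n → Fin n → ℝ} (hΓ : ∀ j k, Γ j k = -Γ k j) (hΓ' : ∀ j k, Γ' j k = -Γ' k j)
    (h : ∀ k p, Γ k p = ∑ l, Q' l k * Q 0 l p + ∑ q, ∑ r, Q 0 q k * Q 0 r p * Γ' q r)
    (h' : HasWeakDeriv a a' 0) : a' + connElt Γ' * a 0 = a 0 * connElt Γ := by
  have ha0 := ha.self_of_nhds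
  have hc0 := hcov.self_of_nhds
  have u1 : star (a 0) * a 0 = 1 := spinGroup.star_mul_self_of_mem ha0
  have u2 : a 0 * star (a 0) = 1 := spinGroup.mul_star_self_of_mem ha0
  let st : Cl n →ₗ[ℝ] Cl n :=
    { toFun := star, map_add' := star_add, map_smul' := CliffordAlgebra.star_smul }
  have hst : HasWeakDeriv (fun t => star (a t)) (star a') 0 := h'.map st
  -- Derivative of `star a * a = 1`: the logarithmic derivative is skew under `star`.
  have d1 : star a' * a 0 = -(star (a 0) * a') := by
    have := (hst.mul h').unique ((hasWeakDeriv_const (1 : Cl n) 0).congr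
      (ha.mono fun t ht => spinGroup.star_mul_self_of_mem ht))
    exact eq_neg_of_add_eq_zero_left this
  -- The inverse rotation is given by the transposed matrix, by orthogonality of the rows.
  have inv : ∀ l, star (a 0) * gen l * a 0 = ∑ p, Q 0 l p • gen p := by
    intro l
    have h1 : gen l = ∑ p, Q 0 l p • (a 0 * gen p * star (a 0)) := by
      simp only [hc0, Finset.smul_sum, smul_smul]
      rw [Finset.sum_comm]
      simp only [← Finset.sum_smul, horth, ite_smul, one_smul, zero_smul]
      simp
    have h2 : ∀ p, star (a 0) * (a 0 * gen p * star (a 0)) * a 0 = gen p := fun p => by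
      have : star (a 0) * (a 0 * gen p * star (a 0)) * a 0 =
        (star (a 0) * a 0) * gen p * (star (a 0) * a 0) := by noncomm_ring
      rw [this, u1, one_mul, mul_one]
    conv_lhs => rw [h1]
    simp only [Finset.mul_sum, Finset.sum_mul, mul_smul_comm, smul_mul_assoc, h2]
  have d2 : ∀ k, a' * gen k * star (a 0) + a 0 * gen k * star a' = ∑ l, Q' l k • gen l := by
    intro k
    have h1 := (h'.mul (hasWeakDeriv_const (gen k) 0)).mul hst
    have h2 := (hasWeakDeriv_sum_smul (fun l => hQ l k) (gen (n := n))).congr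
      (hcov.mono fun t ht => ht k)
    have := h1.unique h2
    simpa using this
  -- This is the error in the claimed identity, multiplied by `a⁻¹ = star a`. It is even and skew.
  -- Its commutator with `gen k` adds the derivative of the rotation to the rotated `Γ'` and
  -- subtracts `Γ`, which is zero by the hypothesis `h`; hence `z = 0`.
  set z := star (a 0) * a' + star (a 0) * connElt Γ' * a 0 - connElt Γ with hz
  have hev : a 0 ∈ CliffordAlgebra.even (cliffordForm n) := spinGroup.mem_even ha0
  have hev' : a' ∈ CliffordAlgebra.even (cliffordForm n) :=
    h'.mem (Subalgebra.toSubmodule (CliffordAlgebra.even (cliffordForm n)))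
      (ha.mono fun t ht => spinGroup.mem_even ht)
  have hevs : star (a 0) ∈ CliffordAlgebra.even (cliffordForm n) :=
    spinGroup.mem_even (spinGroup.star_mem ha0)
  have z0 : z = 0 := by
    refine eq_zero_of_even_of_commute ?_ ?_ ?_
    · exact sub_mem (add_mem (mul_mem hevs hev') (mul_mem (mul_mem hevs (connElt_mem_even _)) hev))
        (connElt_mem_even _)
    · intro k
      have c1 : star (a 0) * a' * gen k - gen k * (star (a 0) * a') =
          ∑ p, (∑ l, Q' l k * Q 0 l p) • gen p := by
        have e1 : star (a 0) * (a' * gen k * star (a 0) + a 0 * gen k * star a') * a 0 =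
            star (a 0) * a' * gen k * (star (a 0) * a 0) +
              (star (a 0) * a 0) * gen k * (star a' * a 0) := by noncomm_ring
        rw [u1, d1, d2, mul_one, one_mul, mul_neg, ← sub_eq_add_neg] at e1
        rw [← e1]
        simp only [Finset.mul_sum, Finset.sum_mul, mul_smul_comm, smul_mul_assoc, inv,
          Finset.smul_sum, smul_smul, Finset.sum_smul]
        rw [Finset.sum_comm]
      have c2 : star (a 0) * connElt Γ' * a 0 * gen k - gen k * (star (a 0) * connElt Γ' * a 0) =
          ∑ p, (∑ q, ∑ r, Q 0 q k * Q 0 r p * Γ' q r) • gen p := by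
        have e1 : star (a 0) * (connElt Γ' * (a 0 * gen k * star (a 0)) -
            (a 0 * gen k * star (a 0)) * connElt Γ') * a 0 =
            star (a 0) * connElt Γ' * a 0 * gen k * (star (a 0) * a 0) -
            (star (a 0) * a 0) * gen k * (star (a 0) * connElt Γ' * a 0) := by noncomm_ring
        rw [u1, mul_one, one_mul, hc0] at e1
        rw [← e1]
        have e2 : connElt Γ' * (∑ l, Q 0 l k • gen l) - (∑ l, Q 0 l k • gen l) * connElt Γ' =
            ∑ l, Q 0 l k • ∑ r, Γ' l r • gen r := by
          simp only [Finset.mul_sum, Finset.sum_mul, mul_smul_comm, smul_mul_assoc,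
            ← Finset.sum_sub_distrib, ← smul_sub, commutator_connElt hΓ']
        rw [e2]
        simp only [Finset.mul_sum, Finset.sum_mul, mul_smul_comm, smul_mul_assoc, inv,
          Finset.smul_sum, smul_smul, Finset.sum_smul]
        symm
        rw [Finset.sum_comm]
        refine Finset.sum_congr rfl fun q _ => ?_
        rw [Finset.sum_comm]
        refine Finset.sum_congr rfl fun r _ => Finset.sum_congr rfl fun p _ => ?_
        congr 1; ring
      have c3 := commutator_connElt hΓ k
      have : z * gen k - gen k * z = 0 := by
        have e : z * gen k - gen k * z = (star (a 0) * a' * gen k - gen k * (star (a 0) * a')) +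
          (star (a 0) * connElt Γ' * a 0 * gen k - gen k * (star (a 0) * connElt Γ' * a 0)) -
          (connElt Γ * gen k - gen k * connElt Γ) := by rw [hz]; noncomm_ring
        rw [e, c1, c2, c3, ← Finset.sum_add_distrib, ← Finset.sum_sub_distrib]
        refine Finset.sum_eq_zero fun p _ => ?_
        rw [← add_smul, ← h, sub_self]
      exact (sub_eq_zero.1 this).symm
    · have e1 : star a' * a 0 = -(star (a 0) * a') := d1
      rw [hz]
      simp only [star_sub, star_add, star_mul, star_star, e1, star_connElt hΓ, star_connElt hΓ']
      noncomm_ring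
  have e : a 0 * z = (a 0 * star (a 0)) * a' + (a 0 * star (a 0)) * connElt Γ' * a 0
      - a 0 * connElt Γ := by rw [hz]; noncomm_ring
  rw [z0, mul_zero, u2, one_mul, one_mul] at e
  exact sub_eq_zero.1 e.symm

end SpinCovariance

end

end WeightedDirac

namespace WeightedDirac

noncomputable section

/-! ### Orthonormal frames in coordinates -/

section LocalFrames

/-- The model space `ℝⁿ`. -/
abbrev Euc (n : ℕ) := EuclideanSpace ℝ (Fin n)

variable {n : ℕ} {M : Type*} [TopologicalSpace M] [ChartedSpace (EuclideanSpace ℝ (Fin n)) M]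
  [IsManifold (𝓡 n) ∞ M] {g : RMetric n M}

/-- The inverse of the preferred chart at `x₀`. -/
abbrev chartInv (x₀ : M) : Euc n → M := (chartAt (Euc n) x₀).symm

/-- The part of the chart at `x₀` where the frame `i` is defined. -/
def locDom (θ : SpinStructure g) (i : Fin θ.N) (x₀ : M) : Set (Euc n) :=
  (chartAt (Euc n) x₀).target ∩ (chartAt (Euc n) x₀).symm ⁻¹' θ.U i

/-- The derivative of the inverse of the chart. -/
abbrev dChartInv (x₀ : M) (y : Euc n) : Euc n →L[ℝ] TangentSpace (𝓡 n) (chartInv x₀ y) :=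
  mfderiv (𝓡 n) (𝓡 n) (chartAt (Euc n) x₀).symm y

/-- The frame `i` in the chart at `x₀`. -/
def locFrame (θ : SpinStructure g) (i : Fin θ.N) (x₀ : M) (l : Fin n) : Euc n → Euc n :=
  VectorField.mpullback (𝓡 n) (𝓡 n) (chartAt (Euc n) x₀).symm (θ.frame i l)

variable (θ : SpinStructure g) {i j : Fin θ.N} {x₀ : M} {y : Euc n}

theorem isOpen_locDom (i : Fin θ.N) (x₀ : M) : IsOpen (locDom θ i x₀) :=
  (chartAt (Euc n) x₀).isOpen_inter_preimage_symm (θ.isOpen i)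

theorem contMDiffAt_chartInv (hy : y ∈ (chartAt (Euc n) x₀).target) :
    ContMDiffAt (𝓡 n) (𝓡 n) ∞ (chartInv x₀) y :=
  (contMDiffOn_chart_symm (I := 𝓡 n) (n := ∞) (x := x₀)).contMDiffAt
    ((chartAt (Euc n) x₀).open_target.mem_nhds hy)

theorem mdifferentiable_chart' (x₀ : M) :
    (chartAt (Euc n) x₀).MDifferentiable (𝓡 n) (𝓡 n) := mdifferentiable_chart x₀

theorem isInvertible_dChartInv (hy : y ∈ (chartAt (Euc n) x₀).target) :
    (dChartInv x₀ y).IsInvertible :=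
  ⟨(mdifferentiable_chart' x₀).symm.mfderiv hy, rfl⟩

theorem dChartInv_locFrame (hy : y ∈ (chartAt (Euc n) x₀).target) (i : Fin θ.N) (l : Fin n) :
    dChartInv x₀ y (locFrame θ i x₀ l y) = θ.frame i l (chartInv x₀ y) := by
  obtain ⟨e, he⟩ := isInvertible_dChartInv hy
  rw [locFrame, VectorField.mpullback_apply]
  change (dChartInv x₀ y) ((dChartInv x₀ y).inverse _) = _
  rw [← he]
  simp

theorem contDiffOn_locFrame (i : Fin θ.N) (x₀ : M) (l : Fin n) :
    ContDiffOn ℝ ∞ (locFrame θ i x₀ l) (locDom θ i x₀) := by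
  intro y hy
  have h := ContMDiffAt.mpullback_vectorField_preimage (m := ∞) (n := ∞)
    ((θ.frame_smooth i l).contMDiffAt ((θ.isOpen i).mem_nhds hy.2))
    (contMDiffAt_chartInv hy.1) (isInvertible_dChartInv hy.1) (by simp)
  have h2 := contMDiffAt_vectorSpace_iff_contDiffAt.1 h
  exact h2.contDiffWithinAt

theorem contDiffAt_locFrame (hy : y ∈ locDom θ i x₀) (l : Fin n) :
    ContDiffAt ℝ ∞ (locFrame θ i x₀ l) y :=
  (contDiffOn_locFrame θ i x₀ l).contDiffAt ((isOpen_locDom θ i x₀).mem_nhds hy)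

/-- Naturality of the Lie bracket under pullback turns the brackets in the Koszul formula into
derivatives of coordinate vector fields on `ℝⁿ`. -/
theorem dChartInv_lieBracket (hy : y ∈ locDom θ i x₀) (l m : Fin n) :
    dChartInv x₀ y (VectorField.lieBracket ℝ (locFrame θ i x₀ l) (locFrame θ i x₀ m) y) =
      VectorField.mlieBracket (𝓡 n) (θ.frame i l) (θ.frame i m) (chartInv x₀ y) := by
  have hd : ∀ k, MDifferentiableAt (𝓡 n) (𝓡 n).tangent
      (fun x => (⟨x, θ.frame i k x⟩ : TangentBundle (𝓡 n) M)) (chartInv x₀ y) := fun k =>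
    ((θ.frame_smooth i k).contMDiffAt ((θ.isOpen i).mem_nhds hy.2)).mdifferentiableAt (by simp)
  have : IsManifold (𝓡 n) (minSmoothness ℝ 2) M := by
    rw [minSmoothness_of_isRCLikeNormedField]
    exact IsManifold.of_le (n := ∞) (WithTop.coe_le_coe.2 le_top)
  have h := VectorField.mpullback_mlieBracket (n := ∞) (hd l) (hd m) (contMDiffAt_chartInv hy.1)
    (by rw [minSmoothness_of_isRCLikeNormedField]; exact WithTop.coe_le_coe.2 le_top)
  have h2 : VectorField.lieBracket ℝ (locFrame θ i x₀ l) (locFrame θ i x₀ m) y =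
      (dChartInv x₀ y).inverse
        (VectorField.mlieBracket (𝓡 n) (θ.frame i l) (θ.frame i m) (chartInv x₀ y)) := by
    refine Eq.trans ?_ h.symm
    rw [← VectorField.mlieBracketWithin_univ, VectorField.mlieBracketWithin_eq_lieBracketWithin]
    exact (congrFun (VectorField.lieBracketWithin_univ (𝕜 := ℝ) (V := locFrame θ i x₀ l)
      (W := locFrame θ i x₀ m)) y).symm
  obtain ⟨e, he⟩ := isInvertible_dChartInv hy.1
  rw [h2, ← he]
  simp

/-- A vector is the sum of its components in an orthonormal frame. -/
theorem sum_inner_smul_frame {x : M} (hx : x ∈ θ.U i) (v : TangentSpace (𝓡 n) x) :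
    ∑ k, g.inner x v (θ.frame i k x) • θ.frame i k x = v := by
  have hlin : LinearIndependent ℝ fun k => θ.frame i k x := by
    rw [Fintype.linearIndependent_iff]
    intro c hc k
    have := congrArg (fun w => g.inner x w (θ.frame i k x)) hc
    simpa [θ.frame_orthonormal i x hx] using this
  have hcard : Fintype.card (Fin n) = Module.finrank ℝ (TangentSpace (𝓡 n) x) := by
    change _ = Module.finrank ℝ (Euc n)
    simp
  have : FiniteDimensional ℝ (TangentSpace (𝓡 n) x) :=
    inferInstanceAs (FiniteDimensional ℝ (Euc n))
  let b := basisOfLinearIndependentOfCardEqFinrank' _ hlin hcard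
  have hb : ∀ k, b k = θ.frame i k x := fun k => by simp [b]
  have hv := b.sum_repr v
  simp only [hb] at hv
  have hc : ∀ k, g.inner x v (θ.frame i k x) = b.repr v k := by
    intro k
    conv_lhs => rw [← hv]
    simp [θ.frame_orthonormal i x hx]
  simp only [hc, hv]

/-- The components of a vector at the point `y` of the chart in the frame `i`. -/
def coframe (θ : SpinStructure g) (i : Fin θ.N) (x₀ : M) (k : Fin n) (y : Euc n) : Euc n →L[ℝ] ℝ :=
  (g.inner (chartInv x₀ y) (θ.frame i k (chartInv x₀ y))).comp (dChartInv x₀ y)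

theorem coframe_apply (k : Fin n) (v : Euc n) : coframe θ i x₀ k y v =
    g.inner (chartInv x₀ y) (dChartInv x₀ y v) (θ.frame i k (chartInv x₀ y)) := by
  rw [coframe, g.symm]; rfl

theorem coframe_locFrame (hy : y ∈ locDom θ i x₀) (k l : Fin n) :
    coframe θ i x₀ k y (locFrame θ i x₀ l y) = if k = l then 1 else 0 := by
  rw [coframe_apply, dChartInv_locFrame θ hy.1, θ.frame_orthonormal i _ hy.2]
  simp only [eq_comm]

theorem sum_coframe_smul (hy : y ∈ locDom θ i x₀) (v : Euc n) :
    ∑ k, coframe θ i x₀ k y v • locFrame θ i x₀ k y = v := by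
  obtain ⟨e, he⟩ := isInvertible_dChartInv hy.1
  have hinj : Function.Injective (dChartInv x₀ y) := by rw [← he]; exact e.injective
  apply hinj
  rw [map_sum]
  simp only [map_smul, coframe_apply, dChartInv_locFrame θ hy.1]
  exact sum_inner_smul_frame θ hy.2 _

theorem inner_eq_sum_coframe (hy : y ∈ locDom θ i x₀) (v w : Euc n) :
    g.inner (chartInv x₀ y) (dChartInv x₀ y v) (dChartInv x₀ y w) =
      ∑ k, coframe θ i x₀ k y v * coframe θ i x₀ k y w := by
  conv_lhs => rw [← sum_inner_smul_frame θ hy.2 (dChartInv x₀ y w)]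
  rw [map_sum]
  refine Finset.sum_congr rfl fun k _ => ?_
  rw [map_smul, coframe_apply, coframe_apply, smul_eq_mul, mul_comm]

/-- The structure functions of the frame `i` in the chart at `x₀`. -/
def structFun (θ : SpinStructure g) (i : Fin θ.N) (x₀ : M) (l j k : Fin n) (y : Euc n) : ℝ :=
  coframe θ i x₀ k y
    (VectorField.lieBracket ℝ (locFrame θ i x₀ l) (locFrame θ i x₀ j) y)

theorem christoffel_chartInv (hy : y ∈ locDom θ i x₀) (l j k : Fin n) :
    θ.christoffel i l j k (chartInv x₀ y) = (1 / 2) * (structFun θ i x₀ l j k y -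
      structFun θ i x₀ l k j y - structFun θ i x₀ j k l y) := by
  simp only [SpinStructure.christoffel, structFun, coframe_apply, dChartInv_lieBracket θ hy]

theorem structFun_swap (l j k : Fin n) :
    structFun θ i x₀ l j k y = -structFun θ i x₀ j l k y := by
  simp only [structFun, VectorField.lieBracket_eq, map_sub]
  ring

theorem christoffel_antisymm {x : M} (l j k : Fin n) :
    θ.christoffel i l j k x = -θ.christoffel i l k j x := by
  simp only [SpinStructure.christoffel]
  rw [VectorField.mlieBracket_swap_apply (V := θ.frame i k) (W := θ.frame i j)]
  simp only [map_neg, neg_apply]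
  ring

/-- The linear map that sends the standard basis to the frame `i` at the point `y` of the chart. -/
def frameMap (θ : SpinStructure g) (i : Fin θ.N) (x₀ : M) (y : Euc n) : Euc n →L[ℝ] Euc n :=
  ∑ k, (EuclideanSpace.proj k : Euc n →L[ℝ] ℝ).smulRight (locFrame θ i x₀ k y)

theorem frameMap_apply (v : Euc n) : frameMap θ i x₀ y v = ∑ k, v k • locFrame θ i x₀ k y := by
  simp [frameMap]

theorem contDiffOn_frameMap (i : Fin θ.N) (x₀ : M) :
    ContDiffOn ℝ ∞ (frameMap θ i x₀) (locDom θ i x₀) := by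
  refine ContDiffOn.sum fun k _ => ?_
  exact (ContinuousLinearMap.smulRightL ℝ (Euc n) (Euc n)
    (EuclideanSpace.proj k)).contDiff.comp_contDiffOn (contDiffOn_locFrame θ i x₀ k)

/-- The frame map as an equivalence. -/
def frameEquiv (hy : y ∈ locDom θ i x₀) : Euc n ≃L[ℝ] Euc n :=
  ContinuousLinearEquiv.equivOfInverse (frameMap θ i x₀ y)
    ((EuclideanSpace.equiv (Fin n) ℝ).symm.toContinuousLinearMap.comp
      (ContinuousLinearMap.pi fun k => coframe θ i x₀ k y))
    (fun v => by
      ext k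
      simp [frameMap_apply, coframe_locFrame θ hy])
    (fun v => by
      rw [frameMap_apply]
      exact sum_coframe_smul θ hy v)

/-- The coframe becomes a smooth function of the frame through inversion of linear maps, so that its
smoothness does not require an analysis of the metric in coordinates. -/
theorem coframe_eq_inverse (hy : y ∈ locDom θ i x₀) (k : Fin n) :
    coframe θ i x₀ k y = (EuclideanSpace.proj k).comp (frameMap θ i x₀ y).inverse := by
  have h : frameMap θ i x₀ y = (frameEquiv θ hy : Euc n →L[ℝ] Euc n) := rfl
  rw [h, ContinuousLinearMap.inverse_equiv]
  rfl

theorem contDiffOn_coframe (i : Fin θ.N) (x₀ : M) (k : Fin n) :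
    ContDiffOn ℝ ∞ (coframe θ i x₀ k) (locDom θ i x₀) := by
  have h : ContDiffOn ℝ ∞ (fun y => (EuclideanSpace.proj k : Euc n →L[ℝ] ℝ).comp
      (frameMap θ i x₀ y).inverse) (locDom θ i x₀) := by
    refine ContDiffOn.clm_comp contDiffOn_const fun y hy => ?_
    have h1 : ContDiffAt ℝ ∞ ContinuousLinearMap.inverse (frameMap θ i x₀ y) :=
      contDiffAt_map_inverse (frameEquiv θ hy)
    exact h1.comp_contDiffWithinAt y (contDiffOn_frameMap θ i x₀ y hy)
  exact h.congr fun y hy => coframe_eq_inverse θ hy k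

theorem contDiffAt_coframe (hy : y ∈ locDom θ i x₀) (k : Fin n) :
    ContDiffAt ℝ ∞ (coframe θ i x₀ k) y :=
  (contDiffOn_coframe θ i x₀ k).contDiffAt ((isOpen_locDom θ i x₀).mem_nhds hy)

theorem contDiffOn_structFun (i : Fin θ.N) (x₀ : M) (l j k : Fin n) :
    ContDiffOn ℝ ∞ (structFun θ i x₀ l j k) (locDom θ i x₀) := by
  refine ContDiffOn.clm_apply (contDiffOn_coframe θ i x₀ k) fun y hy => ContDiffAt.contDiffWithinAt ?_
  have hd : ∀ m, ContDiffAt ℝ ∞ (fderiv ℝ (locFrame θ i x₀ m)) y := fun m =>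
    (contDiffAt_locFrame θ hy m).fderiv_right (by simp)
  exact ((hd j).clm_apply (contDiffAt_locFrame θ hy l)).sub
    ((hd l).clm_apply (contDiffAt_locFrame θ hy j))

theorem contDiffOn_christoffel (i : Fin θ.N) (x₀ : M) (l j k : Fin n) :
    ContDiffOn ℝ ∞ (fun y => θ.christoffel i l j k (chartInv x₀ y)) (locDom θ i x₀) := by
  refine ContDiffOn.congr ?_ fun y hy => christoffel_chartInv θ hy l j k
  exact contDiffOn_const.mul (((contDiffOn_structFun θ i x₀ l j k).sub
    (contDiffOn_structFun θ i x₀ l k j)).sub (contDiffOn_structFun θ i x₀ j k l))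

/-! ### Change of frame -/

/-- The orthogonal matrix of the change of frame in the chart at `x₀`. -/
def frameChange (θ : SpinStructure g) (i j : Fin θ.N) (x₀ : M) (l k : Fin n) (y : Euc n) : ℝ :=
  coframe θ j x₀ l y (locFrame θ i x₀ k y)

theorem frameChange_eq (hy : y ∈ (chartAt (Euc n) x₀).target) (l k : Fin n) :
    frameChange θ i j x₀ l k y =
      g.inner (chartInv x₀ y) (θ.frame j l (chartInv x₀ y)) (θ.frame i k (chartInv x₀ y)) := by
  rw [frameChange, coframe_apply, dChartInv_locFrame θ hy, g.symm]

theorem coframe_locFrame_swap (hy : y ∈ (chartAt (Euc n) x₀).target) (l k : Fin n) :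
    coframe θ i x₀ k y (locFrame θ j x₀ l y) = frameChange θ i j x₀ l k y := by
  rw [frameChange_eq θ hy, coframe_apply, dChartInv_locFrame θ hy]

theorem locFrame_eq_sum (hj : y ∈ locDom θ j x₀) (k : Fin n) :
    locFrame θ i x₀ k y = ∑ r, frameChange θ i j x₀ r k y • locFrame θ j x₀ r y :=
  (sum_coframe_smul θ hj _).symm

theorem locFrame_eq_sum' (hi : y ∈ locDom θ i x₀) (r : Fin n) :
    locFrame θ j x₀ r y = ∑ k, frameChange θ i j x₀ r k y • locFrame θ i x₀ k y := by
  conv_lhs => rw [← sum_coframe_smul θ hi (locFrame θ j x₀ r y)]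
  simp only [coframe_locFrame_swap θ hi.1]

theorem coframe_eq_sum (hj : y ∈ locDom θ j x₀) (p : Fin n) (v : Euc n) :
    coframe θ i x₀ p y v = ∑ s, coframe θ j x₀ s y v * frameChange θ i j x₀ s p y := by
  conv_lhs => rw [← sum_coframe_smul θ hj v]
  simp only [map_sum, map_smul, smul_eq_mul, coframe_locFrame_swap θ hj.1]

theorem frameChange_orth (hi : y ∈ locDom θ i x₀) (hj : y ∈ locDom θ j x₀) (k p : Fin n) :
    ∑ r, frameChange θ i j x₀ r k y * frameChange θ i j x₀ r p y = if k = p then 1 else 0 := by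
  have h := coframe_eq_sum θ (i := i) hj p (locFrame θ i x₀ k y)
  rw [coframe_locFrame θ hi] at h
  rw [show (if k = p then (1 : ℝ) else 0) = if p = k then 1 else 0 by simp only [eq_comm], h]
  rfl

theorem frameChange_orth' (hi : y ∈ locDom θ i x₀) (hj : y ∈ locDom θ j x₀) (l m : Fin n) :
    ∑ p, frameChange θ i j x₀ l p y * frameChange θ i j x₀ m p y = if l = m then 1 else 0 := by
  have h := congrArg (coframe θ j x₀ m y) (locFrame_eq_sum' θ (j := j) hi l)
  rw [coframe_locFrame θ hj, map_sum] at h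
  rw [show (if l = m then (1 : ℝ) else 0) = if m = l then 1 else 0 by simp only [eq_comm], h]
  simp only [map_smul, smul_eq_mul]
  rfl

theorem contDiffAt_frameChange (hi : y ∈ locDom θ i x₀) (hj : y ∈ locDom θ j x₀) (l k : Fin n) :
    ContDiffAt ℝ ∞ (frameChange θ i j x₀ l k) y :=
  (contDiffAt_coframe θ hj l).clm_apply (contDiffAt_locFrame θ hi k)

/-- The components of the derivative of the change of frame. -/
def frameChangeDeriv (θ : SpinStructure g) (i j : Fin θ.N) (x₀ : M) (y v : Euc n) (k p : Fin n) :
    ℝ :=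
  ∑ r, fderiv ℝ (frameChange θ i j x₀ r k) y v * frameChange θ i j x₀ r p y

/-- Differentiate the orthogonality relation `QᵀQ = 1` of the change of frame. -/
theorem frameChangeDeriv_antisymm (hi : y ∈ locDom θ i x₀) (hj : y ∈ locDom θ j x₀) (v : Euc n)
    (k p : Fin n) :
    frameChangeDeriv θ i j x₀ y v k p = -frameChangeDeriv θ i j x₀ y v p k := by
  have hd : ∀ r m, HasFDerivAt (frameChange θ i j x₀ r m)
      (fderiv ℝ (frameChange θ i j x₀ r m) y) y := fun r m =>
    ((contDiffAt_frameChange θ hi hj r m).differentiableAt (by simp)).hasFDerivAt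
  have h1 : HasFDerivAt (fun y => ∑ r, frameChange θ i j x₀ r k y * frameChange θ i j x₀ r p y) _ y :=
    HasFDerivAt.fun_sum fun r _ => (hd r k).mul (hd r p)
  have h2 : HasFDerivAt (fun y => ∑ r, frameChange θ i j x₀ r k y * frameChange θ i j x₀ r p y)
      (0 : Euc n →L[ℝ] ℝ) y := by
    refine (hasFDerivAt_const (if k = p then (1 : ℝ) else 0) y).congr_of_eventuallyEq ?_
    filter_upwards [(isOpen_locDom θ i x₀).mem_nhds hi, (isOpen_locDom θ j x₀).mem_nhds hj]
      with z h h'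
    exact frameChange_orth θ h h' k p
  have h3 := congrArg (fun f => f v) (h1.unique h2)
  simp only [sum_apply, add_apply, smul_apply, smul_eq_mul, zero_apply,
    Finset.sum_add_distrib] at h3
  simp only [frameChangeDeriv]
  have h4 : ∀ a b : Fin n, ∑ r, fderiv ℝ (frameChange θ i j x₀ r a) y v * frameChange θ i j x₀ r b y
      = ∑ r, frameChange θ i j x₀ r b y * fderiv ℝ (frameChange θ i j x₀ r a) y v :=
    fun a b => Finset.sum_congr rfl fun r _ => mul_comm _ _
  rw [h4, h4]
  linarith

/-- The bracket is not tensorial: with `e_k = ∑_r Q_{rk} f_r` the Leibniz rule yields two terms with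
derivatives of `Q` besides the tensorial one. -/
theorem structFun_change (hi : y ∈ locDom θ i x₀) (hj : y ∈ locDom θ j x₀) (m k p : Fin n) :
    structFun θ i x₀ m k p y =
      frameChangeDeriv θ i j x₀ y (locFrame θ i x₀ m y) k p -
      frameChangeDeriv θ i j x₀ y (locFrame θ i x₀ k y) m p +
      ∑ q, ∑ r, ∑ s, frameChange θ i j x₀ q m y * frameChange θ i j x₀ r k y *
        frameChange θ i j x₀ s p y * structFun θ j x₀ q r s y := by
  have hd : ∀ r m, HasFDerivAt (frameChange θ i j x₀ r m)
      (fderiv ℝ (frameChange θ i j x₀ r m) y) y := fun r m =>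
    ((contDiffAt_frameChange θ hi hj r m).differentiableAt (by simp)).hasFDerivAt
  have hf : ∀ r, HasFDerivAt (locFrame θ j x₀ r) (fderiv ℝ (locFrame θ j x₀ r) y) y := fun r =>
    ((contDiffAt_locFrame θ hj r).differentiableAt (by simp)).hasFDerivAt
  have hfd : ∀ k v, fderiv ℝ (locFrame θ i x₀ k) y v =
      ∑ r, (fderiv ℝ (frameChange θ i j x₀ r k) y v • locFrame θ j x₀ r y +
        frameChange θ i j x₀ r k y • fderiv ℝ (locFrame θ j x₀ r) y v) := by
    intro k v
    have h1 : HasFDerivAt (fun y => ∑ r, frameChange θ i j x₀ r k y • locFrame θ j x₀ r y) _ y :=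
      HasFDerivAt.fun_sum fun r _ => (hd r k).smul (hf r)
    have h2 : HasFDerivAt (locFrame θ i x₀ k) _ y := h1.congr_of_eventuallyEq (by
      filter_upwards [(isOpen_locDom θ j x₀).mem_nhds hj] with z h'
      exact locFrame_eq_sum θ h' k)
    rw [h2.fderiv]
    simp [add_comm]
  have key : VectorField.lieBracket ℝ (locFrame θ i x₀ m) (locFrame θ i x₀ k) y =
      ∑ r, fderiv ℝ (frameChange θ i j x₀ r k) y (locFrame θ i x₀ m y) • locFrame θ j x₀ r y -
      ∑ r, fderiv ℝ (frameChange θ i j x₀ r m) y (locFrame θ i x₀ k y) • locFrame θ j x₀ r y +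
      ∑ q, ∑ r, (frameChange θ i j x₀ q m y * frameChange θ i j x₀ r k y) •
        VectorField.lieBracket ℝ (locFrame θ j x₀ q) (locFrame θ j x₀ r) y := by
    have e1 : ∑ r, frameChange θ i j x₀ r k y • fderiv ℝ (locFrame θ j x₀ r) y (locFrame θ i x₀ m y)
        = ∑ q, ∑ r, (frameChange θ i j x₀ q m y * frameChange θ i j x₀ r k y) •
          fderiv ℝ (locFrame θ j x₀ r) y (locFrame θ j x₀ q y) := by
      rw [Finset.sum_comm]
      refine Finset.sum_congr rfl fun r _ => ?_
      conv_lhs => rw [locFrame_eq_sum θ (i := i) hj m]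
      rw [map_sum, Finset.smul_sum]
      refine Finset.sum_congr rfl fun q _ => ?_
      rw [map_smul, smul_smul, mul_comm]
    have e2 : ∑ r, frameChange θ i j x₀ r m y • fderiv ℝ (locFrame θ j x₀ r) y (locFrame θ i x₀ k y)
        = ∑ q, ∑ r, (frameChange θ i j x₀ q m y * frameChange θ i j x₀ r k y) •
          fderiv ℝ (locFrame θ j x₀ q) y (locFrame θ j x₀ r y) := by
      refine Finset.sum_congr rfl fun q _ => ?_
      conv_lhs => rw [locFrame_eq_sum θ (i := i) hj k]
      rw [map_sum, Finset.smul_sum]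
      refine Finset.sum_congr rfl fun r _ => ?_
      rw [map_smul, smul_smul]
    rw [VectorField.lieBracket_eq]
    simp only [hfd, Finset.sum_add_distrib, VectorField.lieBracket_eq, smul_sub,
      Finset.sum_sub_distrib]
    rw [e1, e2]
    abel
  rw [structFun, key]
  simp only [map_add, map_sub, map_sum, map_smul, smul_eq_mul, coframe_locFrame_swap θ hi.1]
  congr 1
  refine Finset.sum_congr rfl fun q _ => Finset.sum_congr rfl fun r _ => ?_
  rw [coframe_eq_sum θ (i := i) hj, Finset.mul_sum]
  refine Finset.sum_congr rfl fun s _ => ?_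
  rw [structFun]
  ring

/-- The Koszul combination contains six terms with derivatives of `Q`. By antisymmetry four of them
cancel in pairs and the other two coincide, which leaves the inhomogeneous term of a connection. -/
theorem christoffel_change (hi : y ∈ locDom θ i x₀) (hj : y ∈ locDom θ j x₀) (m k p : Fin n) :
    θ.christoffel i m k p (chartInv x₀ y) =
      frameChangeDeriv θ i j x₀ y (locFrame θ i x₀ m y) k p +
      ∑ q, ∑ r, ∑ s, frameChange θ i j x₀ q m y * frameChange θ i j x₀ r k y *
        frameChange θ i j x₀ s p y * θ.christoffel j q r s (chartInv x₀ y) := by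
  simp only [christoffel_chartInv θ hi, christoffel_chartInv θ hj]
  rw [structFun_change θ hi hj m k p, structFun_change θ hi hj m p k,
    structFun_change θ hi hj k p m]
  set Q := fun a b => frameChange θ i j x₀ a b y
  set Cj := fun a b c => structFun θ j x₀ a b c y
  have t1 : ∑ q, ∑ r, ∑ s, Q q m * Q r p * Q s k * Cj q r s =
      ∑ q, ∑ r, ∑ s, Q q m * Q r k * Q s p * Cj q s r := by
    refine Finset.sum_congr rfl fun q _ => ?_
    rw [Finset.sum_comm]
    exact Finset.sum_congr rfl fun r _ => Finset.sum_congr rfl fun s _ => by ring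
  have t2 : ∑ q, ∑ r, ∑ s, Q q k * Q r p * Q s m * Cj q r s =
      ∑ q, ∑ r, ∑ s, Q q m * Q r k * Q s p * Cj r s q := by
    rw [Finset.sum_comm_cycle]
    refine Finset.sum_congr rfl fun q _ => ?_
    exact Finset.sum_congr rfl fun r _ => Finset.sum_congr rfl fun s _ => by ring
  have t3 : ∑ q, ∑ r, ∑ s, Q q m * Q r k * Q s p *
      (1 / 2 * (Cj q r s - Cj q s r - Cj r s q)) = 1 / 2 * (∑ q, ∑ r, ∑ s, Q q m * Q r k * Q s p * Cj q r s
      - ∑ q, ∑ r, ∑ s, Q q m * Q r k * Q s p * Cj q s r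
      - ∑ q, ∑ r, ∑ s, Q q m * Q r k * Q s p * Cj r s q) := by
    simp only [← Finset.sum_sub_distrib, Finset.mul_sum]
    exact Finset.sum_congr rfl fun q _ => Finset.sum_congr rfl fun r _ =>
      Finset.sum_congr rfl fun s _ => by ring
  rw [t1, t2, t3]
  have a1 := frameChangeDeriv_antisymm θ hi hj (locFrame θ i x₀ m y) k p
  have a2 := frameChangeDeriv_antisymm θ hi hj (locFrame θ i x₀ k y) m p
  have a3 := frameChangeDeriv_antisymm θ hi hj (locFrame θ i x₀ p y) m k
  linarith

/-- Contraction of the direction index with `Q` makes both sides refer to the same direction, the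
`l`-th vector of the frame `j`. This is the form of the hypothesis of `spin_change_of_frame`. -/
theorem christoffel_change_along (hi : y ∈ locDom θ i x₀) (hj : y ∈ locDom θ j x₀)
    (l k p : Fin n) :
    ∑ m, frameChange θ i j x₀ l m y * θ.christoffel i m k p (chartInv x₀ y) =
      frameChangeDeriv θ i j x₀ y (locFrame θ j x₀ l y) k p +
      ∑ r, ∑ s, frameChange θ i j x₀ r k y *
        frameChange θ i j x₀ s p y * θ.christoffel j l r s (chartInv x₀ y) := by
  simp only [christoffel_change θ hi hj, mul_add, Finset.sum_add_distrib]
  congr 1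
  · rw [locFrame_eq_sum' θ (j := j) hi l]
    simp only [frameChangeDeriv, map_sum, map_smul, smul_eq_mul, Finset.mul_sum, Finset.sum_mul]
    rw [Finset.sum_comm]
    exact Finset.sum_congr rfl fun r _ => Finset.sum_congr rfl fun s _ => by ring
  · simp only [Finset.mul_sum]
    rw [Finset.sum_comm]
    have : ∀ q, ∑ m, ∑ r, ∑ s, frameChange θ i j x₀ l m y * (frameChange θ i j x₀ q m y *
        frameChange θ i j x₀ r k y * frameChange θ i j x₀ s p y *
          θ.christoffel j q r s (chartInv x₀ y)) = (if l = q then 1 else 0) *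
        ∑ r, ∑ s, frameChange θ i j x₀ r k y * frameChange θ i j x₀ s p y *
          θ.christoffel j q r s (chartInv x₀ y) := by
      intro q
      rw [← frameChange_orth' θ hi hj, Finset.sum_mul]
      refine Finset.sum_congr rfl fun m _ => ?_
      simp only [Finset.mul_sum]
      exact Finset.sum_congr rfl fun r _ => Finset.sum_congr rfl fun s _ => by ring
    simp only [this]
    simp

end LocalFrames

end

end WeightedDirac

namespace WeightedDirac

noncomputable section

/-! ### Covariant derivatives in a frame -/

section CovDerivIn

variable {𝕜 : Type*} [RCLike 𝕜] {n : ℕ} {M : Type*} [TopologicalSpace M]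
  [ChartedSpace (EuclideanSpace ℝ (Fin n)) M] [IsManifold (𝓡 n) ∞ M]
  {g : RMetric n M} {θ : SpinStructure g}
  {V : Type*} [NormedAddCommGroup V] [NormedSpace 𝕜 V] [NormedSpace ℝ V] [IsScalarTower ℝ 𝕜 V]

/-- The section `σ` in the frame `i`. -/
def FramedBundle.inFrame (E : FramedBundle 𝕜 θ V) (i : Fin θ.N) (σ : M → V) (x : M) : V :=
  E.trans i x (σ x)

/-- The covariant derivative of the section `σ`, in the frame `i`. -/
def FramedBundle.covDerivIn (E : FramedBundle 𝕜 θ V) (i : Fin θ.N) (σ : M → V) (x : M) :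
    PiLp 2 (fun _ : Fin n => V) :=
  WithLp.toLp 2 fun l =>
    (show V from mfderiv (𝓡 n) 𝓘(ℝ, V) (E.inFrame i σ) x (θ.frame i l x)) +
      E.conn i l x (E.inFrame i σ x)

theorem FramedBundle.covDeriv_eq (E : FramedBundle 𝕜 θ V) (σ : M → V) (x : M) :
    E.covDeriv σ x = E.covDerivIn (θ.idx x) σ x := rfl

theorem hasDerivAt_line {X W : Type*} [NormedAddCommGroup X] [NormedSpace ℝ X]
    [NormedAddCommGroup W] [NormedSpace ℝ W] {f : X → W} {f' : X →L[ℝ] W} {y : X}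
    (hf : HasFDerivAt f f' y) (v : X) : HasDerivAt (fun t : ℝ => f (y + t • v)) (f' v) 0 := by
  have hcurve : HasDerivAt (fun t : ℝ => y + t • v) v 0 := by
    simpa using (((hasDerivAt_id (0 : ℝ)).smul_const v).const_add y)
  exact HasFDerivAt.comp_hasDerivAt (0 : ℝ) (by simpa using hf) hcurve

theorem mdifferentiableAt_chartInv {x₀ : M} {y : Euc n} (hy : y ∈ (chartAt (Euc n) x₀).target) :
    MDifferentiableAt (𝓡 n) (𝓡 n) (chartInv x₀) y :=
  (contMDiffAt_chartInv hy).mdifferentiableAt (by simp)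

theorem hasFDerivAt_comp_chartInv {f : M → V} {x₀ : M} {y : Euc n}
    (hy : y ∈ (chartAt (Euc n) x₀).target)
    (hf : MDifferentiableAt (𝓡 n) 𝓘(ℝ, V) f (chartInv x₀ y)) :
    HasFDerivAt (f ∘ chartInv x₀) ((show Euc n →L[ℝ] V from
      mfderiv (𝓡 n) 𝓘(ℝ, V) f (chartInv x₀ y)).comp (dChartInv x₀ y)) y :=
  (hf.hasMFDerivAt.comp y (mdifferentiableAt_chartInv hy).hasMFDerivAt).hasFDerivAt

theorem mfderiv_frame {f : M → V} {i : Fin θ.N} {x₀ : M} {y : Euc n}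
    (hy : y ∈ (chartAt (Euc n) x₀).target)
    (hf : MDifferentiableAt (𝓡 n) 𝓘(ℝ, V) f (chartInv x₀ y)) (l : Fin n) :
    (show V from mfderiv (𝓡 n) 𝓘(ℝ, V) f (chartInv x₀ y) (θ.frame i l (chartInv x₀ y))) =
      fderiv ℝ (f ∘ chartInv x₀) y (locFrame θ i x₀ l y) := by
  rw [(hasFDerivAt_comp_chartInv hy hf).fderiv, ← dChartInv_locFrame θ hy i l]
  rfl

theorem FramedBundle.covDerivIn_chartInv (E : FramedBundle 𝕜 θ V) {i : Fin θ.N} {σ : M → V}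
    {x₀ : M} {y : Euc n} (hy : y ∈ (chartAt (Euc n) x₀).target)
    (hσ : MDifferentiableAt (𝓡 n) 𝓘(ℝ, V) (E.inFrame i σ) (chartInv x₀ y)) (l : Fin n) :
    E.covDerivIn i σ (chartInv x₀ y) l =
      fderiv ℝ (E.inFrame i σ ∘ chartInv x₀) y (locFrame θ i x₀ l y) +
        E.conn i l (chartInv x₀ y) (E.inFrame i σ (chartInv x₀ y)) := by
  rw [← mfderiv_frame hy hσ]; rfl

theorem FramedBundle.IsSmooth.mdifferentiableAt_inFrame {E : FramedBundle 𝕜 θ V} {σ : M → V}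
    (h : E.IsSmooth σ) {i : Fin θ.N} {x : M} (hx : x ∈ θ.U i) :
    MDifferentiableAt (𝓡 n) 𝓘(ℝ, V) (E.inFrame i σ) x :=
  ((h i).contMDiffAt ((θ.isOpen i).mem_nhds hx)).mdifferentiableAt (by simp)

theorem chart_mem_locDom {i : Fin θ.N} {x : M} (hx : x ∈ θ.U i) :
    chartAt (Euc n) x x ∈ locDom θ i x := by
  refine ⟨mem_chart_target _ x, ?_⟩
  rw [Set.mem_preimage, OpenPartialHomeomorph.left_inv _ (mem_chart_source _ x)]
  exact hx

theorem chartInv_chart (x : M) : chartInv x (chartAt (Euc n) x x) = x :=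
  OpenPartialHomeomorph.left_inv _ (mem_chart_source _ x)

end CovDerivIn

/-! ### The spin representation -/

section SpinRep

variable {𝕜 : Type*} [RCLike 𝕜] {n : ℕ} {M : Type*} [TopologicalSpace M]
  [ChartedSpace (EuclideanSpace ℝ (Fin n)) M] [IsManifold (𝓡 n) ∞ M] {g : RMetric n M}
  {S : Type*} [NormedAddCommGroup S] [InnerProductSpace 𝕜 S] [NormedSpace ℝ S]
  [IsScalarTower ℝ 𝕜 S] [FiniteDimensional 𝕜 S]

theorem repCLM_apply (c : CliffordModule 𝕜 n S) (a : Cl n) (s : S) : c.repCLM a s = c.rep a s := rfl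

theorem rep_ι (c : CliffordModule 𝕜 n S) (v : Euc n) :
    c.rep (CliffordAlgebra.ι (cliffordForm n) v) = c.γ v := by
  simp [CliffordModule.rep]

theorem repCLM_gen (c : CliffordModule 𝕜 n S) (k : Fin n) : c.repCLM (gen k) = c.γ' k := by
  ext s
  rw [repCLM_apply, gen, rep_ι]; rfl

/-- The representation as a linear map. -/
def repₗ (c : CliffordModule 𝕜 n S) : Cl n →ₗ[ℝ] (S →L[𝕜] S) where
  toFun := c.repCLM
  map_add' a b := by ext s; simp [repCLM_apply]
  map_smul' r a := by ext s; simp [repCLM_apply]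

theorem repCLM_comp (c : CliffordModule 𝕜 n S) (a b : Cl n) :
    (c.repCLM a).comp (c.repCLM b) = c.repCLM (a * b) := by
  ext s; exact repCLM_mul c a b s

theorem repCLM_one (c : CliffordModule 𝕜 n S) : c.repCLM 1 = ContinuousLinearMap.id 𝕜 S := by
  ext s; simp [repCLM_apply]

/-- The involution `star` is `-1` on vectors, and `γ(v)` is skew-adjoint; the rest follows by
induction over the Clifford algebra. In consequence the spin group acts isometrically. -/
theorem inner_rep_left (c : CliffordModule 𝕜 n S) (a : Cl n) (s t : S) :
    inner 𝕜 (c.repCLM a s) t = inner 𝕜 s (c.repCLM (star a) t) := by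
  induction a using CliffordAlgebra.induction generalizing s t with
  | algebraMap r =>
    rw [CliffordAlgebra.star_algebraMap]
    simp only [repCLM_apply, AlgHom.commutes, Module.algebraMap_end_apply]
    rw [RCLike.real_smul_eq_coe_smul (K := 𝕜) r s, RCLike.real_smul_eq_coe_smul (K := 𝕜) r t,
      inner_smul_left, inner_smul_right, RCLike.conj_ofReal]
  | ι v =>
    rw [CliffordAlgebra.star_ι, repCLM_apply, repCLM_apply, map_neg, rep_ι, c.skew]
    simp
  | mul a b ha hb =>
    rw [star_mul, ← repCLM_mul, ← repCLM_mul, ha, hb]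
  | add a b ha hb =>
    have h : ∀ a b s, c.repCLM (a + b) s = c.repCLM a s + c.repCLM b s := fun a b s => by
      simp [repCLM_apply]
    rw [star_add, h, h, inner_add_left, inner_add_right, ha, hb]

theorem inner_rep_rep (c : CliffordModule 𝕜 n S) {a : Cl n} (ha : star a * a = 1) (s t : S) :
    inner 𝕜 (c.repCLM a s) (c.repCLM a t) = inner 𝕜 s t := by
  rw [inner_rep_left, repCLM_mul, ha, repCLM_one]; rfl

theorem norm_rep (c : CliffordModule 𝕜 n S) {a : Cl n} (ha : star a * a = 1) (s : S) :
    ‖c.repCLM a s‖ = ‖s‖ := by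
  have h := inner_rep_rep (𝕜 := 𝕜) c ha s s
  rw [inner_self_eq_norm_sq_to_K, inner_self_eq_norm_sq_to_K] at h
  have h2 : ‖c.repCLM a s‖ ^ 2 = ‖s‖ ^ 2 := by exact_mod_cast h
  exact (pow_left_inj₀ (norm_nonneg _) (norm_nonneg _) two_ne_zero).1 h2

variable (θ : SpinStructure g) (c : CliffordModule 𝕜 n S)

theorem star_lift_mul (i j : Fin θ.N) (x : M) :
    star (θ.lift i j x : Cl n) * (θ.lift i j x : Cl n) = 1 := spinGroup.coe_star_mul_self _

/-- The action of the change of frame on spinors. -/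
def cocyc (j i : Fin θ.N) (x : M) : S →L[𝕜] S := c.repCLM (θ.lift j i x : Cl n)

theorem spinorFramed_trans (i : Fin θ.N) (x : M) :
    (spinorFramed θ c).trans i x = cocyc θ c i (θ.idx x) x := rfl

theorem norm_cocyc (j i : Fin θ.N) (x : M) (s : S) : ‖cocyc θ c j i x s‖ = ‖s‖ :=
  norm_rep c (star_lift_mul θ j i x) s

theorem inner_cocyc (j i : Fin θ.N) (x : M) (s t : S) :
    inner 𝕜 (cocyc θ c j i x s) (cocyc θ c j i x t) = inner 𝕜 s t :=
  inner_rep_rep c (star_lift_mul θ j i x) s t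

variable {θ}

theorem cocyc_comp {i j k : Fin θ.N} {x : M} (hi : x ∈ θ.U i) (hj : x ∈ θ.U j) (hk : x ∈ θ.U k)
    (s : S) : cocyc θ c k j x (cocyc θ c j i x s) = cocyc θ c k i x s := by
  rw [cocyc, cocyc, repCLM_mul]
  have := θ.cocycle k j i x ⟨⟨hk, hj⟩, hi⟩
  rw [cocyc, ← this]
  rfl

theorem cocyc_self {i : Fin θ.N} {x : M} (hi : x ∈ θ.U i) (s : S) : cocyc θ c i i x s = s := by
  have h : θ.lift i i x = 1 := mul_eq_left.1 (θ.cocycle i i i x ⟨⟨hi, hi⟩, hi⟩)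
  rw [cocyc, h]
  simp [repCLM_apply]

theorem cocyc_cancel {i j : Fin θ.N} {x : M} (hi : x ∈ θ.U i) (hj : x ∈ θ.U j) (s : S) :
    cocyc θ c i j x (cocyc θ c j i x s) = s := by
  rw [cocyc_comp c hi hj hi, cocyc_self c hi]

theorem spinor_inFrame_change {i j : Fin θ.N} {x : M} (hi : x ∈ θ.U i) (hj : x ∈ θ.U j)
    (σ : M → S) : (spinorFramed θ c).inFrame j σ x =
      cocyc θ c j i x ((spinorFramed θ c).inFrame i σ x) :=
  (cocyc_comp c (θ.mem_idx x) hi hj _).symm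

variable (θ)

theorem contMDiffOn_linear_lift {W : Type*} [NormedAddCommGroup W] [NormedSpace ℝ W]
    (F : Cl n →ₗ[ℝ] W) (j i : Fin θ.N) :
    ContMDiffOn (𝓡 n) 𝓘(ℝ, W) ∞ (fun x => F (θ.lift j i x : Cl n)) (θ.U j ∩ θ.U i) := by
  let b := Module.finBasis ℝ (Cl n)
  have e : ∀ x, F x = ∑ k, b.coord k x • F (b k) := fun x => by
    conv_lhs => rw [← b.sum_repr x, map_sum]
    simp only [map_smul, Module.Basis.coord_apply]
  have h : ContMDiffOn (𝓡 n) 𝓘(ℝ, W) ∞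
      (fun x => ∑ k, b.coord k (θ.lift j i x : Cl n) • F (b k)) (θ.U j ∩ θ.U i) :=
    contMDiffOn_finsetSum fun k _ => (θ.lift_smooth j i (b.coord k)).smul contMDiffOn_const
  exact h.congr fun x _ => e _

theorem contMDiffOn_cocyc (j i : Fin θ.N) :
    ContMDiffOn (𝓡 n) 𝓘(ℝ, S →L[𝕜] S) ∞ (cocyc θ c j i) (θ.U j ∩ θ.U i) :=
  contMDiffOn_linear_lift θ (repₗ c) j i

theorem spinConnection_eq (i : Fin θ.N) (l : Fin n) (x : M) :
    spinConnection θ c i l x = c.repCLM (connElt fun j k => θ.christoffel i l j k x) := by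
  have : c.repCLM (connElt fun j k => θ.christoffel i l j k x) =
    repₗ c (connElt fun j k => θ.christoffel i l j k x) := rfl
  rw [this, connElt, map_smul, map_sum]
  simp only [map_sum, map_smul]
  rw [spinConnection]
  congr 1
  refine Finset.sum_congr rfl fun j _ => Finset.sum_congr rfl fun k _ => ?_
  rw [← repCLM_gen, ← repCLM_gen, repCLM_comp]; rfl

/-- Equivariance of Clifford multiplication: the covering relation `a e_k a* = ∑_l Q_{lk} e_l` is
multiplied by `a` on the right and represented on `S`. -/
theorem sum_frameChange_γ {i j : Fin θ.N} {x₀ : M} {y : Euc n} (hi : y ∈ locDom θ i x₀)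
    (hj : y ∈ locDom θ j x₀) (k : Fin n) (s : S) :
    ∑ l, frameChange θ i j x₀ l k y • c.γ' l (cocyc θ c j i (chartInv x₀ y) s) =
      cocyc θ c j i (chartInv x₀ y) (c.γ' k s) := by
  have h := θ.covers j i _ ⟨hj.2, hi.2⟩ k
  have h2 := congrArg (fun z => z * (θ.lift j i (chartInv x₀ y) : Cl n)) h
  simp only [mul_assoc, star_lift_mul, mul_one] at h2
  have h3 := congrArg (fun z => repₗ c z s) h2
  simp only [Finset.sum_mul, map_sum, smul_mul_assoc, map_smul] at h3
  change c.repCLM _ s = (∑ l, _ • c.repCLM _) s at h3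
  rw [← repCLM_mul] at h3
  change c.repCLM _ (c.repCLM (gen k) s) = _ at h3
  rw [repCLM_gen] at h3
  rw [cocyc, h3, sum_apply]
  refine Finset.sum_congr rfl fun l _ => ?_
  rw [smul_apply, ← repCLM_mul, frameChange_eq θ hi.1]
  change _ = _ • c.repCLM (gen l) _
  rw [repCLM_gen]

/-- Independence of the covariant derivative from the frame. Along the coordinate line through `y`
with velocity `f_l`, the spinor in the frame `j` is `a(t)` applied to the spinor in the frame `i`.
The product rule produces `a'`, and `spin_change_of_frame` trades `a' + ω_j a` for `a ω_i`. A
straight line suffices because only its velocity at `0` matters. -/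
theorem covDerivIn_change {i j : Fin θ.N} {x₀ : M} {y : Euc n} (hi : y ∈ locDom θ i x₀)
    (hj : y ∈ locDom θ j x₀) {σ : M → S}
    (hσi : MDifferentiableAt (𝓡 n) 𝓘(ℝ, S) ((spinorFramed θ c).inFrame i σ) (chartInv x₀ y))
    (hσj : MDifferentiableAt (𝓡 n) 𝓘(ℝ, S) ((spinorFramed θ c).inFrame j σ) (chartInv x₀ y))
    (l : Fin n) :
    (spinorFramed θ c).covDerivIn j σ (chartInv x₀ y) l = ∑ m, frameChange θ i j x₀ l m y •
      cocyc θ c j i (chartInv x₀ y) ((spinorFramed θ c).covDerivIn i σ (chartInv x₀ y) m) := by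
  set E := spinorFramed θ c with hE
  set v := locFrame θ j x₀ l y with hv
  have hcurve : HasDerivAt (fun t : ℝ => y + t • v) v 0 := by
    simpa using (((hasDerivAt_id (0 : ℝ)).smul_const v).const_add y)
  have hc0 : y + (0 : ℝ) • v = y := by simp
  have hev : ∀ᶠ t : ℝ in nhds 0, y + t • v ∈ locDom θ i x₀ ∧ y + t • v ∈ locDom θ j x₀ := by
    have hcont : Filter.Tendsto (fun t : ℝ => y + t • v) (nhds 0) (nhds y) := by
      have := hcurve.continuousAt.tendsto
      rwa [hc0] at this
    exact hcont.eventually (Filter.inter_mem ((isOpen_locDom θ i x₀).mem_nhds hi)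
      ((isOpen_locDom θ j x₀).mem_nhds hj))
  set a : ℝ → Cl n := fun t => (θ.lift j i (chartInv x₀ (y + t • v)) : Cl n) with ha
  obtain ⟨a', ha'⟩ : ∃ a', HasWeakDeriv a a' 0 := by
    refine exists_hasWeakDeriv fun f => ?_
    have h1 : MDifferentiableAt (𝓡 n) 𝓘(ℝ, ℝ) (fun x => f (θ.lift j i x : Cl n)) (chartInv x₀ y) :=
      ((θ.lift_smooth j i f).contMDiffAt (((θ.isOpen j).inter (θ.isOpen i)).mem_nhds
        ⟨hj.2, hi.2⟩)).mdifferentiableAt (by simp)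
    exact (hasDerivAt_line (hasFDerivAt_comp_chartInv hi.1 h1) v).differentiableAt
  have key : a' + connElt (fun q r => θ.christoffel j l q r (chartInv x₀ y)) * a 0 =
      a 0 * connElt (fun k p => ∑ m, frameChange θ i j x₀ l m y *
        θ.christoffel i m k p (chartInv x₀ y)) := by
    refine spin_change_of_frame (a := a) (Q := fun t l k => frameChange θ i j x₀ l k (y + t • v))
      (Q' := fun l k => fderiv ℝ (frameChange θ i j x₀ l k) y v)
      (Filter.Eventually.of_forall fun t => Subtype.prop _) ?_ ?_ ?_ ?_ ?_ ?_ ha'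
    · filter_upwards [hev] with t ht k
      have := θ.covers j i _ ⟨ht.2.2, ht.1.2⟩ k
      simp only [frameChange_eq θ ht.1.1]
      exact this
    · intro p k
      exact hasDerivAt_line
        ((contDiffAt_frameChange θ hi hj p k).differentiableAt (by simp)).hasFDerivAt v
    · intro p q
      simp only [hc0]
      exact frameChange_orth' θ hi hj p q
    · intro p q
      rw [← Finset.sum_neg_distrib]
      refine Finset.sum_congr rfl fun m _ => ?_
      rw [christoffel_antisymm]; ring
    · intro p q; exact christoffel_antisymm θ l p q
    · intro k p
      simp only [hc0]
      exact christoffel_change_along θ hi hj l k p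
  have ha0 : c.repCLM (a 0) = cocyc θ c j i (chartInv x₀ y) := by
    simp only [ha, hc0]; rfl
  have hs : HasDerivAt (fun t : ℝ => E.inFrame i σ (chartInv x₀ (y + t • v)))
      (fderiv ℝ (E.inFrame i σ ∘ chartInv x₀) y v) 0 :=
    hasDerivAt_line (hasFDerivAt_comp_chartInv hi.1 hσi).differentiableAt.hasFDerivAt v
  have hs' : HasDerivAt (fun t : ℝ => E.inFrame j σ (chartInv x₀ (y + t • v)))
      (fderiv ℝ (E.inFrame j σ ∘ chartInv x₀) y v) 0 :=
    hasDerivAt_line (hasFDerivAt_comp_chartInv hj.1 hσj).differentiableAt.hasFDerivAt v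
  let resₗ : Cl n →ₗ[ℝ] (S →L[ℝ] S) :=
    { toFun := fun z => (c.repCLM z).restrictScalars ℝ
      map_add' := fun a b => by ext s; simp [repCLM_apply]
      map_smul' := fun r a => by ext s; simp [repCLM_apply] }
  have hprod := (ha'.hasDerivAt resₗ).clm_apply hs
  have hder : fderiv ℝ (E.inFrame j σ ∘ chartInv x₀) y v =
      c.repCLM a' (E.inFrame i σ (chartInv x₀ y)) +
        cocyc θ c j i (chartInv x₀ y) (fderiv ℝ (E.inFrame i σ ∘ chartInv x₀) y v) := by
    have h2 := hs'.unique (hprod.congr_of_eventuallyEq (by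
      filter_upwards [hev] with t ht
      exact spinor_inFrame_change c ht.1.2 ht.2.2 σ))
    rw [h2, hc0, ← ha0]
    rfl
  rw [E.covDerivIn_chartInv hj.1 hσj, ← hv, hder]
  have hs0 : E.inFrame j σ (chartInv x₀ y) = c.repCLM (a 0) (E.inFrame i σ (chartInv x₀ y)) := by
    rw [ha0]; exact spinor_inFrame_change c hi.2 hj.2 σ
  have hconn : ∀ k m, E.conn k m (chartInv x₀ y) = spinConnection θ c k m (chartInv x₀ y) :=
    fun _ _ => rfl
  rw [hs0, hconn, spinConnection_eq, repCLM_mul, add_right_comm]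
  have hadd : ∀ a b s, c.repCLM (a + b) s = c.repCLM a s + c.repCLM b s := fun a b s => by
      simp [repCLM_apply]
  rw [← hadd, key, ← repCLM_mul, ha0]
  have hlin : c.repCLM (connElt (fun k p => ∑ m, frameChange θ i j x₀ l m y *
        θ.christoffel i m k p (chartInv x₀ y))) = ∑ m, frameChange θ i j x₀ l m y •
          spinConnection θ c i m (chartInv x₀ y) := by
    have h1 : connElt (fun k p => ∑ m, frameChange θ i j x₀ l m y *
        θ.christoffel i m k p (chartInv x₀ y)) = ∑ m, frameChange θ i j x₀ l m y •
          connElt (fun k p => θ.christoffel i m k p (chartInv x₀ y)) := by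
      simp only [connElt, Finset.sum_smul, Finset.smul_sum, smul_smul]
      rw [Finset.sum_comm_cycle]
      refine Finset.sum_congr rfl fun m _ => ?_
      refine Finset.sum_congr rfl fun k _ => Finset.sum_congr rfl fun p _ => ?_
      congr 1; ring
    simp only [spinConnection_eq]
    rw [h1]
    exact (map_sum (repₗ c) _ _).trans (Finset.sum_congr rfl fun m _ => map_smul (repₗ c) _ _)
  have hdlin : fderiv ℝ (E.inFrame i σ ∘ chartInv x₀) y v = ∑ m, frameChange θ i j x₀ l m y •
      fderiv ℝ (E.inFrame i σ ∘ chartInv x₀) y (locFrame θ i x₀ m y) := by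
    rw [hv, locFrame_eq_sum' θ (j := j) hi l, map_sum]
    simp only [map_smul]
  rw [hlin, hdlin, ← map_add, sum_apply, ← Finset.sum_add_distrib, map_sum]
  refine Finset.sum_congr rfl fun m _ => ?_
  rw [E.covDerivIn_chartInv hi.1 hσi, smul_apply, ← smul_add]
  have hsm : ∀ (r : ℝ) (s : S), cocyc θ c j i (chartInv x₀ y) (r • s) =
      r • cocyc θ c j i (chartInv x₀ y) s := fun r s =>
    map_smul ((cocyc θ c j i (chartInv x₀ y)).restrictScalars ℝ) r s
  rw [hsm, add_comm (spinConnection θ c i m _ _)]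
  rfl

end SpinRep

end

end WeightedDirac

namespace WeightedDirac

noncomputable section

/-! ### Bundles with an invariant covariant derivative -/

section Geometric

variable {𝕜 : Type*} [RCLike 𝕜] {n : ℕ} {M : Type*} [TopologicalSpace M]
  [ChartedSpace (EuclideanSpace ℝ (Fin n)) M] [IsManifold (𝓡 n) ∞ M]
  {g : RMetric n M} {θ : SpinStructure g}

/-- The properties of a framed bundle that make norms of sections and of covariant derivatives
comparable in different frames. -/
structure FramedBundle.IsGeometric {V : Type*} [NormedAddCommGroup V] [NormedSpace 𝕜 V]
    [NormedSpace ℝ V] [IsScalarTower ℝ 𝕜 V] (E : FramedBundle 𝕜 θ V) : Prop where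
  norm_trans : ∀ i, ∀ x ∈ θ.U i, ∀ v, ‖E.trans i x v‖ = ‖v‖
  trans_idx : ∀ x v, E.trans (θ.idx x) x v = v
  covDerivIn_le : ∀ σ, E.IsSmooth σ → ∀ i j, ∀ x ∈ θ.U i, x ∈ θ.U j → ∀ l,
    ‖E.covDerivIn j σ x l‖ ≤ ∑ m, ‖E.covDerivIn i σ x m‖
  continuousOn_conn : ∀ i l x₀, ContinuousOn (fun y => E.conn i l (chartInv x₀ y)) (locDom θ i x₀)

theorem abs_frameChange_le {i j : Fin θ.N} {x₀ : M} {y : Euc n} (hi : y ∈ locDom θ i x₀)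
    (hj : y ∈ locDom θ j x₀) (l k : Fin n) : |frameChange θ i j x₀ l k y| ≤ 1 := by
  have h := frameChange_orth θ hi hj k k
  rw [if_pos rfl] at h
  have h2 : frameChange θ i j x₀ l k y * frameChange θ i j x₀ l k y ≤ 1 := by
    rw [← h]
    exact Finset.single_le_sum (f := fun r => frameChange θ i j x₀ r k y * frameChange θ i j x₀ r k y)
      (fun r _ => mul_self_nonneg _) (Finset.mem_univ l)
  exact abs_le_of_sq_le_sq' (by nlinarith) zero_le_one |> abs_le.2

variable {S : Type*} [NormedAddCommGroup S] [InnerProductSpace 𝕜 S] [NormedSpace ℝ S]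
  [IsScalarTower ℝ 𝕜 S] [FiniteDimensional 𝕜 S] (c : CliffordModule 𝕜 n S)

theorem contDiffOn_spinConnection (i : Fin θ.N) (l : Fin n) (x₀ : M) :
    ContDiffOn ℝ ∞ (fun y => spinConnection θ c i l (chartInv x₀ y)) (locDom θ i x₀) := by
  refine ContDiffOn.const_smul (1 / 4 : ℝ)
    (ContDiffOn.sum fun j _ => ContDiffOn.sum fun k _ => ?_)
  exact (contDiffOn_christoffel θ i x₀ l j k).smul contDiffOn_const

theorem spinorFramed_isGeometric : (spinorFramed θ c).IsGeometric where
  norm_trans i x _ v := norm_cocyc θ c i _ x v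
  trans_idx x v := cocyc_self c (θ.mem_idx x) v
  covDerivIn_le σ hσ i j x hi hj l := by
    have hi' := chart_mem_locDom hi
    have hj' := chart_mem_locDom hj
    have h := covDerivIn_change θ c hi' hj' (σ := σ)
      (by rw [chartInv_chart]; exact hσ.mdifferentiableAt_inFrame hi)
      (by rw [chartInv_chart]; exact hσ.mdifferentiableAt_inFrame hj) l
    rw [chartInv_chart] at h
    rw [h]
    refine (norm_sum_le _ _).trans (Finset.sum_le_sum fun m _ => ?_)
    rw [norm_smul, norm_cocyc]
    exact mul_le_of_le_one_left (norm_nonneg _) (abs_frameChange_le hi' hj' l m)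
  continuousOn_conn i l x₀ := (contDiffOn_spinConnection c i l x₀).continuousOn

/-- The directions of differentiation and the Clifford matrices turn with the same orthogonal
matrix, so the Dirac operator transforms like a spinor. -/
theorem contract_covDerivIn_change {i j : Fin θ.N} {x : M} (hi : x ∈ θ.U i) (hj : x ∈ θ.U j)
    {σ : M → S} (hσ : (spinorFramed θ c).IsSmooth σ) :
    c.contract ((spinorFramed θ c).covDerivIn j σ x) =
      cocyc θ c j i x (c.contract ((spinorFramed θ c).covDerivIn i σ x)) := by
  have hi' := chart_mem_locDom hi
  have hj' := chart_mem_locDom hj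
  have h := fun l => covDerivIn_change θ c hi' hj' (σ := σ)
      (by rw [chartInv_chart]; exact hσ.mdifferentiableAt_inFrame hi)
      (by rw [chartInv_chart]; exact hσ.mdifferentiableAt_inFrame hj) l
  have hγ := sum_frameChange_γ θ c hi' hj'
  simp only [chartInv_chart] at h hγ
  have hc : ∀ Ψ : PiLp 2 (fun _ : Fin n => S), c.contract Ψ = ∑ l, c.γ' l (Ψ l) := fun Ψ => by
    simp [CliffordModule.contract]
  have hsm : ∀ (k : Fin n) (r : ℝ) (s : S), c.γ' k (r • s) = r • c.γ' k s := fun k r s =>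
    map_smul ((c.γ' k).restrictScalars ℝ) r s
  simp only [hc, h, map_sum, hsm]
  rw [Finset.sum_comm]
  refine Finset.sum_congr rfl fun m _ => ?_
  exact hγ m _

theorem endFramed_trans_apply (i : Fin θ.N) (x : M) (F : S →L[𝕜] S) (s : S) :
    (endFramed θ c).trans i x F s = cocyc θ c i (θ.idx x) x (F (cocyc θ c (θ.idx x) i x s)) := rfl

theorem endFramed_conn_apply (i : Fin θ.N) (l : Fin n) (x : M) (F : S →L[𝕜] S) (s : S) :
    (endFramed θ c).conn i l x F s =
      spinConnection θ c i l x (F s) - F (spinConnection θ c i l x s) := rfl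

/-- The restriction of scalars as a real linear map. -/
def toRealCLM (𝕜 S : Type*) [RCLike 𝕜] [NormedAddCommGroup S] [InnerProductSpace 𝕜 S]
    [NormedSpace ℝ S] [IsScalarTower ℝ 𝕜 S] : (S →L[𝕜] S) →L[ℝ] (S →L[ℝ] S) :=
  ContinuousLinearMap.restrictScalarsL 𝕜 S S ℝ ℝ

theorem toRealCLM_apply (F : S →L[𝕜] S) (s : S) : toRealCLM 𝕜 S F s = F s := rfl

theorem inFrame_apply {i : Fin θ.N} {x : M} (hx : x ∈ θ.U i) (F : M → S →L[𝕜] S) (σ : M → S) :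
    (spinorFramed θ c).inFrame i (fun y => F y (σ y)) x =
      (endFramed θ c).inFrame i F x ((spinorFramed θ c).inFrame i σ x) := by
  rw [FramedBundle.inFrame, FramedBundle.inFrame, FramedBundle.inFrame, endFramed_trans_apply,
    spinorFramed_trans, cocyc_cancel c (θ.mem_idx x) hx]

/-- The Leibniz rule. The connection on endomorphisms is the commutator, so the terms of order zero
match: `ω(Fσ) = [ω, F]σ + F(ωσ)`. -/
theorem covDerivIn_apply {i : Fin θ.N} {x : M} (hx : x ∈ θ.U i) {F : M → S →L[𝕜] S} {σ : M → S}
    (hF : MDifferentiableAt (𝓡 n) 𝓘(ℝ, S →L[𝕜] S) ((endFramed θ c).inFrame i F) x)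
    (hσ : MDifferentiableAt (𝓡 n) 𝓘(ℝ, S) ((spinorFramed θ c).inFrame i σ) x) (l : Fin n) :
    MDifferentiableAt (𝓡 n) 𝓘(ℝ, S) ((spinorFramed θ c).inFrame i (fun y => F y (σ y))) x ∧
    (spinorFramed θ c).covDerivIn i (fun y => F y (σ y)) x l =
      (endFramed θ c).covDerivIn i F x l ((spinorFramed θ c).inFrame i σ x) +
      (endFramed θ c).inFrame i F x ((spinorFramed θ c).covDerivIn i σ x l) := by
  have hev : (spinorFramed θ c).inFrame i (fun y => F y (σ y)) =ᶠ[nhds x] fun y =>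
      toRealCLM 𝕜 S ((endFramed θ c).inFrame i F y) ((spinorFramed θ c).inFrame i σ y) := by
    filter_upwards [(θ.isOpen i).mem_nhds hx] with y hy
    exact inFrame_apply c hy F σ
  have hF' : MDifferentiableAt (𝓡 n) 𝓘(ℝ, S →L[ℝ] S)
      (fun y => toRealCLM 𝕜 S ((endFramed θ c).inFrame i F y)) x :=
    (toRealCLM 𝕜 S).mdifferentiableAt.comp x hF
  have hmd : MDifferentiableAt (𝓡 n) 𝓘(ℝ, S)
      ((spinorFramed θ c).inFrame i (fun y => F y (σ y))) x :=
    (hF'.clm_apply hσ).congr_of_eventuallyEq hev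
  refine ⟨hmd, ?_⟩
  have hy := mem_chart_target (Euc n) x
  have hcx := chartInv_chart (n := n) x
  set y := chartAt (Euc n) x x
  have hFy : MDifferentiableAt (𝓡 n) 𝓘(ℝ, S →L[𝕜] S) ((endFramed θ c).inFrame i F)
    (chartInv x y) := by rw [hcx]; exact hF
  have hσy : MDifferentiableAt (𝓡 n) 𝓘(ℝ, S) ((spinorFramed θ c).inFrame i σ)
    (chartInv x y) := by rw [hcx]; exact hσ
  have hmy : MDifferentiableAt (𝓡 n) 𝓘(ℝ, S)
      ((spinorFramed θ c).inFrame i (fun y => F y (σ y))) (chartInv x y) := by rw [hcx]; exact hmd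
  have e1 := (spinorFramed θ c).covDerivIn_chartInv hy hmy l
  have e2 := (spinorFramed θ c).covDerivIn_chartInv hy hσy l
  have e3 := (endFramed θ c).covDerivIn_chartInv hy hFy l
  have d2 := (hasFDerivAt_comp_chartInv hy hσy).differentiableAt.hasFDerivAt
  have d3 := (toRealCLM 𝕜 S).hasFDerivAt.comp y
    (hasFDerivAt_comp_chartInv hy hFy).differentiableAt.hasFDerivAt
  have d1 := (d3.clm_apply d2).congr_of_eventuallyEq (f₁ := (spinorFramed θ c).inFrame i
      (fun y => F y (σ y)) ∘ chartInv x) (by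
    have := (mdifferentiableAt_chartInv hy).continuousAt.eventually (by rw [hcx]; exact hev)
    exact this)
  rw [hcx] at e1 e2 e3
  rw [e1, e2, e3, d1.fderiv]
  have hop := inFrame_apply c hx F σ
  have hcy : ((endFramed θ c).inFrame i F ∘ chartInv x) y = (endFramed θ c).inFrame i F x := by
    rw [Function.comp, hcx]
  have hcy' : ((spinorFramed θ c).inFrame i σ ∘ chartInv x) y = (spinorFramed θ c).inFrame i σ x := by
    rw [Function.comp, hcx]
  have hconn : (spinorFramed θ c).conn i l x = spinConnection θ c i l x := rfl
  simp only [add_apply, ContinuousLinearMap.comp_apply, ContinuousLinearMap.flip_apply, hcy, hcy',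
    Function.comp_apply, toRealCLM_apply, endFramed_conn_apply, hop, hconn, map_add]
  abel

/-- The local section that is constant in the frame `i`. -/
def constSection (i : Fin θ.N) (s : S) (x : M) : S := cocyc θ c (θ.idx x) i x s

theorem inFrame_constSection {i j : Fin θ.N} {x : M} (hi : x ∈ θ.U i) (hj : x ∈ θ.U j) (s : S) :
    (spinorFramed θ c).inFrame j (constSection c i s) x = cocyc θ c j i x s :=
  cocyc_comp c hi (θ.mem_idx x) hj s

theorem contMDiffOn_cocyc_apply (i j : Fin θ.N) (s : S) :
    ContMDiffOn (𝓡 n) 𝓘(ℝ, S) ∞ (fun x => cocyc θ c j i x s) (θ.U j ∩ θ.U i) :=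
  contMDiffOn_linear_lift θ
    ({ toFun := fun z => c.repCLM z s
       map_add' := fun a b => by simp [repCLM_apply]
       map_smul' := fun r a => by simp [repCLM_apply] } : Cl n →ₗ[ℝ] S) j i

theorem mdifferentiableAt_constSection {i j : Fin θ.N} {x : M} (hi : x ∈ θ.U i) (hj : x ∈ θ.U j)
    (s : S) : MDifferentiableAt (𝓡 n) 𝓘(ℝ, S)
      ((spinorFramed θ c).inFrame j (constSection c i s)) x := by
  have h := ((contMDiffOn_cocyc_apply c i j s).contMDiffAt
    (((θ.isOpen j).inter (θ.isOpen i)).mem_nhds ⟨hj, hi⟩)).mdifferentiableAt (by simp)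
  refine h.congr_of_eventuallyEq ?_
  filter_upwards [((θ.isOpen j).inter (θ.isOpen i)).mem_nhds ⟨hj, hi⟩] with y hy
  exact inFrame_constSection c hy.2 hy.1 s

/-- Reduction to spinors: the Leibniz rule is applied to `F` acting on the section that is constant
in the frame `i`, and both `σ` and `Fσ` obey `covDerivIn_change`. The terms that contain `∇σ`
cancel. -/
theorem end_covDerivIn_change {i j : Fin θ.N} {x : M} (hi : x ∈ θ.U i) (hj : x ∈ θ.U j)
    {F : M → S →L[𝕜] S} (hF : (endFramed θ c).IsSmooth F) (l : Fin n) (s : S) :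
    (endFramed θ c).covDerivIn j F x l (cocyc θ c j i x s) =
      ∑ m, frameChange θ i j x l m (chartAt (Euc n) x x) •
        cocyc θ c j i x ((endFramed θ c).covDerivIn i F x m s) := by
  have hi' := chart_mem_locDom hi
  have hj' := chart_mem_locDom hj
  set σ := constSection c i s with hσ
  have hσi := mdifferentiableAt_constSection c hi hi s
  have hσj := mdifferentiableAt_constSection c hi hj s
  have hFi := hF.mdifferentiableAt_inFrame hi
  have hFj := hF.mdifferentiableAt_inFrame hj
  have h1 := covDerivIn_change θ c hi' hj' (σ := fun y => F y (σ y))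
    (by rw [chartInv_chart]; exact (covDerivIn_apply c hi hFi hσi l).1)
    (by rw [chartInv_chart]; exact (covDerivIn_apply c hj hFj hσj l).1) l
  have h2 := covDerivIn_change θ c hi' hj' (σ := σ)
    (by rw [chartInv_chart]; exact hσi) (by rw [chartInv_chart]; exact hσj) l
  rw [chartInv_chart] at h1 h2
  rw [(covDerivIn_apply c hj hFj hσj l).2, h2] at h1
  simp only [fun m => (covDerivIn_apply c hi hFi hσi m).2, hσ, inFrame_constSection c hi hj,
    inFrame_constSection c hi hi, cocyc_self c hi, map_add, smul_add,
    Finset.sum_add_distrib] at h1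
  have hFij : ∀ t, (endFramed θ c).inFrame j F x (cocyc θ c j i x t) =
      cocyc θ c j i x ((endFramed θ c).inFrame i F x t) := by
    intro t
    rw [FramedBundle.inFrame, FramedBundle.inFrame, endFramed_trans_apply, endFramed_trans_apply,
      cocyc_comp c hi hj (θ.mem_idx x), cocyc_comp c (θ.mem_idx x) hi hj]
  have hsm : ∀ (r : ℝ) (t : S), (endFramed θ c).inFrame j F x (r • t) =
      r • (endFramed θ c).inFrame j F x t := fun r t =>
    map_smul (((endFramed θ c).inFrame j F x).restrictScalars ℝ) r t
  rw [map_sum] at h1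
  simp only [hsm, hFij] at h1
  exact add_right_cancel h1

theorem opNorm_le_of_isometric {A B : S →L[𝕜] S} {ρ : S →L[𝕜] S} (hρ : Function.Surjective ρ)
    (hn : ∀ s, ‖ρ s‖ = ‖s‖) (h : ∀ s, ‖A (ρ s)‖ ≤ ‖B s‖) : ‖A‖ ≤ ‖B‖ := by
  refine ContinuousLinearMap.opNorm_le_bound _ (norm_nonneg _) fun t => ?_
  obtain ⟨s, rfl⟩ := hρ t
  rw [hn]
  exact (h s).trans (B.le_opNorm s)

theorem continuousOn_end_conn (i : Fin θ.N) (l : Fin n) (x₀ : M) :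
    ContinuousOn (fun y => (endFramed θ c).conn i l (chartInv x₀ y)) (locDom θ i x₀) :=
  (ContinuousLinearMap.compL 𝕜 S S S -
    (ContinuousLinearMap.compL 𝕜 S S S).flip).continuous.comp_continuousOn
      (contDiffOn_spinConnection c i l x₀ (θ := θ)).continuousOn

theorem endFramed_isGeometric : (endFramed θ c).IsGeometric where
  norm_trans i x hx F := by
    have h1 : ∀ s, (endFramed θ c).trans i x F (cocyc θ c i (θ.idx x) x s) =
        cocyc θ c i (θ.idx x) x (F s) := fun s => by
      rw [endFramed_trans_apply, cocyc_cancel c (θ.mem_idx x) hx]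
    refine le_antisymm ?_ ?_
    · refine opNorm_le_of_isometric (ρ := cocyc θ c i (θ.idx x) x) (fun t =>
        ⟨cocyc θ c (θ.idx x) i x t, cocyc_cancel c hx (θ.mem_idx x) t⟩) (norm_cocyc θ c _ _ x) ?_
      intro s
      rw [h1, norm_cocyc]
    · refine ContinuousLinearMap.opNorm_le_bound _ (norm_nonneg _) fun s => ?_
      rw [← norm_cocyc θ c i (θ.idx x) x (F s), ← h1, ← norm_cocyc θ c i (θ.idx x) x s]
      exact ContinuousLinearMap.le_opNorm _ _
  trans_idx x F := by
    ext s
    rw [endFramed_trans_apply, cocyc_self c (θ.mem_idx x), cocyc_self c (θ.mem_idx x)]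
  covDerivIn_le F hF i j x hi hj l := by
    have hi' := chart_mem_locDom hi
    have hj' := chart_mem_locDom hj
    refine ContinuousLinearMap.opNorm_le_bound _ (Finset.sum_nonneg fun _ _ => norm_nonneg _)
      fun t => ?_
    obtain ⟨s, rfl⟩ : ∃ s, cocyc θ c j i x s = t :=
      ⟨cocyc θ c i j x t, cocyc_cancel c hj hi t⟩
    rw [end_covDerivIn_change c hi hj hF, norm_cocyc, Finset.sum_mul]
    refine (norm_sum_le _ _).trans (Finset.sum_le_sum fun m _ => ?_)
    rw [norm_smul, norm_cocyc]
    exact (mul_le_of_le_one_left (norm_nonneg _) (abs_frameChange_le hi' hj' l m)).trans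
      (ContinuousLinearMap.le_opNorm _ _)
  continuousOn_conn i l x₀ := continuousOn_end_conn c i l x₀

theorem isSmooth_apply {F : M → S →L[𝕜] S} {σ : M → S} (hF : (endFramed θ c).IsSmooth F)
    (hσ : (spinorFramed θ c).IsSmooth σ) :
    (spinorFramed θ c).IsSmooth fun x => F x (σ x) := by
  intro i
  have h1 : ContMDiffOn (𝓡 n) 𝓘(ℝ, S →L[ℝ] S) ∞
      (fun y => toRealCLM 𝕜 S ((endFramed θ c).inFrame i F y)) (θ.U i) :=
    (toRealCLM 𝕜 S).contMDiff.comp_contMDiffOn (hF i)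
  exact (h1.clm_apply (hσ i)).congr fun x hx => inFrame_apply c hx F σ

theorem covDeriv_apply {F : M → S →L[𝕜] S} {σ : M → S} (hF : (endFramed θ c).IsSmooth F)
    (hσ : (spinorFramed θ c).IsSmooth σ) (x : M) (l : Fin n) :
    (spinorFramed θ c).covDeriv (fun y => F y (σ y)) x l =
      (endFramed θ c).covDeriv F x l (σ x) + F x ((spinorFramed θ c).covDeriv σ x l) := by
  have h := (covDerivIn_apply c (θ.mem_idx x) (hF.mdifferentiableAt_inFrame (θ.mem_idx x))
    (hσ.mdifferentiableAt_inFrame (θ.mem_idx x)) l).2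
  rw [FramedBundle.inFrame, FramedBundle.inFrame, (spinorFramed_isGeometric c).trans_idx,
    (endFramed_isGeometric c).trans_idx] at h
  exact h

end Geometric

end

end WeightedDirac

namespace WeightedDirac

noncomputable section

/-! ### The Riemannian volume in a chart -/

section Volume

variable {n : ℕ} {M : Type*} [TopologicalSpace M] [ChartedSpace (EuclideanSpace ℝ (Fin n)) M]
  [IsManifold (𝓡 n) ∞ M] {g : RMetric n M} (θ : SpinStructure g) {i : Fin θ.N} {x₀ : M} {y : Euc n}

/-- The matrix whose columns are the vectors of the frame `i` in the chart at `x₀`. -/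
def frameMatrix (θ : SpinStructure g) (i : Fin θ.N) (x₀ : M) (y : Euc n) :
    Matrix (Fin n) (Fin n) ℝ := Matrix.of fun a l => locFrame θ i x₀ l y a

/-- The matrix of the dual coframe. -/
def coframeMatrix (θ : SpinStructure g) (i : Fin θ.N) (x₀ : M) (y : Euc n) :
    Matrix (Fin n) (Fin n) ℝ := Matrix.of fun k a => coframe θ i x₀ k y (stdVec n a)

theorem coord_sum (v : Euc n) : ∑ a, v a • stdVec n a = v := by
  ext j
  simp [Pi.single_apply]

theorem coframeMatrix_mul_frameMatrix (hy : y ∈ locDom θ i x₀) :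
    coframeMatrix θ i x₀ y * frameMatrix θ i x₀ y = 1 := by
  ext k l
  rw [Matrix.mul_apply, Matrix.one_apply, ← coframe_locFrame θ hy]
  conv_rhs => rw [← coord_sum (locFrame θ i x₀ l y), map_sum]
  refine Finset.sum_congr rfl fun a _ => ?_
  rw [map_smul, smul_eq_mul, mul_comm]
  rfl

theorem gramMatrix_eq (hy : y ∈ locDom θ i x₀) :
    gramMatrix g x₀ y = (coframeMatrix θ i x₀ y).transpose * coframeMatrix θ i x₀ y := by
  ext a b
  rw [Matrix.mul_apply]
  exact inner_eq_sum_coframe θ hy (stdVec n a) (stdVec n b)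

/-- The density of the Riemannian volume in the chart at `x₀`. -/
def volDensity (g : RMetric n M) (x₀ : M) (y : Euc n) : ℝ := Real.sqrt (gramMatrix g x₀ y).det

theorem det_frameMatrix_ne_zero (hy : y ∈ locDom θ i x₀) : (frameMatrix θ i x₀ y).det ≠ 0 := by
  have h := congrArg Matrix.det (coframeMatrix_mul_frameMatrix θ hy)
  rw [Matrix.det_mul, Matrix.det_one] at h
  exact right_ne_zero_of_mul_eq_one h

/-- The Gram matrix is `CᵀC` for the coframe matrix `C`, the inverse of the frame matrix. The square
root disappears, and smoothness of the density reduces to that of a nonvanishing determinant. -/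
theorem volDensity_eq (hy : y ∈ locDom θ i x₀) :
    volDensity g x₀ y = |(frameMatrix θ i x₀ y).det|⁻¹ := by
  have h := congrArg Matrix.det (coframeMatrix_mul_frameMatrix θ hy)
  rw [Matrix.det_mul, Matrix.det_one] at h
  rw [volDensity, gramMatrix_eq θ hy, Matrix.det_mul, Matrix.det_transpose, Real.sqrt_mul_self_eq_abs,
    ← abs_inv, eq_inv_of_mul_eq_one_left h]

theorem volDensity_pos (hy : y ∈ locDom θ i x₀) : 0 < volDensity g x₀ y := by
  rw [volDensity_eq θ hy]
  exact inv_pos.2 (abs_pos.2 (det_frameMatrix_ne_zero θ hy))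

theorem contDiffOn_locFrame_coord (i : Fin θ.N) (x₀ : M) (l a : Fin n) :
    ContDiffOn ℝ ∞ (fun y => locFrame θ i x₀ l y a) (locDom θ i x₀) :=
  (EuclideanSpace.proj a : Euc n →L[ℝ] ℝ).contDiff.comp_contDiffOn (contDiffOn_locFrame θ i x₀ l)

theorem contDiffOn_det_frameMatrix (i : Fin θ.N) (x₀ : M) :
    ContDiffOn ℝ ∞ (fun y => (frameMatrix θ i x₀ y).det) (locDom θ i x₀) := by
  simp only [Matrix.det_apply]
  refine ContDiffOn.sum fun σ _ => ContDiffOn.const_smul _ (contDiffOn_prod fun a _ => ?_)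
  exact contDiffOn_locFrame_coord θ i x₀ _ _

theorem contDiffOn_volDensity (i : Fin θ.N) (x₀ : M) :
    ContDiffOn ℝ ∞ (volDensity g x₀) (locDom θ i x₀) := by
  refine ContDiffOn.congr (f := fun y => |(frameMatrix θ i x₀ y).det|⁻¹) ?_
    fun y hy => volDensity_eq θ hy
  refine ContDiffOn.inv (fun y hy => ?_) fun y hy => abs_ne_zero.2 (det_frameMatrix_ne_zero θ hy)
  exact (contDiffOn_det_frameMatrix θ i x₀ y hy).abs (det_frameMatrix_ne_zero θ hy)

theorem continuousOn_volDensity (θ : SpinStructure g) (x₀ : M) :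
    ContinuousOn (volDensity g x₀) (chartAt (Euc n) x₀).target := by
  intro y hy
  have h : y ∈ locDom θ (θ.idx (chartInv x₀ y)) x₀ := ⟨hy, θ.mem_idx _⟩
  exact ((contDiffOn_volDensity θ _ x₀).continuousOn.continuousAt
    ((isOpen_locDom θ _ x₀).mem_nhds h)).continuousWithinAt

theorem mfderiv_chart_frame {x : M} (hx : x ∈ (chartAt (Euc n) x₀).source) (i : Fin θ.N)
    (l : Fin n) : (mfderiv (𝓡 n) (𝓡 n) (chartAt (Euc n) x₀) x) (θ.frame i l x) =
      locFrame θ i x₀ l (chartAt (Euc n) x₀ x) := by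
  have hy := (chartAt (Euc n) x₀).map_source hx
  have h1 := dChartInv_locFrame θ hy i l
  have h2 := (mdifferentiable_chart' x₀).comp_symm_deriv hy
  have h4 : (mfderiv (𝓡 n) (𝓡 n) (chartAt (Euc n) x₀) (chartInv x₀ (chartAt (Euc n) x₀ x)))
      (dChartInv x₀ (chartAt (Euc n) x₀ x) (locFrame θ i x₀ l (chartAt (Euc n) x₀ x))) =
        locFrame θ i x₀ l (chartAt (Euc n) x₀ x) :=
    congrArg (fun T => T (locFrame θ i x₀ l (chartAt (Euc n) x₀ x))) h2
  rw [h1, chartInv, (chartAt (Euc n) x₀).left_inv hx] at h4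
  exact h4

/-- The derivative of the transition map carries the frame as seen in one chart to the same frame as
seen in the other, and both densities are inverse determinants of these frames. -/
theorem volDensity_change (θ : SpinStructure g) {x₁ : M} (hy : y ∈ (chartAt (Euc n) x₀).target)
    (hy' : chartInv x₀ y ∈ (chartAt (Euc n) x₁).source) :
    ∃ T : Euc n →L[ℝ] Euc n, HasFDerivAt (fun y => chartAt (Euc n) x₁ (chartInv x₀ y)) T y ∧
      volDensity g x₀ y = |T.det| * volDensity g x₁ (chartAt (Euc n) x₁ (chartInv x₀ y)) := by
  set x := chartInv x₀ y with hx
  set i := θ.idx x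
  set z := chartAt (Euc n) x₁ x with hz
  have hyi : y ∈ locDom θ i x₀ := ⟨hy, θ.mem_idx _⟩
  have hzi : z ∈ locDom θ i x₁ := by
    refine ⟨(chartAt (Euc n) x₁).map_source hy', ?_⟩
    rw [Set.mem_preimage, hz, (chartAt (Euc n) x₁).left_inv hy']
    exact θ.mem_idx _
  have hd : MDifferentiableAt (𝓡 n) 𝓘(ℝ, Euc n) (chartAt (Euc n) x₁) x :=
    (mdifferentiable_chart' x₁).mdifferentiableAt hy'
  obtain ⟨T, hT, hTapp⟩ : ∃ T : Euc n →L[ℝ] Euc n,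
      HasFDerivAt (fun y => chartAt (Euc n) x₁ (chartInv x₀ y)) T y ∧
      ∀ v, T v = mfderiv (𝓡 n) (𝓡 n) (chartAt (Euc n) x₁) (chartInv x₀ y) (dChartInv x₀ y v) :=
    ⟨_, hasFDerivAt_comp_chartInv hy hd, fun _ => rfl⟩
  refine ⟨T, hT, ?_⟩
  have hTf : ∀ l, T (locFrame θ i x₀ l y) = locFrame θ i x₁ l z := by
    intro l
    rw [hTapp, dChartInv_locFrame θ hy]
    exact mfderiv_chart_frame θ hy' i l
  have hmat : frameMatrix θ i x₁ z =
      LinearMap.toMatrix (EuclideanSpace.basisFun (Fin n) ℝ).toBasis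
        (EuclideanSpace.basisFun (Fin n) ℝ).toBasis T.toLinearMap * frameMatrix θ i x₀ y := by
    ext a l
    rw [Matrix.mul_apply, frameMatrix, Matrix.of_apply, ← hTf]
    conv_lhs => rw [← coord_sum (locFrame θ i x₀ l y), map_sum]
    rw [WithLp.ofLp_sum, Finset.sum_apply]
    refine Finset.sum_congr rfl fun b _ => ?_
    rw [map_smul, LinearMap.toMatrix_apply]
    simp [frameMatrix, mul_comm]
  rw [volDensity_eq θ hyi, volDensity_eq θ hzi, hmat, Matrix.det_mul, LinearMap.det_toMatrix, abs_mul,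
    mul_inv]
  have h0 : |LinearMap.det T.toLinearMap| ≠ 0 := by
    have h1 := det_frameMatrix_ne_zero θ hzi
    rw [hmat, Matrix.det_mul, LinearMap.det_toMatrix] at h1
    exact abs_ne_zero.2 (left_ne_zero_of_mul h1)
  rw [← mul_assoc, ContinuousLinearMap.det, mul_inv_cancel₀ h0, one_mul]

theorem measurableSet_inter_preimage_of_continuousOn {X Y : Type*} [TopologicalSpace X]
    [MeasurableSpace X] [BorelSpace X] [TopologicalSpace Y] [MeasurableSpace Y] [BorelSpace Y]
    {f : X → Y} {s : Set X} (hf : ContinuousOn f s) (hs : MeasurableSet s) {B : Set Y}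
    (hB : MeasurableSet B) : MeasurableSet (s ∩ f ⁻¹' B) := by
  have h1 : Measurable fun x : s => f x := (continuousOn_iff_continuous_domRestrict.1 hf).measurable
  have h2 := MeasurableSet.subtype_image hs (h1 hB)
  convert h2 using 1
  ext x
  simp [and_comm]

variable [MeasurableSpace M] [BorelSpace M]

theorem aemeasurable_chartInv (x₀ : M) :
    AEMeasurable (chartInv x₀) (volume.restrict (chartAt (Euc n) x₀).target) :=
  (chartAt (Euc n) x₀).continuousOn_symm.aemeasurable
    (chartAt (Euc n) x₀).open_target.measurableSet

theorem chartVolume_apply (g : RMetric n M) (x₀ : M) {B : Set M} (hB : MeasurableSet B) :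
    chartVolume g x₀ B = ∫⁻ y in (chartAt (Euc n) x₀).target ∩ chartInv x₀ ⁻¹' B,
      ENNReal.ofReal (volDensity g x₀ y) := by
  rw [chartVolume, Measure.map_apply_of_aemeasurable
    ((aemeasurable_chartInv x₀).mono_ac (withDensity_absolutelyContinuous _ _)) hB,
    withDensity_apply', Measure.restrict_restrict' (chartAt (Euc n) x₀).open_target.measurableSet,
    Set.inter_comm]
  rfl

/-- Change of variables for the transition map, whose Jacobian is absorbed by `volDensity_change`.
-/
theorem chartVolume_agree (θ : SpinStructure g) (x₀ x₁ : M) {B : Set M} (hB : MeasurableSet B)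
    (h₀ : B ⊆ (chartAt (Euc n) x₀).source) (h₁ : B ⊆ (chartAt (Euc n) x₁).source) :
    chartVolume g x₀ B = chartVolume g x₁ B := by
  rw [chartVolume_apply g x₀ hB, chartVolume_apply g x₁ hB]
  set s₀ := (chartAt (Euc n) x₀).target ∩ chartInv x₀ ⁻¹' B
  have hs₀ : MeasurableSet s₀ := measurableSet_inter_preimage_of_continuousOn
    (chartAt (Euc n) x₀).continuousOn_symm (chartAt (Euc n) x₀).open_target.measurableSet hB
  have hT : ∀ y : Euc n, ∃ T : Euc n →L[ℝ] Euc n, y ∈ s₀ →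
      HasFDerivAt (fun y => chartAt (Euc n) x₁ (chartInv x₀ y)) T y ∧
      volDensity g x₀ y = |T.det| * volDensity g x₁ (chartAt (Euc n) x₁ (chartInv x₀ y)) := by
    intro y
    by_cases hy : y ∈ s₀
    · obtain ⟨T, h⟩ := volDensity_change θ (g := g) hy.1 (h₁ hy.2)
      exact ⟨T, fun _ => h⟩
    · exact ⟨0, fun h => absurd h hy⟩
  choose T hT using hT
  have himg : (fun y => chartAt (Euc n) x₁ (chartInv x₀ y)) '' s₀ =
      (chartAt (Euc n) x₁).target ∩ chartInv x₁ ⁻¹' B := by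
    ext z
    constructor
    · rintro ⟨y, hy, rfl⟩
      refine ⟨(chartAt (Euc n) x₁).map_source (h₁ hy.2), ?_⟩
      rw [Set.mem_preimage, chartInv, (chartAt (Euc n) x₁).left_inv (h₁ hy.2)]
      exact hy.2
    · rintro ⟨hz, hzB⟩
      refine ⟨chartAt (Euc n) x₀ (chartInv x₁ z), ⟨(chartAt (Euc n) x₀).map_source (h₀ hzB), ?_⟩, ?_⟩
      · rw [Set.mem_preimage, chartInv, (chartAt (Euc n) x₀).left_inv (h₀ hzB)]
        exact hzB
      · simp only [chartInv]
        rw [(chartAt (Euc n) x₀).left_inv (h₀ hzB), (chartAt (Euc n) x₁).right_inv hz]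
  have hinj : Set.InjOn (fun y => chartAt (Euc n) x₁ (chartInv x₀ y)) s₀ := by
    intro y hy z hz h
    have h2 := (chartAt (Euc n) x₁).injOn (h₁ hy.2) (h₁ hz.2) h
    exact (chartAt (Euc n) x₀).symm.injOn hy.1 hz.1 h2
  rw [← himg, lintegral_image_eq_lintegral_abs_det_fderiv_mul volume hs₀
    (fun y hy => (hT y hy).1.hasFDerivWithinAt) hinj]
  refine setLIntegral_congr_fun hs₀ fun y hy => ?_
  rw [(hT y hy).2, ENNReal.ofReal_mul (abs_nonneg _)]

theorem chartVolume_compl_source (g : RMetric n M) (x₀ : M) :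
    chartVolume g x₀ (chartAt (Euc n) x₀).sourceᶜ = 0 := by
  rw [chartVolume_apply g x₀ (chartAt (Euc n) x₀).open_source.measurableSet.compl]
  have : (chartAt (Euc n) x₀).target ∩ chartInv x₀ ⁻¹' (chartAt (Euc n) x₀).sourceᶜ = ∅ := by
    ext y
    simp only [Set.mem_inter_iff, Set.mem_preimage, Set.mem_compl_iff, Set.mem_empty_iff_false,
      iff_false, not_and, not_not]
    exact fun hy => (chartAt (Euc n) x₀).map_target hy
  rw [this]
  simp

theorem chartVolume_le (g : RMetric n M) (x₀ : M) : chartVolume g x₀ ≤ riemannianVolume g :=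
  le_iSup (fun x => chartVolume g x) x₀

/-- The supremum over all charts adds no mass on the domain of a given chart, because the chart
measures agree on overlaps. -/
theorem riemannianVolume_restrict_source (θ : SpinStructure g) (x₀ : M) :
    (riemannianVolume g).restrict (chartAt (Euc n) x₀).source = chartVolume g x₀ := by
  have hs := (chartAt (Euc n) x₀).open_source.measurableSet
  set s := (chartAt (Euc n) x₀).source
  have hself : (chartVolume g x₀).restrict s = chartVolume g x₀ :=
    Measure.restrict_eq_self_of_ae_mem (by
      rw [ae_iff]
      exact chartVolume_compl_source g x₀)
  refine le_antisymm ?_ ?_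
  -- The largest measure off the chart domain dominates whatever the other charts contribute there,
  -- and it disappears upon restriction to the domain.
  · have h : riemannianVolume g ≤ chartVolume g x₀ + (⊤ : Measure M).restrict sᶜ := by
      refine iSup_le fun x₁ => Measure.le_iff.2 fun B hB => ?_
      rw [← measure_inter_add_sdiff B hs, Measure.add_apply]
      refine add_le_add ?_ ?_
      · have h1 : chartVolume g x₁ (B ∩ s) =
            chartVolume g x₁ (B ∩ s ∩ (chartAt (Euc n) x₁).source) := by
          rw [← measure_inter_add_sdiff (B ∩ s) (chartAt (Euc n) x₁).open_source.measurableSet,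
            measure_mono_null (Set.sdiff_subset_compl _ _) (chartVolume_compl_source g x₁), add_zero]
        rw [h1, chartVolume_agree θ x₁ x₀ ((hB.inter hs).inter
          (chartAt (Euc n) x₁).open_source.measurableSet) Set.inter_subset_right
          (Set.inter_subset_left.trans Set.inter_subset_right)]
        exact measure_mono (Set.inter_subset_left.trans Set.inter_subset_left)
      · rw [Measure.restrict_apply hB, ← Set.sdiff_eq]
        exact Measure.le_iff'.1 le_top _
    have h2 := Measure.restrict_mono (subset_refl s) h
    rw [Measure.restrict_add, Measure.restrict_restrict hs] at h2
    simpa [hself] using h2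
  · rw [← hself]
    exact Measure.restrict_mono (subset_refl s) (chartVolume_le g x₀)

theorem riemannianVolume_restrict_source_eq_map (θ : SpinStructure g) (x₀ : M) :
    (riemannianVolume g).restrict (chartAt (Euc n) x₀).source = Measure.map (chartInv x₀)
      ((volume.restrict (chartAt (Euc n) x₀).target).withDensity
        fun y => ENNReal.ofReal (volDensity g x₀ y)) := by
  rw [riemannianVolume_restrict_source θ x₀]; rfl

end Volume

end

end WeightedDirac

namespace WeightedDirac

noncomputable section

/-! ### Partitions of unity and products with functions -/

section Partition

variable {n : ℕ} {M : Type*} [TopologicalSpace M] [T2Space M] [CompactSpace M]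
  [ChartedSpace (EuclideanSpace ℝ (Fin n)) M] [IsManifold (𝓡 n) ∞ M]

theorem exists_smooth_partition (O : M → Set M) (hO : ∀ x, IsOpen (O x)) (hx : ∀ x, x ∈ O x) :
    ∃ (t : Finset M) (ζ : M → M → ℝ), (∀ a, ContMDiff (𝓡 n) 𝓘(ℝ, ℝ) ∞ (ζ a)) ∧
      (∀ a ∈ t, tsupport (ζ a) ⊆ O a) ∧ ∀ x, ∑ a ∈ t, ζ a x = 1 := by
  obtain ⟨f, hf⟩ := SmoothPartitionOfUnity.exists_isSubordinate (𝓡 n) isClosed_univ O hO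
    (fun x _ => Set.mem_iUnion.2 ⟨x, hx x⟩)
  have hfin : {a | (Function.support (f a)).Nonempty}.Finite :=
    f.locallyFinite.finite_nonempty_of_compact
  refine ⟨hfin.toFinset, fun a => f a, fun a => (f a).contMDiff, fun a _ => hf a, fun x => ?_⟩
  rw [← f.sum_eq_one (Set.mem_univ x), finsum_eq_sum_of_support_subset]
  intro a ha
  rw [Finset.mem_coe, Set.Finite.mem_toFinset]
  exact ⟨x, ha⟩

theorem exists_bound_of_locally_bounded {f : M → ℝ}
    (h : ∀ x, ∃ C, ∀ᶠ y in nhds x, f y ≤ C) : ∃ C, ∀ x, f x ≤ C := by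
  have := isCompact_univ.induction_on (p := fun s => ∃ C, ∀ x ∈ s, f x ≤ C) (X := M)
    ⟨0, by simp⟩ (fun s t hst ⟨C, hC⟩ => ⟨C, fun x hx => hC x (hst hx)⟩)
    (fun s t ⟨C, hC⟩ ⟨C', hC'⟩ => ⟨max C C', fun x hx => hx.elim
      (fun h => (hC x h).trans (le_max_left _ _)) (fun h => (hC' x h).trans (le_max_right _ _))⟩)
    (fun x _ => by
      obtain ⟨C, hC⟩ := h x
      exact ⟨_, mem_nhdsWithin_of_mem_nhds hC, C, fun y hy => hy⟩)
  obtain ⟨C, hC⟩ := this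
  exact ⟨C, fun x => hC x (Set.mem_univ x)⟩

end Partition

/-! ### Smooth sections: comparison of derivatives, bounds by compactness, measurability. -/

section SmoothSections

variable {𝕜 : Type*} [RCLike 𝕜] {n : ℕ} {M : Type*} [TopologicalSpace M]
  [ChartedSpace (EuclideanSpace ℝ (Fin n)) M] [IsManifold (𝓡 n) ∞ M]
  {g : RMetric n M} {θ : SpinStructure g}
  {V : Type*} [NormedAddCommGroup V] [NormedSpace 𝕜 V] [NormedSpace ℝ V] [IsScalarTower ℝ 𝕜 V]
  {E : FramedBundle 𝕜 θ V}

theorem clm_map_real_smul {W : Type*} [NormedAddCommGroup W] [NormedSpace 𝕜 W] [NormedSpace ℝ W]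
    [IsScalarTower ℝ 𝕜 W] (T : V →L[𝕜] W) (r : ℝ) (v : V) : T (r • v) = r • T v :=
  map_smul (T.restrictScalars ℝ) r v

theorem FramedBundle.inFrame_smul (E : FramedBundle 𝕜 θ V) (i : Fin θ.N) (ζ : M → ℝ) (σ : M → V)
    (x : M) : E.inFrame i (fun x => ζ x • σ x) x = ζ x • E.inFrame i σ x :=
  clm_map_real_smul _ _ _

theorem FramedBundle.IsSmooth.fun_smul {ζ : M → ℝ} (hζ : ContMDiff (𝓡 n) 𝓘(ℝ, ℝ) ∞ ζ) {σ : M → V}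
    (hσ : E.IsSmooth σ) : E.IsSmooth fun x => ζ x • σ x := fun i =>
  (hζ.contMDiffOn.smul (hσ i)).congr fun x _ => E.inFrame_smul i ζ σ x

theorem FramedBundle.IsSmooth.sum {ι : Type*} (t : Finset ι) {σ : ι → M → V}
    (h : ∀ a ∈ t, E.IsSmooth (σ a)) : E.IsSmooth fun x => ∑ a ∈ t, σ a x := fun i =>
  (contMDiffOn_finsetSum fun a ha => h a ha i).congr fun x _ => by
    change E.trans i x (∑ a ∈ t, σ a x) = _
    rw [map_sum]

theorem norm_piLp_le_sum {W : Type*} [NormedAddCommGroup W] (Ψ : PiLp 2 (fun _ : Fin n => W)) :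
    ‖Ψ‖ ≤ ∑ l, ‖Ψ l‖ := by
  refine (sq_le_sq₀ (norm_nonneg _) (Finset.sum_nonneg fun _ _ => norm_nonneg _)).1 ?_
  rw [PiLp.norm_sq_eq_of_L2]
  exact Finset.sum_sq_le_sq_sum_of_nonneg fun _ _ => norm_nonneg _

theorem FramedBundle.IsGeometric.norm_inFrame (hE : E.IsGeometric) {i : Fin θ.N} {x : M}
    (hx : x ∈ θ.U i) (σ : M → V) : ‖E.inFrame i σ x‖ = ‖σ x‖ := hE.norm_trans i x hx _

theorem FramedBundle.IsGeometric.inFrame_idx (hE : E.IsGeometric) (σ : M → V) (x : M) :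
    E.inFrame (θ.idx x) σ x = σ x := hE.trans_idx x _

theorem FramedBundle.IsSmooth.contDiffOn_local {σ : M → V} (hσ : E.IsSmooth σ) (i : Fin θ.N)
    (x₀ : M) : ContDiffOn ℝ ∞ (E.inFrame i σ ∘ chartInv x₀) (locDom θ i x₀) := by
  rw [← contMDiffOn_iff_contDiffOn]
  exact (hσ i).comp (contMDiffOn_chart_symm.mono Set.inter_subset_left) fun y hy => hy.2

theorem FramedBundle.IsSmooth.covDerivIn_eq {σ : M → V} (hσ : E.IsSmooth σ) {i : Fin θ.N}
    {x₀ : M} {y : Euc n} (hy : y ∈ locDom θ i x₀) (l : Fin n) :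
    E.covDerivIn i σ (chartInv x₀ y) l =
      fderiv ℝ (E.inFrame i σ ∘ chartInv x₀) y (locFrame θ i x₀ l y) +
        E.conn i l (chartInv x₀ y) (E.inFrame i σ (chartInv x₀ y)) :=
  E.covDerivIn_chartInv hy.1 (hσ.mdifferentiableAt_inFrame hy.2) l

theorem FramedBundle.IsGeometric.continuousOn_covDerivIn_chart (hE : E.IsGeometric) {σ : M → V}
    (hσ : E.IsSmooth σ) (i : Fin θ.N) (x₀ : M) (l : Fin n) :
    ContinuousOn (fun y => E.covDerivIn i σ (chartInv x₀ y) l) (locDom θ i x₀) := by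
  have h1 := hσ.contDiffOn_local i x₀
  have h2 : ContinuousOn (fderiv ℝ (E.inFrame i σ ∘ chartInv x₀)) (locDom θ i x₀) :=
    h1.continuousOn_fderiv_of_isOpen (isOpen_locDom θ i x₀) (by simp)
  exact ((h2.clm_apply (contDiffOn_locFrame θ i x₀ l).continuousOn).add
    ((hE.continuousOn_conn i l x₀).clm_apply h1.continuousOn)).congr
      fun y hy => hσ.covDerivIn_eq hy l

theorem FramedBundle.IsGeometric.continuousOn_covDerivIn (hE : E.IsGeometric) {σ : M → V}
    (hσ : E.IsSmooth σ) (i : Fin θ.N) : ContinuousOn (E.covDerivIn i σ) (θ.U i) := by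
  intro x hx
  refine ContinuousAt.continuousWithinAt ?_
  have h : ContinuousAt (fun x' l => E.covDerivIn i σ x' l) x := by
    refine continuousAt_pi.2 fun l => ?_
    have h1 := (hE.continuousOn_covDerivIn_chart hσ i x l).continuousAt
      ((isOpen_locDom θ i x).mem_nhds (chart_mem_locDom hx))
    have h2 : ContinuousAt (chartAt (Euc n) x) x :=
      (chartAt (Euc n) x).continuousAt (mem_chart_source _ x)
    refine (ContinuousAt.comp (f := chartAt (Euc n) x) h1 h2).congr ?_
    filter_upwards [(chartAt (Euc n) x).open_source.mem_nhds (mem_chart_source _ x)] with x' hx'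
    rw [Function.comp, chartInv, (chartAt (Euc n) x).left_inv hx']
  exact (PiLp.continuous_toLp 2 _).continuousAt.comp h

theorem FramedBundle.IsGeometric.norm_covDeriv_le (hE : E.IsGeometric) {σ : M → V}
    (hσ : E.IsSmooth σ) {i : Fin θ.N} {x : M} (hx : x ∈ θ.U i) :
    ‖E.covDeriv σ x‖ ≤ n * ∑ m, ‖E.covDerivIn i σ x m‖ := by
  refine (norm_piLp_le_sum _).trans ?_
  have := Finset.sum_le_card_nsmul Finset.univ (fun l => ‖E.covDeriv σ x l‖) _
    fun l _ => hE.covDerivIn_le σ hσ i (θ.idx x) x hx (θ.mem_idx x) l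
  simpa using this

theorem FramedBundle.IsGeometric.norm_covDerivIn_le (hE : E.IsGeometric) {σ : M → V}
    (hσ : E.IsSmooth σ) {i : Fin θ.N} {x : M} (hx : x ∈ θ.U i) (l : Fin n) :
    ‖E.covDerivIn i σ x l‖ ≤ n * ‖E.covDeriv σ x‖ := by
  refine (hE.covDerivIn_le σ hσ (θ.idx x) i x (θ.mem_idx x) hx l).trans ?_
  have := Finset.sum_le_card_nsmul Finset.univ (fun m => ‖E.covDerivIn (θ.idx x) σ x m‖) _
    fun m _ => PiLp.norm_apply_le (E.covDerivIn (θ.idx x) σ x) m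
  rw [FramedBundle.covDeriv_eq]
  simpa using this

/-- A vector is expanded in the frame, and each frame derivative is the covariant one minus the
connection form. The coframe and the connection forms are bounded on the compact set `K`, so the
constant does not depend on the section. -/
theorem FramedBundle.IsGeometric.exists_fderiv_le (hE : E.IsGeometric) {i : Fin θ.N} {x₀ : M}
    {K : Set (Euc n)} (hK : IsCompact K) (hKi : K ⊆ locDom θ i x₀) :
    ∃ C : ℝ, 0 ≤ C ∧ ∀ σ, E.IsSmooth σ → ∀ y ∈ K,
      ‖fderiv ℝ (E.inFrame i σ ∘ chartInv x₀) y‖ ≤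
        C * (‖σ (chartInv x₀ y)‖ + ‖E.covDeriv σ (chartInv x₀ y)‖) := by
  have b1 : ∀ l, ∃ C, ∀ y ∈ K, ‖coframe θ i x₀ l y‖ ≤ C := fun l =>
    hK.exists_bound_of_continuousOn ((contDiffOn_coframe θ i x₀ l).continuousOn.mono hKi)
  have b2 : ∀ l, ∃ C, ∀ y ∈ K, ‖E.conn i l (chartInv x₀ y)‖ ≤ C := fun l =>
    hK.exists_bound_of_continuousOn ((hE.continuousOn_conn i l x₀).mono hKi)
  choose C1 hC1 using b1
  choose C2 hC2 using b2
  refine ⟨∑ l, |C1 l| * (n + |C2 l|), by positivity, fun σ hσ y hy => ?_⟩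
  refine ContinuousLinearMap.opNorm_le_bound _ (by positivity) fun v => ?_
  have hyi := hKi hy
  conv_lhs => rw [← sum_coframe_smul θ hyi v]
  rw [map_sum, Finset.sum_mul, Finset.sum_mul]
  refine (norm_sum_le _ _).trans (Finset.sum_le_sum fun l _ => ?_)
  have e := hσ.covDerivIn_eq hyi l
  have e' : fderiv ℝ (E.inFrame i σ ∘ chartInv x₀) y (locFrame θ i x₀ l y) =
      E.covDerivIn i σ (chartInv x₀ y) l -
        E.conn i l (chartInv x₀ y) (E.inFrame i σ (chartInv x₀ y)) := by rw [e]; abel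
  rw [map_smul, norm_smul, e']
  have n1 : ‖coframe θ i x₀ l y v‖ ≤ |C1 l| * ‖v‖ :=
    ((coframe θ i x₀ l y).le_opNorm v).trans
      (mul_le_mul_of_nonneg_right ((hC1 l y hy).trans (le_abs_self _)) (norm_nonneg _))
  have n2 : ‖E.conn i l (chartInv x₀ y) (E.inFrame i σ (chartInv x₀ y))‖ ≤
      |C2 l| * ‖σ (chartInv x₀ y)‖ := by
    refine (ContinuousLinearMap.le_opNorm _ _).trans ?_
    rw [hE.norm_inFrame hyi.2]
    exact mul_le_mul_of_nonneg_right ((hC2 l y hy).trans (le_abs_self _)) (norm_nonneg _)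
  have n3 := hE.norm_covDerivIn_le hσ hyi.2 l
  have n4 : ‖E.covDerivIn i σ (chartInv x₀ y) l -
      E.conn i l (chartInv x₀ y) (E.inFrame i σ (chartInv x₀ y))‖ ≤
      (n + |C2 l|) * (‖σ (chartInv x₀ y)‖ + ‖E.covDeriv σ (chartInv x₀ y)‖) := by
    refine (norm_sub_le _ _).trans ((add_le_add n3 n2).trans ?_)
    have h1 := norm_nonneg (σ (chartInv x₀ y))
    have h2 := norm_nonneg (E.covDeriv σ (chartInv x₀ y))
    have h3 := abs_nonneg (C2 l)
    have h4 : (0 : ℝ) ≤ n := Nat.cast_nonneg n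
    nlinarith [mul_nonneg h4 h1, mul_nonneg h3 h2]
  calc _ ≤ (|C1 l| * ‖v‖) * ((n + |C2 l|) *
        (‖σ (chartInv x₀ y)‖ + ‖E.covDeriv σ (chartInv x₀ y)‖)) :=
        mul_le_mul n1 n4 (norm_nonneg _) (by positivity)
    _ = _ := by ring

/-- The converse comparison, with the frame vectors bounded on `K` in place of the coframe. -/
theorem FramedBundle.IsGeometric.exists_covDeriv_le (hE : E.IsGeometric) {i : Fin θ.N} {x₀ : M}
    {K : Set (Euc n)} (hK : IsCompact K) (hKi : K ⊆ locDom θ i x₀) :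
    ∃ C : ℝ, 0 ≤ C ∧ ∀ σ, E.IsSmooth σ → ∀ y ∈ K,
      ‖E.covDeriv σ (chartInv x₀ y)‖ ≤
        C * (‖fderiv ℝ (E.inFrame i σ ∘ chartInv x₀) y‖ + ‖σ (chartInv x₀ y)‖) := by
  have b1 : ∀ l, ∃ C, ∀ y ∈ K, ‖locFrame θ i x₀ l y‖ ≤ C := fun l =>
    hK.exists_bound_of_continuousOn ((contDiffOn_locFrame θ i x₀ l).continuousOn.mono hKi)
  have b2 : ∀ l, ∃ C, ∀ y ∈ K, ‖E.conn i l (chartInv x₀ y)‖ ≤ C := fun l =>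
    hK.exists_bound_of_continuousOn ((hE.continuousOn_conn i l x₀).mono hKi)
  choose C1 hC1 using b1
  choose C2 hC2 using b2
  refine ⟨n * ∑ l, (|C1 l| + |C2 l|), by positivity, fun σ hσ y hy => ?_⟩
  have hyi := hKi hy
  refine (hE.norm_covDeriv_le hσ hyi.2).trans ?_
  rw [mul_assoc, Finset.sum_mul]
  refine mul_le_mul_of_nonneg_left (Finset.sum_le_sum fun l _ => ?_) (Nat.cast_nonneg n)
  rw [hσ.covDerivIn_eq hyi l]
  have n1 : ‖fderiv ℝ (E.inFrame i σ ∘ chartInv x₀) y (locFrame θ i x₀ l y)‖ ≤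
      ‖fderiv ℝ (E.inFrame i σ ∘ chartInv x₀) y‖ * |C1 l| :=
    (ContinuousLinearMap.le_opNorm _ _).trans
      (mul_le_mul_of_nonneg_left ((hC1 l y hy).trans (le_abs_self _)) (norm_nonneg _))
  have n2 : ‖E.conn i l (chartInv x₀ y) (E.inFrame i σ (chartInv x₀ y))‖ ≤
      |C2 l| * ‖σ (chartInv x₀ y)‖ := by
    refine (ContinuousLinearMap.le_opNorm _ _).trans ?_
    rw [hE.norm_inFrame hyi.2]
    exact mul_le_mul_of_nonneg_right ((hC2 l y hy).trans (le_abs_self _)) (norm_nonneg _)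
  refine (norm_add_le _ _).trans ((add_le_add n1 n2).trans ?_)
  have h1 := norm_nonneg (σ (chartInv x₀ y))
  have h2 := norm_nonneg (fderiv ℝ (E.inFrame i σ ∘ chartInv x₀) y)
  nlinarith [mul_nonneg (abs_nonneg (C1 l)) h1, mul_nonneg (abs_nonneg (C2 l)) h2]

variable [T2Space M] [CompactSpace M]

theorem FramedBundle.IsGeometric.exists_bound (hE : E.IsGeometric) {σ : M → V}
    (hσ : E.IsSmooth σ) : ∃ C, ∀ x, ‖σ x‖ ≤ C ∧ ‖E.covDeriv σ x‖ ≤ C := by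
  have h1 : ∃ C, ∀ x, ‖σ x‖ ≤ C := exists_bound_of_locally_bounded fun x => by
    have hx := θ.mem_idx x
    have hc : ContinuousAt (fun x' => ‖E.inFrame (θ.idx x) σ x'‖) x :=
      ((hσ (θ.idx x)).continuousOn.continuousAt ((θ.isOpen _).mem_nhds hx)).norm
    refine ⟨‖E.inFrame (θ.idx x) σ x‖ + 1, ?_⟩
    filter_upwards [hc.eventually (gt_mem_nhds (lt_add_one _)),
      (θ.isOpen _).mem_nhds hx] with x' h hx'
    rw [hE.norm_inFrame hx'] at h
    exact h.le
  have h2 : ∃ C, ∀ x, ‖E.covDeriv σ x‖ ≤ C := exists_bound_of_locally_bounded fun x => by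
    have hx := θ.mem_idx x
    have hc : ContinuousAt (fun x' => (n : ℝ) * ∑ m, ‖E.covDerivIn (θ.idx x) σ x' m‖) x := by
      have h := (hE.continuousOn_covDerivIn hσ (θ.idx x)).continuousAt ((θ.isOpen _).mem_nhds hx)
      refine continuousAt_const.mul (tendsto_finsetSum _ fun m _ => ?_)
      exact ((PiLp.continuous_apply 2 _ m).continuousAt.comp h).norm
    refine ⟨(n : ℝ) * ∑ m, ‖E.covDerivIn (θ.idx x) σ x m‖ + 1, ?_⟩
    filter_upwards [hc.eventually (gt_mem_nhds (lt_add_one _)),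
      (θ.isOpen _).mem_nhds hx] with x' h hx'
    exact (hE.norm_covDeriv_le hσ hx').trans h.le
  obtain ⟨C, hC⟩ := h1
  obtain ⟨C', hC'⟩ := h2
  exact ⟨max C C', fun x => ⟨(hC x).trans (le_max_left _ _), (hC' x).trans (le_max_right _ _)⟩⟩

variable [MeasurableSpace M] [BorelSpace M]

/-- The index is the first one that is admissible, so the set is `U i` without the earlier `U j`.
The values of a section refer to the frame `idx x`, which jumps; on each of these finitely many
pieces a smooth section is continuous. -/
theorem measurableSet_idx (i : Fin θ.N) : MeasurableSet {x | θ.idx x = i} := by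
  classical
  have : {x | θ.idx x = i} = θ.U i \ ⋃ j : {j // j < i}, θ.U j := by
    ext x
    simp only [Set.mem_ofPred_eq, Set.mem_sdiff, Set.mem_iUnion, not_exists]
    rw [SpinStructure.idx, Fin.find_eq_iff]
    constructor
    · rintro ⟨h1, h2⟩
      exact ⟨h1, fun j => h2 j.1 j.2⟩
    · rintro ⟨h1, h2⟩
      exact ⟨h1, fun j hj => h2 ⟨j, hj⟩⟩
  rw [this]
  exact (θ.isOpen i).measurableSet.diff (MeasurableSet.iUnion fun j => (θ.isOpen _).measurableSet)

theorem secondCountable_of_compact_charted (n : ℕ) (M : Type*) [TopologicalSpace M] [CompactSpace M]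
    [ChartedSpace (EuclideanSpace ℝ (Fin n)) M] : SecondCountableTopology M :=
  ChartedSpace.secondCountable_of_sigmaCompact (EuclideanSpace ℝ (Fin n)) M

theorem aestronglyMeasurable_of_continuousOn_frames {W : Type*} [NormedAddCommGroup W]
    {f : M → W} {h : Fin θ.N → M → W} (hc : ∀ i, ContinuousOn (h i) (θ.U i))
    (hf : ∀ x, f x = h (θ.idx x) x) (μ : Measure M) : AEStronglyMeasurable f μ := by
  have := secondCountable_of_compact_charted n M
  have hU : (⋃ i, {x | θ.idx x = i}) = Set.univ := by
    ext x; simp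
  rw [← Measure.restrict_univ (μ := μ), ← hU, aestronglyMeasurable_iUnion_iff]
  intro i
  have h1 : AEStronglyMeasurable (h i) (μ.restrict {x | θ.idx x = i}) :=
    ((hc i).mono fun x hx => by
      have hx : θ.idx x = i := hx
      rw [← hx]; exact θ.mem_idx x).aestronglyMeasurable (measurableSet_idx i)
  refine h1.congr ?_
  filter_upwards [ae_restrict_mem (measurableSet_idx i)] with x hx
  have hx : θ.idx x = i := hx
  rw [hf, hx]

theorem FramedBundle.IsGeometric.aestronglyMeasurable (hE : E.IsGeometric) {σ : M → V}
    (hσ : E.IsSmooth σ) (μ : Measure M) : AEStronglyMeasurable σ μ :=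
  aestronglyMeasurable_of_continuousOn_frames (fun i => (hσ i).continuousOn)
    (fun x => (hE.inFrame_idx σ x).symm) μ

theorem FramedBundle.IsGeometric.aestronglyMeasurable_covDeriv (hE : E.IsGeometric) {σ : M → V}
    (hσ : E.IsSmooth σ) (μ : Measure M) : AEStronglyMeasurable (E.covDeriv σ) μ :=
  aestronglyMeasurable_of_continuousOn_frames (fun i => hE.continuousOn_covDerivIn hσ i)
    (fun _ => rfl) μ

end SmoothSections

end

end WeightedDirac

namespace WeightedDirac

noncomputable section

/-! ### Comparison of the volume with Lebesgue measure in charts -/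

section Comparison

open scoped NNReal

variable {n : ℕ} {M : Type*} [TopologicalSpace M] [T2Space M]
  [ChartedSpace (EuclideanSpace ℝ (Fin n)) M] [IsManifold (𝓡 n) ∞ M]
  [MeasurableSpace M] [BorelSpace M] {g : RMetric n M} (θ : SpinStructure g) {i : Fin θ.N} {x₀ : M}
  {K : Set (Euc n)}

theorem subset_target (hKi : K ⊆ locDom θ i x₀) : K ⊆ (chartAt (Euc n) x₀).target :=
  fun _ hy => (hKi hy).1

theorem isCompact_image_chartInv (hK : IsCompact K) (hKi : K ⊆ locDom θ i x₀) :
    IsCompact (chartInv x₀ '' K) :=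
  hK.image_of_continuousOn ((chartAt (Euc n) x₀).continuousOn_symm.mono (subset_target θ hKi))

theorem mem_image_chartInv_iff (hKi : K ⊆ locDom θ i x₀) {y : Euc n}
    (hy : y ∈ (chartAt (Euc n) x₀).target) : chartInv x₀ y ∈ chartInv x₀ '' K ↔ y ∈ K := by
  constructor
  · rintro ⟨y', hy', h⟩
    rwa [← (chartAt (Euc n) x₀).symm.injOn (subset_target θ hKi hy') hy h]
  · exact fun h => ⟨y, h, rfl⟩

theorem aemeasurable_chartInv_restrict (hKi : K ⊆ locDom θ i x₀) :
    AEMeasurable (chartInv x₀) (volume.restrict K) :=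
  (aemeasurable_chartInv x₀).mono_measure (Measure.restrict_mono (subset_target θ hKi) le_rfl)

theorem measurableSet_inter_chartInv (hK : IsCompact K) (hKi : K ⊆ locDom θ i x₀) {B : Set M}
    (hB : MeasurableSet B) : MeasurableSet (K ∩ chartInv x₀ ⁻¹' B) :=
  measurableSet_inter_preimage_of_continuousOn
    ((chartAt (Euc n) x₀).continuousOn_symm.mono (subset_target θ hKi)) hK.measurableSet hB

theorem map_chartInv_restrict_apply (hK : IsCompact K) (hKi : K ⊆ locDom θ i x₀) {B : Set M}
    (hB : MeasurableSet B) :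
    (volume.restrict K).map (chartInv x₀) B = volume (K ∩ chartInv x₀ ⁻¹' B) := by
  rw [Measure.map_apply_of_aemeasurable (aemeasurable_chartInv_restrict θ hKi) hB,
    Measure.restrict_apply' hK.measurableSet, Set.inter_comm]

/-- The density of the volume has a positive lower bound on a compact part of a chart. With the
upper bound used in `exists_restrict_image_le`, this makes `L^r` norms in the chart and on `M`
comparable. -/
theorem exists_map_chartInv_le (hK : IsCompact K) (hKi : K ⊆ locDom θ i x₀) :
    ∃ C : ℝ≥0, C ≠ 0 ∧ (volume.restrict K).map (chartInv x₀) ≤ (C : ℝ≥0∞) • riemannianVolume g := by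
  obtain ⟨a, ha, hle⟩ := hK.exists_forall_le'
    ((continuousOn_volDensity θ x₀).mono (subset_target θ hKi))
    (fun y hy => volDensity_pos θ (hKi hy))
  refine ⟨(Real.toNNReal a)⁻¹, inv_ne_zero (by simpa using ha), Measure.le_iff.2 fun B hB => ?_⟩
  rw [map_chartInv_restrict_apply θ hK hKi hB, Measure.smul_apply, smul_eq_mul,
    ENNReal.coe_inv (by simpa using ha), mul_comm, ← div_eq_mul_inv]
  rw [ENNReal.le_div_iff_mul_le (Or.inl (by simpa using ha)) (Or.inl ENNReal.coe_ne_top), mul_comm]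
  refine le_trans ?_ ((chartVolume_le g x₀) B)
  rw [chartVolume_apply g x₀ hB, ← setLIntegral_const]
  refine (setLIntegral_mono' (measurableSet_inter_chartInv θ hK hKi hB) fun y hy => ?_).trans
    (lintegral_mono_set (Set.inter_subset_inter_left _ (subset_target θ hKi)))
  exact ENNReal.ofReal_le_ofReal (hle y hy.1)

theorem exists_restrict_image_le (hK : IsCompact K) (hKi : K ⊆ locDom θ i x₀) :
    ∃ C : ℝ≥0, C ≠ 0 ∧ (riemannianVolume g).restrict (chartInv x₀ '' K) ≤
      (C : ℝ≥0∞) • (volume.restrict K).map (chartInv x₀) := by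
  obtain ⟨a, ha⟩ := hK.exists_bound_of_continuousOn
    ((continuousOn_volDensity θ x₀).mono (subset_target θ hKi))
  have hmeas := (isCompact_image_chartInv θ hK hKi).measurableSet
  refine ⟨Real.toNNReal (max a 1), ?_, Measure.le_iff.2 fun B hB => ?_⟩
  · rw [Ne, Real.toNNReal_eq_zero, not_le]
    exact lt_of_lt_of_le one_pos (le_max_right _ _)
  have hs : chartInv x₀ '' K ⊆ (chartAt (Euc n) x₀).source := by
    rintro _ ⟨y, hy, rfl⟩
    exact (chartAt (Euc n) x₀).map_target (hKi hy).1
  rw [Measure.restrict_apply hB, Measure.smul_apply, smul_eq_mul,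
    map_chartInv_restrict_apply θ hK hKi hB]
  rw [← Set.inter_eq_left.2 (Set.inter_subset_right.trans hs : B ∩ chartInv x₀ '' K ⊆ _),
    ← Measure.restrict_apply (hB.inter hmeas), riemannianVolume_restrict_source θ,
    chartVolume_apply g x₀ (hB.inter hmeas), ← setLIntegral_const]
  have : (chartAt (Euc n) x₀).target ∩ chartInv x₀ ⁻¹' (B ∩ chartInv x₀ '' K) =
      K ∩ chartInv x₀ ⁻¹' B := by
    ext y
    constructor
    · rintro ⟨h1, h2, h3⟩
      exact ⟨(mem_image_chartInv_iff θ hKi h1).1 h3, h2⟩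
    · rintro ⟨h1, h2⟩
      exact ⟨subset_target θ hKi h1, h2, y, h1, rfl⟩
  rw [this]
  refine setLIntegral_mono' (measurableSet_inter_chartInv θ hK hKi hB) fun y hy => ?_
  exact ENNReal.ofReal_le_ofReal ((le_abs_self _).trans ((ha y hy.1).trans (le_max_left _ _)))

theorem exists_eLpNorm_chart_le {W : Type*} [NormedAddCommGroup W] (hK : IsCompact K)
    (hKi : K ⊆ locDom θ i x₀) (r : ℝ≥0∞) : ∃ C : ℝ≥0, ∀ f : M → W,
      AEStronglyMeasurable f (riemannianVolume g) →
      eLpNorm (f ∘ chartInv x₀) r (volume.restrict K) ≤ C * eLpNorm f r (riemannianVolume g) := by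
  obtain ⟨C, hC0, hC⟩ := exists_map_chartInv_le θ hK hKi
  refine ⟨C ^ (1 / r).toReal, fun f hf => ?_⟩
  have hac : (volume.restrict K).map (chartInv x₀) ≪ riemannianVolume g :=
    (Measure.absolutelyContinuous_of_le hC).trans Measure.smul_absolutelyContinuous
  rw [← eLpNorm_map_measure (hf.mono_ac hac) (aemeasurable_chartInv_restrict θ hKi)]
  refine (eLpNorm_mono_measure f hC).trans ?_
  rw [eLpNorm_smul_measure_of_ne_zero (by simpa using hC0), smul_eq_mul,
    ENNReal.coe_rpow_of_ne_zero hC0]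

theorem exists_eLpNorm_le_chart {W : Type*} [NormedAddCommGroup W] (hK : IsCompact K)
    (hKi : K ⊆ locDom θ i x₀) (r : ℝ≥0∞) : ∃ C : ℝ≥0, ∀ f : M → W,
      AEStronglyMeasurable f (riemannianVolume g) →
      eLpNorm f r ((riemannianVolume g).restrict (chartInv x₀ '' K)) ≤
        C * eLpNorm (f ∘ chartInv x₀) r (volume.restrict K) := by
  obtain ⟨C, hC0, hC⟩ := exists_restrict_image_le θ hK hKi
  obtain ⟨C', -, hC'⟩ := exists_map_chartInv_le θ hK hKi
  refine ⟨C ^ (1 / r).toReal, fun f hf => ?_⟩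
  have hac : (volume.restrict K).map (chartInv x₀) ≪ riemannianVolume g :=
    (Measure.absolutelyContinuous_of_le hC').trans Measure.smul_absolutelyContinuous
  rw [← eLpNorm_map_measure (hf.mono_ac hac) (aemeasurable_chartInv_restrict θ hKi)]
  refine (eLpNorm_mono_measure f hC).trans ?_
  rw [eLpNorm_smul_measure_of_ne_zero (by simpa using hC0), smul_eq_mul,
    ENNReal.coe_rpow_of_ne_zero hC0]

theorem exists_closedBall_subset_locDom (x : M) :
    ∃ R > 0, Metric.closedBall (chartAt (Euc n) x x) R ⊆ locDom θ (θ.idx x) x :=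
  Metric.nhds_basis_closedBall.mem_iff.1
    ((isOpen_locDom θ _ x).mem_nhds (chart_mem_locDom (θ.mem_idx x)))

theorem isFiniteMeasure_riemannianVolume [CompactSpace M] (θ : SpinStructure g) :
    IsFiniteMeasure (riemannianVolume g) := by
  have : IsLocallyFiniteMeasure (riemannianVolume g) := ⟨fun x => by
    obtain ⟨R, hR, hsub⟩ := exists_closedBall_subset_locDom θ x
    have hK := isCompact_closedBall (chartAt (Euc n) x x) R
    obtain ⟨C, -, hC⟩ := exists_restrict_image_le θ hK hsub
    refine ⟨chartInv x '' Metric.closedBall (chartAt (Euc n) x x) R, ?_, ?_⟩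
    · have h1 := (chartAt (Euc n) x).symm.image_mem_nhds
        (show chartAt (Euc n) x x ∈ (chartAt (Euc n) x).symm.source from mem_chart_target _ x)
        (Metric.closedBall_mem_nhds (chartAt (Euc n) x x) hR)
      rwa [(chartAt (Euc n) x).left_inv (mem_chart_source _ x)] at h1
    · have h1 := hC (chartInv x '' Metric.closedBall (chartAt (Euc n) x x) R)
      rw [Measure.restrict_apply_self, Measure.smul_apply, map_chartInv_restrict_apply θ hK hsub
        (isCompact_image_chartInv θ hK hsub).measurableSet] at h1
      refine h1.trans_lt (ENNReal.mul_lt_top ENNReal.coe_lt_top ?_)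
      exact (measure_mono Set.inter_subset_left).trans_lt hK.measure_lt_top⟩
  exact CompactSpace.isFiniteMeasure

/-- Integrals of functions that vanish off a chart, in coordinates. -/
theorem integral_eq_integral_chart {W : Type*} [NormedAddCommGroup W] [NormedSpace ℝ W]
    (θ : SpinStructure g) (x₀ : M) {f : M → W} (hf : ∀ x ∉ (chartAt (Euc n) x₀).source, f x = 0)
    (hm : AEStronglyMeasurable f (riemannianVolume g)) :
    ∫ x, f x ∂(riemannianVolume g) =
      ∫ y in (chartAt (Euc n) x₀).target, volDensity g x₀ y • f (chartInv x₀ y) := by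
  have hT := (chartAt (Euc n) x₀).open_target.measurableSet
  rw [← setIntegral_eq_integral_of_forall_compl_eq_zero hf,
    riemannianVolume_restrict_source_eq_map θ x₀]
  have h0 := (aemeasurable_chartInv x₀).mono_ac (withDensity_absolutelyContinuous
    (volume.restrict (chartAt (Euc n) x₀).target) fun y => ENNReal.ofReal (volDensity g x₀ y))
  rw [integral_map h0]
  · have hw : AEMeasurable (fun y => Real.toNNReal (volDensity g x₀ y))
        (volume.restrict (chartAt (Euc n) x₀).target) :=
      ((continuousOn_volDensity θ x₀).aemeasurable hT).real_toNNReal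
    have := integral_withDensity_eq_integral_smul₀ hw fun y => f (chartInv x₀ y)
    refine this.trans (setIntegral_congr_fun hT fun y _ => ?_)
    change (Real.toNNReal (volDensity g x₀ y) : ℝ) • f (chartInv x₀ y) = _
    rw [Real.coe_toNNReal (volDensity g x₀ y) (Real.sqrt_nonneg _)]
  · rw [← riemannianVolume_restrict_source_eq_map θ x₀]
    exact hm.restrict

end Comparison

/-! ### Smooth sections as elements of Sobolev spaces -/

section Elements

variable {𝕜 : Type*} [RCLike 𝕜] {n : ℕ} {M : Type*} [TopologicalSpace M] [T2Space M]
  [CompactSpace M]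
  [ChartedSpace (EuclideanSpace ℝ (Fin n)) M] [IsManifold (𝓡 n) ∞ M]
  [MeasurableSpace M] [BorelSpace M] {g : RMetric n M} {θ : SpinStructure g}

section General

variable {V : Type*} [NormedAddCommGroup V] [NormedSpace 𝕜 V] [NormedSpace ℝ V] [IsScalarTower ℝ 𝕜 V]
  {E : FramedBundle 𝕜 θ V}

theorem FramedBundle.IsGeometric.memLp (hE : E.IsGeometric) {σ : M → V} (hσ : E.IsSmooth σ)
    (q : ℝ≥0∞) : MemLp σ q (riemannianVolume g) := by
  have := isFiniteMeasure_riemannianVolume θ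
  obtain ⟨C, hC⟩ := hE.exists_bound hσ
  exact MemLp.of_bound (hE.aestronglyMeasurable hσ _) C (Filter.Eventually.of_forall fun x => (hC x).1)

theorem FramedBundle.IsGeometric.memLp_covDeriv (hE : E.IsGeometric) {σ : M → V}
    (hσ : E.IsSmooth σ) (q : ℝ≥0∞) : MemLp (E.covDeriv σ) q (riemannianVolume g) := by
  have := isFiniteMeasure_riemannianVolume θ
  obtain ⟨C, hC⟩ := hE.exists_bound hσ
  exact MemLp.of_bound (hE.aestronglyMeasurable_covDeriv hσ _) C
    (Filter.Eventually.of_forall fun x => (hC x).2)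

/-- A smooth section as an element of the Sobolev space. -/
def FramedBundle.IsGeometric.toSobolev (hE : E.IsGeometric) {σ : M → V} (hσ : E.IsSmooth σ)
    (r q : ℝ≥0∞) [Fact (1 ≤ r)] [Fact (1 ≤ q)] : sobolevSpace E r q :=
  ⟨WithLp.toLp r ((hE.memLp hσ q).toLp, (hE.memLp_covDeriv hσ q).toLp),
    Submodule.le_topologicalClosure _ ⟨σ, hσ, (hE.memLp hσ q).coeFn_toLp, (hE.memLp_covDeriv hσ q).coeFn_toLp⟩⟩

theorem FramedBundle.IsGeometric.toSobolev_of_mem_smoothGraph (hE : E.IsGeometric) (r q : ℝ≥0∞)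
    [Fact (1 ≤ r)] [Fact (1 ≤ q)] {P} (hP : P ∈ smoothGraph E r q) :
    ∃ (σ : M → V) (hσ : E.IsSmooth σ), P = hE.toSobolev hσ r q := by
  obtain ⟨σ, hσ, h1, h2⟩ := hP
  refine ⟨σ, hσ, ?_⟩
  apply WithLp.ofLp_injective
  refine Prod.ext (Lp.ext ?_) (Lp.ext ?_)
  · exact h1.trans (hE.memLp hσ q).coeFn_toLp.symm
  · exact h2.trans (hE.memLp_covDeriv hσ q).coeFn_toLp.symm

/-- A closed property that holds for smooth sections holds in the Sobolev space. -/
theorem FramedBundle.IsGeometric.sobolev_induction (hE : E.IsGeometric) {r q : ℝ≥0∞}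
    [Fact (1 ≤ r)] [Fact (1 ≤ q)] {p : sobolevSpace E r q → Prop} (hp : IsClosed {P | p P})
    (h : ∀ (σ : M → V) (hσ : E.IsSmooth σ), p (hE.toSobolev hσ r q)) (P : sobolevSpace E r q) :
    p P := by
  have hd : P ∈ closure {Q : sobolevSpace E r q | (Q : WithLp r _) ∈ smoothGraph E r q} := by
    rw [closure_subtype]
    refine closure_mono ?_ P.2
    intro Q hQ
    exact ⟨⟨Q, Submodule.le_topologicalClosure _ hQ⟩, hQ, rfl⟩
  refine closure_minimal ?_ hp hd
  intro Q hQ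
  obtain ⟨σ, hσ, hQσ⟩ := hE.toSobolev_of_mem_smoothGraph r q hQ
  have : Q = hE.toSobolev hσ r q := Subtype.ext hQσ
  rw [Set.mem_ofPred_eq, this]
  exact h σ hσ

end General

variable {S : Type*} [NormedAddCommGroup S] [InnerProductSpace 𝕜 S] [NormedSpace ℝ S]
  [IsScalarTower ℝ 𝕜 S] [FiniteDimensional 𝕜 S] (c : CliffordModule 𝕜 n S)

open Classical in
/-- The spinor field that is given by `u` in the frame `i` and the chart at `x₀`, and vanishes
outside of the chart. -/
def extSection (c : CliffordModule 𝕜 n S) (i : Fin θ.N) (x₀ : M) (u : Euc n → S) (x : M) : S :=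
  if x ∈ (chartAt (Euc n) x₀).source ∩ θ.U i then
    cocyc θ c (θ.idx x) i x (u (chartAt (Euc n) x₀ x)) else 0

theorem inFrame_extSection {i j : Fin θ.N} {x₀ x : M} (hx : x ∈ (chartAt (Euc n) x₀).source)
    (hi : x ∈ θ.U i) (hj : x ∈ θ.U j) (u : Euc n → S) :
    (spinorFramed θ c).inFrame j (extSection c i x₀ u) x =
      cocyc θ c j i x (u (chartAt (Euc n) x₀ x)) := by
  rw [FramedBundle.inFrame, extSection, if_pos ⟨hx, hi⟩, spinorFramed_trans,
    cocyc_comp c hi (θ.mem_idx x) hj]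

theorem inFrame_extSection_chartInv {i : Fin θ.N} {x₀ : M} {y : Euc n} (hy : y ∈ locDom θ i x₀)
    (u : Euc n → S) :
    (spinorFramed θ c).inFrame i (extSection c i x₀ u) (chartInv x₀ y) = u y := by
  rw [inFrame_extSection c ((chartAt (Euc n) x₀).map_target hy.1) hy.2 hy.2,
    cocyc_self c hy.2, (chartAt (Euc n) x₀).right_inv hy.1]

theorem extSection_eq_zero {i : Fin θ.N} {x₀ x : M} {K : Set (Euc n)} {u : Euc n → S}
    (hu : ∀ y ∉ K, u y = 0) (hx : x ∉ chartInv x₀ '' K) : extSection c i x₀ u x = 0 := by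
  rw [extSection]
  split_ifs with h
  · rw [hu, map_zero]
    intro hK
    exact hx ⟨_, hK, (chartAt (Euc n) x₀).left_inv h.1⟩
  · rfl

/-- Near the compact image of `K` the section is, in the frame `j`, the smooth cocycle applied to
`u` in the chart. That image is closed since `M` is Hausdorff, so every other point has a
neighbourhood on which the section vanishes. -/
theorem isSmooth_extSection {i : Fin θ.N} {x₀ : M} {K : Set (Euc n)} (hK : IsCompact K)
    (hKi : K ⊆ locDom θ i x₀) {u : Euc n → S} (hu : ContDiff ℝ ∞ u) (hu0 : ∀ y ∉ K, u y = 0) :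
    (spinorFramed θ c).IsSmooth (extSection c i x₀ u) := by
  intro j x hj
  by_cases hx : x ∈ chartInv x₀ '' K
  · obtain ⟨y, hy, rfl⟩ := hx
    have hyi := hKi hy
    set x := chartInv x₀ y
    have hs : x ∈ (chartAt (Euc n) x₀).source := (chartAt (Euc n) x₀).map_target hyi.1
    refine ContMDiffAt.contMDiffWithinAt ?_
    have h1 : ContMDiffAt (𝓡 n) 𝓘(ℝ, S →L[ℝ] S) ∞ (fun x => toRealCLM 𝕜 S (cocyc θ c j i x)) x :=
      ((toRealCLM 𝕜 S).contMDiff.comp_contMDiffOn (contMDiffOn_cocyc θ c j i)).contMDiffAt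
        (((θ.isOpen j).inter (θ.isOpen i)).mem_nhds ⟨hj, hyi.2⟩)
    have h2 : ContMDiffAt (𝓡 n) 𝓘(ℝ, S) ∞ (fun x => u (chartAt (Euc n) x₀ x)) x :=
      hu.contMDiff.contMDiffAt.comp x
        ((contMDiffOn_chart (I := 𝓡 n) (n := ∞) (x := x₀)).contMDiffAt
          ((chartAt (Euc n) x₀).open_source.mem_nhds hs))
    refine (h1.clm_apply h2).congr_of_eventuallyEq ?_
    filter_upwards [(chartAt (Euc n) x₀).open_source.mem_nhds hs, (θ.isOpen i).mem_nhds hyi.2,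
      (θ.isOpen j).mem_nhds hj] with x' h1 h2 h3
    exact inFrame_extSection c h1 h2 h3 u
  · refine ContMDiffAt.contMDiffWithinAt ?_
    have h0 : ContMDiffAt (𝓡 n) 𝓘(ℝ, S) ∞ (fun _ : M => (0 : S)) x := contMDiffAt_const
    refine h0.congr_of_eventuallyEq ?_
    filter_upwards [(isCompact_image_chartInv θ hK hKi).isClosed.isOpen_compl.mem_nhds hx]
      with x' hx'
    rw [extSection_eq_zero c hu0 hx', map_zero]

end Elements

end

end WeightedDirac

namespace WeightedDirac

noncomputable section

/-! ### The divergence of the frame -/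

section Divergence

theorem contDiff_det_of (n : ℕ) :
    ContDiff ℝ ∞ (fun A : Fin n → Fin n → ℝ => (Matrix.of A).det) := by
  simp only [Matrix.det_apply, Matrix.of_apply]
  exact ContDiff.sum fun σ _ => ContDiff.const_smul _ (contDiff_prod fun a _ =>
    contDiff_apply_apply ℝ ℝ _ _)

/-- The derivative of the determinant at the identity is the trace, read off from the expansion of
`det(1 + tX)` up to a remainder with the factor `t²`. -/
theorem fderiv_det_one (n : ℕ) (X : Fin n → Fin n → ℝ) :
    fderiv ℝ (fun A : Fin n → Fin n → ℝ => (Matrix.of A).det)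
      (fun k l => (1 : Matrix (Fin n) (Fin n) ℝ) k l) X = ∑ k, X k k := by
  have h1 := hasDerivAt_line ((contDiff_det_of n).differentiable (by simp)
    (fun k l => (1 : Matrix (Fin n) (Fin n) ℝ) k l)).hasFDerivAt X
  refine h1.unique ?_
  have h2 : (fun t : ℝ => (Matrix.of
      ((fun k l => (1 : Matrix (Fin n) (Fin n) ℝ) k l) + t • X)).det) = fun t : ℝ =>
      1 + (∑ k, X k k) * t + (Polynomial.eval t
        (Matrix.det (1 + (Polynomial.X : Polynomial ℝ) •
          (Matrix.of X).map Polynomial.C)).divX.divX) * t ^ 2 := by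
    funext t
    exact Matrix.det_one_add_smul t (Matrix.of X)
  rw [h2]
  have h3 : HasDerivAt (fun t : ℝ => Polynomial.eval t
      (Matrix.det (1 + (Polynomial.X : Polynomial ℝ) •
          (Matrix.of X).map Polynomial.C)).divX.divX) _ (0 : ℝ) := Polynomial.hasDerivAt _ _
  have h4 := (((hasDerivAt_id (0 : ℝ)).const_mul (∑ k, X k k)).const_add 1).add
    (h3.mul ((hasDerivAt_id (0 : ℝ)).pow 2))
  exact h4.congr_deriv (by simp)

variable {n : ℕ} {M : Type*} [TopologicalSpace M] [ChartedSpace (EuclideanSpace ℝ (Fin n)) M]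
  [IsManifold (𝓡 n) ∞ M] {g : RMetric n M} (θ : SpinStructure g) {i : Fin θ.N} {x₀ : M} {y : Euc n}

/-- Normalising the frame by its value at `y` reduces the derivative of the determinant to the one
at the identity matrix. -/
theorem det_frameMatrix_eq (hy : y ∈ locDom θ i x₀) (y' : Euc n) :
    (frameMatrix θ i x₀ y').det = (frameMatrix θ i x₀ y).det *
      (Matrix.of fun k l => coframe θ i x₀ k y (locFrame θ i x₀ l y')).det := by
  have h1 : (Matrix.of fun k l => coframe θ i x₀ k y (locFrame θ i x₀ l y')) =
      coframeMatrix θ i x₀ y * frameMatrix θ i x₀ y' := by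
    ext k l
    rw [Matrix.mul_apply, Matrix.of_apply]
    conv_lhs => rw [← coord_sum (locFrame θ i x₀ l y'), map_sum]
    refine Finset.sum_congr rfl fun a _ => ?_
    rw [map_smul, smul_eq_mul, mul_comm]
    rfl
  have h2 := congrArg Matrix.det (coframeMatrix_mul_frameMatrix θ hy)
  rw [Matrix.det_mul, Matrix.det_one, mul_comm] at h2
  rw [h1, Matrix.det_mul, ← mul_assoc, h2, one_mul]

/-- Close to `y` the normalised determinant is positive, so the absolute value in the density can be
dropped; the derivative of its inverse is minus a trace. -/
theorem hasFDerivAt_volDensity (hy : y ∈ locDom θ i x₀) (v : Euc n) :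
    fderiv ℝ (volDensity g x₀) y v =
      -(volDensity g x₀ y * ∑ k, coframe θ i x₀ k y (fderiv ℝ (locFrame θ i x₀ k) y v)) := by
  set N : Euc n → Fin n → Fin n → ℝ := fun y' k l => coframe θ i x₀ k y (locFrame θ i x₀ l y')
  set D : (Fin n → Fin n → ℝ) → ℝ := fun A => (Matrix.of A).det
  have hN : HasFDerivAt N (ContinuousLinearMap.pi fun k => ContinuousLinearMap.pi fun l =>
      (coframe θ i x₀ k y).comp (fderiv ℝ (locFrame θ i x₀ l) y)) y := by
    refine hasFDerivAt_pi.2 fun k => hasFDerivAt_pi.2 fun l => ?_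
    exact (coframe θ i x₀ k y).hasFDerivAt.comp y
      ((contDiffAt_locFrame θ hy l).differentiableAt (by simp)).hasFDerivAt
  have hN1 : N y = fun k l => (1 : Matrix (Fin n) (Fin n) ℝ) k l := by
    funext k l
    rw [Matrix.one_apply]
    exact coframe_locFrame θ hy k l
  have hD1 : D (N y) = 1 := by
    rw [hN1]; exact Matrix.det_one
  have hDN := (((contDiff_det_of n).differentiable (by simp) (N y)).hasFDerivAt).comp y hN
  have hinv := (hasDerivAt_inv (show ((fun A => (Matrix.of A).det) ∘ N) y ≠ 0 by
    change D (N y) ≠ 0; rw [hD1]; exact one_ne_zero)).comp_hasFDerivAt y hDN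
  have hw := hinv.const_mul (volDensity g x₀ y)
  have hev : volDensity g x₀ =ᶠ[nhds y]
      fun y' => volDensity g x₀ y * (((fun A => (Matrix.of A).det) ∘ N) y')⁻¹ := by
    have hpos : ∀ᶠ y' in nhds y, 0 < D (N y') :=
      hDN.continuousAt.eventually (lt_mem_nhds (by change 0 < D (N y); rw [hD1]; exact one_pos))
    filter_upwards [hpos, (isOpen_locDom θ i x₀).mem_nhds hy] with y' h1 h2
    rw [volDensity_eq θ h2, volDensity_eq θ hy, det_frameMatrix_eq θ hy y', abs_mul, mul_inv]
    congr 2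
    exact abs_of_pos h1
  rw [(hw.congr_of_eventuallyEq hev).fderiv]
  have e1 : ((fun A => (Matrix.of A).det) ∘ N) y = 1 := hD1
  simp only [smul_apply, ContinuousLinearMap.comp_apply, e1, smul_eq_mul]
  have e2 := fderiv_det_one n (ContinuousLinearMap.pi (fun k => ContinuousLinearMap.pi fun l =>
      (coframe θ i x₀ k y).comp (fderiv ℝ (locFrame θ i x₀ l) y)) v)
  rw [← hN1] at e2
  rw [e2]
  simp

/-- The trace of `T` is the same in the standard basis and in the frame. -/
theorem sum_fderiv_coord (hy : y ∈ locDom θ i x₀) (T : Euc n →L[ℝ] Euc n) :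
    ∑ a, T (stdVec n a) a = ∑ m, coframe θ i x₀ m y (T (locFrame θ i x₀ m y)) := by
  have h1 : ∀ a, T (stdVec n a) a =
      ∑ m, coframe θ i x₀ m y (stdVec n a) * T (locFrame θ i x₀ m y) a := fun a => by
    conv_lhs => rw [← sum_coframe_smul θ hy (stdVec n a), map_sum]
    rw [WithLp.ofLp_sum, Finset.sum_apply]
    refine Finset.sum_congr rfl fun m _ => ?_
    rw [map_smul]; rfl
  simp_rw [h1]
  rw [Finset.sum_comm]
  refine Finset.sum_congr rfl fun m _ => ?_
  conv_rhs => rw [← coord_sum (T (locFrame θ i x₀ m y)), map_sum]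
  refine Finset.sum_congr rfl fun a _ => ?_
  rw [map_smul, smul_eq_mul, mul_comm]

/-- The divergence of the vectors of an orthonormal frame. -/
theorem divergence_locFrame (hy : y ∈ locDom θ i x₀) (k : Fin n) :
    fderiv ℝ (volDensity g x₀) y (locFrame θ i x₀ k y) +
      volDensity g x₀ y * ∑ a, fderiv ℝ (locFrame θ i x₀ k) y (stdVec n a) a =
      volDensity g x₀ y * ∑ m, structFun θ i x₀ m k m y := by
  rw [hasFDerivAt_volDensity θ hy, sum_fderiv_coord θ hy]
  simp only [structFun, VectorField.lieBracket, map_sub, Finset.sum_sub_distrib]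
  ring

end Divergence

/-! ### Symmetry of the Dirac operator on smooth sections -/

section Symmetry

variable {𝕜 : Type*} [RCLike 𝕜] {n : ℕ} {M : Type*} [TopologicalSpace M]
  [ChartedSpace (EuclideanSpace ℝ (Fin n)) M] [IsManifold (𝓡 n) ∞ M]
  {g : RMetric n M} {θ : SpinStructure g}
  {S : Type*} [NormedAddCommGroup S] [InnerProductSpace 𝕜 S] [NormedSpace ℝ S]
  [IsScalarTower ℝ 𝕜 S] [FiniteDimensional 𝕜 S] (c : CliffordModule 𝕜 n S)

theorem inner_γ' (k : Fin n) (s t : S) : inner 𝕜 (c.γ' k s) t = -inner 𝕜 s (c.γ' k t) :=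
  c.skew _ s t

theorem contract_apply (Ψ : PiLp 2 (fun _ : Fin n => S)) : c.contract Ψ = ∑ l, c.γ' l (Ψ l) := by
  simp [CliffordModule.contract, sum_apply]

theorem inner_spinConnection (i : Fin θ.N) (l : Fin n) (x : M) (s t : S) :
    inner 𝕜 (spinConnection θ c i l x s) t = -inner 𝕜 s (spinConnection θ c i l x t) := by
  rw [spinConnection_eq, inner_rep_left,
    star_connElt fun j k => christoffel_antisymm θ l j k]
  have : c.repCLM (-connElt fun j k => θ.christoffel i l j k x) =
      -c.repCLM (connElt fun j k => θ.christoffel i l j k x) := map_neg (repₗ c) _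
  rw [this, neg_apply, inner_neg_right]

theorem commutator_spinConnection (i : Fin θ.N) (l m : Fin n) (x : M) (s : S) :
    spinConnection θ c i l x (c.γ' m s) - c.γ' m (spinConnection θ c i l x s) =
      ∑ k, θ.christoffel i l m k x • c.γ' k s := by
  have h := congrArg (fun a => repₗ c a s) (commutator_connElt
    (fun j k => christoffel_antisymm θ (i := i) (x := x) l j k) m)
  simp only [map_sub, map_sum, map_smul, sub_apply, sum_apply, smul_apply] at h
  have e : ∀ a, repₗ c a = c.repCLM a := fun _ => rfl
  simp only [e, ← repCLM_comp, repCLM_gen, ← spinConnection_eq, ContinuousLinearMap.comp_apply] at h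
  exact h

/-- The Dirac operator in the frame `i` and the chart at `x₀`. -/
def locDirac (c : CliffordModule 𝕜 n S) (i : Fin θ.N) (x₀ : M) (u : Euc n → S) (y : Euc n) : S :=
  ∑ l, c.γ' l (fderiv ℝ u y (locFrame θ i x₀ l y) + spinConnection θ c i l (chartInv x₀ y) (u y))

theorem inner_real_smul_right (r : ℝ) (s t : S) : inner 𝕜 s (r • t) = r • inner 𝕜 s t := by
  rw [RCLike.real_smul_eq_coe_smul (K := 𝕜), inner_smul_right, RCLike.real_smul_eq_coe_mul]

/-- The commutators of Clifford multiplication with the connection forms add up to the divergences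
of the frame vectors, by `divergence_locFrame`. This is the term that integration by parts requires.
-/
theorem sum_commutator {i : Fin θ.N} {x₀ : M} {y : Euc n} (hy : y ∈ locDom θ i x₀) (s : S) :
    ∑ l, (c.γ' l (spinConnection θ c i l (chartInv x₀ y) s) -
      spinConnection θ c i l (chartInv x₀ y) (c.γ' l s)) =
      ∑ k, (∑ m, structFun θ i x₀ m k m y) • c.γ' k s := by
  have h1 : ∀ l, c.γ' l (spinConnection θ c i l (chartInv x₀ y) s) -
      spinConnection θ c i l (chartInv x₀ y) (c.γ' l s) =
      ∑ k, structFun θ i x₀ l k l y • c.γ' k s := fun l => by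
    rw [← neg_sub, commutator_spinConnection, ← Finset.sum_neg_distrib]
    refine Finset.sum_congr rfl fun k _ => ?_
    rw [christoffel_chartInv θ hy, ← neg_smul]
    congr 1
    have : structFun θ i x₀ l l k y = 0 := by
      have := structFun_swap θ (i := i) (x₀ := x₀) (y := y) l l k
      linarith
    rw [this]; ring
  simp_rw [h1]
  rw [Finset.sum_comm]
  simp_rw [Finset.sum_smul]

/-- After multiplication by the density, the right-hand side is the divergence of the vector field
with frame components `⟨u, γ(e_l) v⟩`. The Clifford matrices and the connection forms move across
the inner product by skewness, and their commutators supply the divergence of the frame. -/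
theorem locDirac_inner_sub {i : Fin θ.N} {x₀ : M} {y : Euc n} (hy : y ∈ locDom θ i x₀)
    {u v : Euc n → S} (hu : DifferentiableAt ℝ u y) (hv : DifferentiableAt ℝ v y) :
    inner 𝕜 (u y) (locDirac c i x₀ v y) - inner 𝕜 (locDirac c i x₀ u y) (v y) =
      ∑ l, (fderiv ℝ (fun z => inner 𝕜 (u z) (c.γ' l (v z))) y (locFrame θ i x₀ l y) +
        (∑ m, structFun θ i x₀ m l m y) • inner 𝕜 (u y) (c.γ' l (v y))) := by
  have hγ : ∀ l, DifferentiableAt ℝ (fun z => c.γ' l (v z)) y := fun l =>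
    ((c.γ' l).restrictScalars ℝ).differentiableAt.comp y hv
  have hγ' : ∀ l w, fderiv ℝ (fun z => c.γ' l (v z)) y w = c.γ' l (fderiv ℝ v y w) := fun l w => by
    have := (((c.γ' l).restrictScalars ℝ).hasFDerivAt.comp y hv.hasFDerivAt).fderiv
    exact congrArg (fun T => T w) this
  have hc := congrArg (fun t => inner 𝕜 (u y) t) (sum_commutator c hy (v y))
  simp only [inner_sum, inner_sub_right, inner_real_smul_right] at hc
  rw [Finset.sum_add_distrib, ← hc]
  simp only [locDirac, sum_inner, inner_sum, map_add, inner_add_left, inner_add_right]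
  rw [← Finset.sum_sub_distrib, ← Finset.sum_add_distrib]
  refine Finset.sum_congr rfl fun l _ => ?_
  rw [fderiv_inner_apply 𝕜 hu (hγ l), hγ', inner_γ', inner_γ', inner_spinConnection]
  ring

theorem contDiff_indicator {X W : Type*} [NormedAddCommGroup X] [NormedSpace ℝ X]
    [NormedAddCommGroup W] [NormedSpace ℝ W] {O K : Set X} (hO : IsOpen O) (hK : IsClosed K)
    (hKO : K ⊆ O) {f : X → W} (hf : ContDiffOn ℝ ∞ f O) (h0 : ∀ y ∈ O, y ∉ K → f y = 0) :
    ContDiff ℝ ∞ (O.indicator f) := by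
  rw [contDiff_iff_contDiffAt]
  intro y
  by_cases hy : y ∈ K
  · refine (hf.contDiffAt (hO.mem_nhds (hKO hy))).congr_of_eventuallyEq ?_
    filter_upwards [hO.mem_nhds (hKO hy)] with z hz
    rw [Set.indicator_of_mem hz]
  · have : ContDiffAt ℝ ∞ (fun _ : X => (0 : W)) y := contDiffAt_const
    refine this.congr_of_eventuallyEq ?_
    filter_upwards [hK.isOpen_compl.mem_nhds hy] with z hz
    by_cases hzO : z ∈ O
    · rw [Set.indicator_of_mem hzO, h0 z hzO hz]
    · rw [Set.indicator_of_notMem hzO]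

theorem integral_fderiv_eq_zero {W : Type*} [NormedAddCommGroup W] [NormedSpace ℝ W]
    {f : Euc n → W} (hf : ContDiff ℝ ∞ f) (hc : HasCompactSupport f) (v : Euc n) :
    ∫ y, fderiv ℝ f y v = 0 := by
  have hi : Integrable (fun y => fderiv ℝ f y v) :=
    ((hf.continuous_fderiv (by simp)).clm_apply continuous_const).integrable_of_hasCompactSupport
      (hc.fderiv_apply (𝕜 := ℝ) v)
  have := integral_smul_fderiv_eq_neg_fderiv_smul_of_integrable (μ := (volume : Measure (Euc n)))
    (f := fun _ => (1 : ℝ)) (g := f) (v := v) (by simp) (by simpa using hi)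
    (by simpa using hf.continuous.integrable_of_hasCompactSupport hc)
    (fun _ _ => differentiableAt_const _) (fun _ _ => hf.differentiable (by simp) _)
  simpa using this

theorem diracAt_eq_cocyc {i : Fin θ.N} {x : M} (hi : x ∈ θ.U i) {σ : M → S}
    (hσ : (spinorFramed θ c).IsSmooth σ) : c.contract ((spinorFramed θ c).covDeriv σ x) =
      cocyc θ c (θ.idx x) i x (c.contract ((spinorFramed θ c).covDerivIn i σ x)) :=
  contract_covDerivIn_change c hi (θ.mem_idx x) hσ

theorem eq_cocyc_inFrame {i : Fin θ.N} {x : M} (hi : x ∈ θ.U i) (σ : M → S) :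
    σ x = cocyc θ c (θ.idx x) i x ((spinorFramed θ c).inFrame i σ x) :=
  (cocyc_cancel c (θ.mem_idx x) hi (σ x)).symm

theorem contract_covDerivIn_chartInv {i : Fin θ.N} {x₀ : M} {y : Euc n} (hy : y ∈ locDom θ i x₀)
    {σ : M → S} (hσ : (spinorFramed θ c).IsSmooth σ) :
    c.contract ((spinorFramed θ c).covDerivIn i σ (chartInv x₀ y)) =
      locDirac c i x₀ ((spinorFramed θ c).inFrame i σ ∘ chartInv x₀) y := by
  rw [contract_apply, locDirac]
  refine Finset.sum_congr rfl fun l _ => ?_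
  rw [hσ.covDerivIn_eq hy l]
  rfl

theorem covDeriv_eq_zero {V : Type*} [NormedAddCommGroup V] [NormedSpace 𝕜 V] [NormedSpace ℝ V]
    [IsScalarTower ℝ 𝕜 V] (E : FramedBundle 𝕜 θ V) {σ : M → V} {x : M}
    (h : ∀ᶠ x' in nhds x, σ x' = 0) : E.covDeriv σ x = 0 := by
  have h1 : (fun y => E.trans (θ.idx x) y (σ y)) =ᶠ[nhds x] fun _ => 0 := by
    filter_upwards [h] with y hy
    rw [hy, map_zero]
  ext l
  simp only [FramedBundle.covDeriv]
  rw [h1.mfderiv_eq, mfderiv_const, h.self_of_nhds, map_zero, map_zero]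
  exact add_zero (0 : V)

variable [T2Space M] [CompactSpace M] [MeasurableSpace M] [BorelSpace M]

theorem integrable_inner_of_memLp {X : Type*} [MeasurableSpace X] {μ : Measure X} {f f' : X → S}
    (h : MemLp f 2 μ) (h' : MemLp f' 2 μ) : Integrable (fun x => inner 𝕜 (f x) (f' x)) μ := by
  refine (L2.integrable_inner (𝕜 := 𝕜) h.toLp h'.toLp).congr ?_
  filter_upwards [h.coeFn_toLp, h'.coeFn_toLp] with x h1 h2
  rw [h1, h2]

theorem integrable_inner_dirac {σ τ : M → S} (hσ : (spinorFramed θ c).IsSmooth σ)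
    (hτ : (spinorFramed θ c).IsSmooth τ) :
    Integrable (fun x => inner 𝕜 (c.contract ((spinorFramed θ c).covDeriv σ x)) (τ x))
      (riemannianVolume g) := by
  have h1 := ((spinorFramed_isGeometric c).memLp_covDeriv hσ 2)
  have h2 := c.contract.comp_memLp' h1
  exact integrable_inner_of_memLp h2 ((spinorFramed_isGeometric c).memLp hτ 2)

theorem integrable_inner_dirac' {σ τ : M → S} (hσ : (spinorFramed θ c).IsSmooth σ)
    (hτ : (spinorFramed θ c).IsSmooth τ) :
    Integrable (fun x => inner 𝕜 (σ x) (c.contract ((spinorFramed θ c).covDeriv τ x)))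
      (riemannianVolume g) :=
  integrable_inner_of_memLp ((spinorFramed_isGeometric c).memLp hσ 2)
    (c.contract.comp_memLp' ((spinorFramed_isGeometric c).memLp_covDeriv hτ 2))

/-- One section is supported in a chart that lies over a single frame, so the integrand becomes a
divergence with compact support in `ℝⁿ`, whose integral is zero. -/
theorem integral_dirac_sub_of_tsupport {i : Fin θ.N} {x₀ : M} {ζ : M → ℝ}
    (hζ : ContMDiff (𝓡 n) 𝓘(ℝ, ℝ) ∞ ζ)
    (hsupp : tsupport ζ ⊆ (chartAt (Euc n) x₀).source ∩ θ.U i) {σ τ : M → S}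
    (hσ : (spinorFramed θ c).IsSmooth σ) (hτ : (spinorFramed θ c).IsSmooth τ) :
    ∫ x, (inner 𝕜 (ζ x • σ x) (c.contract ((spinorFramed θ c).covDeriv τ x)) -
      inner 𝕜 (c.contract ((spinorFramed θ c).covDeriv (fun x => ζ x • σ x) x)) (τ x))
        ∂(riemannianVolume g) = 0 := by
  set E := spinorFramed θ c
  set σ' : M → S := fun x => ζ x • σ x with hσ'
  have hs' : E.IsSmooth σ' := hσ.fun_smul hζ
  set K : Set (Euc n) := chartAt (Euc n) x₀ '' tsupport ζ
  have hK : IsCompact K := (isClosed_tsupport ζ).isCompact.image_of_continuousOn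
    ((chartAt (Euc n) x₀).continuousOn.mono fun x hx => (hsupp hx).1)
  have hKi : K ⊆ locDom θ i x₀ := by
    rintro _ ⟨x, hx, rfl⟩
    refine ⟨(chartAt (Euc n) x₀).map_source (hsupp hx).1, ?_⟩
    rw [Set.mem_preimage, (chartAt (Euc n) x₀).left_inv (hsupp hx).1]
    exact (hsupp hx).2
  have hKmem : ∀ y ∈ (chartAt (Euc n) x₀).target, y ∉ K → chartInv x₀ y ∉ tsupport ζ :=
    fun y hy hyK h => hyK ⟨_, h, (chartAt (Euc n) x₀).right_inv hy⟩
  have hzero : ∀ x ∉ tsupport ζ, ∀ᶠ x' in nhds x, σ' x' = 0 := fun x hx => by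
    filter_upwards [(isClosed_tsupport ζ).isOpen_compl.mem_nhds hx] with x' hx'
    change ζ x' • σ x' = 0
    rw [image_eq_zero_of_notMem_tsupport hx', zero_smul]
  set h : M → 𝕜 := fun x => inner 𝕜 (σ' x) (c.contract (E.covDeriv τ x)) -
      inner 𝕜 (c.contract (E.covDeriv σ' x)) (τ x) with hh
  have h0 : ∀ x ∉ tsupport ζ, h x = 0 := fun x hx => by
    have e1 := (hzero x hx).self_of_nhds
    simp only [hh, e1, covDeriv_eq_zero E (hzero x hx), map_zero, inner_zero_left, sub_zero]
  change ∫ x, h x ∂(riemannianVolume g) = 0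
  have hint : Integrable h (riemannianVolume g) :=
    (integrable_inner_dirac' c hs' hτ).sub (integrable_inner_dirac c hs' hτ)
  rw [integral_eq_integral_chart θ x₀ (fun x hx => h0 x fun hx' => hx (hsupp hx').1)
    hint.aestronglyMeasurable]
  set u : Euc n → S := E.inFrame i σ' ∘ chartInv x₀
  set v : Euc n → S := E.inFrame i τ ∘ chartInv x₀
  have hu : ContDiffOn ℝ ∞ u (locDom θ i x₀) := hs'.contDiffOn_local i x₀
  have hv : ContDiffOn ℝ ∞ v (locDom θ i x₀) := hτ.contDiffOn_local i x₀
  have hO := isOpen_locDom θ i x₀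
  set I : Fin n → Euc n → 𝕜 := fun l y => inner 𝕜 (u y) (c.γ' l (v y))
  -- The `a`-th coordinate of the contribution of `e_l` to the vector field, with the volume density
  -- included.
  set f : Fin n → Fin n → Euc n → 𝕜 := fun l a y =>
    (volDensity g x₀ y * locFrame θ i x₀ l y a) • I l y
  have hI : ∀ l, ContDiffOn ℝ ∞ (I l) (locDom θ i x₀) := fun l =>
    hu.inner 𝕜 (((c.γ' l).restrictScalars ℝ).contDiff.comp_contDiffOn hv)
  have hwe : ∀ l a, ContDiffOn ℝ ∞ (fun y => volDensity g x₀ y * locFrame θ i x₀ l y a)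
      (locDom θ i x₀) := fun l a =>
    (contDiffOn_volDensity θ i x₀).mul (contDiffOn_locFrame_coord θ i x₀ l a)
  have hf : ∀ l a, ContDiffOn ℝ ∞ (f l a) (locDom θ i x₀) := fun l a => (hwe l a).smul (hI l)
  have hf0 : ∀ l a, ∀ y ∈ locDom θ i x₀, y ∉ K → f l a y = 0 := fun l a y hy hyK => by
    have : u y = 0 := by
      change E.trans i (chartInv x₀ y) (σ' (chartInv x₀ y)) = 0
      rw [(hzero _ (hKmem y hy.1 hyK)).self_of_nhds, map_zero]
    simp only [f, I, this, inner_zero_left, smul_zero]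
  -- Extension by zero is smooth because `f` vanishes outside of the compact set `K` inside the
  -- chart.
  set G : Fin n → Fin n → Euc n → 𝕜 := fun l a => (locDom θ i x₀).indicator (f l a)
  have hG : ∀ l a, ContDiff ℝ ∞ (G l a) := fun l a =>
    contDiff_indicator hO hK.isClosed hKi (hf l a) (hf0 l a)
  have hG0 : ∀ l a, ∀ y ∉ K, G l a y = 0 := fun l a y hy => by
    by_cases hyO : y ∈ locDom θ i x₀
    · simp only [G]; rw [Set.indicator_of_mem hyO, hf0 l a y hyO hy]
    · simp only [G]; rw [Set.indicator_of_notMem hyO]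
  have hGc : ∀ l a, HasCompactSupport (G l a) := fun l a =>
    HasCompactSupport.intro hK (hG0 l a)
  have hdG0 : ∀ l a, ∀ y ∉ K, fderiv ℝ (G l a) y = 0 := fun l a y hy => by
    have : G l a =ᶠ[nhds y] fun _ => 0 := by
      filter_upwards [hK.isClosed.isOpen_compl.mem_nhds hy] with z hz using hG0 l a z hz
    rw [this.fderiv_eq, fderiv_const_apply]
  have key : ∀ y ∈ (chartAt (Euc n) x₀).target, volDensity g x₀ y • h (chartInv x₀ y) =
      ∑ l, ∑ a, fderiv ℝ (G l a) y (stdVec n a) := fun y hy => by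
    by_cases hyK : y ∈ K
    swap
    · rw [h0 _ (hKmem y hy hyK), smul_zero]
      simp [hdG0 _ _ y hyK]
    have hyi := hKi hyK
    have hGf : ∀ l a, fderiv ℝ (G l a) y = fderiv ℝ (f l a) y := fun l a => by
      refine Filter.EventuallyEq.fderiv_eq ?_
      filter_upwards [hO.mem_nhds hyi] with z hz
      exact Set.indicator_of_mem hz _
    have hdu := (hu.contDiffAt (hO.mem_nhds hyi)).differentiableAt (by simp)
    have hdv := (hv.contDiffAt (hO.mem_nhds hyi)).differentiableAt (by simp)
    have e1 : h (chartInv x₀ y) = inner 𝕜 (u y) (locDirac c i x₀ v y) -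
        inner 𝕜 (locDirac c i x₀ u y) (v y) := by
      simp only [hh]
      rw [diracAt_eq_cocyc c hyi.2 hτ, diracAt_eq_cocyc c hyi.2 hs', eq_cocyc_inFrame c hyi.2 σ',
        eq_cocyc_inFrame c hyi.2 τ, inner_cocyc, inner_cocyc, contract_covDerivIn_chartInv c hyi hs',
        contract_covDerivIn_chartInv c hyi hτ]
      rfl
    rw [e1, locDirac_inner_sub c hyi hdu hdv, Finset.smul_sum]
    refine Finset.sum_congr rfl fun l _ => ?_
    have hdI := ((hI l).contDiffAt (hO.mem_nhds hyi)).differentiableAt (by simp)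
    have hdw := ((contDiffOn_volDensity θ i x₀).contDiffAt (hO.mem_nhds hyi)).differentiableAt
      (by simp)
    have hde := (contDiffAt_locFrame θ hyi l).differentiableAt (by simp)
    have e2 : ∀ a, fderiv ℝ (G l a) y (stdVec n a) =
        (volDensity g x₀ y * locFrame θ i x₀ l y a) • fderiv ℝ (I l) y (stdVec n a) +
        (volDensity g x₀ y * fderiv ℝ (locFrame θ i x₀ l) y (stdVec n a) a +
          locFrame θ i x₀ l y a * fderiv ℝ (volDensity g x₀) y (stdVec n a)) • I l y := fun a => by
      rw [hGf l a]
      have hea : HasFDerivAt (fun z => locFrame θ i x₀ l z a)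
          ((EuclideanSpace.proj a : Euc n →L[ℝ] ℝ).comp (fderiv ℝ (locFrame θ i x₀ l) y)) y :=
        (EuclideanSpace.proj a : Euc n →L[ℝ] ℝ).hasFDerivAt.comp y hde.hasFDerivAt
      have := ((hdw.hasFDerivAt.mul hea).smul hdI.hasFDerivAt).fderiv
      change fderiv ℝ (fun y => (volDensity g x₀ y * locFrame θ i x₀ l y a) • I l y) y _ = _
      refine (congrArg (fun T => T (stdVec n a)) this).trans ?_
      simp [add_apply, smul_apply]
    simp_rw [e2]
    rw [Finset.sum_add_distrib, ← Finset.sum_smul, Finset.sum_add_distrib, ← Finset.mul_sum]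
    have e3 : ∑ a, locFrame θ i x₀ l y a * fderiv ℝ (volDensity g x₀) y (stdVec n a) =
        fderiv ℝ (volDensity g x₀) y (locFrame θ i x₀ l y) := by
      conv_rhs => rw [← coord_sum (locFrame θ i x₀ l y), map_sum]
      simp only [map_smul, smul_eq_mul]
    have e4 : ∑ a, (volDensity g x₀ y * locFrame θ i x₀ l y a) • fderiv ℝ (I l) y (stdVec n a) =
        volDensity g x₀ y • fderiv ℝ (I l) y (locFrame θ i x₀ l y) := by
      conv_rhs => rw [← coord_sum (locFrame θ i x₀ l y), map_sum]
      rw [Finset.smul_sum]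
      simp only [map_smul, mul_smul]
    rw [e3, e4, add_comm (_ * _) _, divergence_locFrame θ hyi l, mul_smul, ← smul_add]
  rw [setIntegral_congr_fun (chartAt (Euc n) x₀).open_target.measurableSet key,
    setIntegral_eq_integral_of_forall_compl_eq_zero fun y hy => by
      have : y ∉ K := fun h => hy (hKi h).1
      simp [hdG0 _ _ y this]]
  have hi : ∀ l a, Integrable (fun y => fderiv ℝ (G l a) y (stdVec n a)) := fun l a =>
    (((hG l a).continuous_fderiv (by simp)).clm_apply
      continuous_const).integrable_of_hasCompactSupport ((hGc l a).fderiv_apply (𝕜 := ℝ) _)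
  rw [integral_finsetSum _ fun l _ => integrable_finsetSum _ fun a _ => hi l a]
  refine Finset.sum_eq_zero fun l _ => ?_
  rw [integral_finsetSum _ fun a _ => hi l a]
  exact Finset.sum_eq_zero fun a _ => integral_fderiv_eq_zero (hG l a) (hGc l a) _

theorem covDeriv_finsetSum {V : Type*} [NormedAddCommGroup V] [NormedSpace 𝕜 V] [NormedSpace ℝ V]
    [IsScalarTower ℝ 𝕜 V] {E : FramedBundle 𝕜 θ V} {ι : Type*} (t : Finset ι) {σ : ι → M → V}
    (h : ∀ a ∈ t, E.IsSmooth (σ a)) (x : M) :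
    E.covDeriv (fun x => ∑ a ∈ t, σ a x) x = ∑ a ∈ t, E.covDeriv (σ a) x := by
  classical
  induction t using Finset.induction_on with
  | empty =>
    simp only [Finset.sum_empty]
    exact covDeriv_eq_zero E (Filter.Eventually.of_forall fun _ => rfl)
  | insert b t hb ih =>
    have h1 := FramedBundle.covDeriv_add (h b (Finset.mem_insert_self b t))
      (FramedBundle.IsSmooth.sum t fun a ha => h a (Finset.mem_insert_of_mem ha)) x
    rw [Finset.sum_insert hb, ← ih fun a ha => h a (Finset.mem_insert_of_mem ha), ← h1]
    congr 1
    funext x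
    exact Finset.sum_insert hb

/-- The Dirac operator is symmetric on smooth sections. -/
theorem integral_inner_dirac {σ τ : M → S}
    (hσ : (spinorFramed θ c).IsSmooth σ) (hτ : (spinorFramed θ c).IsSmooth τ) :
    ∫ x, inner 𝕜 (σ x) (c.contract ((spinorFramed θ c).covDeriv τ x)) ∂(riemannianVolume g) =
      ∫ x, inner 𝕜 (c.contract ((spinorFramed θ c).covDeriv σ x)) (τ x) ∂(riemannianVolume g) := by
  obtain ⟨t, ζ, hζ, hsupp, hsum⟩ := exists_smooth_partition (n := n)
    (fun x : M => (chartAt (Euc n) x).source ∩ θ.U (θ.idx x))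
    (fun x => (chartAt (Euc n) x).open_source.inter (θ.isOpen _))
    (fun x => ⟨mem_chart_source _ x, θ.mem_idx x⟩)
  have hs : ∀ a, (spinorFramed θ c).IsSmooth fun x => ζ a x • σ x := fun a => hσ.fun_smul (hζ a)
  have h1 : ∀ x, σ x = ∑ a ∈ t, ζ a x • σ x := fun x => by
    rw [← Finset.sum_smul, hsum, one_smul]
  have h2 : ∀ x, (spinorFramed θ c).covDeriv σ x =
      ∑ a ∈ t, (spinorFramed θ c).covDeriv (fun x => ζ a x • σ x) x := fun x => by
    rw [← covDeriv_finsetSum t fun a _ => hs a]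
    congr 1
    exact funext h1
  rw [← sub_eq_zero, ← integral_sub (integrable_inner_dirac' c hσ hτ)
    (integrable_inner_dirac c hσ hτ)]
  have h3 : ∀ x, inner 𝕜 (σ x) (c.contract ((spinorFramed θ c).covDeriv τ x)) -
      inner 𝕜 (c.contract ((spinorFramed θ c).covDeriv σ x)) (τ x) =
      ∑ a ∈ t, (inner 𝕜 (ζ a x • σ x) (c.contract ((spinorFramed θ c).covDeriv τ x)) -
      inner 𝕜 (c.contract ((spinorFramed θ c).covDeriv (fun x => ζ a x • σ x) x)) (τ x)) :=
    fun x => by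
      rw [Finset.sum_sub_distrib, ← sum_inner, ← sum_inner, ← map_sum, ← h1, ← h2]
  simp_rw [h3]
  refine (integral_finsetSum t fun a _ => (integrable_inner_dirac' c (hs a) hτ).sub
    (integrable_inner_dirac c (hs a) hτ)).trans ?_
  exact Finset.sum_eq_zero fun a ha =>
    integral_dirac_sub_of_tsupport c (hζ a) (hsupp a ha) hσ hτ

end Symmetry

end

end WeightedDirac

namespace WeightedDirac

noncomputable section

/-! ### Sobolev inequalities in Euclidean space -/

section Euclidean

open scoped NNReal

variable {n : ℕ} {W : Type*} [NormedAddCommGroup W] [NormedSpace ℝ W]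

theorem enorm_le_add_lintegral_fderiv [CompleteSpace W] {u : Euc n → W} (hu : ContDiff ℝ 1 u)
    (x z : Euc n) :
    ‖u x‖ₑ ≤ ‖u (x + z)‖ₑ +
      ∫⁻ t in Set.Ioc (0 : ℝ) 1, ‖fderiv ℝ u (x + t • z)‖ₑ * ‖z‖ₑ := by
  have hline : ∀ t : ℝ, HasDerivAt (fun t : ℝ => u (x + t • z)) (fderiv ℝ u (x + t • z) z) t := by
    intro t
    have h1 : HasDerivAt (fun t : ℝ => x + t • z) z t := by
      simpa using ((hasDerivAt_id t).smul_const z).const_add x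
    exact ((hu.differentiable (by simp) _).hasFDerivAt).comp_hasDerivAt t h1
  have hcont : Continuous fun t : ℝ => fderiv ℝ u (x + t • z) z :=
    ((hu.continuous_fderiv (by simp)).comp (by fun_prop)).clm_apply continuous_const
  have hint := intervalIntegral.integral_eq_sub_of_hasDerivAt (a := 0) (b := 1)
    (fun t _ => hline t) (hcont.intervalIntegrable 0 1)
  have e : u x = u (x + z) - ∫ t in (0 : ℝ)..1, fderiv ℝ u (x + t • z) z := by
    rw [hint]; simp
  rw [e]
  refine (enorm_sub_le).trans (add_le_add le_rfl ?_)
  rw [intervalIntegral.integral_of_le zero_le_one]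
  refine (enorm_integral_le_lintegral_enorm _).trans (lintegral_mono fun t => ?_)
  exact (fderiv ℝ u (x + t • z)).le_opENorm z

theorem eLpNorm_comp_add_smul {V : Type*} [NormedAddCommGroup V] {h : Euc n → V}
    (hh : Continuous h) {p : ℝ≥0∞} (x : Euc n) {t : ℝ} (ht : 0 < t) :
    eLpNorm (fun z => h (x + t • z)) p volume =
      ENNReal.ofReal ((t ^ n)⁻¹) ^ (1 / p).toReal * eLpNorm h p volume := by
  have h1 : eLpNorm (fun z => h (x + z)) p volume = eLpNorm h p volume :=
    eLpNorm_comp_measurePreserving hh.aestronglyMeasurable (measurePreserving_add_left volume x)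
  have h2 : Measurable fun z : Euc n => t • z := measurable_const_smul t
  have h3 := eLpNorm_map_measure (μ := (volume : Measure (Euc n))) (p := p)
    (g := fun z => h (x + z)) (f := fun z => t • z)
    (hh.comp (continuous_const_add x)).aestronglyMeasurable h2.aemeasurable
  rw [Measure.map_addHaar_smul volume ht.ne'] at h3
  have h4 : ENNReal.ofReal |(t ^ Module.finrank ℝ (Euc n))⁻¹| = ENNReal.ofReal ((t ^ n)⁻¹) := by
    rw [finrank_euclideanSpace_fin, abs_of_pos (by positivity)]
  rw [h4, eLpNorm_smul_measure_of_ne_zero (by simpa using pow_pos ht n), h1, smul_eq_mul] at h3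
  rw [h3]
  rfl

/-- Morrey's inequality: functions in `W^{1,p}` with `p > n` are bounded. -/
theorem exists_morrey [CompleteSpace W] {p : ℝ≥0∞} (hp1 : 1 ≤ p) (hnp : (n : ℝ≥0∞) < p)
    (hp : p ≠ ⊤) : ∃ C : ℝ≥0, ∀ u : Euc n → W, ContDiff ℝ 1 u → ∀ x,
      ‖u x‖ₑ ≤ C * (eLpNorm u p volume + eLpNorm (fderiv ℝ u) p volume) := by
  set B : Set (Euc n) := Metric.ball 0 1
  set b := volume B with hb
  have hb0 : b ≠ 0 := (Metric.measure_ball_pos volume _ one_pos).ne'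
  have hbt : b ≠ ⊤ := measure_ball_lt_top.ne
  have hB : MeasurableSet B := measurableSet_ball
  set κ : ℝ≥0∞ := b ^ (1 / (1 : ℝ≥0∞).toReal - 1 / p.toReal) with hκ
  have hκt : κ ≠ ⊤ := ENNReal.rpow_ne_top_of_ne_zero hb0 hbt
  have hp0 : 0 < p.toReal := ENNReal.toReal_pos (zero_lt_one.trans_le hp1).ne' hp
  set I : ℝ≥0∞ := ∫⁻ t in Set.Ioc (0 : ℝ) 1, ENNReal.ofReal ((t ^ n)⁻¹) ^ (1 / p).toReal with hI
  have hIt : I ≠ ⊤ := by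
    -- Here `p > n` is decisive: `t^{-n/p}` is integrable at `0`.
    have hlt : (n : ℝ) / p.toReal < 1 := by
      rw [div_lt_one hp0]
      have := (ENNReal.toReal_lt_toReal (ENNReal.natCast_ne_top n) hp).2 hnp
      simpa using this
    have h1 : IntervalIntegrable (fun t : ℝ => t ^ (-((n : ℝ) / p.toReal))) volume 0 1 :=
      intervalIntegral.intervalIntegrable_rpow' (by linarith)
    rw [intervalIntegrable_iff_integrableOn_Ioc_of_le zero_le_one] at h1
    have h2 := h1.lintegral_lt_top
    refine ne_of_lt (lt_of_eq_of_lt ?_ h2)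
    refine setLIntegral_congr_fun measurableSet_Ioc fun t ht => ?_
    have ht0 : 0 < t := ht.1
    change ENNReal.ofReal ((t ^ n)⁻¹) ^ (1 / p).toReal = ENNReal.ofReal (t ^ (-((n : ℝ) / p.toReal)))
    rw [ENNReal.ofReal_rpow_of_pos (by positivity)]
    congr 1
    rw [← Real.rpow_natCast, ← Real.rpow_neg ht0.le, ← Real.rpow_mul ht0.le, ENNReal.toReal_div,
      ENNReal.toReal_one]
    congr 1
    ring
  -- Hölder's inequality on the unit ball gives the factor `κ`, and rescaling by `t` gives the
  -- factor `t^{-n/p}`.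
  have hbound : ∀ {V : Type _} [NormedAddCommGroup V] (h : Euc n → V), Continuous h →
      ∀ x : Euc n, ∀ t : ℝ, 0 < t → ∫⁻ z in B, ‖h (x + t • z)‖ₑ ≤
        ENNReal.ofReal ((t ^ n)⁻¹) ^ (1 / p).toReal * eLpNorm h p volume * κ := by
    intro V _ h hh x t ht
    have hc : Continuous fun z => h (x + t • z) := hh.comp (by fun_prop)
    have h1 := eLpNorm_le_eLpNorm_mul_rpow_measure_univ (μ := volume.restrict B) hp1
      hc.aestronglyMeasurable
    rw [eLpNorm_one_eq_lintegral_enorm, Measure.restrict_apply_univ] at h1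
    refine h1.trans (mul_le_mul_left ?_ _)
    rw [← eLpNorm_comp_add_smul hh x ht]
    exact eLpNorm_mono_measure _ Measure.restrict_le_self
  refine ⟨(b⁻¹ * (κ * (1 + I))).toNNReal, fun u hu x => ?_⟩
  rw [ENNReal.coe_toNNReal (ENNReal.mul_ne_top (ENNReal.inv_ne_top.2 hb0)
    (ENNReal.mul_ne_top hκt (by simp [hIt]))), mul_assoc]
  suffices h : b * ‖u x‖ₑ ≤ κ * (1 + I) * (eLpNorm u p volume + eLpNorm (fderiv ℝ u) p volume) by
    calc ‖u x‖ₑ = b⁻¹ * (b * ‖u x‖ₑ) := by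
          rw [← mul_assoc, ENNReal.inv_mul_cancel hb0 hbt, one_mul]
      _ ≤ _ := mul_le_mul_right h _
  have hcu := hu.continuous
  have hcd : Continuous (fderiv ℝ u) := hu.continuous_fderiv (by simp)
  have hmeas : Measurable (Function.uncurry fun (z : Euc n) (t : ℝ) => ‖fderiv ℝ u (x + t • z)‖ₑ) :=
    ((hcd.comp (by fun_prop : Continuous fun q : Euc n × ℝ => x + q.2 • q.1)).enorm).measurable
  -- The fundamental theorem of calculus along the segment from `x` to `x + z` is averaged over `z`
  -- in the unit ball; the integrals over `z` and `t` are then exchanged.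
  calc b * ‖u x‖ₑ = ∫⁻ _ in B, ‖u x‖ₑ := by rw [setLIntegral_const, mul_comm]
    _ ≤ ∫⁻ z in B, (‖u (x + (1 : ℝ) • z)‖ₑ +
        ∫⁻ t in Set.Ioc (0 : ℝ) 1, ‖fderiv ℝ u (x + t • z)‖ₑ) := by
      refine setLIntegral_mono' hB fun z hz => ?_
      rw [one_smul]
      refine (enorm_le_add_lintegral_fderiv hu x z).trans
        (add_le_add le_rfl (lintegral_mono fun t => ?_))
      have hz1 : ‖z‖ₑ ≤ 1 := by
        rw [← ofReal_norm, ENNReal.ofReal_le_one]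
        exact (mem_ball_zero_iff.1 hz).le
      exact mul_le_of_le_one_right' hz1
    _ = (∫⁻ z in B, ‖u (x + (1 : ℝ) • z)‖ₑ) +
        ∫⁻ t in Set.Ioc (0 : ℝ) 1, ∫⁻ z in B, ‖fderiv ℝ u (x + t • z)‖ₑ := by
      rw [lintegral_add_left, lintegral_lintegral_swap hmeas.aemeasurable]
      exact (hcu.comp (by fun_prop)).enorm.measurable
    _ ≤ eLpNorm u p volume * κ + ∫⁻ t in Set.Ioc (0 : ℝ) 1,
        ENNReal.ofReal ((t ^ n)⁻¹) ^ (1 / p).toReal * (eLpNorm (fderiv ℝ u) p volume * κ) := by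
      refine add_le_add ?_ (setLIntegral_mono' measurableSet_Ioc fun t ht => ?_)
      · simpa using hbound u hcu x 1 one_pos
      · rw [← mul_assoc]; exact hbound _ hcd x t ht.1
    _ = eLpNorm u p volume * κ + I * (eLpNorm (fderiv ℝ u) p volume * κ) := by
      rw [lintegral_mul_const]
      exact ((((measurable_id.pow_const n).inv).ennreal_ofReal).pow_const _)
    _ ≤ κ * (1 + I) * (eLpNorm u p volume + eLpNorm (fderiv ℝ u) p volume) := by
      calc _ ≤ eLpNorm u p volume * κ + I * (eLpNorm (fderiv ℝ u) p volume * κ) +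
            (I * (eLpNorm u p volume * κ) + eLpNorm (fderiv ℝ u) p volume * κ) := le_self_add
        _ = _ := by ring

theorem eLpNorm_le_of_support_subset {V : Type*} [NormedAddCommGroup V] {f : Euc n → V}
    (hf : Continuous f) {s : Set (Euc n)} (hs : Function.support f ⊆ s) {p q : ℝ≥0∞} (hpq : p ≤ q) :
    eLpNorm f p volume ≤ eLpNorm f q volume * volume s ^ (1 / p.toReal - 1 / q.toReal) := by
  have h2 := eLpNorm_le_eLpNorm_mul_rpow_measure_univ (μ := volume.restrict s) hpq
    hf.aestronglyMeasurable
  rwa [eLpNorm_restrict_eq_of_support_subset hs, eLpNorm_restrict_eq_of_support_subset hs,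
    Measure.restrict_apply_univ] at h2

/-- The Sobolev inequality for functions with support in a fixed bounded set. -/
theorem exists_sobolev [FiniteDimensional ℝ W] (hn : 2 ≤ n) {p q : ℝ≥0} (hnp : (n : ℝ≥0) < p)
    (hpq : (q : ℝ)⁻¹ = 2⁻¹ - (p : ℝ)⁻¹) {s : Set (Euc n)} (hs : Bornology.IsBounded s) :
    ∃ C : ℝ≥0, ∀ u : Euc n → W, ContDiff ℝ 1 u → Function.support u ⊆ s →
      eLpNorm u q volume ≤ C * eLpNorm (fderiv ℝ u) 2 volume := by
  have hn0 : (0 : ℝ) < n := by exact_mod_cast (by omega : 0 < n)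
  have hn2 : (2 : ℝ) ≤ n := by exact_mod_cast hn
  have hp0 : (0 : ℝ) < p := lt_trans hn0 (by exact_mod_cast hnp)
  have hnp' : (p : ℝ)⁻¹ < (n : ℝ)⁻¹ := inv_strictAnti₀ hn0 (by exact_mod_cast hnp)
  have hn2' : (n : ℝ)⁻¹ ≤ 2⁻¹ := inv_anti₀ two_pos hn2
  have hpi : (0 : ℝ) < (p : ℝ)⁻¹ := inv_pos.2 hp0
  have hni : (0 : ℝ) < (n : ℝ)⁻¹ := inv_pos.2 hn0
  -- The inverse of the exponent `r` whose Sobolev conjugate is `q`, that is `1/q = 1/r - 1/n`. From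
  -- `1/2 < ρ < 1` and `1/n ≤ 1/2` one gets `1 ≤ r < n`, also for `n = 2`, where `r = 2` would be
  -- excluded. As `r ≤ 2`, the `L^r` norm of the gradient is bounded by the `L²` norm on a bounded
  -- set.
  set ρ : ℝ := 2⁻¹ - (p : ℝ)⁻¹ + (n : ℝ)⁻¹ with hρ
  have hρ0 : 2⁻¹ < ρ := by rw [hρ]; linarith
  have hρ1 : ρ < 1 := by rw [hρ]; linarith
  have hρn : (n : ℝ)⁻¹ < ρ := lt_of_le_of_lt hn2' hρ0
  have hρpos : 0 < ρ := lt_trans (by norm_num) hρ0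
  set r : ℝ≥0 := ⟨ρ⁻¹, (inv_pos.2 hρpos).le⟩ with hr
  have hrc : (r : ℝ) = ρ⁻¹ := rfl
  have hr1 : 1 ≤ r := by
    rw [← NNReal.coe_le_coe, hrc, NNReal.coe_one]
    exact (one_lt_inv₀ hρpos).2 hρ1 |>.le
  have hr2 : r ≤ 2 := by
    rw [← NNReal.coe_le_coe, hrc]
    have := (inv_lt_inv₀ hρpos (by norm_num : (0 : ℝ) < 2⁻¹)).2 hρ0
    rw [inv_inv] at this
    exact this.le
  have hrn : r < Module.finrank ℝ (Euc n) := by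
    rw [finrank_euclideanSpace_fin, ← NNReal.coe_lt_coe, hrc]
    have := (inv_lt_inv₀ hρpos hni).2 hρn
    rw [inv_inv] at this
    simpa using this
  set s' := closure s
  have hs' : Bornology.IsBounded s' := hs.closure
  have hv : volume s' ≠ ⊤ := hs'.measure_lt_top.ne
  set K := eLpNormLESNormFDerivOfLeConst W (volume : Measure (Euc n)) s r q
  set v : ℝ≥0∞ := volume s' ^ (1 / (r : ℝ≥0∞).toReal - 1 / (2 : ℝ≥0∞).toReal) with hvdef
  have hv' : v ≠ ⊤ := by
    refine ENNReal.rpow_ne_top_of_nonneg ?_ hv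
    rw [ENNReal.coe_toReal, hrc, one_div, inv_inv, ENNReal.toReal_ofNat]
    norm_num at hρ0 ⊢
    linarith
  refine ⟨K * v.toNNReal, fun u hu hus => ?_⟩
  have h1 := eLpNorm_le_eLpNorm_fderiv_of_le (μ := (volume : Measure (Euc n))) hu hus hr1 hrn
    (q := q) (by
      rw [finrank_euclideanSpace_fin, hpq]
      rw [NNReal.coe_inv, hrc, inv_inv, hρ]
      linarith) hs
  refine h1.trans ?_
  rw [ENNReal.coe_mul, mul_assoc, ENNReal.coe_toNNReal hv']
  refine mul_le_mul_right ?_ _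
  -- The support of the derivative may leave `s`, but not its closure.
  have hsupp : Function.support (fderiv ℝ u) ⊆ s' :=
    (support_fderiv_subset ℝ).trans (closure_mono hus)
  rw [mul_comm]
  exact eLpNorm_le_of_support_subset (hu.continuous_fderiv (by simp)) hsupp
    (by exact_mod_cast hr2)

end Euclidean

end

end WeightedDirac

namespace WeightedDirac

noncomputable section

/-! ### Localisation of sections -/

section Localise

open scoped NNReal

variable {𝕜 : Type*} [RCLike 𝕜] {n : ℕ} {M : Type*} [TopologicalSpace M]
  [ChartedSpace (EuclideanSpace ℝ (Fin n)) M] [IsManifold (𝓡 n) ∞ M]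
  {g : RMetric n M} {θ : SpinStructure g}
  {V : Type*} [NormedAddCommGroup V] [NormedSpace 𝕜 V] [NormedSpace ℝ V] [IsScalarTower ℝ 𝕜 V]
  {E : FramedBundle 𝕜 θ V}

/-- The coordinate ball of radius `R` about `x₀`, as a subset of `M`. -/
def coordBall (x₀ : M) (R : ℝ) : Set M :=
  (chartAt (Euc n) x₀).source ∩ chartAt (Euc n) x₀ ⁻¹' Metric.ball (chartAt (Euc n) x₀ x₀) R

theorem isOpen_coordBall (x₀ : M) (R : ℝ) : IsOpen (coordBall (n := n) x₀ R) :=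
  (chartAt (Euc n) x₀).isOpen_inter_preimage Metric.isOpen_ball

theorem mem_coordBall_self (x₀ : M) {R : ℝ} (hR : 0 < R) : x₀ ∈ coordBall (n := n) x₀ R :=
  ⟨mem_chart_source _ x₀, Metric.mem_ball_self hR⟩

theorem coordBall_subset {i : Fin θ.N} {x₀ : M} {R : ℝ}
    (hR : Metric.closedBall (chartAt (Euc n) x₀ x₀) R ⊆ locDom θ i x₀) :
    coordBall (n := n) x₀ R ⊆ (chartAt (Euc n) x₀).source ∩ θ.U i := by
  rintro x ⟨h1, h2⟩
  refine ⟨h1, ?_⟩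
  have := (hR (Metric.ball_subset_closedBall h2)).2
  rwa [Set.mem_preimage, (chartAt (Euc n) x₀).left_inv h1] at this

/-- The section `ζσ` in the frame `i` and the chart at `x₀`, cut off outside of a ball. -/
def localRep (E : FramedBundle 𝕜 θ V) (i : Fin θ.N) (x₀ : M) (R : ℝ) (ζ : M → ℝ) (σ : M → V) :
    Euc n → V :=
  (Metric.ball (chartAt (Euc n) x₀ x₀) R).indicator fun y =>
    ζ (chartInv x₀ y) • E.inFrame i σ (chartInv x₀ y)

variable {i : Fin θ.N} {x₀ : M} {R : ℝ} {ζ : M → ℝ}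

theorem isCompact_chart_tsupport [CompactSpace M] (hsupp : tsupport ζ ⊆ coordBall (n := n) x₀ R) :
    IsCompact (chartAt (Euc n) x₀ '' tsupport ζ) :=
  (isClosed_tsupport ζ).isCompact.image_of_continuousOn
    ((chartAt (Euc n) x₀).continuousOn.mono fun _ hx => (hsupp hx).1)

theorem chart_tsupport_subset (hsupp : tsupport ζ ⊆ coordBall (n := n) x₀ R) :
    chartAt (Euc n) x₀ '' tsupport ζ ⊆ Metric.ball (chartAt (Euc n) x₀ x₀) R := by
  rintro _ ⟨x, hx, rfl⟩
  exact (hsupp hx).2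

theorem cutoff_eq_zero {y : Euc n} (hy : y ∈ (chartAt (Euc n) x₀).target)
    (hyK : y ∉ chartAt (Euc n) x₀ '' tsupport ζ) : ζ (chartInv x₀ y) = 0 :=
  image_eq_zero_of_notMem_tsupport fun h => hyK ⟨_, h, (chartAt (Euc n) x₀).right_inv hy⟩

theorem localRep_eq_zero (hR : Metric.closedBall (chartAt (Euc n) x₀ x₀) R ⊆ locDom θ i x₀)
    (σ : M → V) {y : Euc n} (hy : y ∉ chartAt (Euc n) x₀ '' tsupport ζ) :
    localRep E i x₀ R ζ σ y = 0 := by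
  by_cases hB : y ∈ Metric.ball (chartAt (Euc n) x₀ x₀) R
  · rw [localRep, Set.indicator_of_mem hB,
      cutoff_eq_zero (hR (Metric.ball_subset_closedBall hB)).1 hy, zero_smul]
  · rw [localRep, Set.indicator_of_notMem hB]

theorem contDiffOn_comp_chartInv {f : M → ℝ} (hf : ContMDiff (𝓡 n) 𝓘(ℝ, ℝ) ∞ f) (x₀ : M) :
    ContDiffOn ℝ ∞ (fun y => f (chartInv x₀ y)) (chartAt (Euc n) x₀).target := by
  rw [← contMDiffOn_iff_contDiffOn]
  exact hf.comp_contMDiffOn (contMDiffOn_chart_symm (I := 𝓡 n))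

theorem contDiff_localRep [CompactSpace M]
    (hR : Metric.closedBall (chartAt (Euc n) x₀ x₀) R ⊆ locDom θ i x₀)
    (hζ : ContMDiff (𝓡 n) 𝓘(ℝ, ℝ) ∞ ζ) (hsupp : tsupport ζ ⊆ coordBall (n := n) x₀ R) {σ : M → V}
    (hσ : E.IsSmooth σ) : ContDiff ℝ ∞ (localRep E i x₀ R ζ σ) := by
  have hB : Metric.ball (chartAt (Euc n) x₀ x₀) R ⊆ locDom θ i x₀ :=
    Metric.ball_subset_closedBall.trans hR
  refine contDiff_indicator Metric.isOpen_ball (isCompact_chart_tsupport hsupp).isClosed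
    (chart_tsupport_subset hsupp) ?_ fun y hy hyK => ?_
  · exact ((contDiffOn_comp_chartInv hζ x₀).mono fun y hy => (hB hy).1).smul
      ((hσ.contDiffOn_local i x₀).mono hB)
  · rw [cutoff_eq_zero (hB hy).1 hyK, zero_smul]

theorem support_localRep (σ : M → V) :
    Function.support (localRep E i x₀ R ζ σ) ⊆ Metric.ball (chartAt (Euc n) x₀ x₀) R :=
  Set.support_indicator_subset

theorem norm_localRep (hE : E.IsGeometric)
    (hR : Metric.closedBall (chartAt (Euc n) x₀ x₀) R ⊆ locDom θ i x₀)
    (hsupp : tsupport ζ ⊆ coordBall (n := n) x₀ R)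
    (σ : M → V) {y : Euc n} (hy : y ∈ (chartAt (Euc n) x₀).target) :
    ‖localRep E i x₀ R ζ σ y‖ = ‖ζ (chartInv x₀ y) • σ (chartInv x₀ y)‖ := by
  by_cases hB : y ∈ Metric.ball (chartAt (Euc n) x₀ x₀) R
  · rw [localRep, Set.indicator_of_mem hB, norm_smul, norm_smul,
      hE.norm_inFrame (hR (Metric.ball_subset_closedBall hB)).2]
  · rw [localRep, Set.indicator_of_notMem hB, cutoff_eq_zero hy
      fun h => hB (chart_tsupport_subset hsupp h), zero_smul]

/-- The product rule, with the cutoff and its derivative bounded on the compact ball and the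
derivative of the section controlled by `exists_fderiv_le`. -/
theorem exists_localRep_bound [CompactSpace M] (hE : E.IsGeometric)
    (hR : Metric.closedBall (chartAt (Euc n) x₀ x₀) R ⊆ locDom θ i x₀)
    (hζ : ContMDiff (𝓡 n) 𝓘(ℝ, ℝ) ∞ ζ) (hsupp : tsupport ζ ⊆ coordBall (n := n) x₀ R) :
    ∃ C : ℝ, 0 ≤ C ∧ ∀ σ, E.IsSmooth σ → ∀ y ∈ Metric.closedBall (chartAt (Euc n) x₀ x₀) R,
      ‖localRep E i x₀ R ζ σ y‖ + ‖fderiv ℝ (localRep E i x₀ R ζ σ) y‖ ≤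
        C * (‖σ (chartInv x₀ y)‖ + ‖E.covDeriv σ (chartInv x₀ y)‖) := by
  have hK := isCompact_closedBall (chartAt (Euc n) x₀ x₀) R
  have hz := contDiffOn_comp_chartInv hζ x₀
  have hT := (chartAt (Euc n) x₀).open_target
  obtain ⟨C1, hC1⟩ := hK.exists_bound_of_continuousOn
    (hz.continuousOn.mono fun y hy => (hR hy).1)
  obtain ⟨C2, hC2⟩ := hK.exists_bound_of_continuousOn
    ((hz.continuousOn_fderiv_of_isOpen hT (by simp)).mono fun y hy => (hR hy).1)
  obtain ⟨C3, hC3, hfd⟩ := hE.exists_fderiv_le hK hR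
  refine ⟨|C1| + |C1| * C3 + |C2|, by positivity, fun σ hσ y hy => ?_⟩
  set a := ‖σ (chartInv x₀ y)‖
  set b := ‖E.covDeriv σ (chartInv x₀ y)‖
  have ha : 0 ≤ a := norm_nonneg _
  have hb : 0 ≤ b := norm_nonneg _
  have hyi := hR hy
  have n1 : ‖localRep E i x₀ R ζ σ y‖ ≤ |C1| * a := by
    rw [norm_localRep hE hR hsupp σ hyi.1, norm_smul]
    exact mul_le_mul_of_nonneg_right ((hC1 y hy).trans (le_abs_self _)) ha
  have n2 : ‖fderiv ℝ (localRep E i x₀ R ζ σ) y‖ ≤ |C1| * (C3 * (a + b)) + |C2| * a := by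
    by_cases hB : y ∈ Metric.ball (chartAt (Euc n) x₀ x₀) R
    · have e : localRep E i x₀ R ζ σ =ᶠ[nhds y]
          fun y => ζ (chartInv x₀ y) • (E.inFrame i σ ∘ chartInv x₀) y := by
        filter_upwards [Metric.isOpen_ball.mem_nhds hB] with z hz'
        exact Set.indicator_of_mem hz' _
      have hd1 := (hz.contDiffAt (hT.mem_nhds hyi.1)).differentiableAt (by simp)
      have hd2 := ((hσ.contDiffOn_local i x₀).contDiffAt
        ((isOpen_locDom θ i x₀).mem_nhds hyi)).differentiableAt (by simp)
      rw [e.fderiv_eq, fderiv_fun_smul hd1 hd2]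
      refine (norm_add_le _ _).trans (add_le_add ?_ ?_)
      · rw [norm_smul]
        exact mul_le_mul ((hC1 y hy).trans (le_abs_self _)) (hfd σ hσ y hy) (norm_nonneg _)
          (abs_nonneg _)
      · rw [ContinuousLinearMap.norm_smulRight_apply]
        refine mul_le_mul ((hC2 y hy).trans (le_abs_self _)) ?_ (norm_nonneg _) (abs_nonneg _)
        exact (hE.norm_inFrame hyi.2 σ).le
    · have e : localRep E i x₀ R ζ σ =ᶠ[nhds y] fun _ => 0 := by
        filter_upwards [(isCompact_chart_tsupport hsupp).isClosed.isOpen_compl.mem_nhds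
          fun h => hB (chart_tsupport_subset hsupp h)] with z hz'
        exact localRep_eq_zero hR σ hz'
      rw [e.fderiv_eq, fderiv_const_apply, norm_zero]
      positivity
  nlinarith [mul_nonneg (abs_nonneg C1) hb, mul_nonneg (abs_nonneg C2) hb]

variable [T2Space M] [CompactSpace M] [MeasurableSpace M] [BorelSpace M]

theorem exists_eLpNorm_localRep_le (hE : E.IsGeometric)
    (hR : Metric.closedBall (chartAt (Euc n) x₀ x₀) R ⊆ locDom θ i x₀)
    (hζ : ContMDiff (𝓡 n) 𝓘(ℝ, ℝ) ∞ ζ) (hsupp : tsupport ζ ⊆ coordBall (n := n) x₀ R)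
    {r : ℝ≥0∞} (hr : 1 ≤ r) : ∃ C : ℝ≥0, ∀ σ, E.IsSmooth σ →
      eLpNorm (localRep E i x₀ R ζ σ) r volume ≤
        C * (eLpNorm σ r (riemannianVolume g) + eLpNorm (E.covDeriv σ) r (riemannianVolume g)) ∧
      eLpNorm (fderiv ℝ (localRep E i x₀ R ζ σ)) r volume ≤
        C * (eLpNorm σ r (riemannianVolume g) + eLpNorm (E.covDeriv σ) r (riemannianVolume g)) := by
  set K := Metric.closedBall (chartAt (Euc n) x₀ x₀) R
  have hK : IsCompact K := isCompact_closedBall _ R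
  obtain ⟨C, hC0, hC⟩ := exists_localRep_bound hE hR hζ hsupp
  obtain ⟨C1, hC1⟩ := exists_eLpNorm_chart_le (g := g) (W := ℝ) θ hK hR r
  refine ⟨Real.toNNReal C * C1, fun σ hσ => ?_⟩
  set f : M → ℝ := fun x => ‖σ x‖ + ‖E.covDeriv σ x‖ with hf
  have hm1 := hE.aestronglyMeasurable hσ (riemannianVolume g)
  have hm2 := hE.aestronglyMeasurable_covDeriv hσ (riemannianVolume g)
  have hfb : eLpNorm (f ∘ chartInv x₀) r (volume.restrict K) ≤
      C1 * (eLpNorm σ r (riemannianVolume g) + eLpNorm (E.covDeriv σ) r (riemannianVolume g)) := by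
    refine (hC1 f (hm1.norm.add hm2.norm)).trans (mul_le_mul_right ?_ _)
    refine (eLpNorm_add_le hm1.norm hm2.norm hr).trans ?_
    rw [eLpNorm_norm, eLpNorm_norm]
  have main : ∀ {W : Type _} [NormedAddCommGroup W] (h : Euc n → W), Function.support h ⊆ K →
      (∀ y ∈ K, ‖h y‖ ≤ C * f (chartInv x₀ y)) → eLpNorm h r volume ≤
        ((Real.toNNReal C * C1 : ℝ≥0) : ℝ≥0∞) * (eLpNorm σ r (riemannianVolume g) +
          eLpNorm (E.covDeriv σ) r (riemannianVolume g)) := by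
    intro W _ h hs hb
    rw [← eLpNorm_restrict_eq_of_support_subset hs, ENNReal.coe_mul, mul_assoc]
    refine le_trans ?_ (mul_le_mul_right hfb _)
    refine eLpNorm_le_nnreal_smul_eLpNorm_of_ae_le_mul ?_ r
    filter_upwards [ae_restrict_mem hK.measurableSet] with y hy
    rw [← NNReal.coe_le_coe, NNReal.coe_mul, Real.coe_toNNReal C hC0, coe_nnnorm, coe_nnnorm,
      Function.comp, Real.norm_of_nonneg (by positivity : 0 ≤ f (chartInv x₀ y))]
    exact hb y hy
  have hsub : Function.support (localRep E i x₀ R ζ σ) ⊆ K :=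
    (support_localRep σ).trans Metric.ball_subset_closedBall
  constructor
  · exact main _ hsub fun y hy => le_trans (le_add_of_nonneg_right (norm_nonneg _)) (hC σ hσ y hy)
  · refine main _ ((support_fderiv_subset ℝ).trans ?_) fun y hy =>
      le_trans (le_add_of_nonneg_left (norm_nonneg _)) (hC σ hσ y hy)
    exact closure_minimal hsub Metric.isClosed_closedBall

/-- A finite atlas of coordinate balls with a subordinate partition of unity. -/
theorem exists_atlas (θ : SpinStructure g) (Q : M → ℝ → Prop)
    (hQ : ∀ x, ∃ R > 0, Metric.closedBall (chartAt (Euc n) x x) R ⊆ locDom θ (θ.idx x) x ∧ Q x R) :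
    ∃ (t : Finset M) (R : M → ℝ) (ζ : M → M → ℝ),
      (∀ a, 0 < R a ∧ Metric.closedBall (chartAt (Euc n) a a) (R a) ⊆ locDom θ (θ.idx a) a ∧
        Q a (R a)) ∧
      (∀ a, ContMDiff (𝓡 n) 𝓘(ℝ, ℝ) ∞ (ζ a)) ∧
      (∀ a ∈ t, tsupport (ζ a) ⊆ coordBall (n := n) a (R a)) ∧ ∀ x, ∑ a ∈ t, ζ a x = 1 := by
  choose R hR0 hR hRQ using hQ
  obtain ⟨t, ζ, h1, h2, h3⟩ := exists_smooth_partition (n := n) (fun x : M => coordBall (n := n) x (R x))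
    (fun x => isOpen_coordBall x _) (fun x => mem_coordBall_self x (hR0 x))
  exact ⟨t, R, ζ, fun a => ⟨hR0 a, hR a, hRQ a⟩, h1, h2, h3⟩

theorem exists_eLpNorm_cutoff_le (hE : E.IsGeometric)
    (hR : Metric.closedBall (chartAt (Euc n) x₀ x₀) R ⊆ locDom θ i x₀)
    (hζ : ContMDiff (𝓡 n) 𝓘(ℝ, ℝ) ∞ ζ) (hsupp : tsupport ζ ⊆ coordBall (n := n) x₀ R)
    (r : ℝ≥0∞) : ∃ C : ℝ≥0, ∀ σ, E.IsSmooth σ →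
      eLpNorm (fun x => ζ x • σ x) r (riemannianVolume g) ≤
        C * eLpNorm (localRep E i x₀ R ζ σ) r volume := by
  set K := Metric.closedBall (chartAt (Euc n) x₀ x₀) R
  have hK : IsCompact K := isCompact_closedBall _ R
  obtain ⟨C, hC⟩ := exists_eLpNorm_le_chart (g := g) (W := V) θ hK hR r
  refine ⟨C, fun σ hσ => ?_⟩
  have hs : Function.support (fun x => ζ x • σ x) ⊆ chartInv x₀ '' K := by
    intro x hx
    have h1 : x ∈ tsupport ζ := by
      by_contra h
      exact hx (by simp [image_eq_zero_of_notMem_tsupport h])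
    refine ⟨chartAt (Euc n) x₀ x, Metric.ball_subset_closedBall (hsupp h1).2,
      (chartAt (Euc n) x₀).left_inv (hsupp h1).1⟩
  rw [← eLpNorm_restrict_eq_of_support_subset hs]
  refine (hC _ (hE.aestronglyMeasurable (hσ.fun_smul hζ) _)).trans (mul_le_mul_right ?_ _)
  refine le_trans (le_of_eq ?_) (eLpNorm_mono_measure _
    (Measure.restrict_le_self (s := K)))
  refine eLpNorm_congr_norm_ae ?_
  filter_upwards [ae_restrict_mem hK.measurableSet] with y hy
  rw [norm_localRep hE hR hsupp σ (hR hy).1]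
  rfl

/-- Morrey's inequality is applied in coordinates to each piece `ζ_a σ` of a finite partition of
unity, and the bounds are added. -/
theorem exists_morrey_global [FiniteDimensional ℝ V] (hE : E.IsGeometric) {p : ℝ≥0∞} (hp1 : 1 ≤ p)
    (hnp : (n : ℝ≥0∞) < p) (hp : p ≠ ⊤) : ∃ C : ℝ≥0, ∀ σ, E.IsSmooth σ →
      eLpNorm σ ⊤ (riemannianVolume g) ≤
        C * (eLpNorm σ p (riemannianVolume g) + eLpNorm (E.covDeriv σ) p (riemannianVolume g)) := by
  have : CompleteSpace V := FiniteDimensional.complete ℝ V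
  obtain ⟨t, R, ζ, hR, hζ, hsupp, hsum⟩ := exists_atlas θ (fun _ _ => True) fun x => by
    obtain ⟨R, h1, h2⟩ := exists_closedBall_subset_locDom θ x
    exact ⟨R, h1, h2, trivial⟩
  obtain ⟨C, hC⟩ := exists_morrey (n := n) (W := V) hp1 hnp hp
  have hloc : ∀ a : t, ∃ C : ℝ≥0, _ := fun a =>
    exists_eLpNorm_localRep_le hE (hR a).2.1 (hζ a) (hsupp a a.2) hp1
  choose C' hC' using hloc
  refine ⟨∑ a, C * (C' a + C' a), fun σ hσ => ?_⟩
  set A := eLpNorm σ p (riemannianVolume g) + eLpNorm (E.covDeriv σ) p (riemannianVolume g)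
  rw [eLpNorm_exponent_top]
  refine eLpNormEssSup_le_of_ae_enorm_bound (Filter.Eventually.of_forall fun x => ?_)
  have h1 : σ x = ∑ a : t, ζ a x • σ x := by
    rw [← Finset.sum_smul, Finset.sum_coe_sort t fun a => ζ a x, hsum, one_smul]
  rw [h1, ENNReal.ofNNReal_finsetSum, Finset.sum_mul]
  refine (enorm_sum_le _ _).trans (Finset.sum_le_sum fun a _ => ?_)
  by_cases hx : x ∈ tsupport (ζ a)
  · have hxs := (hsupp a a.2 hx).1
    have e : ‖ζ a x • σ x‖ₑ =
        ‖localRep E (θ.idx a) a (R a) (ζ a) σ (chartAt (Euc n) (a : M) x)‖ₑ := by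
      rw [← ofReal_norm, ← ofReal_norm,
        norm_localRep hE (hR a).2.1 (hsupp a a.2) σ ((chartAt (Euc n) (a : M)).map_source hxs),
        show chartInv (a : M) (chartAt (Euc n) (a : M) x) = x from
          (chartAt (Euc n) (a : M)).left_inv hxs]
    rw [e]
    refine (hC _ ((contDiff_localRep (hR a).2.1 (hζ a) (hsupp a a.2) hσ).of_le (by simp)) _).trans ?_
    rw [ENNReal.coe_mul, mul_assoc, ENNReal.coe_add, add_mul]
    exact mul_le_mul_right (add_le_add (hC' a σ hσ).1 (hC' a σ hσ).2) _
  · rw [image_eq_zero_of_notMem_tsupport hx, zero_smul, enorm_zero]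
    simp

theorem exists_sobolev_cutoff [FiniteDimensional ℝ V] (hE : E.IsGeometric) (hn : 2 ≤ n) {p q : ℝ≥0}
    (hnp : (n : ℝ≥0) < p) (hpq : (q : ℝ)⁻¹ = 2⁻¹ - (p : ℝ)⁻¹)
    (hR : Metric.closedBall (chartAt (Euc n) x₀ x₀) R ⊆ locDom θ i x₀)
    (hζ : ContMDiff (𝓡 n) 𝓘(ℝ, ℝ) ∞ ζ) (hsupp : tsupport ζ ⊆ coordBall (n := n) x₀ R) :
    ∃ C : ℝ≥0, ∀ σ, E.IsSmooth σ → eLpNorm (fun x => ζ x • σ x) q (riemannianVolume g) ≤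
        C * (eLpNorm σ 2 (riemannianVolume g) + eLpNorm (E.covDeriv σ) 2 (riemannianVolume g)) := by
  obtain ⟨C1, hC1⟩ := exists_eLpNorm_localRep_le hE hR hζ hsupp (r := 2) one_le_two
  obtain ⟨C2, hC2⟩ := exists_eLpNorm_cutoff_le hE hR hζ hsupp (q : ℝ≥0∞)
  obtain ⟨C3, hC3⟩ := exists_sobolev (n := n) (W := V) hn hnp hpq
    (s := Metric.ball (chartAt (Euc n) x₀ x₀) R) Metric.isBounded_ball
  refine ⟨C2 * (C3 * C1), fun σ hσ => ?_⟩
  have h1 := hC3 _ ((contDiff_localRep hR hζ hsupp hσ).of_le (by simp)) (support_localRep σ)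
  calc _ ≤ C2 * eLpNorm (localRep E i x₀ R ζ σ) q volume := hC2 σ hσ
    _ ≤ C2 * (C3 * eLpNorm (fderiv ℝ (localRep E i x₀ R ζ σ)) 2 volume) := mul_le_mul_right h1 _
    _ ≤ C2 * (C3 * (C1 * (eLpNorm σ 2 (riemannianVolume g) +
        eLpNorm (E.covDeriv σ) 2 (riemannianVolume g)))) :=
      mul_le_mul_right (mul_le_mul_right (hC1 σ hσ).2 _) _
    _ = _ := by rw [ENNReal.coe_mul, ENNReal.coe_mul, mul_assoc, mul_assoc]

theorem exists_sobolev_global [FiniteDimensional ℝ V] (hE : E.IsGeometric) (hn : 2 ≤ n) {p q : ℝ≥0}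
    (hq : 1 ≤ q) (hnp : (n : ℝ≥0) < p) (hpq : (q : ℝ)⁻¹ = 2⁻¹ - (p : ℝ)⁻¹) :
    ∃ C : ℝ≥0, ∀ σ, E.IsSmooth σ → eLpNorm σ q (riemannianVolume g) ≤
        C * (eLpNorm σ 2 (riemannianVolume g) + eLpNorm (E.covDeriv σ) 2 (riemannianVolume g)) := by
  obtain ⟨t, R, ζ, hR, hζ, hsupp, hsum⟩ := exists_atlas θ (fun _ _ => True) fun x => by
    obtain ⟨R, h1, h2⟩ := exists_closedBall_subset_locDom θ x
    exact ⟨R, h1, h2, trivial⟩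
  have hloc : ∀ a : t, ∃ C : ℝ≥0, ∀ σ, E.IsSmooth σ →
      eLpNorm (fun x => ζ a x • σ x) q (riemannianVolume g) ≤
        C * (eLpNorm σ 2 (riemannianVolume g) + eLpNorm (E.covDeriv σ) 2 (riemannianVolume g)) :=
    fun a => exists_sobolev_cutoff hE hn hnp hpq (hR a).2.1 (hζ a) (hsupp a a.2)
  choose C hC using hloc
  refine ⟨∑ a, C a, fun σ hσ => ?_⟩
  have h1 : σ = ∑ a : t, fun x => ζ a x • σ x := by
    funext x
    rw [Finset.sum_apply, ← Finset.sum_smul, Finset.sum_coe_sort t fun a => ζ a x, hsum, one_smul]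
  have h2 : eLpNorm σ q (riemannianVolume g) ≤
      ∑ a : t, eLpNorm (fun x => ζ a x • σ x) q (riemannianVolume g) := by
    conv_lhs => rw [h1]
    exact eLpNorm_sum_le (fun a _ => hE.aestronglyMeasurable (hσ.fun_smul (hζ a)) _)
      (by exact_mod_cast hq)
  rw [ENNReal.ofNNReal_finsetSum, Finset.sum_mul]
  exact h2.trans (Finset.sum_le_sum fun a _ => hC a σ hσ)

/-! ### Sobolev embeddings -/

/-- The section that underlies an element of a Sobolev space. -/
def sobFst (E : FramedBundle 𝕜 θ V) (r q : ℝ≥0∞) [Fact (1 ≤ r)] [Fact (1 ≤ q)] :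
    sobolevSpace E r q →L[𝕜] Lp V q (riemannianVolume g) :=
  (WithLp.fstL r 𝕜 (Lp V q (riemannianVolume g))
    (Lp (PiLp 2 (fun _ : Fin n => V)) q (riemannianVolume g))).comp (sobolevSpace E r q).subtypeL

/-- The covariant derivative of an element of a Sobolev space. -/
def sobSnd (E : FramedBundle 𝕜 θ V) (r q : ℝ≥0∞) [Fact (1 ≤ r)] [Fact (1 ≤ q)] :
    sobolevSpace E r q →L[𝕜] Lp (PiLp 2 (fun _ : Fin n => V)) q (riemannianVolume g) :=
  (WithLp.sndL r 𝕜 (Lp V q (riemannianVolume g))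
    (Lp (PiLp 2 (fun _ : Fin n => V)) q (riemannianVolume g))).comp (sobolevSpace E r q).subtypeL

section Embedding

variable (r q : ℝ≥0∞) [Fact (1 ≤ r)] [Fact (1 ≤ q)]

theorem norm_sobFst_le (P : sobolevSpace E r q) : ‖sobFst E r q P‖ ≤ ‖P‖ := WithLp.norm_fst_le _ _

theorem norm_sobSnd_le (P : sobolevSpace E r q) : ‖sobSnd E r q P‖ ≤ ‖P‖ := WithLp.norm_snd_le _ _

theorem sobFst_toSobolev (hE : E.IsGeometric) {σ : M → V} (hσ : E.IsSmooth σ) :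
    sobFst E r q (hE.toSobolev hσ r q) =ᵐ[riemannianVolume g] σ := (hE.memLp hσ q).coeFn_toLp

theorem sobSnd_toSobolev (hE : E.IsGeometric) {σ : M → V} (hσ : E.IsSmooth σ) :
    sobSnd E r q (hE.toSobolev hσ r q) =ᵐ[riemannianVolume g] E.covDeriv σ :=
  (hE.memLp_covDeriv hσ q).coeFn_toLp

/-- The inequality passes from smooth sections to limits: an `L^q` convergent sequence has a
subsequence that converges almost everywhere, and the `L^s` norm is lower semicontinuous by Fatou's
lemma. -/
theorem eLpNorm_sobFst_le (hE : E.IsGeometric) (s : ℝ≥0∞) {C : ℝ≥0}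
    (h : ∀ σ, E.IsSmooth σ → eLpNorm σ s (riemannianVolume g) ≤
      C * (eLpNorm σ q (riemannianVolume g) + eLpNorm (E.covDeriv σ) q (riemannianVolume g)))
    (P : sobolevSpace E r q) :
    eLpNorm (sobFst E r q P) s (riemannianVolume g) ≤
      C * (‖sobFst E r q P‖ₑ + ‖sobSnd E r q P‖ₑ) := by
  refine hE.sobolev_induction (p := fun P => eLpNorm (sobFst E r q P) s (riemannianVolume g) ≤
      C * (‖sobFst E r q P‖ₑ + ‖sobSnd E r q P‖ₑ)) ?_ ?_ P
  · refine IsSeqClosed.isClosed fun Pk P hk hlim => ?_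
    have h1 := ((sobFst E r q).continuous.tendsto P).comp hlim
    obtain ⟨ns, hns, hae⟩ := (tendstoInMeasure_of_tendsto_Lp h1).exists_seq_tendsto_ae
    refine (Lp.eLpNorm_lim_le_liminf_eLpNorm (fun k => Lp.aestronglyMeasurable _) _ hae).trans ?_
    have hc : Continuous fun P => ‖sobFst E r q P‖ₑ + ‖sobSnd E r q P‖ₑ :=
      (sobFst E r q).continuous.enorm.add (sobSnd E r q).continuous.enorm
    have h2 : Filter.Tendsto (fun k => (C : ℝ≥0∞) * (‖sobFst E r q (Pk (ns k))‖ₑ +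
        ‖sobSnd E r q (Pk (ns k))‖ₑ)) Filter.atTop
        (nhds ((C : ℝ≥0∞) * (‖sobFst E r q P‖ₑ + ‖sobSnd E r q P‖ₑ))) :=
      ENNReal.Tendsto.const_mul ((hc.tendsto P).comp
        (hlim.comp hns.tendsto_atTop)) (Or.inr ENNReal.coe_ne_top)
    rw [← h2.liminf_eq]
    exact Filter.liminf_le_liminf (Filter.Eventually.of_forall fun k => hk (ns k))
  · intro σ hσ
    rw [eLpNorm_congr_ae (sobFst_toSobolev r q hE hσ), Lp.enorm_def, Lp.enorm_def,
      eLpNorm_congr_ae (sobFst_toSobolev r q hE hσ), eLpNorm_congr_ae (sobSnd_toSobolev r q hE hσ)]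
    exact h σ hσ

/-- An embedding of a Sobolev space into a Lebesgue space, from an inequality for smooth sections. -/
theorem exists_embedding (hE : E.IsGeometric) (s : ℝ≥0∞) [Fact (1 ≤ s)] {C : ℝ≥0}
    (h : ∀ σ, E.IsSmooth σ → eLpNorm σ s (riemannianVolume g) ≤
      C * (eLpNorm σ q (riemannianVolume g) + eLpNorm (E.covDeriv σ) q (riemannianVolume g))) :
    ∃ J : sobolevSpace E r q →L[𝕜] Lp V s (riemannianVolume g), ∀ P : sobolevSpace E r q,
      J P =ᵐ[riemannianVolume g] sobFst E r q P := by
  have hb := eLpNorm_sobFst_le r q hE s h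
  have hm : ∀ P : sobolevSpace E r q, MemLp (sobFst E r q P) s (riemannianVolume g) :=
    fun P => ⟨Lp.aestronglyMeasurable _, (hb P).trans_lt
      (ENNReal.mul_lt_top ENNReal.coe_lt_top (ENNReal.add_lt_top.2 ⟨enorm_lt_top, enorm_lt_top⟩))⟩
  let J₀ : sobolevSpace E r q →ₗ[𝕜] Lp V s (riemannianVolume g) :=
    { toFun := fun P => (hm P).toLp
      map_add' := fun P P' => by
        apply Lp.ext
        filter_upwards [(hm (P + P')).coeFn_toLp, Lp.coeFn_add (hm P).toLp (hm P').toLp,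
          (hm P).coeFn_toLp, (hm P').coeFn_toLp,
          Lp.coeFn_add (sobFst E r q P) (sobFst E r q P')] with x h1 h2 h3 h4 h5
        rw [h1, h2, map_add, h5, Pi.add_apply, Pi.add_apply, h3, h4]
      map_smul' := fun a P => by
        apply Lp.ext
        filter_upwards [(hm (a • P)).coeFn_toLp, Lp.coeFn_smul a (hm P).toLp,
          (hm P).coeFn_toLp, Lp.coeFn_smul a (sobFst E r q P)] with x h1 h2 h3 h4
        rw [h1, RingHom.id_apply, h2, map_smul, h4, Pi.smul_apply, Pi.smul_apply, h3] }
  refine ⟨J₀.mkContinuous (C * (1 + 1)) fun P => ?_, fun P => (hm P).coeFn_toLp⟩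
  have h1 : ‖J₀ P‖ₑ ≤ C * (‖sobFst E r q P‖ₑ + ‖sobSnd E r q P‖ₑ) := by
    rw [Lp.enorm_def]
    refine (eLpNorm_congr_ae (hm P).coeFn_toLp).trans_le (hb P)
  rw [enorm_eq_nnnorm, enorm_eq_nnnorm, enorm_eq_nnnorm, ← ENNReal.coe_add, ← ENNReal.coe_mul,
    ENNReal.coe_le_coe, ← NNReal.coe_le_coe] at h1
  refine h1.trans ?_
  rw [mul_assoc, NNReal.coe_mul, NNReal.coe_add, coe_nnnorm, coe_nnnorm, add_mul, one_mul]
  exact mul_le_mul_of_nonneg_left (add_le_add (norm_sobFst_le r q P) (norm_sobSnd_le r q P))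
    C.coe_nonneg

end Embedding

end Localise

end

end WeightedDirac

namespace WeightedDirac

noncomputable section

/-! ### Mollifiers on Euclidean space -/

section Mollifier

/-- The Cauchy–Schwarz inequality for `k^{1/2}` and `k^{1/2} f`. -/
theorem lintegral_mul_sq_le {X : Type*} [MeasurableSpace X] (μ : Measure X) {k f : X → ℝ≥0∞}
    (hk : AEMeasurable k μ) (hf : AEMeasurable f μ) :
    (∫⁻ x, k x * f x ∂μ) ^ 2 ≤ (∫⁻ x, k x ∂μ) * ∫⁻ x, k x * f x ^ 2 ∂μ := by
  have h := ENNReal.lintegral_mul_le_Lp_mul_Lq μ (p := 2) (q := 2) Real.HolderConjugate.two_two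
    (hk.pow_const (1 / 2 : ℝ)) ((hk.pow_const (1 / 2 : ℝ)).mul hf)
  have e1 : ∀ a : ℝ≥0∞, (a ^ (1 / 2 : ℝ)) ^ (2 : ℝ) = a := fun a => by
    rw [← ENNReal.rpow_mul]; norm_num
  have e2 : ∀ a : ℝ≥0∞, a ^ (1 / 2 : ℝ) * a ^ (1 / 2 : ℝ) = a := fun a => by
    rw [← ENNReal.rpow_add_of_nonneg _ _ (by norm_num) (by norm_num)]; norm_num
  simp only [Pi.mul_apply, e1, ENNReal.mul_rpow_of_nonneg _ _ (zero_le_two (α := ℝ)), ← mul_assoc,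
    e2] at h
  calc (∫⁻ x, k x * f x ∂μ) ^ 2 ≤ _ := pow_le_pow_left' h 2
    _ = _ := by
      rw [mul_pow, ← ENNReal.rpow_natCast, ← ENNReal.rpow_natCast, ← ENNReal.rpow_mul,
        ← ENNReal.rpow_mul]
      norm_num

theorem eLpNorm_two_sq {X W : Type*} [MeasurableSpace X] {μ : Measure X} [NormedAddCommGroup W]
    (f : X → W) : eLpNorm f 2 μ ^ 2 = ∫⁻ x, ‖f x‖ₑ ^ 2 ∂μ := by
  have := eLpNorm_nnreal_pow_eq_lintegral (f := f) (μ := μ) (p := 2) (by norm_num)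
  simpa using this

variable {n : ℕ} {W : Type*} [NormedAddCommGroup W] [NormedSpace ℝ W]

/-- Young's inequality for `L¹ * L²`. -/
theorem eLpNorm_le_of_kernel {W' : Type*} [NormedAddCommGroup W'] {F : Euc n → W'} {U : Euc n → W}
    {k : Euc n → ℝ≥0∞} (hk : Measurable k) (hU : AEStronglyMeasurable U volume)
    (h : ∀ x, ‖F x‖ₑ ≤ ∫⁻ y, k (x - y) * ‖U y‖ₑ) :
    eLpNorm F 2 volume ≤ (∫⁻ x, k x) * eLpNorm U 2 volume := by
  refine (ENNReal.pow_le_pow_left_iff two_ne_zero).1 ?_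
  rw [mul_pow, eLpNorm_two_sq, eLpNorm_two_sq]
  have hkxy : Measurable fun z : Euc n × Euc n => k (z.1 - z.2) :=
    hk.comp (measurable_fst.sub measurable_snd)
  have htr : ∀ x : Euc n, ∫⁻ y, k (x - y) = ∫⁻ y, k y := fun x =>
    lintegral_sub_left_eq_self (μ := (volume : Measure (Euc n))) k x
  calc ∫⁻ x, ‖F x‖ₑ ^ 2 ≤ ∫⁻ x, (∫⁻ y, k (x - y) * ‖U y‖ₑ) ^ 2 :=
        lintegral_mono fun x => pow_le_pow_left' (h x) 2
    _ ≤ ∫⁻ x, (∫⁻ y, k y) * ∫⁻ y, k (x - y) * ‖U y‖ₑ ^ 2 := by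
        refine lintegral_mono fun x => (lintegral_mul_sq_le volume
          (hk.comp (measurable_const.sub measurable_id)).aemeasurable hU.enorm).trans_eq ?_
        rw [← htr x]; rfl
    _ = (∫⁻ y, k y) * ∫⁻ x, ∫⁻ y, k (x - y) * ‖U y‖ₑ ^ 2 := by
        refine lintegral_const_mul'' _ ?_
        exact (hkxy.aemeasurable.mul (hU.comp_snd.enorm.pow_const 2)).lintegral_prod_right'
    _ = (∫⁻ y, k y) * ∫⁻ y, ∫⁻ x, k (x - y) * ‖U y‖ₑ ^ 2 := by
        rw [lintegral_lintegral_swap]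
        exact hkxy.aemeasurable.mul (hU.comp_snd.enorm.pow_const 2)
    _ = (∫⁻ x, k x) ^ 2 * ∫⁻ x, ‖U x‖ₑ ^ 2 := by
        rw [sq, mul_assoc]
        congr 1
        rw [← lintegral_const_mul'' _ (hU.enorm.pow_const 2)]
        refine lintegral_congr fun y => ?_
        have hm : Measurable fun x => k (x - y) := hk.comp (measurable_id.sub_const y)
        rw [lintegral_mul_const _ hm]
        congr 1
        exact lintegral_sub_right_eq_self (μ := (volume : Measure (Euc n))) k y

/-- The standard mollifier of width `ε`. -/
def molKernel (n : ℕ) (ε : ℝ) (x : Euc n) : ℝ :=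
  (ε ^ n)⁻¹ * (default : ContDiffBump (0 : Euc n)).normed volume (ε⁻¹ • x)

variable {ε : ℝ}

theorem molKernel_nonneg (hε : 0 < ε) (x : Euc n) : 0 ≤ molKernel n ε x :=
  mul_nonneg (by positivity) (ContDiffBump.nonneg_normed _ _)

theorem contDiff_molKernel : ContDiff ℝ ∞ (molKernel n ε) :=
  contDiff_const.mul ((ContDiffBump.contDiff_normed _).comp (contDiff_id.const_smul _))

theorem molKernel_eq_zero (hε : 0 < ε) {x : Euc n} (hx : 2 * ε ≤ ‖x‖) : molKernel n ε x = 0 := by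
  have h : ε⁻¹ • x ∉ Function.support ((default : ContDiffBump (0 : Euc n)).normed volume) := by
    rw [ContDiffBump.support_normed_eq, mem_ball_zero_iff, norm_smul, norm_inv, Real.norm_eq_abs,
      abs_of_pos hε, not_lt]
    change 2 ≤ _
    rw [inv_mul_eq_div, le_div_iff₀ hε]
    exact hx
  rw [molKernel, Function.notMem_support.1 h, mul_zero]

theorem support_molKernel (hε : 0 < ε) :
    Function.support (molKernel n ε) ⊆ Metric.ball 0 (2 * ε) := fun x hx => by
  rw [mem_ball_zero_iff]
  by_contra h
  exact hx (molKernel_eq_zero hε (not_lt.1 h))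

theorem hasCompactSupport_molKernel (hε : 0 < ε) : HasCompactSupport (molKernel n ε) :=
  HasCompactSupport.intro (isCompact_closedBall 0 (2 * ε)) fun x hx =>
    molKernel_eq_zero hε (by simpa using (not_le.1 (fun h => hx (by simpa using h))).le)

theorem integral_scale (hε : 0 < ε) (f : Euc n → ℝ) :
    ∫ x, (ε ^ n)⁻¹ * f (ε⁻¹ • x) = ∫ x, f x := by
  rw [integral_const_mul, Measure.integral_comp_inv_smul_of_nonneg _ _ hε.le]
  simp [hε.ne']

theorem integral_molKernel (hε : 0 < ε) : ∫ x, molKernel n ε x = 1 :=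
  (integral_scale hε _).trans (ContDiffBump.integral_normed _)

theorem fderiv_molKernel (x : Euc n) : fderiv ℝ (molKernel n ε) x =
    (ε ^ n)⁻¹ • ε⁻¹ • fderiv ℝ ((default : ContDiffBump (0 : Euc n)).normed volume) (ε⁻¹ • x) := by
  have h1 : HasFDerivAt (fun x : Euc n => ε⁻¹ • x) (ε⁻¹ • ContinuousLinearMap.id ℝ (Euc n)) x :=
    (hasFDerivAt_id x).const_smul ε⁻¹
  have h2 := (((ContDiffBump.contDiff_normed (n := 1) (μ := volume)
    (default : ContDiffBump (0 : Euc n))).differentiable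
    one_ne_zero (ε⁻¹ • x)).hasFDerivAt.comp x h1).const_mul (ε ^ n)⁻¹
  refine h2.fderiv.trans ?_
  congr 1
  ext v
  simp

/-- The first moment of the derivative of the mollifier, which does not depend on the width. -/
def molMoment (n : ℕ) : ℝ :=
  ∫ x, ‖x‖ * ‖fderiv ℝ ((default : ContDiffBump (0 : Euc n)).normed volume) x‖

theorem lintegral_molKernel (hε : 0 < ε) : ∫⁻ x, ENNReal.ofReal (molKernel n ε x) = 1 := by
  rw [← ofReal_integral_eq_lintegral_ofReal, integral_molKernel hε, ENNReal.ofReal_one]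
  · exact (contDiff_molKernel.continuous).integrable_of_hasCompactSupport
      (hasCompactSupport_molKernel hε)
  · exact Filter.Eventually.of_forall (molKernel_nonneg hε)

/-- The factor `‖x‖` gains the power of `ε` that the derivative loses. This scale invariance makes
the commutator of mollification with Lipschitz coefficients bounded uniformly in `ε`. -/
theorem lintegral_moment (hε : 0 < ε) :
    ∫⁻ x, ENNReal.ofReal (‖x‖ * ‖fderiv ℝ (molKernel n ε) x‖) = ENNReal.ofReal (molMoment n) := by
  rw [← ofReal_integral_eq_lintegral_ofReal, molMoment,
    ← integral_scale hε (fun x => ‖x‖ * ‖fderiv ℝ ((default : ContDiffBump (0 : Euc n)).normed volume) x‖)]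
  · congr 2
    ext x
    rw [fderiv_molKernel, norm_smul, norm_smul, norm_smul, norm_inv, norm_inv, Real.norm_eq_abs,
      Real.norm_eq_abs, abs_of_pos hε, abs_of_pos (pow_pos hε n)]
    ring
  · exact (continuous_norm.mul (contDiff_molKernel.continuous_fderiv
      (by simp)).norm).integrable_of_hasCompactSupport
      (((hasCompactSupport_molKernel hε).fderiv ℝ).norm.mul_left)
  · exact Filter.Eventually.of_forall fun x => by positivity

/-- The mollification of a function. -/
def mollify (ε : ℝ) (U : Euc n → W) : Euc n → W :=
  convolution (molKernel n ε) U (ContinuousLinearMap.lsmul ℝ ℝ) volume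

theorem mollify_apply (U : Euc n → W) (x : Euc n) :
    mollify ε U x = ∫ y, molKernel n ε (x - y) • U y := by
  simp [mollify, convolution_eq_swap]

theorem contDiff_mollify (hε : 0 < ε) {U : Euc n → W} (hU : LocallyIntegrable U volume) :
    ContDiff ℝ ∞ (mollify ε U) :=
  (hasCompactSupport_molKernel hε).contDiff_convolution_left (n := ⊤) _ contDiff_molKernel hU

theorem integrable_kernel {k : Euc n → ℝ} (hk : Continuous k) (hkc : HasCompactSupport k)
    {U : Euc n → W} (hU : LocallyIntegrable U volume) (x : Euc n) :
    Integrable fun y => k (x - y) • U y := by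
  have := (hkc.convolutionExists_left (L := ContinuousLinearMap.lsmul ℝ ℝ) hk hU x).integrable_swap
  simpa using this

theorem fderiv_mollify (hε : 0 < ε) {U : Euc n → W} [CompleteSpace W]
    (hU : LocallyIntegrable U volume) (x v : Euc n) :
    fderiv ℝ (mollify ε U) x v = ∫ y, fderiv ℝ (molKernel n ε) (x - y) v • U y := by
  have hc := hasCompactSupport_molKernel (n := n) hε
  have h := hc.hasFDerivAt_convolution_left (ContinuousLinearMap.lsmul ℝ ℝ)
    (contDiff_molKernel.of_le (by simp)) hU x
  have hi := ((hc.fderiv ℝ).convolutionExists_left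
    (L := (ContinuousLinearMap.lsmul ℝ ℝ).precompL (Euc n))
    (contDiff_molKernel.continuous_fderiv (by simp)) hU x).integrable_swap
  rw [mollify, h.fderiv, convolution_eq_swap, ContinuousLinearMap.integral_apply hi]
  simp [ContinuousLinearMap.precompL_apply]

theorem mollify_eq_zero (hε : 0 < ε) {U : Euc n → W} {x : Euc n}
    (h : ∀ y ∈ Metric.ball x (2 * ε), U y = 0) : mollify ε U x = 0 := by
  rw [mollify_apply]
  refine integral_eq_zero_of_ae (Filter.Eventually.of_forall fun y => ?_)
  by_cases hy : y ∈ Metric.ball x (2 * ε)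
  · simp [h y hy]
  · change molKernel n ε (x - y) • U y = 0
    rw [molKernel_eq_zero hε, zero_smul]
    rw [← dist_eq_norm, dist_comm]
    exact not_lt.1 hy

theorem eLpNorm_mollify_le (hε : 0 < ε) {U : Euc n → W} (hU : AEStronglyMeasurable U volume) :
    eLpNorm (mollify ε U) 2 volume ≤ eLpNorm U 2 volume := by
  have := eLpNorm_le_of_kernel (F := mollify ε U) (U := U)
    (k := fun x => ENNReal.ofReal (molKernel n ε x))
    (contDiff_molKernel.continuous.measurable.ennreal_ofReal) hU fun x => by
      rw [mollify_apply]
      refine (enorm_integral_le_lintegral_enorm _).trans (lintegral_mono fun y => ?_)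
      rw [enorm_smul, Real.enorm_eq_ofReal (molKernel_nonneg hε _)]
  rwa [lintegral_molKernel hε, one_mul] at this

theorem mollify_sub (hε : 0 < ε) {U U' : Euc n → W} (hU : LocallyIntegrable U volume)
    (hU' : LocallyIntegrable U' volume) : mollify ε (U - U') = mollify ε U - mollify ε U' := by
  ext x
  rw [Pi.sub_apply, mollify_apply, mollify_apply, mollify_apply, ← integral_sub]
  · simp [smul_sub]
  · exact integrable_kernel contDiff_molKernel.continuous (hasCompactSupport_molKernel hε) hU x
  · exact integrable_kernel contDiff_molKernel.continuous (hasCompactSupport_molKernel hε) hU' x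

theorem exists_mollify_sub_le_of_continuous [CompleteSpace W] {U : Euc n → W} (hU : Continuous U)
    (hc : HasCompactSupport U) {δ : ℝ≥0∞} (hδ : δ ≠ 0) :
    ∃ ε₀ > 0, ∀ ε, 0 < ε → ε ≤ ε₀ → eLpNorm (mollify ε U - U) 2 volume ≤ δ := by
  obtain ⟨r, hr⟩ := hc.isCompact.isBounded.subset_closedBall (0 : Euc n)
  set B : Set (Euc n) := Metric.closedBall 0 (r + 2)
  have hBfin : volume B ≠ ⊤ := (isCompact_closedBall _ _).measure_lt_top.ne
  obtain ⟨η, hη0, hη⟩ : ∃ η : NNReal, 0 < η ∧ volume B ^ (1 / (2 : ℝ)) * (η : ℝ≥0∞) ≤ δ := by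
    by_cases hδ' : δ = ⊤
    · exact ⟨1, one_pos, by simp [hδ']⟩
    have hfin : volume B ^ (1 / (2 : ℝ)) ≠ ⊤ := ENNReal.rpow_ne_top_of_nonneg (by norm_num) hBfin
    obtain ⟨η, hη0, hη⟩ := ENNReal.exists_nnreal_pos_mul_lt hfin hδ
    exact ⟨η, hη0, by rw [mul_comm]; exact hη.le⟩
  obtain ⟨d, hd0, hd⟩ := Metric.uniformContinuous_iff.1
    (hc.uniformContinuous_of_continuous hU) η hη0
  -- The kernel lives in the ball of radius `2ε`. The bound `d / 2` puts this radius within the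
  -- modulus of continuity, and the bound `1` keeps the supports inside the ball of radius `r + 2`.
  refine ⟨min (d / 2) 1, by positivity, fun ε hε hε1 => ?_⟩
  have hεd : 2 * ε ≤ d := by have := hε1.trans (min_le_left _ _); linarith
  have hε2 : ε ≤ 1 := hε1.trans (min_le_right _ _)
  have hb : ∀ x, ‖(mollify ε U - U) x‖ ≤ η := fun x => by
    rw [Pi.sub_apply, ← dist_eq_norm]
    exact dist_convolution_le η.2 (support_molKernel hε) (molKernel_nonneg hε)
      (integral_molKernel hε) hU.aestronglyMeasurable fun y hy => (hd (lt_of_lt_of_le hy hεd)).le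
  have hs : Function.support (mollify ε U - U) ⊆ B := fun x hx => by
    by_contra hxB
    refine hx ?_
    have hz : ∀ y ∈ Metric.ball x (2 * ε), U y = 0 := fun y hy => by
      by_contra h0
      have h1 := hr (subset_tsupport _ h0)
      rw [mem_closedBall_zero_iff] at h1
      refine hxB (mem_closedBall_zero_iff.2 ?_)
      have h2 := norm_le_norm_add_norm_sub' x y
      rw [← dist_eq_norm, dist_comm] at h2
      have h3 : dist y x < 2 * ε := hy
      linarith
    rw [Pi.sub_apply, mollify_eq_zero hε hz, hz x (Metric.mem_ball_self (by positivity)), sub_zero]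
  rw [← eLpNorm_restrict_eq_of_support_subset hs]
  refine (eLpNorm_le_of_ae_bound (Filter.Eventually.of_forall hb)).trans ?_
  refine le_trans (le_of_eq ?_) hη
  simp

theorem exists_mollify_sub_le [CompleteSpace W] {U : Euc n → W} (hU : MemLp U 2 volume)
    {δ : ℝ≥0∞} (hδ : δ ≠ 0) :
    ∃ ε₀ > 0, ∀ ε, 0 < ε → ε ≤ ε₀ → eLpNorm (mollify ε U - U) 2 volume ≤ δ := by
  have h3 : δ / 3 ≠ 0 := ENNReal.div_ne_zero.2 ⟨hδ, by norm_num⟩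
  obtain ⟨f, hfc, hf1, hf2, hf3⟩ := hU.exists_hasCompactSupport_eLpNorm_sub_le (by simp) h3
  obtain ⟨ε₀, hε₀, h⟩ := exists_mollify_sub_le_of_continuous hf2 hfc h3
  refine ⟨ε₀, hε₀, fun ε hε hε' => ?_⟩
  have hUl := hU.locallyIntegrable (by norm_num)
  have hfl := hf3.locallyIntegrable (by norm_num)
  -- The usual argument with thirds: the outer terms are small by density of continuous functions
  -- and because mollification does not increase the `L²` norm.
  have e : mollify ε U - U = mollify ε (U - f) + (mollify ε f - f) + (f - U) := by
    rw [mollify_sub hε hUl hfl]; abel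
  have m1 := (contDiff_mollify (ε := ε) hε hfl).continuous.aestronglyMeasurable (μ := volume)
  have m2 := (contDiff_mollify (ε := ε) hε (hUl.sub hfl)).continuous.aestronglyMeasurable
    (μ := volume)
  rw [e]
  refine (eLpNorm_add_le (m2.add (m1.sub hf3.1)) (hf3.1.sub hU.1) (by norm_num)).trans ?_
  refine (add_le_add (eLpNorm_add_le m2 (m1.sub hf3.1) (by norm_num)) le_rfl).trans ?_
  rw [eLpNorm_sub_comm f U]
  refine (add_le_add (add_le_add ((eLpNorm_mollify_le hε (hU.1.sub hf3.1)).trans hf1)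
    (h ε hε hε')) hf1).trans_eq ?_
  rw [ENNReal.add_thirds]

end Mollifier

end

end WeightedDirac

namespace WeightedDirac

noncomputable section

/-! ### The Gårding inequality and local regularity on Euclidean space -/

section Garding

variable {𝕜 : Type*} [RCLike 𝕜] {n : ℕ}
  {S : Type*} [NormedAddCommGroup S] [InnerProductSpace 𝕜 S] [NormedSpace ℝ S]
  [IsScalarTower ℝ 𝕜 S] [FiniteDimensional 𝕜 S] (c : CliffordModule 𝕜 n S)

theorem γ'_γ' {k l : Fin n} (hkl : k ≠ l) (s : S) : c.γ' k (c.γ' l s) = -c.γ' l (c.γ' k s) := by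
  have h := congrArg (fun T => T s) (c.clifford (stdVec n k) (stdVec n l))
  have h0 : inner ℝ (stdVec n k) (stdVec n l) = 0 := by
    simp [EuclideanSpace.inner_single_left, hkl]
  simp only [h0, mul_zero, zero_smul, LinearMap.add_apply, Module.End.mul_apply,
    LinearMap.zero_apply] at h
  exact eq_neg_of_add_eq_zero_left h

theorem γ'_sq (k : Fin n) (s : S) : c.γ' k (c.γ' k s) = -s := by
  have h := congrArg (fun T => T s) (c.sq (stdVec n k))
  simp only [Module.End.mul_apply, Module.algebraMap_end_apply] at h
  refine h.trans ?_
  simp [cliffordForm]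

theorem inner_γ'_γ' (k : Fin n) (s t : S) : inner 𝕜 (c.γ' k s) (c.γ' k t) = inner 𝕜 s t := by
  rw [inner_γ', γ'_sq, inner_neg_right, neg_neg]

theorem norm_γ' (k : Fin n) (s : S) : ‖c.γ' k s‖ = ‖s‖ := by
  rw [@norm_eq_sqrt_re_inner 𝕜, inner_γ'_γ', ← @norm_eq_sqrt_re_inner 𝕜]

/-- The Dirac operator with constant coefficients of the frame `v`. -/
def flatDirac (v : Fin n → Euc n) (u : Euc n → S) (x : Euc n) : S :=
  ∑ l, c.γ' l (fderiv ℝ u x (v l))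

variable {u w : Euc n → S}

theorem contDiff_fderiv_apply {W : Type*} [NormedAddCommGroup W] [NormedSpace ℝ W]
    {u : Euc n → W} (hu : ContDiff ℝ ∞ u) (a : Euc n) :
    ContDiff ℝ ∞ fun x => fderiv ℝ u x a :=
  (hu.fderiv_right (m := ∞) (by simp)).clm_apply contDiff_const

/-- Integration by parts twice. -/
theorem integral_inner_fderiv_comm (hu : ContDiff ℝ ∞ u) (hw : ContDiff ℝ ∞ w) (hwc : HasCompactSupport w) (a b : Euc n) :
    ∫ x, inner 𝕜 (fderiv ℝ u x a) (fderiv ℝ w x b) =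
      ∫ x, inner 𝕜 (fderiv ℝ u x b) (fderiv ℝ w x a) := by
  have hsm : ∀ a : Euc n, ContDiff ℝ ∞ fun x => inner 𝕜 (fderiv ℝ u x a) (w x) := fun a =>
    (contDiff_fderiv_apply hu a).inner 𝕜 hw
  have hcs : ∀ a : Euc n, HasCompactSupport fun x => inner 𝕜 (fderiv ℝ u x a) (w x) := fun a =>
    hwc.mono fun x hx h => hx (by simp [h])
  have hint : ∀ a b : Euc n, Integrable fun x => inner 𝕜 (fderiv ℝ u x a) (fderiv ℝ w x b) :=
    fun a b => ((contDiff_fderiv_apply hu a).inner 𝕜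
      (contDiff_fderiv_apply hw b)).continuous.integrable_of_hasCompactSupport
      ((hwc.fderiv_apply (𝕜 := ℝ) b).mono fun x hx h => hx (by simp [h]))
  have hder : ∀ a b x, fderiv ℝ (fun x => inner 𝕜 (fderiv ℝ u x a) (w x)) x b =
      inner 𝕜 (fderiv ℝ u x a) (fderiv ℝ w x b) +
        inner 𝕜 (fderiv ℝ (fderiv ℝ u) x b a) (w x) := fun a b x => by
    rw [fderiv_inner_apply 𝕜 ((contDiff_fderiv_apply hu a).differentiable (by simp) x)
      (hw.differentiable (by simp) x)]
    congr 2
    have h1 := ((hu.fderiv_right (m := ∞) (by simp)).differentiable (by simp) x).hasFDerivAt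
    have h2 := (h1.clm_apply (hasFDerivAt_const a x)).fderiv
    rw [h2]
    simp
  have hi : ∀ a b : Euc n, Integrable
      fun x => fderiv ℝ (fun x => inner 𝕜 (fderiv ℝ u x a) (w x)) x b := fun a b =>
    (contDiff_fderiv_apply (hsm a) b).continuous.integrable_of_hasCompactSupport
      ((hcs a).fderiv_apply (𝕜 := ℝ) b)
  have hsymm : ∀ x, fderiv ℝ (fderiv ℝ u) x a b = fderiv ℝ (fderiv ℝ u) x b a := fun x =>
    (hu.contDiffAt.isSymmSndFDerivAt
      (by rw [minSmoothness_of_isRCLikeNormedField]; exact WithTop.coe_le_coe.2 le_top)).eq a b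
  have e1 := integral_fderiv_eq_zero (hsm a) (hcs a) b
  have e2 := integral_fderiv_eq_zero (hsm b) (hcs b) a
  -- The second derivatives of `u` that arise in the two total derivatives cancel by their symmetry;
  -- only `w` needs compact support.
  have e3 := integral_sub (hi a b) (hi b a)
  rw [e1, e2, sub_zero] at e3
  rw [← sub_eq_zero, ← integral_sub (hint a b) (hint b a), ← e3]
  refine integral_congr_ae (Filter.Eventually.of_forall fun x => ?_)
  simp only [hder, hsymm]
  abel

theorem γ'_real_smul (k : Fin n) (r : ℝ) (s : S) : c.γ' k (r • s) = r • c.γ' k s :=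
  clm_map_real_smul (c.γ' k) r s

theorem inner_real_smul_left (r : ℝ) (s t : S) : inner 𝕜 (r • s) t = r • inner 𝕜 s t := by
  rw [← inner_conj_symm, inner_real_smul_right, RCLike.real_smul_eq_coe_mul, map_mul,
    RCLike.conj_ofReal, inner_conj_symm, RCLike.real_smul_eq_coe_mul]

theorem fderiv_γ' {x : Euc n} (hu : DifferentiableAt ℝ u x) (k : Fin n) (a : Euc n) :
    fderiv ℝ (fun y => c.γ' k (u y)) x a = c.γ' k (fderiv ℝ u x a) := by
  have := (((c.γ' k).restrictScalars ℝ).hasFDerivAt.comp x hu.hasFDerivAt).fderiv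
  exact congrArg (fun T => T a) this

theorem contDiff_γ' (hu : ContDiff ℝ ∞ u) (k : Fin n) : ContDiff ℝ ∞ fun y => c.γ' k (u y) :=
  ((c.γ' k).restrictScalars ℝ).contDiff.comp hu

theorem hasCompactSupport_γ' (huc : HasCompactSupport u) (k : Fin n) :
    HasCompactSupport fun y => c.γ' k (u y) :=
  huc.mono fun x hx h => hx (by simp [h])

/-- Integration by parts exchanges the two directions of differentiation, and anticommutation of the
two Clifford matrices then produces the sign. -/
theorem integral_γ'_anticomm (hu : ContDiff ℝ ∞ u) (huc : HasCompactSupport u) {l m : Fin n}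
    (hlm : l ≠ m) (a b : Euc n) :
    ∫ x, inner 𝕜 (c.γ' l (fderiv ℝ u x a)) (c.γ' m (fderiv ℝ u x b)) =
      -∫ x, inner 𝕜 (c.γ' m (fderiv ℝ u x b)) (c.γ' l (fderiv ℝ u x a)) := by
  have hd := fun x => hu.differentiable (by simp) x
  have h := integral_inner_fderiv_comm (𝕜 := 𝕜) (contDiff_γ' c hu l)
    (contDiff_γ' c hu m) (hasCompactSupport_γ' c huc m) a b
  simp only [fderiv_γ' c (hd _)] at h
  rw [h, ← integral_neg]
  refine integral_congr_ae (Filter.Eventually.of_forall fun x => ?_)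
  simp only
  rw [inner_γ', γ'_γ' c hlm, inner_neg_right, neg_neg, ← inner_neg_neg, inner_γ']
  simp

/-- The Gårding identity for constant coefficients. -/
theorem sum_integral_norm_sq (hu : ContDiff ℝ ∞ u) (huc : HasCompactSupport u) (v : Fin n → Euc n) :
    ∑ l, ∫ x, ‖fderiv ℝ u x (v l)‖ ^ 2 = ∫ x, ‖flatDirac c v u x‖ ^ 2 := by
  set T : Fin n → Fin n → 𝕜 := fun l m =>
    ∫ x, inner 𝕜 (c.γ' l (fderiv ℝ u x (v l))) (c.γ' m (fderiv ℝ u x (v m))) with hT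
  have hg : ∀ l, ContDiff ℝ ∞ fun x => c.γ' l (fderiv ℝ u x (v l)) := fun l =>
    contDiff_γ' c (contDiff_fderiv_apply hu (v l)) l
  have hint : ∀ l m, Integrable
      fun x => inner 𝕜 (c.γ' l (fderiv ℝ u x (v l))) (c.γ' m (fderiv ℝ u x (v m))) := fun l m =>
    ((hg l).inner 𝕜 (hg m)).continuous.integrable_of_hasCompactSupport
      ((huc.fderiv_apply (𝕜 := ℝ) (v m)).mono fun x hx h => hx (by simp [h]))
  have hself : ∀ f : Euc n → S, ∫ x, inner 𝕜 (f x) (f x) = ((∫ x, ‖f x‖ ^ 2 : ℝ) : 𝕜) := fun f => by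
    rw [← integral_ofReal]
    simp only [inner_self_eq_norm_sq_to_K, RCLike.ofReal_pow]
  have h1 : ∑ l, ∑ m, T l m = ((∫ x, ‖flatDirac c v u x‖ ^ 2 : ℝ) : 𝕜) := by
    rw [← hself]
    simp only [flatDirac, sum_inner, inner_sum]
    rw [integral_finsetSum _ fun l _ => integrable_finsetSum _ fun m _ => hint m l, Finset.sum_comm]
    refine Finset.sum_congr rfl fun l _ => ?_
    rw [integral_finsetSum _ fun m _ => hint m l]
  -- The mixed terms of the square of the Dirac operator cancel after symmetrisation, so only the
  -- squares of the single derivatives remain.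
  have h2 : ∀ l m, T l m + T m l = if l = m then 2 * T l l else 0 := fun l m => by
    split_ifs with h
    · subst h; ring
    · rw [hT]
      simp only
      rw [integral_γ'_anticomm c hu huc h]
      simp
  have h3 : ∑ l, ∑ m, T l m = ∑ l, T l l := by
    have h4 : ∑ l, ∑ m, (T l m + T m l) = 2 * ∑ l, T l l := by
      simp only [h2, Finset.sum_ite_eq, Finset.mem_univ, if_true, Finset.mul_sum]
    simp only [Finset.sum_add_distrib] at h4
    rw [Finset.sum_comm (f := fun l m => T m l), ← two_mul] at h4
    exact mul_left_cancel₀ two_ne_zero h4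
  have h5 : ∀ l, T l l = ((∫ x, ‖fderiv ℝ u x (v l)‖ ^ 2 : ℝ) : 𝕜) := fun l => by
    rw [← hself]
    simp only [hT, inner_γ'_γ']
  rw [h1] at h3
  simp only [h5] at h3
  rw [← RCLike.ofReal_sum, RCLike.ofReal_inj] at h3
  exact h3.symm

theorem eLpNorm_fderiv_apply_le (hu : ContDiff ℝ ∞ u) (huc : HasCompactSupport u)
    (v : Fin n → Euc n) (l : Fin n) :
    eLpNorm (fun x => fderiv ℝ u x (v l)) 2 volume ≤ eLpNorm (flatDirac c v u) 2 volume := by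
  have hcv : ∀ {f : Euc n → S}, Continuous f → HasCompactSupport f →
      eLpNorm f 2 volume ^ 2 = ENNReal.ofReal (∫ x, ‖f x‖ ^ 2) := fun {f} hf hc => by
    rw [eLpNorm_two_sq, ofReal_integral_eq_lintegral_ofReal]
    · refine lintegral_congr fun x => ?_
      rw [ENNReal.ofReal_pow (norm_nonneg _), ofReal_norm]
    · exact (hf.norm.pow 2).integrable_of_hasCompactSupport
        (hc.mono fun x hx h => hx (by simp [h]))
    · exact Filter.Eventually.of_forall fun x => by positivity
  refine (ENNReal.pow_le_pow_left_iff two_ne_zero).1 ?_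
  have hc1 : HasCompactSupport (flatDirac c v u) := (huc.fderiv ℝ).mono fun x hx h => hx (by
    have h' : fderiv ℝ u x = 0 := h
    simp [flatDirac, h'])
  rw [hcv (contDiff_fderiv_apply hu _).continuous (huc.fderiv_apply (𝕜 := ℝ) _), hcv _ hc1,
    ← sum_integral_norm_sq c hu huc v]
  · refine ENNReal.ofReal_le_ofReal (Finset.single_le_sum
      (f := fun l => ∫ x, ‖fderiv ℝ u x (v l)‖ ^ 2) (fun l _ => ?_) (Finset.mem_univ l))
    exact integral_nonneg fun x => by positivity
  · exact continuous_finsetSum _ fun l _ =>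
      (contDiff_γ' c (contDiff_fderiv_apply hu (v l)) l).continuous

/-! ### The elliptic estimate for mollified weak solutions. -/

section Estimate

variable {v : Fin n → Euc n} {b : Fin n → Euc n → Euc n} {U h : Euc n → S} {ε : ℝ}

/-- A weak solution, tested with a mollifier. -/
theorem sum_γ'_integral_eq_mollify [CompleteSpace S] (hU : LocallyIntegrable U volume)
    (hh : LocallyIntegrable h volume) (hb : ∀ l, Continuous (b l))
    (hweak : ∀ φ : Euc n → S, ContDiff ℝ ∞ φ → HasCompactSupport φ →
      ∫ y, inner 𝕜 (U y) (∑ l, c.γ' l (fderiv ℝ φ y (v l + b l y))) = ∫ y, inner 𝕜 (h y) (φ y))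
    (hε : 0 < ε) (x : Euc n) :
    ∑ l, c.γ' l (∫ y, fderiv ℝ (molKernel n ε) (x - y) (v l + b l y) • U y) = mollify ε h x := by
  have hD : Continuous fun y => fderiv ℝ (molKernel n ε) (x - y) :=
    (contDiff_molKernel.continuous_fderiv (by simp)).comp (continuous_const.sub continuous_id)
  have hi : ∀ l, Integrable fun y => fderiv ℝ (molKernel n ε) (x - y) (v l + b l y) • U y := by
    intro l
    refine hU.integrable_smul_left_of_hasCompactSupport ?_ ?_
    · exact hD.clm_apply (continuous_const.add (hb l))
    · have h1 : HasCompactSupport fun y => fderiv ℝ (molKernel n ε) (x - y) :=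
        ((hasCompactSupport_molKernel hε).fderiv ℝ).comp_homeomorph (Homeomorph.subLeft x)
      exact h1.mono fun y hy h => hy (by
        have h' : fderiv ℝ (molKernel n ε) (x - y) = 0 := h
        simp [h'])
  have hi' : Integrable fun y => molKernel n ε (x - y) • h y :=
    integrable_kernel contDiff_molKernel.continuous (hasCompactSupport_molKernel hε) hh x
  rw [mollify_apply]
  refine ext_inner_right 𝕜 fun s => ?_
  -- The test function is the translated and reflected kernel times a constant spinor, so the weak
  -- equation becomes an equation for mollifications at `x`.
  have hφ := hweak (fun y => molKernel n ε (x - y) • s)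
    ((contDiff_molKernel.comp (contDiff_const.sub contDiff_id)).smul contDiff_const)
    ((((hasCompactSupport_molKernel (n := n) hε).comp_homeomorph
      (Homeomorph.subLeft x))).mono fun y hy h => hy (by
        have h' : molKernel n ε (x - y) = 0 := h
        simp [h']))
  have hder : ∀ y w, fderiv ℝ (fun y => molKernel n ε (x - y) • s) y w =
      -(fderiv ℝ (molKernel n ε) (x - y) w • s) := fun y w => by
    have h1 : HasFDerivAt (fun y : Euc n => x - y) (-ContinuousLinearMap.id ℝ (Euc n)) y := by
      simpa using (hasFDerivAt_id y).const_sub x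
    have h2 := ((contDiff_molKernel (n := n) (ε := ε)).differentiable (by simp)
      (x - y)).hasFDerivAt.comp y h1
    refine (congrArg (fun T => T w) (h2.smul_const s).fderiv).trans ?_
    simp
  simp only [hder, map_neg, γ'_real_smul, Finset.sum_neg_distrib, inner_neg_right, inner_sum,
    inner_real_smul_right] at hφ
  have hL : ∀ (f : Euc n → S) (s : S), Integrable f →
      inner 𝕜 (∫ y, f y) s = ∫ y, inner 𝕜 (f y) s := fun f s hf => by
    rw [← inner_conj_symm, ← integral_inner hf, ← integral_conj]
    simp only [inner_conj_symm]
  rw [hL _ _ hi', sum_inner]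
  simp only [inner_real_smul_left]
  rw [← hφ, integral_neg, integral_finsetSum, ← Finset.sum_neg_distrib]
  · refine Finset.sum_congr rfl fun l _ => ?_
    rw [inner_γ', hL _ _ (hi l)]
    simp only [inner_real_smul_left]
  · intro l _
    have := (hi l).inner_const (𝕜 := 𝕜) (c.γ' l s)
    simpa only [inner_real_smul_left] using this

/-- Friedrichs' commutator: the coefficients are moved from `y` under the integral to `x` outside of
it. The error contains `b l x - b l y`, which compensates the singularity of the differentiated
kernel when `b` is Lipschitz. -/
theorem flatDirac_mollify [CompleteSpace S] (hU : LocallyIntegrable U volume)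
    (hh : LocallyIntegrable h volume) (hb : ∀ l, Continuous (b l))
    (hweak : ∀ φ : Euc n → S, ContDiff ℝ ∞ φ → HasCompactSupport φ →
      ∫ y, inner 𝕜 (U y) (∑ l, c.γ' l (fderiv ℝ φ y (v l + b l y))) = ∫ y, inner 𝕜 (h y) (φ y))
    (hε : 0 < ε) (x : Euc n) :
    flatDirac c v (mollify ε U) x - mollify ε h x +
      ∑ l, c.γ' l (fderiv ℝ (mollify ε U) x (b l x)) =
      ∑ l, c.γ' l (∫ y, fderiv ℝ (molKernel n ε) (x - y) (b l x - b l y) • U y) := by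
  have hi : ∀ w : Euc n → Euc n, Continuous w →
      Integrable fun y => fderiv ℝ (molKernel n ε) (x - y) (w y) • U y := fun w hw => by
    refine hU.integrable_smul_left_of_hasCompactSupport ?_ ?_
    · exact ((contDiff_molKernel.continuous_fderiv (by simp)).comp
        (continuous_const.sub continuous_id)).clm_apply hw
    · have h1 : HasCompactSupport fun y => fderiv ℝ (molKernel n ε) (x - y) :=
        ((hasCompactSupport_molKernel hε).fderiv ℝ).comp_homeomorph (Homeomorph.subLeft x)
      exact h1.mono fun y hy h => hy (by
        have h' : fderiv ℝ (molKernel n ε) (x - y) = 0 := h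
        simp [h'])
  rw [← sum_γ'_integral_eq_mollify c hU hh hb hweak hε x, flatDirac, ← Finset.sum_sub_distrib,
    ← Finset.sum_add_distrib]
  refine Finset.sum_congr rfl fun l _ => ?_
  have i1 := hi (fun _ => v l) continuous_const
  have i2 := hi (fun y => v l + b l y) (continuous_const.add (hb l))
  have i3 := hi (fun _ => b l x) continuous_const
  rw [← map_sub, ← map_add, fderiv_mollify hε hU, fderiv_mollify hε hU, ← integral_sub' i1 i2,
    ← integral_add' (i1.sub i2) i3]
  congr 2
  ext y
  rw [Pi.add_apply, Pi.sub_apply, ← sub_smul, ← add_smul, ← map_sub, ← map_add]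
  congr 2
  abel

/-- Absorption into the left-hand side requires `N` to be finite. This is why the estimate is made
for the mollified function and not for the weak solution itself. -/
theorem ennreal_absorb {N a q : ℝ≥0∞} (hN : N ≠ ⊤) (hq : q ≤ 2⁻¹) (h : N ≤ a + q * N) :
    N ≤ 2 * a := by
  by_cases ha : a = ⊤
  · simp [ha]
  have h1 : N ≤ a + 2⁻¹ * N := h.trans (add_le_add le_rfl (mul_le_mul_left hq _))
  lift N to NNReal using hN
  lift a to NNReal using ha
  have h2 : (2⁻¹ : ℝ≥0∞) = ((2⁻¹ : NNReal) : ℝ≥0∞) := by simp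
  rw [h2] at h1
  norm_cast at h1 ⊢
  rw [← NNReal.coe_le_coe] at h1 ⊢
  push_cast at h1 ⊢
  linarith

/-- Uniform bounds for the mollifications of a weak solution. -/
theorem eLpNorm_fderiv_mollify_le [CompleteSpace S] {κ δ K : NNReal} (hU : MemLp U 2 volume)
    (hUc : HasCompactSupport U) (hh : MemLp h 2 volume) (hb : ∀ l, LipschitzWith K (b l))
    (hbδ : ∀ l y, ‖b l y‖ ≤ δ)
    (hκ : ∀ T : Euc n →L[ℝ] S, ‖T‖ ≤ κ * ∑ l, ‖T (v l)‖) (hδ : κ * n * (n * δ) ≤ 2⁻¹)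
    (hweak : ∀ φ : Euc n → S, ContDiff ℝ ∞ φ → HasCompactSupport φ →
      ∫ y, inner 𝕜 (U y) (∑ l, c.γ' l (fderiv ℝ φ y (v l + b l y))) = ∫ y, inner 𝕜 (h y) (φ y))
    (hε : 0 < ε) :
    eLpNorm (fderiv ℝ (mollify ε U)) 2 volume ≤ 2 * ((κ * n : NNReal) * (eLpNorm h 2 volume +
      (n * K : NNReal) * ENNReal.ofReal (molMoment n) * eLpNorm U 2 volume)) := by
  have hUl := hU.locallyIntegrable (by norm_num)
  have hhl := hh.locallyIntegrable (by norm_num)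
  have hs := contDiff_mollify hε hUl
  have hsc : HasCompactSupport (mollify ε U) :=
    HasCompactSupport.convolution _ (hasCompactSupport_molKernel hε) hUc
  have hfc : Continuous (fderiv ℝ (mollify ε U)) := hs.continuous_fderiv (by simp)
  set N := eLpNorm (fderiv ℝ (mollify ε U)) 2 volume with hN
  have hNtop : N ≠ ⊤ := (hfc.memLp_of_hasCompactSupport (hsc.fderiv ℝ)).eLpNorm_ne_top
  set A : Euc n → S := fun x => ∑ l, c.γ' l (fderiv ℝ (mollify ε U) x (b l x)) with hA
  set R : Euc n → S := fun x =>
    ∑ l, c.γ' l (∫ y, fderiv ℝ (molKernel n ε) (x - y) (b l x - b l y) • U y) with hR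
  have hAc : Continuous A := continuous_finsetSum _ fun l _ =>
    (c.γ' l).continuous.comp (hfc.clm_apply (hb l).continuous)
  have hmc : Continuous (mollify ε h) := (contDiff_mollify hε hhl).continuous
  have hFc : Continuous (flatDirac c v (mollify ε U)) := continuous_finsetSum _ fun l _ =>
    (contDiff_γ' c (contDiff_fderiv_apply hs (v l)) l).continuous
  have hRe : R = flatDirac c v (mollify ε U) - mollify ε h + A := funext fun x =>
    (flatDirac_mollify c hUl hhl (fun l => (hb l).continuous) hweak hε x).symm
  have hRc : Continuous R := hRe ▸ (hFc.sub hmc).add hAc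
  have hFe : flatDirac c v (mollify ε U) = mollify ε h - A + R := by rw [hRe]; abel
  -- The variation of the frame is at most `δ`, so this part of the operator is small compared with
  -- the full gradient.
  have bA : eLpNorm A 2 volume ≤ (n * δ : NNReal) * N := by
    refine eLpNorm_le_nnreal_smul_eLpNorm_of_ae_le_mul (Filter.Eventually.of_forall fun x => ?_) 2
    rw [← NNReal.coe_le_coe]
    push_cast
    refine (norm_sum_le _ _).trans ((Finset.sum_le_card_nsmul _ _ (δ * ‖fderiv ℝ (mollify ε U) x‖)
      fun l _ => ?_).trans_eq ?_)
    · rw [norm_γ', mul_comm]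
      exact (ContinuousLinearMap.le_opNorm _ _).trans
        (mul_le_mul_of_nonneg_left (hbδ l x) (norm_nonneg _))
    · simp [mul_assoc]
  -- The commutator is bounded by convolution with `‖t‖ ‖∇ρ_ε(t)‖` times the Lipschitz constant,
  -- hence in `L²` by Young's inequality and the scale-invariant moment.
  have bR : eLpNorm R 2 volume ≤
      (n * K : NNReal) * ENNReal.ofReal (molMoment n) * eLpNorm U 2 volume := by
    have hmk : Measurable fun t : Euc n => ENNReal.ofReal (‖t‖ * ‖fderiv ℝ (molKernel n ε) t‖) :=
      (continuous_norm.mul (contDiff_molKernel.continuous_fderiv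
        (by simp)).norm).measurable.ennreal_ofReal
    have := eLpNorm_le_of_kernel (F := R) (U := U) (k := fun t => (n * K : NNReal) *
      ENNReal.ofReal (‖t‖ * ‖fderiv ℝ (molKernel n ε) t‖)) (hmk.const_mul _) hU.1 fun x => by
        have hl : ∀ l, ‖c.γ' l (∫ y, fderiv ℝ (molKernel n ε) (x - y) (b l x - b l y) • U y)‖ₑ ≤
            ∫⁻ y, K * ENNReal.ofReal (‖x - y‖ * ‖fderiv ℝ (molKernel n ε) (x - y)‖) * ‖U y‖ₑ := by
          intro l
          rw [← ofReal_norm, norm_γ', ofReal_norm]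
          refine (enorm_integral_le_lintegral_enorm _).trans (lintegral_mono fun y => ?_)
          rw [enorm_smul]
          refine mul_le_mul_left ?_ _
          rw [← ofReal_norm, ← ENNReal.ofReal_coe_nnreal, ← ENNReal.ofReal_mul K.coe_nonneg]
          refine ENNReal.ofReal_le_ofReal ?_
          refine (ContinuousLinearMap.le_opNorm _ _).trans ?_
          have h2 := (hb l).dist_le_mul x y
          rw [dist_eq_norm, dist_eq_norm] at h2
          calc _ ≤ ‖fderiv ℝ (molKernel n ε) (x - y)‖ * (K * ‖x - y‖) :=
                mul_le_mul_of_nonneg_left h2 (norm_nonneg _)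
            _ = _ := by ring
        refine (enorm_sum_le _ _).trans ((Finset.sum_le_card_nsmul _ _ _
          fun l _ => hl l).trans_eq ?_)
        rw [Finset.card_univ, Fintype.card_fin, nsmul_eq_mul,
          ← lintegral_const_mul' _ _ (ENNReal.natCast_ne_top n)]
        refine lintegral_congr fun y => ?_
        push_cast
        ring
    rwa [lintegral_const_mul _ hmk, lintegral_moment hε] at this
  have bF : eLpNorm (flatDirac c v (mollify ε U)) 2 volume ≤ eLpNorm h 2 volume +
      (n * δ : NNReal) * N +
        (n * K : NNReal) * ENNReal.ofReal (molMoment n) * eLpNorm U 2 volume := by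
    rw [hFe]
    refine (eLpNorm_add_le (hmc.sub hAc).aestronglyMeasurable hRc.aestronglyMeasurable
      (by norm_num)).trans (add_le_add ?_ bR)
    exact (eLpNorm_sub_le hmc.aestronglyMeasurable hAc.aestronglyMeasurable
      (by norm_num)).trans (add_le_add (eLpNorm_mollify_le hε hh.1) bA)
  -- The gradient is controlled by its values on the frame `v`, and each of these by the Dirac
  -- operator with constant coefficients.
  have bN : N ≤ (κ * n : NNReal) * eLpNorm (flatDirac c v (mollify ε U)) 2 volume := by
    have h1 : N ≤ κ * eLpNorm (fun x => ∑ l, ‖fderiv ℝ (mollify ε U) x (v l)‖) 2 volume := by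
      refine eLpNorm_le_nnreal_smul_eLpNorm_of_ae_le_mul (Filter.Eventually.of_forall fun x => ?_) 2
      rw [← NNReal.coe_le_coe]
      push_cast
      refine (hκ _).trans (mul_le_mul_of_nonneg_left (le_abs_self _) κ.2)
    refine h1.trans ?_
    rw [ENNReal.coe_mul, mul_assoc]
    refine mul_le_mul_right ?_ _
    have h2 : (fun x => ∑ l, ‖fderiv ℝ (mollify ε U) x (v l)‖) =
        ∑ l, fun x => ‖fderiv ℝ (mollify ε U) x (v l)‖ := by ext x; simp
    rw [h2]
    refine (eLpNorm_sum_le (fun l _ =>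
      (hfc.clm_apply continuous_const).norm.aestronglyMeasurable) (by norm_num)).trans ?_
    refine (Finset.sum_le_card_nsmul _ _ _ fun l _ =>
      (eLpNorm_norm _).trans_le (eLpNorm_fderiv_apply_le c hs hsc v l)).trans_eq ?_
    simp
  -- Smallness of `δ` makes the coefficient of `N` at most one half, which accounts for the factor
  -- `2` in the bound.
  refine ennreal_absorb (q := ((κ * n * (n * δ) : NNReal) : ℝ≥0∞)) hNtop ?_ ?_
  · have h2 : (2⁻¹ : ℝ≥0∞) = ((2⁻¹ : NNReal) : ℝ≥0∞) := by simp
    rw [h2]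
    exact_mod_cast hδ
  · refine bN.trans ((mul_le_mul_right bF _).trans_eq ?_)
    push_cast
    ring

end Estimate

end Garding

end

end WeightedDirac

namespace WeightedDirac

noncomputable section

/-! ### Symmetry of the Dirac operator on `H¹`, and smoothing of `L²` sections -/

section Smoothing

variable {𝕜 : Type*} [RCLike 𝕜] {n : ℕ} {M : Type*} [TopologicalSpace M] [T2Space M]
  [CompactSpace M] [ChartedSpace (EuclideanSpace ℝ (Fin n)) M] [IsManifold (𝓡 n) ∞ M]
  [MeasurableSpace M] [BorelSpace M] {g : RMetric n M} {θ : SpinStructure g}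
  {S : Type*} [NormedAddCommGroup S] [InnerProductSpace 𝕜 S] [NormedSpace ℝ S]
  [IsScalarTower ℝ 𝕜 S] [FiniteDimensional 𝕜 S] [CompleteSpace S] (c : CliffordModule 𝕜 n S)

/-- A smooth spinor as an element of `H¹`. -/
def toH1 {σ : M → S} (hσ : (spinorFramed θ c).IsSmooth σ) : H1 θ c :=
  (spinorFramed_isGeometric c).toSobolev hσ 2 2

theorem incl_toH1 {σ : M → S} (hσ : (spinorFramed θ c).IsSmooth σ) :
    H1.incl θ c (toH1 c hσ) =ᵐ[riemannianVolume g] σ :=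
  sobFst_toSobolev 2 2 (spinorFramed_isGeometric c) hσ

theorem dirac_apply (η : H1 θ c) : dirac θ c η =ᵐ[riemannianVolume g]
    fun x => c.contract (sobSnd (spinorFramed θ c) 2 2 η x) :=
  ContinuousLinearMap.coeFn_compLpL _ _

theorem dirac_toH1 {σ : M → S} (hσ : (spinorFramed θ c).IsSmooth σ) :
    dirac θ c (toH1 c hσ) =ᵐ[riemannianVolume g]
      fun x => c.contract ((spinorFramed θ c).covDeriv σ x) := by
  filter_upwards [dirac_apply c (toH1 c hσ),
    sobSnd_toSobolev 2 2 (spinorFramed_isGeometric c) hσ] with x h1 h2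
  rw [h1]
  exact congrArg c.contract h2

theorem inner_L2_congr {f f' : L2 θ c} {σ τ : M → S} (h : f =ᵐ[riemannianVolume g] σ)
    (h' : f' =ᵐ[riemannianVolume g] τ) :
    inner 𝕜 f f' = ∫ x, inner 𝕜 (σ x) (τ x) ∂(riemannianVolume g) := by
  rw [L2.inner_def]
  refine integral_congr_ae ?_
  filter_upwards [h, h'] with x h1 h2
  rw [h1, h2]

/-- The Dirac operator is symmetric on `H¹`. -/
theorem inner_dirac (η η' : H1 θ c) :
    inner 𝕜 (H1.incl θ c η) (dirac θ c η') = inner 𝕜 (dirac θ c η) (H1.incl θ c η') := by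
  have hE := spinorFramed_isGeometric (θ := θ) c
  refine hE.sobolev_induction (p := fun η => inner 𝕜 (H1.incl θ c η) (dirac θ c η') =
    inner 𝕜 (dirac θ c η) (H1.incl θ c η')) ?_ (fun σ hσ => ?_) η
  · exact isClosed_eq ((H1.incl θ c).continuous.inner continuous_const)
      ((dirac θ c).continuous.inner continuous_const)
  refine hE.sobolev_induction (p := fun η' =>
    inner 𝕜 (H1.incl θ c (hE.toSobolev hσ 2 2)) (dirac θ c η') =
    inner 𝕜 (dirac θ c (hE.toSobolev hσ 2 2)) (H1.incl θ c η')) ?_ (fun τ hτ => ?_) η'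
  · exact isClosed_eq (continuous_const.inner (dirac θ c).continuous)
      (continuous_const.inner (H1.incl θ c).continuous)
  · exact (inner_L2_congr c (incl_toH1 c hσ) (dirac_toH1 c hτ)).trans
      ((integral_inner_dirac c hσ hτ).trans
        (inner_L2_congr c (dirac_toH1 c hσ) (incl_toH1 c hτ)).symm)

theorem norm_inFrame_spinor (i : Fin θ.N) (σ : M → S) (x : M) :
    ‖(spinorFramed θ c).inFrame i σ x‖ = ‖σ x‖ := norm_cocyc θ c i (θ.idx x) x _

/-- The change to the frame `i` is continuous on each piece where the index of the reference frame
is constant, and finitely many pieces cover. -/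
theorem aestronglyMeasurable_inFrame (i : Fin θ.N) {σ : M → S}
    (hσ : AEStronglyMeasurable σ (riemannianVolume g)) :
    AEStronglyMeasurable ((spinorFramed θ c).inFrame i σ)
      ((riemannianVolume g).restrict (θ.U i)) := by
  have := secondCountable_of_compact_charted n M
  have hfin : FiniteDimensional ℝ S := FiniteDimensional.trans ℝ 𝕜 S
  have hU : θ.U i = ⋃ j : Fin θ.N, θ.U i ∩ {x | θ.idx x = j} := by
    rw [← Set.inter_iUnion]
    ext x
    simp
  rw [hU]
  refine aestronglyMeasurable_iUnion_iff.2 fun j => ?_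
  have hm : MeasurableSet (θ.U i ∩ {x | θ.idx x = j}) :=
    (θ.isOpen i).measurableSet.inter (measurableSet_idx j)
  have h1 : AEStronglyMeasurable (fun x => cocyc θ c i j x)
      ((riemannianVolume g).restrict (θ.U i ∩ {x | θ.idx x = j})) := by
    refine ((contMDiffOn_cocyc θ c i j).continuousOn.mono ?_).aestronglyMeasurable hm
    rintro x ⟨hx, rfl⟩
    exact ⟨hx, θ.mem_idx x⟩
  have h2 := (ContinuousLinearMap.id 𝕜 (S →L[𝕜] S)).aestronglyMeasurable_comp₂ h1
    (hσ.mono_measure (Measure.restrict_le_self (s := θ.U i ∩ {x | θ.idx x = j})))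
  refine h2.congr ?_
  filter_upwards [ae_restrict_mem hm] with x hx
  have hx2 : θ.idx x = j := hx.2
  rw [← hx2]
  rfl

/-! ### Transfer of norms between a chart and the manifold. -/

section Chart

variable {i : Fin θ.N} {x₀ : M} {K : Set (Euc n)}

theorem memLp_inFrame_chart (hK : IsCompact K) (hKi : K ⊆ locDom θ i x₀) {σ : M → S}
    (hσ : MemLp σ 2 (riemannianVolume g)) :
    MemLp ((spinorFramed θ c).inFrame i σ ∘ chartInv x₀) 2 (volume.restrict K) := by
  set f : M → S := (θ.U i).indicator ((spinorFramed θ c).inFrame i σ) with hf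
  have hfm : AEStronglyMeasurable f (riemannianVolume g) :=
    (aestronglyMeasurable_indicator_iff (θ.isOpen i).measurableSet).2
      (aestronglyMeasurable_inFrame c i hσ.1)
  obtain ⟨C, -, hC⟩ := exists_map_chartInv_le (g := g) θ hK hKi
  obtain ⟨C', hC'⟩ := exists_eLpNorm_chart_le (W := S) θ hK hKi 2
  have hm : AEStronglyMeasurable (f ∘ chartInv x₀) (volume.restrict K) :=
    ((hfm.smul_measure (C : ℝ≥0∞)).mono_measure hC).comp_aemeasurable
      (aemeasurable_chartInv_restrict θ hKi)
  have he : f ∘ chartInv x₀ =ᵐ[volume.restrict K]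
      (spinorFramed θ c).inFrame i σ ∘ chartInv x₀ := by
    filter_upwards [ae_restrict_mem hK.measurableSet] with y hy
    exact Set.indicator_of_mem (s := θ.U i) (hKi hy).2 ((spinorFramed θ c).inFrame i σ)
  refine MemLp.ae_eq he ⟨hm, (hC' f hfm).trans_lt (ENNReal.mul_lt_top ENNReal.coe_lt_top ?_)⟩
  refine lt_of_le_of_lt (eLpNorm_mono (f := f) (g := σ) fun x => ?_) hσ.2
  exact (norm_indicator_le_norm_self (s := θ.U i) ((spinorFramed θ c).inFrame i σ) x).trans_eq
    (norm_inFrame_spinor c i σ x)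

theorem exists_eLpNorm_extSection_le (hK : IsCompact K) (hKi : K ⊆ locDom θ i x₀) :
    ∃ C : NNReal, ∀ u : Euc n → S, (∀ y ∉ K, u y = 0) →
      AEStronglyMeasurable (extSection c i x₀ u) (riemannianVolume g) →
      eLpNorm (extSection c i x₀ u) 2 (riemannianVolume g) ≤ C * eLpNorm u 2 volume := by
  obtain ⟨C, hC⟩ := exists_eLpNorm_le_chart (W := S) θ hK hKi 2
  refine ⟨C, fun u hu hm => ?_⟩
  have hs : Function.support (extSection c i x₀ u) ⊆ chartInv x₀ '' K := fun x hx => by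
    by_contra h
    exact hx (extSection_eq_zero c hu h)
  rw [← eLpNorm_restrict_eq_of_support_subset hs]
  refine (hC _ hm).trans (mul_le_mul_right ?_ _)
  refine le_trans (eLpNorm_mono_ae ?_) (eLpNorm_restrict_le u 2 volume K)
  filter_upwards [ae_restrict_mem hK.measurableSet] with y hy
  have := inFrame_extSection_chartInv c (hKi hy) u
  rw [← this, norm_inFrame_spinor]
  rfl

theorem exists_eLpNorm_covDeriv_extSection_le (hK : IsCompact K) (hKi : K ⊆ locDom θ i x₀) :
    ∃ C : NNReal, ∀ u : Euc n → S, (∀ y ∉ K, u y = 0) → ContDiff ℝ ∞ u →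
      eLpNorm ((spinorFramed θ c).covDeriv (extSection c i x₀ u)) 2 (riemannianVolume g) ≤
        C * (eLpNorm (fderiv ℝ u) 2 volume + eLpNorm u 2 volume) := by
  have hE := spinorFramed_isGeometric (θ := θ) c
  obtain ⟨C, hC⟩ := exists_eLpNorm_le_chart (W := PiLp 2 (fun _ : Fin n => S)) θ hK hKi 2
  obtain ⟨C', hC'0, hC'⟩ := hE.exists_covDeriv_le hK hKi
  refine ⟨C * C'.toNNReal, fun u hu hus => ?_⟩
  have hsm := isSmooth_extSection c hK hKi hus hu
  have hcl := (isCompact_image_chartInv θ hK hKi).isClosed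
  have hs : Function.support ((spinorFramed θ c).covDeriv (extSection c i x₀ u)) ⊆
      chartInv x₀ '' K := fun x hx => by
    by_contra h
    refine hx (covDeriv_eq_zero _ ?_)
    filter_upwards [hcl.isOpen_compl.mem_nhds h] with x' hx'
    exact extSection_eq_zero c hu hx'
  rw [← eLpNorm_restrict_eq_of_support_subset hs]
  refine (hC _ (hE.aestronglyMeasurable_covDeriv hsm _)).trans ?_
  rw [ENNReal.coe_mul, mul_assoc]
  refine mul_le_mul_right ?_ _
  have h1 : eLpNorm ((spinorFramed θ c).covDeriv (extSection c i x₀ u) ∘ chartInv x₀) 2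
      (volume.restrict K) ≤ C'.toNNReal *
        eLpNorm (fun y => ‖fderiv ℝ u y‖ + ‖u y‖) 2 (volume.restrict K) := by
    refine eLpNorm_le_nnreal_smul_eLpNorm_of_ae_le_mul ?_ 2
    filter_upwards [ae_restrict_mem hK.measurableSet] with y hy
    rw [← NNReal.coe_le_coe]
    push_cast
    rw [Real.coe_toNNReal _ hC'0]
    refine (hC' _ hsm y hy).trans (mul_le_mul_of_nonneg_left ?_ hC'0)
    have e : (spinorFramed θ c).inFrame i (extSection c i x₀ u) ∘ chartInv x₀ =ᶠ[nhds y] u := by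
      filter_upwards [(isOpen_locDom θ i x₀).mem_nhds (hKi hy)] with z hz
      exact inFrame_extSection_chartInv c hz u
    rw [e.fderiv_eq, ← norm_inFrame_spinor c i, inFrame_extSection_chartInv c (hKi hy) u]
    exact le_abs_self _
  refine h1.trans (mul_le_mul_right ((eLpNorm_restrict_le _ 2 volume K).trans ?_) _)
  refine (eLpNorm_add_le (f := fun y => ‖fderiv ℝ u y‖) (g := fun y => ‖u y‖)
    (hus.continuous_fderiv (by simp)).norm.aestronglyMeasurable
    hus.continuous.norm.aestronglyMeasurable (by norm_num)).trans_eq ?_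
  rw [eLpNorm_norm, eLpNorm_norm]

end Chart

/-! ### Mollification of a localised section. -/

section Cutoff

variable {i : Fin θ.N} {x₀ : M} {R : ℝ} {ζ : M → ℝ}

theorem extSection_localRep (hR : Metric.closedBall (chartAt (Euc n) x₀ x₀) R ⊆ locDom θ i x₀)
    (hsupp : tsupport ζ ⊆ coordBall (n := n) x₀ R) (σ : M → S) :
    extSection c i x₀ (localRep (spinorFramed θ c) i x₀ R ζ σ) = fun x => ζ x • σ x := by
  ext x
  by_cases hx : x ∈ coordBall (n := n) x₀ R
  · have hx' := coordBall_subset hR hx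
    rw [extSection, if_pos hx', localRep,
      Set.indicator_of_mem (show chartAt (Euc n) x₀ x ∈ Metric.ball _ R from hx.2)]
    have e : chartInv x₀ (chartAt (Euc n) x₀ x) = x := (chartAt (Euc n) x₀).left_inv hx'.1
    rw [e, clm_map_real_smul, ← eq_cocyc_inFrame c hx'.2]
  · have h0 : ζ x = 0 := image_eq_zero_of_notMem_tsupport fun h => hx (hsupp h)
    rw [h0, zero_smul, extSection]
    split_ifs with hx'
    · rw [localRep, Set.indicator_of_notMem (s := Metric.ball _ R) fun h => hx ⟨hx'.1, h⟩, map_zero]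
    · rfl

theorem memLp_localRep (hR : Metric.closedBall (chartAt (Euc n) x₀ x₀) R ⊆ locDom θ i x₀)
    (hζ : ContMDiff (𝓡 n) 𝓘(ℝ, ℝ) ∞ ζ) {σ : M → S} (hσ : MemLp σ 2 (riemannianVolume g)) :
    MemLp (localRep (spinorFramed θ c) i x₀ R ζ σ) 2 volume := by
  have hK := isCompact_closedBall (chartAt (Euc n) x₀ x₀) R
  have hzc : ContinuousOn (fun y => ζ (chartInv x₀ y))
      (Metric.closedBall (chartAt (Euc n) x₀ x₀) R) :=
    (contDiffOn_comp_chartInv hζ x₀).continuousOn.mono fun y hy => (hR hy).1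
  obtain ⟨C, hC⟩ := hK.exists_bound_of_continuousOn hzc
  have h1 := memLp_inFrame_chart c hK hR hσ
  rw [localRep, memLp_indicator_iff_restrict Metric.isOpen_ball.measurableSet]
  refine MemLp.mono_measure (Measure.restrict_mono Metric.ball_subset_closedBall le_rfl) ?_
  refine h1.of_le_mul (c := C) ((hzc.aestronglyMeasurable hK.measurableSet).smul h1.1) ?_
  filter_upwards [ae_restrict_mem hK.measurableSet] with y hy
  rw [norm_smul]
  exact mul_le_mul_of_nonneg_right (hC y hy) (norm_nonneg _)

theorem hasCompactSupport_localRep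
    (hR : Metric.closedBall (chartAt (Euc n) x₀ x₀) R ⊆ locDom θ i x₀)
    (hsupp : tsupport ζ ⊆ coordBall (n := n) x₀ R) (σ : M → S) :
    HasCompactSupport (localRep (spinorFramed θ c) i x₀ R ζ σ) :=
  HasCompactSupport.intro (isCompact_chart_tsupport hsupp) fun _ hy => localRep_eq_zero hR σ hy

/-- The support of the localised section is compact in the open ball, hence it has a margin `d`;
mollification enlarges it by at most `2ε`. -/
theorem exists_mollify_localRep_eq_zero
    (hR : Metric.closedBall (chartAt (Euc n) x₀ x₀) R ⊆ locDom θ i x₀)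
    (hsupp : tsupport ζ ⊆ coordBall (n := n) x₀ R) (σ : M → S) :
    ∃ ε₀ > 0, ∀ ε, 0 < ε → ε ≤ ε₀ → ∀ y ∉ Metric.closedBall (chartAt (Euc n) x₀ x₀) R,
      mollify ε (localRep (spinorFramed θ c) i x₀ R ζ σ) y = 0 := by
  obtain ⟨d, hd, hdK⟩ := (isCompact_chart_tsupport hsupp).exists_thickening_subset_open
    Metric.isOpen_ball (chart_tsupport_subset hsupp)
  refine ⟨d / 2, half_pos hd, fun ε hε hεd y hy => mollify_eq_zero hε fun z hz => ?_⟩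
  refine localRep_eq_zero hR σ fun hzK => hy (Metric.ball_subset_closedBall (hdK ?_))
  refine Metric.mem_thickening_iff.2 ⟨z, hzK, ?_⟩
  rw [dist_comm]
  exact lt_of_lt_of_le hz (by linarith)

theorem extSection_sub (u w : Euc n → S) :
    extSection c i x₀ (u - w) = extSection c i x₀ u - extSection c i x₀ w := by
  ext x
  simp only [extSection, Pi.sub_apply]
  split_ifs <;> simp

theorem norm_H1_le (η : H1 θ c) : ‖η‖ ≤ ‖sobFst (spinorFramed θ c) 2 2 η‖ +
    ‖sobSnd (spinorFramed θ c) 2 2 η‖ := by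
  have h := WithLp.prod_norm_sq_eq_of_L2 (η : WithLp 2 (Lp S 2 (riemannianVolume g) ×
      Lp (PiLp 2 (fun _ : Fin n => S)) 2 (riemannianVolume g)))
  refine (sq_le_sq₀ (norm_nonneg _) (by positivity)).1 ?_
  have e : ‖η‖ ^ 2 = ‖sobFst (spinorFramed θ c) 2 2 η‖ ^ 2 +
    ‖sobSnd (spinorFramed θ c) 2 2 η‖ ^ 2 := h
  rw [e, add_sq]
  nlinarith [mul_nonneg (norm_nonneg (sobFst (spinorFramed θ c) 2 2 η))
    (norm_nonneg (sobSnd (spinorFramed θ c) 2 2 η))]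

theorem enorm_toH1_le {σ : M → S} (hσ : (spinorFramed θ c).IsSmooth σ) :
    ‖toH1 c hσ‖ₑ ≤ eLpNorm σ 2 (riemannianVolume g) +
      eLpNorm ((spinorFramed θ c).covDeriv σ) 2 (riemannianVolume g) := by
  have hE := spinorFramed_isGeometric (θ := θ) c
  have h := ENNReal.ofReal_le_ofReal (norm_H1_le c (toH1 c hσ))
  rw [ENNReal.ofReal_add (norm_nonneg _) (norm_nonneg _), ofReal_norm, ofReal_norm, ofReal_norm,
    Lp.enorm_def, Lp.enorm_def] at h
  exact h.trans_eq (congrArg₂ _ (eLpNorm_congr_ae (sobFst_toSobolev 2 2 hE hσ))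
    (eLpNorm_congr_ae (sobSnd_toSobolev 2 2 hE hσ)))

/-- Smoothing of `ζσ` in a coordinate ball. -/
theorem exists_smoothing (hR : Metric.closedBall (chartAt (Euc n) x₀ x₀) R ⊆ locDom θ i x₀)
    (hζ : ContMDiff (𝓡 n) 𝓘(ℝ, ℝ) ∞ ζ) (hsupp : tsupport ζ ⊆ coordBall (n := n) x₀ R) {σ : M → S}
    (hσ : MemLp σ 2 (riemannianVolume g)) :
    ∃ C : NNReal, ∀ δ : ℝ≥0∞, δ ≠ 0 → ∃ ε > 0, ∃ (τ : M → S) (hτ : (spinorFramed θ c).IsSmooth τ),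
      eLpNorm (τ - fun x => ζ x • σ x) 2 (riemannianVolume g) ≤ δ ∧
      ‖toH1 c hτ‖ₑ ≤ C * (eLpNorm (localRep (spinorFramed θ c) i x₀ R ζ σ) 2 volume +
        eLpNorm (fderiv ℝ (mollify ε (localRep (spinorFramed θ c) i x₀ R ζ σ))) 2 volume) := by
  have hfin : FiniteDimensional ℝ S := FiniteDimensional.trans ℝ 𝕜 S
  have hE := spinorFramed_isGeometric (θ := θ) c
  have hK := isCompact_closedBall (chartAt (Euc n) x₀ x₀) R
  set U := localRep (spinorFramed θ c) i x₀ R ζ σ with hUdef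
  have hU : MemLp U 2 volume := memLp_localRep c hR hζ hσ
  have hUl := hU.locallyIntegrable (by norm_num)
  obtain ⟨C₁, hC₁⟩ := exists_eLpNorm_extSection_le c hK hR
  obtain ⟨C₂, hC₂⟩ := exists_eLpNorm_covDeriv_extSection_le c hK hR
  obtain ⟨ε₁, hε₁, hz⟩ := exists_mollify_localRep_eq_zero c hR hsupp σ
  -- The constant is fixed before `δ`, and only `ε` depends on `δ`. A bound on the mollified
  -- gradient that is uniform in `ε` therefore yields approximations that are bounded in `H¹`.
  refine ⟨C₁ + C₂, fun δ hδ => ?_⟩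
  obtain ⟨η, hη0, hη⟩ := ENNReal.exists_nnreal_pos_mul_lt (ENNReal.coe_ne_top (r := C₁)) hδ
  obtain ⟨ε₂, hε₂, hm⟩ := exists_mollify_sub_le hU (δ := η) (by exact_mod_cast hη0.ne')
  have hε : 0 < min ε₁ ε₂ := lt_min hε₁ hε₂
  set ε := min ε₁ ε₂
  have hz' := hz ε hε (min_le_left _ _)
  have hsm := contDiff_mollify hε hUl
  have hτ := isSmooth_extSection c hK hR hsm hz'
  refine ⟨ε, hε, extSection c i x₀ (mollify ε U), hτ, ?_, ?_⟩
  · have hU0 : ∀ y ∉ Metric.closedBall (chartAt (Euc n) x₀ x₀) R, (mollify ε U - U) y = 0 :=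
      fun y hy => by
        rw [Pi.sub_apply, hz' y hy, hUdef, localRep, Set.indicator_of_notMem fun h =>
          hy (Metric.ball_subset_closedBall h), sub_zero]
    have hms : AEStronglyMeasurable (fun x => ζ x • σ x) (riemannianVolume g) :=
      hζ.continuous.aestronglyMeasurable.smul hσ.1
    have e : (extSection c i x₀ (mollify ε U) - fun x => ζ x • σ x) =
        extSection c i x₀ (mollify ε U - U) := by
      rw [extSection_sub, hUdef, extSection_localRep c hR hsupp]
    rw [e]
    refine (hC₁ _ hU0 ?_).trans ?_
    · rw [← e]
      exact (hE.aestronglyMeasurable hτ _).sub hms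
    · rw [mul_comm]
      exact (mul_le_mul_left (hm ε hε (min_le_right _ _)) _).trans hη.le
  · refine (enorm_toH1_le c hτ).trans ?_
    have b1 := hC₁ _ hz' (hE.aestronglyMeasurable hτ _)
    have b2 := hC₂ _ hz' hsm
    have b3 := eLpNorm_mollify_le hε hU.1
    refine (add_le_add (b1.trans (mul_le_mul_right b3 _))
      (b2.trans (mul_le_mul_right (add_le_add le_rfl b3) _))).trans ?_
    rw [ENNReal.coe_add, add_mul]
    refine add_le_add (mul_le_mul_right le_self_add _) (le_of_eq ?_)
    rw [add_comm]

end Cutoff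

theorem memLp_cutoff {ζ : M → ℝ} (hζ : Continuous ζ) (ψ : L2 θ c) :
    MemLp (fun x => ζ x • ψ x) 2 (riemannianVolume g) := by
  obtain ⟨C, hC⟩ := isCompact_univ.exists_bound_of_continuousOn hζ.continuousOn
  refine (Lp.memLp ψ).of_le_mul (c := C) (hζ.aestronglyMeasurable.smul (Lp.aestronglyMeasurable ψ))
    (Filter.Eventually.of_forall fun x => ?_)
  rw [norm_smul]
  exact mul_le_mul_of_nonneg_right (hC x trivial) (norm_nonneg _)

theorem eq_sum_cutoff (t : Finset M) {ζ : M → M → ℝ} (hζ : ∀ a, Continuous (ζ a))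
    (hsum : ∀ x, ∑ a ∈ t, ζ a x = 1) (ψ : L2 θ c) :
    ψ = ∑ a ∈ t, (memLp_cutoff c (hζ a) ψ).toLp := by
  apply Lp.ext
  have h1 : ∀ a ∈ t, ((memLp_cutoff c (hζ a) ψ).toLp : M → S) =ᵐ[riemannianVolume g]
      fun x => ζ a x • ψ x := fun a _ => (memLp_cutoff c (hζ a) ψ).coeFn_toLp
  filter_upwards [Lp.coeFn_finsetSum t fun a => (memLp_cutoff c (hζ a) ψ).toLp,
    (Filter.eventually_all_finset t).2 h1] with x h2 h3
  rw [h2, Finset.sum_apply, Finset.sum_congr rfl h3, ← Finset.sum_smul, hsum, one_smul]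

theorem edist_incl_toH1 {τ : M → S} (hτ : (spinorFramed θ c).IsSmooth τ) {ζ : M → ℝ}
    (hζ : Continuous ζ) (ψ : L2 θ c) : edist (H1.incl θ c (toH1 c hτ)) (memLp_cutoff c hζ ψ).toLp =
      eLpNorm (τ - fun x => ζ x • ψ x) 2 (riemannianVolume g) := by
  rw [Lp.edist_def]
  refine eLpNorm_congr_ae ?_
  filter_upwards [incl_toH1 c hτ, (memLp_cutoff c hζ ψ).coeFn_toLp] with x e1 e2
  rw [Pi.sub_apply, Pi.sub_apply, e1, e2]

/-- Smooth sections are dense in `L²`. -/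
theorem dense_range_incl : Dense (Set.range (H1.incl θ c)) := by
  intro ψ
  obtain ⟨t, R, ζ, hR, hζ, hsupp, hsum⟩ := exists_atlas θ (fun _ _ => True) fun x => by
    obtain ⟨R, h0, h⟩ := exists_closedBall_subset_locDom θ x
    exact ⟨R, h0, h, trivial⟩
  have key : ψ ∈ (LinearMap.range (H1.incl θ c).toLinearMap).topologicalClosure := by
    rw [eq_sum_cutoff c t (fun a => (hζ a).continuous) hsum ψ]
    refine Submodule.sum_mem _ fun a ha => ?_
    obtain ⟨C, hC⟩ := exists_smoothing c (hR a).2.1 (hζ a) (hsupp a ha) (Lp.memLp ψ)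
    refine Metric.mem_closure_iff.2 fun δ hδ => ?_
    obtain ⟨ε, -, τ, hτ, h1, -⟩ := hC (ENNReal.ofReal (δ / 2)) (by simpa using hδ)
    refine ⟨H1.incl θ c (toH1 c hτ), ⟨_, rfl⟩, ?_⟩
    rw [dist_comm, ← ENNReal.ofReal_lt_ofReal_iff hδ, ← edist_dist, edist_incl_toH1 c hτ (hζ a).continuous ψ]
    exact lt_of_le_of_lt h1 ((ENNReal.ofReal_lt_ofReal_iff hδ).2 (half_lt_self hδ))
  exact key

end Smoothing

end

end WeightedDirac

namespace WeightedDirac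

noncomputable section

/-! ### Regularity of weak solutions -/

/-- A strong limit of images of a bounded sequence is an image. -/
theorem mem_range_of_bounded {𝕜 H G : Type*} [RCLike 𝕜] [NormedAddCommGroup H]
    [InnerProductSpace 𝕜 H] [CompleteSpace H] [NormedAddCommGroup G] [InnerProductSpace 𝕜 G]
    [CompleteSpace G] (T : H →L[𝕜] G) {y : G} {C : ℝ}
    (h : ∀ δ > 0, ∃ x, ‖x‖ ≤ C ∧ dist (T x) y ≤ δ) : y ∈ Set.range T := by
  -- Pairing `T x` with `w` is bounded by `C ‖T* w‖`, and the error of the approximation tends to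
  -- zero.
  have hb : ∀ w, ‖inner 𝕜 y w‖ ≤ C * ‖T.adjoint w‖ := fun w => by
    refine le_of_forall_pos_le_add fun e he => ?_
    obtain ⟨x, hx, hd⟩ := h (e / (‖w‖ + 1)) (by positivity)
    have e1 : inner 𝕜 y w = inner 𝕜 x (T.adjoint w) - inner 𝕜 (T x - y) w := by
      rw [ContinuousLinearMap.adjoint_inner_right, inner_sub_left]; ring
    rw [e1]
    refine (norm_sub_le _ _).trans (add_le_add ?_ ?_)
    · exact (norm_inner_le_norm _ _).trans (mul_le_mul_of_nonneg_right hx (norm_nonneg _))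
    · refine (norm_inner_le_norm _ _).trans ?_
      rw [← dist_eq_norm]
      calc dist (T x) y * ‖w‖ ≤ e / (‖w‖ + 1) * (‖w‖ + 1) :=
            mul_le_mul hd (by linarith) (norm_nonneg _) (by positivity)
        _ = e := by field_simp
  let f₀ : G →ₗ[𝕜] 𝕜 := (innerSL 𝕜 y).toLinearMap
  have hker : LinearMap.ker T.adjoint.toLinearMap ≤ LinearMap.ker f₀ := fun w hw => by
    have hw' : T.adjoint w = 0 := hw
    have := hb w
    rw [hw', norm_zero, mul_zero] at this
    exact norm_le_zero_iff.1 this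
  set A : G →ₗ[𝕜] H := T.adjoint.toLinearMap
  let f : LinearMap.range A →ₗ[𝕜] 𝕜 :=
    ((LinearMap.ker A).liftQ f₀ hker).comp A.quotKerEquivRange.symm.toLinearMap
  have hf : ∀ w, f ⟨A w, LinearMap.mem_range_self A w⟩ = inner 𝕜 y w := fun w => by
    have e := A.quotKerEquivRange_symm_apply_image w (LinearMap.mem_range_self A w)
    change (LinearMap.ker A).liftQ f₀ hker (A.quotKerEquivRange.symm _) = _
    rw [e]
    rfl
  -- By the bound, `T* w ↦ ⟨y, w⟩` is well defined and bounded on the range of `T*`. Its Hahn–Banach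
  -- extension is represented by a vector, which is the preimage of `y`; no weakly convergent
  -- subsequence has to be chosen.
  obtain ⟨ℓ, hℓ, -⟩ := exists_extension_norm_eq (LinearMap.range A) (f.mkContinuous C (by
    rintro ⟨_, w, rfl⟩
    rw [hf]
    exact hb w))
  refine ⟨(InnerProductSpace.toDual 𝕜 H).symm ℓ, ext_inner_right 𝕜 fun w => ?_⟩
  rw [← ContinuousLinearMap.adjoint_inner_right, InnerProductSpace.toDual_symm_apply, ← hf w]
  exact hℓ ⟨A w, LinearMap.mem_range_self A w⟩

section Regularity

variable {𝕜 : Type*} [RCLike 𝕜] {n : ℕ} {M : Type*} [TopologicalSpace M] [T2Space M]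
  [CompactSpace M] [ChartedSpace (EuclideanSpace ℝ (Fin n)) M] [IsManifold (𝓡 n) ∞ M]
  [MeasurableSpace M] [BorelSpace M] {g : RMetric n M} {θ : SpinStructure g}
  {S : Type*} [NormedAddCommGroup S] [InnerProductSpace 𝕜 S] [NormedSpace ℝ S]
  [IsScalarTower ℝ 𝕜 S] [FiniteDimensional 𝕜 S] [CompleteSpace S] (c : CliffordModule 𝕜 n S)
  {i : Fin θ.N} {x₀ : M} {R : ℝ} {ζ : M → ℝ}

/-- A constant that controls a linear map by its values on the frame at one point. -/
def frameBound (θ : SpinStructure g) (i : Fin θ.N) (x₀ : M) : NNReal :=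
  ∑ k, ‖coframe θ i x₀ k (chartAt (Euc n) x₀ x₀)‖₊

theorem norm_le_frameBound {W : Type*} [NormedAddCommGroup W] [NormedSpace ℝ W]
    (h : chartAt (Euc n) x₀ x₀ ∈ locDom θ i x₀) (T : Euc n →L[ℝ] W) :
    ‖T‖ ≤ frameBound θ i x₀ * ∑ l, ‖T (locFrame θ i x₀ l (chartAt (Euc n) x₀ x₀))‖ := by
  refine T.opNorm_le_bound (by positivity) fun w => ?_
  conv_lhs => rw [← sum_coframe_smul θ h w, map_sum]
  rw [frameBound, NNReal.coe_sum, Finset.sum_mul, Finset.sum_mul]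
  refine (norm_sum_le _ _).trans (Finset.sum_le_sum fun k _ => ?_)
  rw [map_smul, norm_smul, coe_nnnorm]
  have h1 := (coframe θ i x₀ k (chartAt (Euc n) x₀ x₀)).le_opNorm w
  have h2 := Finset.single_le_sum
    (f := fun l => ‖T (locFrame θ i x₀ l (chartAt (Euc n) x₀ x₀))‖)
    (fun l _ => norm_nonneg _) (Finset.mem_univ k)
  calc _ ≤ ‖coframe θ i x₀ k (chartAt (Euc n) x₀ x₀)‖ * ‖w‖ *
        ∑ l, ‖T (locFrame θ i x₀ l (chartAt (Euc n) x₀ x₀))‖ :=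
        mul_le_mul h1 h2 (norm_nonneg _) (by positivity)
    _ = _ := by ring

/-- The difference of the frame from its value at the centre is cut off by a bump that is `1` on the
ball of radius `R` and vanishes outside of the ball of radius `2R`. The result is defined on all of
`ℝⁿ`, is Lipschitz, and is no larger than the original difference. -/
theorem exists_frame_perturbation (hR0 : 0 < R)
    (hR : Metric.closedBall (chartAt (Euc n) x₀ x₀) (2 * R) ⊆ locDom θ i x₀) {δ : NNReal}
    (hδ : ∀ y ∈ Metric.closedBall (chartAt (Euc n) x₀ x₀) (2 * R), ∀ l,
      ‖locFrame θ i x₀ l y - locFrame θ i x₀ l (chartAt (Euc n) x₀ x₀)‖ ≤ δ) :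
    ∃ (b : Fin n → Euc n → Euc n) (K : NNReal), (∀ l, LipschitzWith K (b l)) ∧
      (∀ l y, ‖b l y‖ ≤ δ) ∧ ∀ y ∈ Metric.closedBall (chartAt (Euc n) x₀ x₀) R, ∀ l,
        locFrame θ i x₀ l (chartAt (Euc n) x₀ x₀) + b l y = locFrame θ i x₀ l y := by
  set y₀ := chartAt (Euc n) x₀ x₀
  let f : ContDiffBump y₀ := ⟨R, 2 * R, hR0, by linarith⟩
  have hf0 : ∀ y ∉ Metric.closedBall y₀ (2 * R), f y = 0 := fun y hy =>
    f.zero_of_le_dist (le_of_lt (not_le.1 fun h => hy h))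
  let b : Fin n → Euc n → Euc n := fun l => (locDom θ i x₀).indicator
    fun y => f y • (locFrame θ i x₀ l y - locFrame θ i x₀ l y₀)
  have hbs : ∀ l, ContDiff ℝ ∞ (b l) := fun l =>
    contDiff_indicator (isOpen_locDom θ i x₀) Metric.isClosed_closedBall hR
      (f.contDiff.contDiffOn.smul ((contDiffOn_locFrame θ i x₀ l).sub contDiffOn_const))
      fun y _ hy => by rw [hf0 y hy, zero_smul]
  have hbc : ∀ l, HasCompactSupport (b l) := fun l =>
    HasCompactSupport.intro (isCompact_closedBall y₀ (2 * R)) fun y hy => by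
      simp only [b, Set.indicator, hf0 y hy, zero_smul, ite_self]
  choose K hK using fun l => (hbs l).lipschitzWith_of_hasCompactSupport (hbc l) (by simp)
  refine ⟨b, ∑ l, K l, fun l => (hK l).weaken
    (Finset.single_le_sum (f := K) (fun _ _ => by simp) (Finset.mem_univ l)), fun l y => ?_,
    fun y hy l => ?_⟩
  · by_cases hy : y ∈ Metric.closedBall y₀ (2 * R)
    · simp only [b]
      rw [Set.indicator_of_mem (hR hy), norm_smul, Real.norm_of_nonneg f.nonneg]
      calc f y * ‖locFrame θ i x₀ l y - locFrame θ i x₀ l y₀‖ ≤ 1 * δ :=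
            mul_le_mul f.le_one (hδ y hy l) (norm_nonneg _) zero_le_one
        _ = δ := one_mul _
    · simp only [b, Set.indicator, hf0 y hy, zero_smul, ite_self, norm_zero]
      exact δ.2
  · have hy2 : y ∈ Metric.closedBall y₀ (2 * R) := Metric.closedBall_subset_closedBall (by linarith) hy
    simp only [b]
    rw [Set.indicator_of_mem (hR hy2), f.one_of_mem_closedBall hy, one_smul]
    abel

/-- The cutoff `ζ`, divided by the density of the volume, in a chart. -/
def densityCutoff (g : RMetric n M) (x₀ : M) (R : ℝ) (ζ : M → ℝ) : Euc n → ℝ :=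
  (Metric.ball (chartAt (Euc n) x₀ x₀) R).indicator
    fun y => ζ (chartInv x₀ y) * (volDensity g x₀ y)⁻¹

theorem contDiff_densityCutoff (hR : Metric.closedBall (chartAt (Euc n) x₀ x₀) R ⊆ locDom θ i x₀)
    (hζ : ContMDiff (𝓡 n) 𝓘(ℝ, ℝ) ∞ ζ) (hsupp : tsupport ζ ⊆ coordBall (n := n) x₀ R) :
    ContDiff ℝ ∞ (densityCutoff g x₀ R ζ) := by
  have hB : Metric.ball (chartAt (Euc n) x₀ x₀) R ⊆ locDom θ i x₀ :=
    Metric.ball_subset_closedBall.trans hR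
  refine contDiff_indicator Metric.isOpen_ball (isCompact_chart_tsupport hsupp).isClosed
    (chart_tsupport_subset hsupp) ?_ fun y hy hyK => ?_
  · exact ((contDiffOn_comp_chartInv hζ x₀).mono fun y hy => (hB hy).1).mul
      (((contDiffOn_volDensity θ i x₀).mono hB).inv fun y hy => (volDensity_pos θ (hB hy)).ne')
  · rw [cutoff_eq_zero (hB hy).1 hyK, zero_mul]

theorem densityCutoff_eq_zero
    (hR : Metric.closedBall (chartAt (Euc n) x₀ x₀) R ⊆ locDom θ i x₀) {y : Euc n}
    (hy : y ∉ chartAt (Euc n) x₀ '' tsupport ζ) : densityCutoff g x₀ R ζ y = 0 := by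
  by_cases hB : y ∈ Metric.ball (chartAt (Euc n) x₀ x₀) R
  · rw [densityCutoff, Set.indicator_of_mem hB,
      cutoff_eq_zero (hR (Metric.ball_subset_closedBall hB)).1 hy, zero_mul]
  · rw [densityCutoff, Set.indicator_of_notMem hB]

theorem volDensity_mul_densityCutoff
    (hR : Metric.closedBall (chartAt (Euc n) x₀ x₀) R ⊆ locDom θ i x₀) {y : Euc n}
    (hy : y ∈ Metric.ball (chartAt (Euc n) x₀ x₀) R) :
    volDensity g x₀ y * densityCutoff g x₀ R ζ y = ζ (chartInv x₀ y) := by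
  rw [densityCutoff, Set.indicator_of_mem hy, mul_comm, mul_assoc, inv_mul_cancel₀, mul_one]
  exact (volDensity_pos θ (hR (Metric.ball_subset_closedBall hy))).ne'

/-- The test section that belongs to a test function in a coordinate ball. -/
theorem isSmooth_test (hR : Metric.closedBall (chartAt (Euc n) x₀ x₀) R ⊆ locDom θ i x₀)
    (hζ : ContMDiff (𝓡 n) 𝓘(ℝ, ℝ) ∞ ζ) (hsupp : tsupport ζ ⊆ coordBall (n := n) x₀ R)
    {φ : Euc n → S} (hφ : ContDiff ℝ ∞ φ) :
    (spinorFramed θ c).IsSmooth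
      (extSection c i x₀ fun y => densityCutoff g x₀ R ζ y • φ y) :=
  isSmooth_extSection c (isCompact_chart_tsupport hsupp)
    (((chart_tsupport_subset hsupp).trans Metric.ball_subset_closedBall).trans hR)
    ((contDiff_densityCutoff hR hζ hsupp).smul hφ) fun y hy => by
      rw [densityCutoff_eq_zero hR hy, zero_smul]

/-- Integrals of functions that are supported in the support of a cutoff. -/
theorem integral_eq_integral_cutoff (θ : SpinStructure g)
    (hsupp : tsupport ζ ⊆ coordBall (n := n) x₀ R) {f : M → 𝕜}
    (hf : ∀ x ∉ tsupport ζ, f x = 0) (hm : AEStronglyMeasurable f (riemannianVolume g))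
    {F : Euc n → 𝕜} (hF : ∀ y ∈ chartAt (Euc n) x₀ '' tsupport ζ,
      F y = volDensity g x₀ y • f (chartInv x₀ y))
    (hF0 : ∀ y ∉ chartAt (Euc n) x₀ '' tsupport ζ, F y = 0) :
    ∫ x, f x ∂(riemannianVolume g) = ∫ y, F y := by
  rw [integral_eq_integral_chart θ x₀ (fun x hx => hf x fun h => hx (hsupp h).1) hm]
  have hKt : chartAt (Euc n) x₀ '' tsupport ζ ⊆ (chartAt (Euc n) x₀).target := by
    rintro _ ⟨x, hx, rfl⟩
    exact (chartAt (Euc n) x₀).map_source (hsupp hx).1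
  rw [← setIntegral_eq_integral_of_forall_compl_eq_zero (s := (chartAt (Euc n) x₀).target)
    fun y hy => hF0 y fun h => hy (hKt h)]
  refine setIntegral_congr_fun (chartAt (Euc n) x₀).open_target.measurableSet fun y hy => ?_
  by_cases h : y ∈ chartAt (Euc n) x₀ '' tsupport ζ
  · exact (hF y h).symm
  · rw [hF0 y h, hf _ fun h' => h ⟨_, h', (chartAt (Euc n) x₀).right_inv hy⟩, smul_zero]

/-- The terms of order zero of the Dirac operator in a chart, with a cutoff. -/
def lowerOrder (θ : SpinStructure g) (c : CliffordModule 𝕜 n S) (i : Fin θ.N) (x₀ : M) (R : ℝ)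
    (ζ : M → ℝ) (y : Euc n) : S →L[𝕜] S :=
  ∑ l, (ζ (chartInv x₀ y) • (spinConnection θ c i l (chartInv x₀ y)).comp (c.γ' l) -
    (volDensity g x₀ y * fderiv ℝ (densityCutoff g x₀ R ζ) y (locFrame θ i x₀ l y)) • c.γ' l)

theorem continuousOn_lowerOrder
    (hR : Metric.closedBall (chartAt (Euc n) x₀ x₀) R ⊆ locDom θ i x₀)
    (hζ : ContMDiff (𝓡 n) 𝓘(ℝ, ℝ) ∞ ζ) (hsupp : tsupport ζ ⊆ coordBall (n := n) x₀ R) :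
    ContinuousOn (lowerOrder θ c i x₀ R ζ) (locDom θ i x₀) := by
  refine continuousOn_finsetSum _ fun l _ => ContinuousOn.fun_sub
    (ContinuousOn.fun_smul ?_ ?_) (ContinuousOn.fun_smul ?_ continuousOn_const)
  · exact (contDiffOn_comp_chartInv hζ x₀).continuousOn.mono fun y hy => hy.1
  · exact (contDiffOn_spinConnection c i l x₀).continuousOn.clm_comp continuousOn_const
  · exact (contDiffOn_volDensity θ i x₀).continuousOn.mul
      ((((contDiff_densityCutoff hR hζ hsupp).continuous_fderiv (by simp)).continuousOn).clm_apply
        (contDiffOn_locFrame θ i x₀ l).continuousOn)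

/-- Product rule. The factor `1/vol` in the cutoff cancels the density, so derivatives of `φ` carry
the coefficient `ζ` only. Terms without derivatives of `φ` are moved to `s` by skewness and
collected in `lowerOrder`. -/
theorem volDensity_smul_inner_locDirac
    (hR : Metric.closedBall (chartAt (Euc n) x₀ x₀) R ⊆ locDom θ i x₀)
    (hζ : ContMDiff (𝓡 n) 𝓘(ℝ, ℝ) ∞ ζ) (hsupp : tsupport ζ ⊆ coordBall (n := n) x₀ R) {y : Euc n}
    (hy : y ∈ Metric.ball (chartAt (Euc n) x₀ x₀) R) {φ : Euc n → S} (hφ : ContDiff ℝ ∞ φ) (s : S) :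
    volDensity g x₀ y •
        inner 𝕜 s (locDirac c i x₀ (fun y => densityCutoff g x₀ R ζ y • φ y) y) =
      inner 𝕜 (ζ (chartInv x₀ y) • s) (∑ l, c.γ' l (fderiv ℝ φ y (locFrame θ i x₀ l y))) +
        inner 𝕜 (lowerOrder θ c i x₀ R ζ y s) (φ y) := by
  have hκ := ((contDiff_densityCutoff hR hζ hsupp).differentiable (by simp) y)
  have hd : ∀ a, fderiv ℝ (fun y => densityCutoff g x₀ R ζ y • φ y) y a =
      densityCutoff g x₀ R ζ y • fderiv ℝ φ y a +
        fderiv ℝ (densityCutoff g x₀ R ζ) y a • φ y := fun a => by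
    rw [fderiv_fun_smul hκ (hφ.differentiable (by simp) y)]
    rfl
  have hv := volDensity_mul_densityCutoff (ζ := ζ) hR hy
  simp only [locDirac, hd, lowerOrder, map_add, clm_map_real_smul, inner_sum,
    sum_inner, inner_add_right, inner_real_smul_right, inner_real_smul_left, sum_apply,
    sub_apply, smul_apply, ContinuousLinearMap.comp_apply,
    inner_sub_left, Finset.smul_sum, smul_add, smul_smul, hv]
  rw [← Finset.sum_add_distrib]
  refine Finset.sum_congr rfl fun l _ => ?_
  rw [inner_spinConnection, inner_γ', inner_γ', neg_neg, smul_neg, sub_neg_eq_add]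
  abel

theorem memLp_lowerOrder (hR : Metric.closedBall (chartAt (Euc n) x₀ x₀) R ⊆ locDom θ i x₀)
    (hζ : ContMDiff (𝓡 n) 𝓘(ℝ, ℝ) ∞ ζ) (hsupp : tsupport ζ ⊆ coordBall (n := n) x₀ R) {σ : M → S}
    (hσ : MemLp σ 2 (riemannianVolume g)) :
    MemLp ((chartAt (Euc n) x₀ '' tsupport ζ).indicator fun y =>
      lowerOrder θ c i x₀ R ζ y ((spinorFramed θ c).inFrame i σ (chartInv x₀ y))) 2 volume := by
  have hK := isCompact_chart_tsupport hsupp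
  have hKi := ((chart_tsupport_subset hsupp).trans Metric.ball_subset_closedBall).trans hR
  have hc := (continuousOn_lowerOrder c hR hζ hsupp).mono hKi
  obtain ⟨C, hC⟩ := hK.exists_bound_of_continuousOn hc
  have h1 := memLp_inFrame_chart c hK hKi hσ
  rw [memLp_indicator_iff_restrict hK.measurableSet]
  refine h1.of_le_mul (c := C) ?_ ?_
  · exact (ContinuousLinearMap.id 𝕜 (S →L[𝕜] S)).aestronglyMeasurable_comp₂
      (hc.aestronglyMeasurable hK.measurableSet) h1.1
  · filter_upwards [ae_restrict_mem hK.measurableSet] with y hy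
    exact (ContinuousLinearMap.le_opNorm _ _).trans
      (mul_le_mul_of_nonneg_right (hC y hy) (norm_nonneg _))

theorem chartInv_image_chart_tsupport (hsupp : tsupport ζ ⊆ coordBall (n := n) x₀ R) :
    chartInv x₀ '' (chartAt (Euc n) x₀ '' tsupport ζ) = tsupport ζ := by
  rw [Set.image_image]
  refine (Set.image_congr fun x hx => ?_).trans (Set.image_id _)
  exact (chartAt (Euc n) x₀).left_inv (hsupp hx).1

/-- A weak solution of the Dirac equation, in a chart. -/
theorem weak_localRep {ψ χ : L2 θ c}
    (hweak : ∀ η : H1 θ c, inner 𝕜 ψ (dirac θ c η) = inner 𝕜 χ (H1.incl θ c η))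
    (hR : Metric.closedBall (chartAt (Euc n) x₀ x₀) R ⊆ locDom θ i x₀)
    (hζ : ContMDiff (𝓡 n) 𝓘(ℝ, ℝ) ∞ ζ) (hsupp : tsupport ζ ⊆ coordBall (n := n) x₀ R)
    {v : Fin n → Euc n} {b : Fin n → Euc n → Euc n} (hb : ∀ l, Continuous (b l))
    (hvb : ∀ y ∈ Metric.closedBall (chartAt (Euc n) x₀ x₀) R, ∀ l, v l + b l y = locFrame θ i x₀ l y)
    {φ : Euc n → S} (hφ : ContDiff ℝ ∞ φ) (hφc : HasCompactSupport φ) :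
    ∫ y, inner 𝕜 (localRep (spinorFramed θ c) i x₀ R ζ ψ y)
      (∑ l, c.γ' l (fderiv ℝ φ y (v l + b l y))) =
    ∫ y, inner 𝕜 (localRep (spinorFramed θ c) i x₀ R ζ χ y -
      (chartAt (Euc n) x₀ '' tsupport ζ).indicator (fun y =>
        lowerOrder θ c i x₀ R ζ y ((spinorFramed θ c).inFrame i ψ (chartInv x₀ y))) y) (φ y) := by
  have hE := spinorFramed_isGeometric (θ := θ) c
  set K := chartAt (Euc n) x₀ '' tsupport ζ with hKdef
  have hK : IsCompact K := isCompact_chart_tsupport hsupp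
  have hKB : K ⊆ Metric.ball (chartAt (Euc n) x₀ x₀) R := chart_tsupport_subset hsupp
  have hKi : K ⊆ locDom θ i x₀ := (hKB.trans Metric.ball_subset_closedBall).trans hR
  -- The test function is divided by the volume density, so that the weak equation on `M` becomes
  -- one for Lebesgue measure.
  set w : Euc n → S := fun y => densityCutoff g x₀ R ζ y • φ y with hw
  set σ := extSection c i x₀ w with hσdef
  have hσ : (spinorFramed θ c).IsSmooth σ := isSmooth_test c hR hζ hsupp hφ
  set h₂ := K.indicator fun y =>
    lowerOrder θ c i x₀ R ζ y ((spinorFramed θ c).inFrame i ψ (chartInv x₀ y)) with hh₂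
  have hσ0 : ∀ x ∉ tsupport ζ, σ x = 0 := fun x hx =>
    extSection_eq_zero c (K := K) (fun y hy => by rw [hw]; simp only [densityCutoff_eq_zero hR hy, zero_smul])
      (by rwa [hKdef, chartInv_image_chart_tsupport hsupp])
  have hinner : ∀ y ∈ K, ∀ (ξ : M → S) (s t : S), t = cocyc θ c (θ.idx (chartInv x₀ y)) i
      (chartInv x₀ y) s → inner 𝕜 (ξ (chartInv x₀ y)) t =
        inner 𝕜 ((spinorFramed θ c).inFrame i ξ (chartInv x₀ y)) s := fun y hy ξ s t ht => by
    rw [eq_cocyc_inFrame c (hKi hy).2 ξ, ht, inner_cocyc]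
  have hloc : ∀ y ∈ K, ∀ ξ : M → S, localRep (spinorFramed θ c) i x₀ R ζ ξ y =
      ζ (chartInv x₀ y) • (spinorFramed θ c).inFrame i ξ (chartInv x₀ y) := fun y hy ξ =>
    Set.indicator_of_mem (hKB hy) _
  have hφ' : Continuous fun y => ∑ l, c.γ' l (fderiv ℝ φ y (v l + b l y)) :=
    continuous_finsetSum _ fun l _ => (c.γ' l).continuous.comp
      ((hφ.continuous_fderiv (by simp)).clm_apply (continuous_const.add (hb l)))
  have hφc' : HasCompactSupport fun y => ∑ l, c.γ' l (fderiv ℝ φ y (v l + b l y)) :=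
    (hφc.fderiv ℝ).mono fun y hy h => hy (by
      have h' : fderiv ℝ φ y = 0 := h
      simp [h'])
  have hI := hweak (toH1 c hσ)
  rw [inner_L2_congr c (Filter.EventuallyEq.refl _ _) (dirac_toH1 c hσ),
    inner_L2_congr c (Filter.EventuallyEq.refl _ _) (incl_toH1 c hσ)] at hI
  have e1 : ∫ x, inner 𝕜 (ψ x) (c.contract ((spinorFramed θ c).covDeriv σ x))
      ∂(riemannianVolume g) = ∫ y, (inner 𝕜 (localRep (spinorFramed θ c) i x₀ R ζ ψ y)
        (∑ l, c.γ' l (fderiv ℝ φ y (v l + b l y))) + inner 𝕜 (h₂ y) (φ y)) := by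
    refine integral_eq_integral_cutoff θ hsupp (fun x hx => ?_) ?_ (fun y hy => ?_) fun y hy => ?_
    · rw [covDeriv_eq_zero, map_zero, inner_zero_right]
      filter_upwards [(isClosed_tsupport ζ).isOpen_compl.mem_nhds hx] with x' hx'
      exact hσ0 x' hx'
    · exact (Lp.aestronglyMeasurable ψ).inner (c.contract.continuous.comp_aestronglyMeasurable
        (hE.aestronglyMeasurable_covDeriv hσ _))
    · have e : (spinorFramed θ c).inFrame i σ ∘ chartInv x₀ =ᶠ[nhds y] w := by
        filter_upwards [(isOpen_locDom θ i x₀).mem_nhds (hKi hy)] with z hz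
        exact inFrame_extSection_chartInv c hz w
      have e' : locDirac c i x₀ ((spinorFramed θ c).inFrame i σ ∘ chartInv x₀) y =
          locDirac c i x₀ w y := by
        simp only [locDirac, e.fderiv_eq, e.eq_of_nhds]
      rw [hinner y hy ψ _ _ (diracAt_eq_cocyc c (hKi hy).2 hσ),
        contract_covDerivIn_chartInv c (hKi hy) hσ, e',
        volDensity_smul_inner_locDirac c hR hζ hsupp (hKB hy) hφ, hloc y hy, hh₂,
        Set.indicator_of_mem hy]
      simp only [hvb y (Metric.ball_subset_closedBall (hKB hy))]
    · rw [localRep_eq_zero hR _ hy, hh₂, Set.indicator_of_notMem hy, inner_zero_left,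
        inner_zero_left, add_zero]
  have e2 : ∫ x, inner 𝕜 (χ x) (σ x) ∂(riemannianVolume g) =
      ∫ y, inner 𝕜 (localRep (spinorFramed θ c) i x₀ R ζ χ y) (φ y) := by
    refine integral_eq_integral_cutoff θ hsupp (fun x hx => ?_) ?_ (fun y hy => ?_) fun y hy => ?_
    · rw [hσ0 x hx, inner_zero_right]
    · exact (Lp.aestronglyMeasurable χ).inner (hE.aestronglyMeasurable hσ _)
    · rw [hinner y hy χ _ _ (eq_cocyc_inFrame c (hKi hy).2 σ),
        inFrame_extSection_chartInv c (hKi hy), hloc y hy, inner_real_smul_right,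
        inner_real_smul_left, smul_smul, volDensity_mul_densityCutoff hR (hKB hy)]
    · rw [localRep_eq_zero hR _ hy, inner_zero_left]
  have m1 := memLp_localRep c hR hζ (Lp.memLp ψ)
  have m2 := memLp_localRep c hR hζ (Lp.memLp χ)
  have m3 : MemLp h₂ 2 volume := memLp_lowerOrder c hR hζ hsupp (Lp.memLp ψ)
  have m4 : MemLp φ 2 volume := hφ.continuous.memLp_of_hasCompactSupport hφc
  rw [e1, e2, integral_add (integrable_inner_of_memLp m1
    (hφ'.memLp_of_hasCompactSupport hφc')) (integrable_inner_of_memLp m3 m4)] at hI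
  simp only [inner_sub_left]
  rw [integral_sub (integrable_inner_of_memLp m2 m4) (integrable_inner_of_memLp m3 m4), ← hI,
    add_sub_cancel_right]

/-- Weak solutions of the Dirac equation lie in `H¹`. -/
theorem mem_range_incl_of_weak {ψ χ : L2 θ c}
    (hweak : ∀ η : H1 θ c, inner 𝕜 ψ (dirac θ c η) = inner 𝕜 χ (H1.incl θ c η)) :
    ψ ∈ LinearMap.range (H1.incl θ c).toLinearMap := by
  have hcomp : CompleteSpace (H1 θ c) :=
    (Submodule.isClosed_topologicalClosure _).completeSpace_coe
  -- The admissible variation of the frame is dictated by the absorption step of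
  -- `eLpNorm_fderiv_mollify_le`; adding `1` to `k` avoids division by zero.
  have hδ : ∀ x : M, ∃ δ : NNReal, 0 < δ ∧ frameBound θ (θ.idx x) x * n * (n * δ) ≤ 2⁻¹ := by
    intro x
    set k := frameBound θ (θ.idx x) x * n * n
    refine ⟨(2 * (k + 1))⁻¹, by positivity, ?_⟩
    rw [← mul_assoc, mul_inv, ← mul_assoc, mul_comm k, mul_assoc]
    refine mul_le_of_le_one_right (by positivity) ?_
    rw [← div_eq_mul_inv, div_le_one (by positivity)]
    exact le_self_add
  choose δ hδ0 hδ1 using hδ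
  -- The balls are so small that the frame varies by at most `δ x` on the ball of twice the radius,
  -- by continuity of the frame at the centre.
  obtain ⟨t, R, ζ, hR, hζ, hsupp, hsum⟩ := exists_atlas θ (fun x R =>
      Metric.closedBall (chartAt (Euc n) x x) (2 * R) ⊆ locDom θ (θ.idx x) x ∧
      ∀ y ∈ Metric.closedBall (chartAt (Euc n) x x) (2 * R), ∀ l,
        ‖locFrame θ (θ.idx x) x l y - locFrame θ (θ.idx x) x l (chartAt (Euc n) x x)‖ ≤ δ x) <| by
    intro x
    have h1 := (isOpen_locDom θ (θ.idx x) x).mem_nhds (chart_mem_locDom (θ.mem_idx x))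
    have h2 : ∀ᶠ y in nhds (chartAt (Euc n) x x), ∀ l,
        ‖locFrame θ (θ.idx x) x l y - locFrame θ (θ.idx x) x l (chartAt (Euc n) x x)‖ ≤ δ x := by
      refine Filter.eventually_all.2 fun l => ?_
      have hc := (contDiffOn_locFrame θ (θ.idx x) x l).continuousOn.continuousAt h1
      filter_upwards [Metric.tendsto_nhds.1 hc (δ x) (hδ0 x)] with y hy
      rw [← dist_eq_norm]
      exact hy.le
    obtain ⟨r, hr, hr'⟩ := Metric.nhds_basis_closedBall.mem_iff.1 (Filter.inter_mem h1 h2)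
    have e : 2 * (r / 2) = r := by ring
    refine ⟨r / 2, half_pos hr, ?_, ?_, ?_⟩
    · exact (Metric.closedBall_subset_closedBall (half_le_self hr.le)).trans
        fun y hy => (hr' hy).1
    · rw [e]; exact fun y hy => (hr' hy).1
    · rw [e]; exact fun y hy => (hr' hy).2
  rw [eq_sum_cutoff c t (fun a => (hζ a).continuous) hsum ψ]
  refine Submodule.sum_mem _ fun a ha => ?_
  obtain ⟨hR0, hRa, hR2, hRδ⟩ := hR a
  obtain ⟨b, K, hbK, hbδ, hvb⟩ := exists_frame_perturbation hR0 hR2 hRδ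
  obtain ⟨C, hC⟩ := exists_smoothing c hRa (hζ a) (hsupp a ha) (Lp.memLp ψ)
  have m1 := memLp_localRep c hRa (hζ a) (Lp.memLp ψ)
  have m2 := memLp_localRep c hRa (hζ a) (Lp.memLp χ)
  have m3 := memLp_lowerOrder c hRa (hζ a) (hsupp a ha) (Lp.memLp ψ)
  have hest := fun ε (hε : 0 < ε) => eLpNorm_fderiv_mollify_le c (ε := ε) m1
    (hasCompactSupport_localRep c hRa (hsupp a ha) ψ) (m2.sub m3) hbK hbδ
    (norm_le_frameBound (chart_mem_locDom (θ.mem_idx a))) (hδ1 a)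
    (fun φ hφ hφc => weak_localRep c hweak hRa (hζ a) (hsupp a ha)
      (fun l => (hbK l).continuous) hvb hφ hφc) hε
  -- Only finiteness of the bound and its independence of `ε` matter from here on.
  obtain ⟨B, hB, hest⟩ : ∃ B : ℝ≥0∞, B ≠ ⊤ ∧ ∀ ε, 0 < ε → eLpNorm (fderiv ℝ (mollify ε
      (localRep (spinorFramed θ c) (θ.idx a) a (R a) (ζ a) ψ))) 2 volume ≤ B := by
    refine ⟨_, ?_, hest⟩
    have t1 := m1.eLpNorm_ne_top
    have t2 := (m2.sub m3).eLpNorm_ne_top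
    finiteness
  have hBtop : C * (eLpNorm (localRep (spinorFramed θ c) (θ.idx a) a (R a) (ζ a) ψ) 2 volume + B) ≠
      ⊤ := by
    have t1 := m1.eLpNorm_ne_top
    finiteness
  refine mem_range_of_bounded (H1.incl θ c) (C := ENNReal.toReal (C *
    (eLpNorm (localRep (spinorFramed θ c) (θ.idx a) a (R a) (ζ a) ψ) 2 volume + B))) fun d hd => ?_
  obtain ⟨ε, hε, τ, hτ, h1, h2⟩ := hC (ENNReal.ofReal d) (by simpa using hd)
  refine ⟨toH1 c hτ, ?_, ?_⟩
  · rw [← toReal_enorm]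
    refine ENNReal.toReal_mono hBtop (h2.trans ?_)
    exact mul_le_mul_right (add_le_add le_rfl (hest ε hε)) _
  · rw [← ENNReal.ofReal_le_ofReal_iff hd.le, ← edist_dist,
      edist_incl_toH1 c hτ (hζ a).continuous ψ]
    exact h1

end Regularity

end

end WeightedDirac

namespace WeightedDirac

noncomputable section

/-! ### The binomial series of the inverse square root -/

section Series

/-- The coefficients of the power series of `(1 - x)^{-1/2}`. -/
def sqrtCoeff (k : ℕ) : ℝ := Ring.multichoose (1 / 2 : ℝ) k

theorem sqrtCoeff_nonneg (k : ℕ) : 0 ≤ sqrtCoeff k := by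
  have h := Ring.factorial_nsmul_multichoose_eq_ascPochhammer (1 / 2 : ℝ) k
  rw [Polynomial.ascPochhammer_smeval_eq_eval, nsmul_eq_mul] at h
  have h1 : 0 < (ascPochhammer ℝ k).eval (1 / 2 : ℝ) := ascPochhammer_pos k _ (by norm_num)
  rw [← h] at h1
  exact (pos_of_mul_pos_right h1 (by positivity)).le

theorem sqrtCoeff_eq (k : ℕ) : sqrtCoeff k = (-1) ^ k * Ring.choose (-(1 / 2) : ℝ) k := by
  rw [Ring.choose_neg, ← Ring.multichoose_eq, sqrtCoeff]
  simp [← mul_assoc, ← mul_pow, Units.smul_def]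

/-- Vandermonde's identity for the exponents `-1/2` and `-1/2` with sum `-1`: the square of the
series is the geometric series. -/
theorem sum_sqrtCoeff (k : ℕ) :
    ∑ ij ∈ Finset.HasAntidiagonal.antidiagonal k, sqrtCoeff ij.1 * sqrtCoeff ij.2 = 1 := by
  have h := Ring.add_choose_eq k (Commute.all (-(1 / 2) : ℝ) (-(1 / 2)))
  have h1 : (-(1 / 2) : ℝ) + -(1 / 2) = -1 := by norm_num
  rw [h1, Ring.choose_neg, ← Ring.multichoose_eq, Ring.multichoose_one] at h
  have h2 : ∑ ij ∈ Finset.HasAntidiagonal.antidiagonal k, sqrtCoeff ij.1 * sqrtCoeff ij.2 =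
      (-1) ^ k * ∑ ij ∈ Finset.HasAntidiagonal.antidiagonal k,
        Ring.choose (-(1 / 2) : ℝ) ij.1 * Ring.choose (-(1 / 2) : ℝ) ij.2 := by
    rw [Finset.mul_sum]
    refine Finset.sum_congr rfl fun ij hij => ?_
    rw [sqrtCoeff_eq, sqrtCoeff_eq, ← Finset.HasAntidiagonal.mem_antidiagonal.1 hij, pow_add]
    ring
  rw [h2, ← h]
  simp [← mul_pow, Units.smul_def]

theorem sqrtCoeff_zero : sqrtCoeff 0 = 1 := by simp [sqrtCoeff]

/-- The product `c_0 c_k = c_k` is one of the nonnegative terms of a sum equal to `1`. Thus the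
series is dominated by the geometric one. -/
theorem sqrtCoeff_le_one (k : ℕ) : sqrtCoeff k ≤ 1 := by
  rw [← sum_sqrtCoeff k]
  refine le_trans ?_ (Finset.single_le_sum (f := fun ij : ℕ × ℕ => sqrtCoeff ij.1 * sqrtCoeff ij.2)
    (fun ij _ => mul_nonneg (sqrtCoeff_nonneg _) (sqrtCoeff_nonneg _))
    (Finset.HasAntidiagonal.mem_antidiagonal.2 (zero_add k) : ((0, k) : ℕ × ℕ) ∈ _))
  simp [sqrtCoeff_zero]

variable {𝕜 : Type*} [RCLike 𝕜] {𝔸 : Type*} [NormedRing 𝔸] [NormedAlgebra 𝕜 𝔸]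

theorem norm_sqrtCoeff_smul_le (k : ℕ) (a : 𝔸) : ‖(sqrtCoeff k : 𝕜) • a‖ ≤ ‖a‖ := by
  rw [norm_smul, RCLike.norm_ofReal, abs_of_nonneg (sqrtCoeff_nonneg k)]
  exact mul_le_of_le_one_left (norm_nonneg _) (sqrtCoeff_le_one k)

variable (𝕜) in
/-- The power series of `(1 - X)^{-1/2}`. -/
def invSqrtSeries (X : 𝔸) : 𝔸 := ∑' k, (sqrtCoeff k : 𝕜) • X ^ k

variable [CompleteSpace 𝔸] {X : 𝔸}

theorem summable_sqrtCoeff_smul (hX : Summable fun k => ‖X ^ k‖) :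
    Summable fun k => ‖(sqrtCoeff k : 𝕜) • X ^ k‖ :=
  hX.of_nonneg_of_le (fun _ => norm_nonneg _) fun k => norm_sqrtCoeff_smul_le k _

theorem hasSum_invSqrtSeries (hX : Summable fun k => ‖X ^ k‖) :
    HasSum (fun k => (sqrtCoeff k : 𝕜) • X ^ k) (invSqrtSeries 𝕜 X) :=
  (summable_sqrtCoeff_smul hX).of_norm.hasSum

theorem commute_invSqrtSeries {B : 𝔸} (hB : Commute B X) :
    Commute B (invSqrtSeries 𝕜 X) :=
  Commute.tsum_right B fun k => (hB.pow_right k).smul_right _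

/-- The Cauchy product of the series with itself is the Neumann series of `1 - X`. -/
theorem invSqrtSeries_mul_self (hX : Summable fun k => ‖X ^ k‖) :
    (1 - X) * (invSqrtSeries 𝕜 X * invSqrtSeries 𝕜 X) = 1 := by
  have h := tsum_mul_tsum_eq_tsum_sum_antidiagonal_of_summable_norm
    (summable_sqrtCoeff_smul (𝕜 := 𝕜) hX) (summable_sqrtCoeff_smul (𝕜 := 𝕜) hX)
  have e : ∀ k, ∑ ij ∈ Finset.HasAntidiagonal.antidiagonal k,
      (sqrtCoeff ij.1 : 𝕜) • X ^ ij.1 * (sqrtCoeff ij.2 : 𝕜) • X ^ ij.2 = X ^ k := fun k => by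
    have h1 : ∑ ij ∈ Finset.HasAntidiagonal.antidiagonal k,
        (sqrtCoeff ij.1 : 𝕜) • X ^ ij.1 * (sqrtCoeff ij.2 : 𝕜) • X ^ ij.2 =
        ∑ ij ∈ Finset.HasAntidiagonal.antidiagonal k, ((sqrtCoeff ij.1 * sqrtCoeff ij.2 : ℝ) : 𝕜) • X ^ k := by
      refine Finset.sum_congr rfl fun ij hij => ?_
      rw [smul_mul_smul_comm, ← pow_add, Finset.HasAntidiagonal.mem_antidiagonal.1 hij, RCLike.ofReal_mul]
    rw [h1, ← Finset.sum_smul, ← RCLike.ofReal_sum, sum_sqrtCoeff, RCLike.ofReal_one, one_smul]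
  simp only [e] at h
  rw [invSqrtSeries, h]
  have hs := hX.of_norm
  rw [sub_mul, one_mul, ← hs.tsum_mul_left, hs.tsum_eq_zero_add]
  simp [pow_succ']

/-- Continuous dependence of the series on parameters. -/
theorem continuous_invSqrtSeries {Y : Type*} [TopologicalSpace Y] {N : Y → 𝔸} (hN : Continuous N)
    {q : ℝ} (hq0 : 0 ≤ q) (hq : q < 1) {r : Y → ℝ} (hr : Continuous r)
    (hb : ∀ A (k : ℕ), ‖N A ^ k‖ ≤ q ^ k * (2 + k * r A)) :
    Continuous fun A => invSqrtSeries 𝕜 (N A) := by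
  refine continuous_iff_continuousAt.2 fun A₀ => ?_
  have ho : IsOpen {A | r A < r A₀ + 1} := isOpen_lt hr continuous_const
  -- On the neighbourhood where `r < r A₀ + 1` one summable majorant serves all parameters, so the
  -- convergence there is uniform.
  have hs : Summable fun k : ℕ => q ^ k * (2 + k * (r A₀ + 1)) := by
    have h1 := (summable_geometric_of_lt_one hq0 hq).mul_left 2
    have h2 := (summable_pow_mul_geometric_of_norm_lt_one 1
      (by rwa [Real.norm_of_nonneg hq0] : ‖q‖ < 1)).mul_left (r A₀ + 1)
    refine (h1.add h2).congr fun k => ?_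
    ring
  have hc : ContinuousOn (fun A => invSqrtSeries 𝕜 (N A)) {A | r A < r A₀ + 1} := by
    refine continuousOn_tsum (fun k => ((hN.pow k).const_smul _).continuousOn) hs
      fun k A hA => (norm_sqrtCoeff_smul_le k _).trans ((hb A k).trans ?_)
    have hA' : r A ≤ r A₀ + 1 := le_of_lt hA
    gcongr
  exact hc.continuousAt (ho.mem_nhds (by simp))

end Series

/-! ### Positive square roots -/

section PosSqrt

variable {𝕜 : Type*} [RCLike 𝕜] {S : Type*} [NormedAddCommGroup S] [InnerProductSpace 𝕜 S]
  [CompleteSpace S]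

/-- Nonnegativity of the form is used at `s - q⁻¹ T s`, and the upper bound at `s` and at `q⁻¹ T s`;
together they give `q⁻¹ ‖T s‖² ≤ q ‖s‖²`. This avoids spectral theory and works over both fields. -/
theorem norm_apply_le_of_form_le {T : S →L[𝕜] S} {q : ℝ} (hq : 0 < q)
    (hs : ∀ s t, inner 𝕜 (T s) t = inner 𝕜 s (T t))
    (h0 : ∀ s, 0 ≤ RCLike.re (inner 𝕜 (T s) s))
    (hb : ∀ s, RCLike.re (inner 𝕜 (T s) s) ≤ q * ‖s‖ ^ 2) (s : S) : ‖T s‖ ≤ q * ‖s‖ := by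
  set t : S := ((q⁻¹ : ℝ) : 𝕜) • T s with ht
  have h1 : RCLike.re (inner 𝕜 (T t) s) = RCLike.re (inner 𝕜 (T s) t) := by
    rw [hs t s, ← inner_conj_symm, RCLike.conj_re]
  have h2 : RCLike.re (inner 𝕜 (T s) t) = q⁻¹ * ‖T s‖ ^ 2 := by
    rw [ht, inner_smul_right, RCLike.re_ofReal_mul, inner_self_eq_norm_sq]
  have h3 : ‖t‖ = q⁻¹ * ‖T s‖ := by
    rw [ht, norm_smul, RCLike.norm_ofReal, abs_of_pos (inv_pos.2 hq)]
  have h4 := hb s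
  have h5 := hb t
  have h6 := h0 (s - t)
  simp only [map_sub, inner_sub_left, inner_sub_right] at h6
  rw [h1, h2] at h6
  rw [h3] at h5
  have h7 : q * (q⁻¹ * ‖T s‖) ^ 2 = q⁻¹ * ‖T s‖ ^ 2 := by field_simp
  rw [h7] at h5
  have h8 : q⁻¹ * ‖T s‖ ^ 2 ≤ q * ‖s‖ ^ 2 := by linarith
  refine (sq_le_sq₀ (norm_nonneg _) (by positivity)).1 ?_
  have := mul_le_mul_of_nonneg_left h8 hq.le
  rw [← mul_assoc, mul_inv_cancel₀ hq.ne', one_mul] at this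
  nlinarith

/-- The contraction `1 - T / Λ₂` that belongs to an endomorphism with `Λ₁ ≤ T ≤ Λ₂`. -/
def defect (Λ₂ : ℝ) {E : Type*} [NormedAddCommGroup E] [NormedSpace 𝕜 E] (T : E →L[𝕜] E) :
    E →L[𝕜] E := 1 - ((Λ₂⁻¹ : ℝ) : 𝕜) • T

/-- The contraction factor. -/
def ratio (Λ₁ Λ₂ : ℝ) : ℝ := max (1 - Λ₁ / Λ₂) (1 / 2)

variable {Λ₁ Λ₂ : ℝ}

theorem ratio_pos : 0 < ratio Λ₁ Λ₂ := lt_of_lt_of_le (by norm_num) (le_max_right _ _)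

/-- The floor `1/2` keeps the factor positive even for `Λ₁ = Λ₂`, and it is a hypothesis of
`norm_pow_le_of_contraction`. -/
theorem half_le_ratio : 1 / 2 ≤ ratio Λ₁ Λ₂ := le_max_right _ _

theorem ratio_lt_one (h1 : 0 < Λ₁) (h2 : Λ₁ ≤ Λ₂) : ratio Λ₁ Λ₂ < 1 :=
  max_lt (by have := div_pos h1 (h1.trans_le h2); linarith) (by norm_num)

/-- Self-adjoint endomorphisms with `Λ₁ ≤ T ≤ Λ₂`. -/
structure IsBounded (Λ₁ Λ₂ : ℝ) (T : S →L[𝕜] S) : Prop where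
  symm : ∀ s t, inner 𝕜 (T s) t = inner 𝕜 s (T t)
  lower : ∀ s, Λ₁ * ‖s‖ ^ 2 ≤ RCLike.re (inner 𝕜 (T s) s)
  upper : ∀ s, RCLike.re (inner 𝕜 (T s) s) ≤ Λ₂ * ‖s‖ ^ 2

variable {T : S →L[𝕜] S}

theorem IsBounded.symm_defect (hT : IsBounded Λ₁ Λ₂ T) (s t : S) :
    inner 𝕜 (defect Λ₂ T s) t = inner 𝕜 s (defect Λ₂ T t) := by
  simp only [defect, sub_apply, smul_apply, one_apply_eq_self, inner_sub_left,
    inner_sub_right, inner_smul_left, inner_smul_right, hT.symm, RCLike.conj_ofReal]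

theorem re_inner_defect (s : S) : RCLike.re (inner 𝕜 (defect Λ₂ T s) s) =
    ‖s‖ ^ 2 - Λ₂⁻¹ * RCLike.re (inner 𝕜 (T s) s) := by
  simp only [defect, sub_apply, smul_apply, one_apply_eq_self, inner_sub_left,
    inner_smul_left, RCLike.conj_ofReal, map_sub, RCLike.re_ofReal_mul, inner_self_eq_norm_sq]

theorem IsBounded.defect_nonneg (hT : IsBounded Λ₁ Λ₂ T) (h1 : 0 < Λ₁) (h2 : Λ₁ ≤ Λ₂) (s : S) :
    0 ≤ RCLike.re (inner 𝕜 (defect Λ₂ T s) s) := by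
  have h : 0 < Λ₂ := h1.trans_le h2
  rw [re_inner_defect]
  have := mul_le_mul_of_nonneg_left (hT.upper s) (inv_pos.2 h).le
  rw [← mul_assoc, inv_mul_cancel₀ h.ne', one_mul] at this
  linarith

theorem IsBounded.norm_defect_apply_le (hT : IsBounded Λ₁ Λ₂ T) (h1 : 0 < Λ₁) (h2 : Λ₁ ≤ Λ₂)
    (s : S) : ‖defect Λ₂ T s‖ ≤ ratio Λ₁ Λ₂ * ‖s‖ := by
  have h : 0 < Λ₂ := h1.trans_le h2
  refine norm_apply_le_of_form_le ratio_pos hT.symm_defect (hT.defect_nonneg h1 h2) (fun s => ?_) s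
  rw [re_inner_defect]
  have := mul_le_mul_of_nonneg_left (hT.lower s) (inv_pos.2 h).le
  have h3 : (1 - Λ₁ / Λ₂) * ‖s‖ ^ 2 ≤ ratio Λ₁ Λ₂ * ‖s‖ ^ 2 :=
    mul_le_mul_of_nonneg_right (le_max_left _ _) (sq_nonneg _)
  have h4 : Λ₂⁻¹ * (Λ₁ * ‖s‖ ^ 2) = Λ₁ / Λ₂ * ‖s‖ ^ 2 := by field_simp
  rw [h4] at this
  linarith

theorem IsBounded.norm_defect_pow_le (hT : IsBounded Λ₁ Λ₂ T) (h1 : 0 < Λ₁) (h2 : Λ₁ ≤ Λ₂)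
    (k : ℕ) : ‖defect Λ₂ T ^ k‖ ≤ ratio Λ₁ Λ₂ ^ k := by
  have hn : ‖defect Λ₂ T‖ ≤ ratio Λ₁ Λ₂ :=
    ContinuousLinearMap.opNorm_le_bound _ ratio_pos.le (hT.norm_defect_apply_le h1 h2)
  -- The power zero is separate, since the identity of a trivial space has norm `0` and
  -- submultiplicativity gives nothing there.
  rcases k with _ | k
  · rw [pow_zero, pow_zero]
    exact ContinuousLinearMap.norm_id_le
  · exact (norm_pow_le' _ k.succ_pos).trans (pow_le_pow_left₀ (norm_nonneg _) hn _)

theorem IsBounded.summable (hT : IsBounded Λ₁ Λ₂ T) (h1 : 0 < Λ₁) (h2 : Λ₁ ≤ Λ₂) :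
    Summable fun k => ‖defect Λ₂ T ^ k‖ :=
  (summable_geometric_of_lt_one ratio_pos.le (ratio_lt_one h1 h2)).of_nonneg_of_le
    (fun _ => norm_nonneg _) (hT.norm_defect_pow_le h1 h2)

theorem IsBounded.symm_defect_pow (hT : IsBounded Λ₁ Λ₂ T) (k : ℕ) (s t : S) :
    inner 𝕜 ((defect Λ₂ T ^ k) s) t = inner 𝕜 s ((defect Λ₂ T ^ k) t) := by
  induction k generalizing s t with
  | zero => simp
  | succ k ih =>
    rw [pow_succ', mul_apply_eq_comp, hT.symm_defect, ih, ← mul_apply_eq_comp,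
      ← pow_succ, pow_succ']

/-- An even power is the square of a symmetric operator, and an odd one is the nonnegative defect
between two equal powers. -/
theorem IsBounded.defect_pow_nonneg (hT : IsBounded Λ₁ Λ₂ T) (h1 : 0 < Λ₁) (h2 : Λ₁ ≤ Λ₂) (k : ℕ)
    (s : S) : 0 ≤ RCLike.re (inner 𝕜 ((defect Λ₂ T ^ k) s) s) := by
  obtain ⟨j, rfl | rfl⟩ := Nat.even_or_odd' k
  · rw [two_mul, pow_add, mul_apply_eq_comp, hT.symm_defect_pow, inner_self_eq_norm_sq]
    positivity
  · have e : defect Λ₂ T ^ (2 * j + 1) = defect Λ₂ T ^ j * (defect Λ₂ T * defect Λ₂ T ^ j) := by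
      rw [← pow_succ', ← pow_add]
      congr 1
      ring
    rw [e, mul_apply_eq_comp, hT.symm_defect_pow, mul_apply_eq_comp]
    exact hT.defect_nonneg h1 h2 _

/-- The inverse `T^{-1/2}` of the square root of `T`, as a power series. -/
def invRoot (Λ₂ : ℝ) {E : Type*} [NormedAddCommGroup E] [NormedSpace 𝕜 E] (T : E →L[𝕜] E) :
    E →L[𝕜] E := (((Real.sqrt Λ₂)⁻¹ : ℝ) : 𝕜) • invSqrtSeries 𝕜 (defect Λ₂ T)

theorem commute_invRoot {E : Type*} [NormedAddCommGroup E] [NormedSpace 𝕜 E] [CompleteSpace E]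
    {T B : E →L[𝕜] E}
    (hB : Commute B T) : Commute B (invRoot Λ₂ T) :=
  (commute_invSqrtSeries ((Commute.one_right B).sub_right (hB.smul_right _))).smul_right _

theorem mul_invRoot_mul_invRoot {E : Type*} [NormedAddCommGroup E] [NormedSpace 𝕜 E]
    [CompleteSpace E] {T : E →L[𝕜] E} (hΛ : 0 < Λ₂)
    (hs : Summable fun k => ‖defect Λ₂ T ^ k‖) :
    T * (invRoot Λ₂ T * invRoot Λ₂ T) = 1 := by
  have h := invSqrtSeries_mul_self (𝕜 := 𝕜) hs
  have e : (1 : E →L[𝕜] E) - defect Λ₂ T = ((Λ₂⁻¹ : ℝ) : 𝕜) • T := by rw [defect, sub_sub_cancel]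
  rw [e, smul_mul_assoc, ← mul_smul_comm] at h
  rw [invRoot, smul_mul_smul_comm, ← RCLike.ofReal_mul, ← mul_inv, Real.mul_self_sqrt hΛ.le]
  exact h

theorem IsBounded.hasSum_invRoot_series (hT : IsBounded Λ₁ Λ₂ T) (h1 : 0 < Λ₁) (h2 : Λ₁ ≤ Λ₂)
    (s : S) : HasSum (fun k => (sqrtCoeff k : 𝕜) • (defect Λ₂ T ^ k) s)
      (invSqrtSeries 𝕜 (defect Λ₂ T) s) :=
  (hasSum_invSqrtSeries (𝕜 := 𝕜) (hT.summable h1 h2)).mapL (ContinuousLinearMap.apply 𝕜 S s)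

theorem IsBounded.symm_invRoot (hT : IsBounded Λ₁ Λ₂ T) (h1 : 0 < Λ₁) (h2 : Λ₁ ≤ Λ₂) (s t : S) :
    inner 𝕜 (invRoot Λ₂ T s) t = inner 𝕜 s (invRoot Λ₂ T t) := by
  have ht := (hT.hasSum_invRoot_series h1 h2 t).mapL (innerSL 𝕜 s)
  have hs := ((hT.hasSum_invRoot_series h1 h2 s).mapL (innerSL 𝕜 t)).map
    (starRingEnd 𝕜) RCLike.continuous_conj
  have e : inner 𝕜 (invSqrtSeries 𝕜 (defect Λ₂ T) s) t =
      inner 𝕜 s (invSqrtSeries 𝕜 (defect Λ₂ T) t) := by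
    rw [← inner_conj_symm]
    refine HasSum.unique hs ?_
    refine ht.congr_fun fun k => ?_
    simp only [Function.comp_apply, innerSL_apply_apply, inner_smul_right, map_mul,
      RCLike.conj_ofReal, inner_conj_symm, hT.symm_defect_pow]
  simp only [invRoot, smul_apply, inner_smul_left, inner_smul_right, RCLike.conj_ofReal, e]

/-- Every term of the series is a nonnegative form, and the term `k = 0` alone gives the lower
bound. It is this strict positivity that makes the root unique below. -/
theorem IsBounded.invRoot_ge (hT : IsBounded Λ₁ Λ₂ T) (h1 : 0 < Λ₁) (h2 : Λ₁ ≤ Λ₂) (s : S) :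
    (Real.sqrt Λ₂)⁻¹ * ‖s‖ ^ 2 ≤ RCLike.re (inner 𝕜 s (invRoot Λ₂ T s)) := by
  have hs := ((hT.hasSum_invRoot_series h1 h2 s).mapL (innerSL 𝕜 s)).mapL
    (RCLike.reCLM (K := 𝕜))
  have h := le_hasSum hs 0 fun k _ => by
    have := mul_nonneg (sqrtCoeff_nonneg k) (hT.defect_pow_nonneg h1 h2 k s)
    rwa [innerSL_apply_apply, inner_smul_right, ← hT.symm_defect_pow, RCLike.reCLM_apply,
      RCLike.re_ofReal_mul]
  rw [invRoot, smul_apply, inner_smul_right, RCLike.re_ofReal_mul]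
  refine mul_le_mul_of_nonneg_left ?_ (by positivity)
  simpa [sqrtCoeff_zero] using h

theorem IsBounded.mul_invRoot_isPositive (hT : IsBounded Λ₁ Λ₂ T) (h1 : 0 < Λ₁) (h2 : Λ₁ ≤ Λ₂) :
    (T * invRoot Λ₂ T).IsPositive := by
  have hc : Commute T (invRoot Λ₂ T) := commute_invRoot (Commute.refl T)
  have hi := mul_invRoot_mul_invRoot (h1.trans_le h2) (hT.summable h1 h2)
  refine ⟨fun s t => ?_, fun s => ?_⟩
  · change inner 𝕜 ((T * invRoot Λ₂ T) s) t = inner 𝕜 s ((T * invRoot Λ₂ T) t)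
    rw [hc.eq, mul_apply_eq_comp, hT.symm_invRoot h1 h2, hT.symm, ← hc.eq,
      mul_apply_eq_comp]
  · have e : invRoot Λ₂ T ((T * invRoot Λ₂ T) s) = s := by
      have : invRoot Λ₂ T * (T * invRoot Λ₂ T) = 1 := by rw [← mul_assoc, ← hc.eq, mul_assoc, hi]
      rw [← mul_apply_eq_comp, this, one_apply_eq_self]
    have := hT.invRoot_ge h1 h2 ((T * invRoot Λ₂ T) s)
    rw [e] at this
    exact le_trans (by positivity) this

/-- Uniqueness of the positive square root. Any positive `R` with `R² = T` commutes with `T`, hence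
with the candidate `P = T · invRoot`, so that `(R + P)(R - P) = 0`. For `t = (R - P) s` both forms
are nonnegative with sum zero; `invRoot_ge` gives `P t = 0`, and `P` is injective. -/
theorem IsBounded.posSqrt_eq (hT : IsBounded Λ₁ Λ₂ T) (h1 : 0 < Λ₁) (h2 : Λ₁ ≤ Λ₂) :
    posSqrt T = T * invRoot Λ₂ T := by
  have hc : Commute T (invRoot Λ₂ T) := commute_invRoot (Commute.refl T)
  have hi := mul_invRoot_mul_invRoot (h1.trans_le h2) (hT.summable h1 h2)
  have hP := hT.mul_invRoot_isPositive h1 h2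
  have hsq : (T * invRoot Λ₂ T) * (T * invRoot Λ₂ T) = T := by
    rw [mul_assoc, ← mul_assoc (invRoot Λ₂ T), ← hc.eq, mul_assoc, hi, mul_one]
  have hex : ∃ R : S →L[𝕜] S, R.IsPositive ∧ R.comp R = T := ⟨_, hP, hsq⟩
  rw [posSqrt, dif_pos hex]
  obtain ⟨hR, hRR⟩ := hex.choose_spec
  set R := hex.choose
  have hRT : Commute R T := by
    rw [← hRR]
    exact (Commute.refl R).mul_right (Commute.refl R)
  have hRP : Commute R (T * invRoot Λ₂ T) := hRT.mul_right (commute_invRoot hRT)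
  have hz : (R + T * invRoot Λ₂ T) * (R - T * invRoot Λ₂ T) = 0 := by
    have hRR' : R * R = T := hRR
    rw [add_mul, mul_sub, mul_sub, hRR', hsq, hRP.eq]
    abel
  refine sub_eq_zero.1 (ContinuousLinearMap.ext fun s => ?_)
  set t := (R - T * invRoot Λ₂ T) s
  have ht : R t + (T * invRoot Λ₂ T) t = 0 := congrArg (fun B : S →L[𝕜] S => B s) hz
  have e : invRoot Λ₂ T ((T * invRoot Λ₂ T) t) = t := by
    have : invRoot Λ₂ T * (T * invRoot Λ₂ T) = 1 := by rw [← mul_assoc, ← hc.eq, mul_assoc, hi]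
    rw [← mul_apply_eq_comp, this, one_apply_eq_self]
  have h3 := hT.invRoot_ge h1 h2 ((T * invRoot Λ₂ T) t)
  rw [e] at h3
  have h4 : 0 ≤ RCLike.re (inner 𝕜 (R t) t) := hR.2 t
  have h5 : RCLike.re (inner 𝕜 (R t) t) + RCLike.re (inner 𝕜 ((T * invRoot Λ₂ T) t) t) = 0 := by
    rw [← map_add, ← inner_add_left, ht, inner_zero_left, map_zero]
  have h6 : (Real.sqrt Λ₂)⁻¹ * ‖(T * invRoot Λ₂ T) t‖ ^ 2 ≤ 0 := by linarith
  have h7 : 0 < (Real.sqrt Λ₂)⁻¹ := inv_pos.2 (Real.sqrt_pos.2 (h1.trans_le h2))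
  have h8 : ‖(T * invRoot Λ₂ T) t‖ ^ 2 ≤ 0 := nonpos_of_mul_nonpos_right h6 h7
  have h9 : (T * invRoot Λ₂ T) t = 0 :=
    norm_eq_zero.1 ((pow_eq_zero_iff two_ne_zero).1 (le_antisymm h8 (sq_nonneg _)))
  rw [← e, h9, map_zero]
  rfl

theorem IsBounded.inverse_posSqrt (hT : IsBounded Λ₁ Λ₂ T) (h1 : 0 < Λ₁) (h2 : Λ₁ ≤ Λ₂) :
    Ring.inverse (posSqrt T) = invRoot Λ₂ T := by
  have hc : Commute T (invRoot Λ₂ T) := commute_invRoot (Commute.refl T)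
  have hi := mul_invRoot_mul_invRoot (h1.trans_le h2) (hT.summable h1 h2)
  rw [hT.posSqrt_eq h1 h2]
  exact Ring.inverse_unit ⟨T * invRoot Λ₂ T, invRoot Λ₂ T, by rw [mul_assoc, hi],
    by rw [← mul_assoc, ← hc.eq, mul_assoc, hi]⟩

theorem IsBounded.inverse_eq (hT : IsBounded Λ₁ Λ₂ T) (h1 : 0 < Λ₁) (h2 : Λ₁ ≤ Λ₂) :
    Ring.inverse T = invRoot Λ₂ T * invRoot Λ₂ T := by
  have hc : Commute T (invRoot Λ₂ T) := commute_invRoot (Commute.refl T)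
  have hi := mul_invRoot_mul_invRoot (h1.trans_le h2) (hT.summable h1 h2)
  exact Ring.inverse_unit ⟨T, invRoot Λ₂ T * invRoot Λ₂ T, hi,
    by rw [← (hc.mul_right hc).eq, hi]⟩

end PosSqrt

end

end WeightedDirac

namespace WeightedDirac

noncomputable section

/-! ### Multiplication of spinors by Sobolev endomorphisms -/

section Multiplication

variable {𝕜 : Type*} [RCLike 𝕜] {n : ℕ} {S : Type*} [NormedAddCommGroup S] [InnerProductSpace 𝕜 S]
  [FiniteDimensional 𝕜 S]

variable (𝕜 S n) in
/-- The bilinear map `(F, (Ψ_l)_l) ↦ (F Ψ_l)_l`. -/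
def applyDeriv : (S →L[𝕜] S) →L[𝕜] PiLp 2 (fun _ : Fin n => S) →L[𝕜] PiLp 2 (fun _ : Fin n => S) :=
  LinearMap.toContinuousBilinearMap (LinearMap.mk₂ 𝕜
    (fun F Ψ => WithLp.toLp 2 fun l => F (Ψ l)) (fun _ _ _ => rfl) (fun _ _ _ => rfl)
    (fun F Ψ Ψ' => by ext l; simp) fun a F Ψ => by ext l; simp)

@[simp]
theorem applyDeriv_apply (F : S →L[𝕜] S) (Ψ : PiLp 2 (fun _ : Fin n => S)) (l : Fin n) :
    applyDeriv 𝕜 n S F Ψ l = F (Ψ l) := rfl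

variable (𝕜 S n) in
/-- The bilinear map `((Φ_l)_l, s) ↦ (Φ_l s)_l`. -/
def derivApply : PiLp 2 (fun _ : Fin n => S →L[𝕜] S) →L[𝕜] S →L[𝕜] PiLp 2 (fun _ : Fin n => S) :=
  LinearMap.toContinuousBilinearMap (LinearMap.mk₂ 𝕜
    (fun Φ s => WithLp.toLp 2 fun l => Φ l s) (fun _ _ _ => rfl) (fun _ _ _ => rfl)
    (fun Φ s s' => by ext l; simp) fun a Φ s => by ext l; simp)

@[simp]
theorem derivApply_apply (Φ : PiLp 2 (fun _ : Fin n => S →L[𝕜] S)) (s : S) (l : Fin n) :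
    derivApply 𝕜 n S Φ s l = Φ l s := rfl

theorem norm_piLp_le_of_forall {q : ℝ} (hq : 0 ≤ q) {Ψ Ψ' : PiLp 2 (fun _ : Fin n => S)}
    (h : ∀ l, ‖Ψ l‖ ≤ q * ‖Ψ' l‖) : ‖Ψ‖ ≤ q * ‖Ψ'‖ := by
  refine (sq_le_sq₀ (norm_nonneg _) (by positivity)).1 ?_
  rw [mul_pow, PiLp.norm_sq_eq_of_L2, PiLp.norm_sq_eq_of_L2, Finset.mul_sum]
  refine Finset.sum_le_sum fun l _ => ?_
  rw [← mul_pow]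
  exact pow_le_pow_left₀ (norm_nonneg _) (h l) 2

/-- The bilinear map with the components `m₀` and `m₁`, with values in a subspace. -/
def bilinearPair {W H X Y : Type*} [NormedAddCommGroup W] [NormedSpace 𝕜 W] [NormedAddCommGroup H]
    [NormedSpace 𝕜 H] [NormedAddCommGroup X] [NormedSpace 𝕜 X] [NormedAddCommGroup Y]
    [NormedSpace 𝕜 Y] (m₀ : W →L[𝕜] H →L[𝕜] X) (m₁ : W →L[𝕜] H →L[𝕜] Y)
    (Z : Submodule 𝕜 (WithLp 2 (X × Y))) (h : ∀ F ψ, WithLp.toLp 2 (m₀ F ψ, m₁ F ψ) ∈ Z) :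
    W →L[𝕜] H →L[𝕜] Z :=
  LinearMap.mkContinuous₂ (LinearMap.mk₂ 𝕜
    (fun F ψ => (⟨WithLp.toLp 2 (m₀ F ψ, m₁ F ψ), h F ψ⟩ : Z))
    (fun F F' ψ => Subtype.ext (congrArg (WithLp.toLp 2) (by simp)))
    (fun a F ψ => Subtype.ext (congrArg (WithLp.toLp 2) (by simp)))
    (fun F ψ ψ' => Subtype.ext (congrArg (WithLp.toLp 2) (by simp)))
    fun a F ψ => Subtype.ext (congrArg (WithLp.toLp 2) (by simp)))
    (‖m₀‖ + ‖m₁‖) fun F ψ => by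
      have h0 := m₀.le_opNorm₂ F ψ
      have h1 := m₁.le_opNorm₂ F ψ
      have hs := WithLp.prod_norm_sq_eq_of_L2 (WithLp.toLp 2 (m₀ F ψ, m₁ F ψ))
      have hle : ‖WithLp.toLp 2 (m₀ F ψ, m₁ F ψ)‖ ≤ ‖m₀ F ψ‖ + ‖m₁ F ψ‖ := by
        refine (sq_le_sq₀ (norm_nonneg _) (by positivity)).1 ?_
        rw [hs, add_sq]
        have := mul_nonneg (norm_nonneg (m₀ F ψ)) (norm_nonneg (m₁ F ψ))
        change ‖m₀ F ψ‖ ^ 2 + ‖m₁ F ψ‖ ^ 2 ≤ _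
        linarith
      rw [add_mul, add_mul]
      exact hle.trans (add_le_add h0 h1)

variable {M : Type*} [TopologicalSpace M] [T2Space M] [CompactSpace M]
  [ChartedSpace (EuclideanSpace ℝ (Fin n)) M] [IsManifold (𝓡 n) ∞ M]
  [MeasurableSpace M] [BorelSpace M] {g : RMetric n M} {θ : SpinStructure g}
  [NormedSpace ℝ S] [IsScalarTower ℝ 𝕜 S] [CompleteSpace S] {c : CliffordModule 𝕜 n S}
  {p : ℝ≥0∞} [Fact (1 ≤ p)]

/-- The embeddings `W^{1,p} ⊆ L^∞` of endomorphisms and `H¹ ⊆ L^q` of spinors, where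
`1/q = 1/2 - 1/p`. -/
structure Embeddings (θ : SpinStructure g) (c : CliffordModule 𝕜 n S) (p q : ℝ≥0∞) [Fact (1 ≤ p)]
    [Fact (1 ≤ q)] where
  bdd : WeightSpace θ c p →L[𝕜] Lp (S →L[𝕜] S) ⊤ (riemannianVolume g)
  bdd_ae : ∀ F, bdd F =ᵐ[riemannianVolume g] weightField F
  lq : H1 θ c →L[𝕜] Lp S q (riemannianVolume g)
  lq_ae : ∀ ψ, lq ψ =ᵐ[riemannianVolume g] H1.incl θ c ψ

variable (c) in
-- The exponent `1/q = 1/2 - 1/p` is the Hölder partner that places `(∇F)ψ` in `L²`. It is positive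
-- since `p > n ≥ 2`.
theorem exists_embeddings (hn : 2 ≤ n) (hnp : (n : ℝ≥0∞) < p) (hp : p ≠ ⊤) :
    ∃ (q : ℝ≥0∞) (_ : Fact (1 ≤ q)) (_ : ENNReal.HolderTriple p q 2),
      Nonempty (Embeddings θ c p q) := by
  have hfS : FiniteDimensional ℝ S := FiniteDimensional.trans ℝ 𝕜 S
  have hfE : FiniteDimensional ℝ (S →L[𝕜] S) := FiniteDimensional.trans ℝ 𝕜 (S →L[𝕜] S)
  lift p to NNReal using hp
  have hp2 : 2 < (p : ℝ) := by
    have h1 : (n : NNReal) < p := by exact_mod_cast hnp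
    have h2 : ((n : NNReal) : ℝ) < p := by exact_mod_cast h1
    have h3 : (2 : ℝ) ≤ n := by exact_mod_cast hn
    simpa using h3.trans_lt (by simpa using h2)
  have hpos : 0 < 2⁻¹ - (p : ℝ)⁻¹ := by
    rw [sub_pos]
    exact inv_strictAnti₀ two_pos hp2
  set q : NNReal := ⟨(2⁻¹ - (p : ℝ)⁻¹)⁻¹, by positivity⟩ with hqdef
  have hqi : (q : ℝ)⁻¹ = 2⁻¹ - (p : ℝ)⁻¹ := inv_inv _
  have hq0 : 0 < (q : ℝ) := inv_pos.2 hpos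
  have hq1 : 1 ≤ q := by
    have h1 : (q : ℝ)⁻¹ ≤ 1 := by
      rw [hqi]
      have : 0 < (p : ℝ)⁻¹ := by positivity
      linarith
    have h2 : (1 : ℝ) ≤ q := (inv_le_one₀ hq0).1 h1
    exact_mod_cast h2
  have hqF : Fact (1 ≤ (q : ℝ≥0∞)) := ⟨by exact_mod_cast hq1⟩
  have hT : ENNReal.HolderTriple (p : ℝ≥0∞) (q : ℝ≥0∞) 2 := ⟨by
    have hp0 : p ≠ 0 := by rintro rfl; norm_num at hp2
    have hq0' : q ≠ 0 := by intro h; rw [h] at hq0; simp at hq0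
    rw [← ENNReal.coe_inv hp0, ← ENNReal.coe_inv hq0', ← ENNReal.coe_add,
      show (2 : ℝ≥0∞) = ((2 : NNReal) : ℝ≥0∞) from rfl, ← ENNReal.coe_inv two_ne_zero]
    congr 1
    apply NNReal.coe_injective
    push_cast
    rw [hqi]
    ring⟩
  obtain ⟨C, hC⟩ := exists_morrey_global (endFramed_isGeometric (θ := θ) c) Fact.out hnp
    ENNReal.coe_ne_top
  obtain ⟨J, hJ⟩ := exists_embedding 1 p (endFramed_isGeometric (θ := θ) c) ⊤ hC
  obtain ⟨C', hC'⟩ := exists_sobolev_global (spinorFramed_isGeometric (θ := θ) c) hn hq1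
    (by exact_mod_cast hnp) hqi
  obtain ⟨J', hJ'⟩ := exists_embedding 2 2 (spinorFramed_isGeometric (θ := θ) c) q hC'
  exact ⟨q, hqF, hT, ⟨⟨J, hJ, J', hJ'⟩⟩⟩

namespace Embeddings

variable {q : ℝ≥0∞} [Fact (1 ≤ q)] (J : Embeddings θ c p q)

/-- Multiplication operators on `L²`. -/
def mulL2 : WeightSpace θ c p →L[𝕜] L2 θ c →L[𝕜] L2 θ c :=
  ((ContinuousLinearMap.id 𝕜 (S →L[𝕜] S)).holderL (riemannianVolume g) ⊤ 2 2).comp J.bdd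

theorem mulL2_ae (F : WeightSpace θ c p) (ψ : L2 θ c) :
    J.mulL2 F ψ =ᵐ[riemannianVolume g] fun x => weightField F x (ψ x) := by
  refine (ContinuousLinearMap.coeFn_holder (r := 2) (ContinuousLinearMap.id 𝕜 (S →L[𝕜] S))
    (J.bdd F) ψ).trans ?_
  filter_upwards [J.bdd_ae F] with x hx
  rw [hx, ContinuousLinearMap.id_apply]

variable [ENNReal.HolderTriple p q 2]

/-- The covariant derivative `(∇F)ψ + F∇ψ` of `Fψ`. -/
def mulDeriv : WeightSpace θ c p →L[𝕜] H1 θ c →L[𝕜]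
    Lp (PiLp 2 (fun _ : Fin n => S)) 2 (riemannianVolume g) :=
  ((applyDeriv 𝕜 n S).holderL (riemannianVolume g) ⊤ 2 2).bilinearComp J.bdd
      (sobSnd (spinorFramed θ c) 2 2) +
    ((derivApply 𝕜 n S).holderL (riemannianVolume g) p q 2).bilinearComp
      (sobSnd (endFramed θ c) 1 p) J.lq

theorem mulDeriv_ae (F : WeightSpace θ c p) (ψ : H1 θ c) :
    J.mulDeriv F ψ =ᵐ[riemannianVolume g] fun x =>
      applyDeriv 𝕜 n S (weightField F x) (sobSnd (spinorFramed θ c) 2 2 ψ x) +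
        derivApply 𝕜 n S (sobSnd (endFramed θ c) 1 p F x) (H1.incl θ c ψ x) := by
  refine (Lp.coeFn_add ((applyDeriv 𝕜 n S).holder 2 (J.bdd F) (sobSnd (spinorFramed θ c) 2 2 ψ))
    ((derivApply 𝕜 n S).holder 2 (sobSnd (endFramed θ c) 1 p F) (J.lq ψ))).trans ?_
  filter_upwards [ContinuousLinearMap.coeFn_holder (r := 2) (applyDeriv 𝕜 n S) (J.bdd F)
      (sobSnd (spinorFramed θ c) 2 2 ψ), ContinuousLinearMap.coeFn_holder (r := 2)
      (derivApply 𝕜 n S) (sobSnd (endFramed θ c) 1 p F) (J.lq ψ), J.bdd_ae F, J.lq_ae ψ]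
    with x h1 h2 h3 h4
  exact congrArg₂ (· + ·) (h1.trans (congrArg (fun F' => applyDeriv 𝕜 n S F' _) h3))
    (h2.trans (congrArg (derivApply 𝕜 n S _) h4))

/-- The pair `(Fψ, ∇(Fψ))`. -/
def mulPair (F : WeightSpace θ c p) (ψ : H1 θ c) : WithLp 2 (Lp S 2 (riemannianVolume g) ×
    Lp (PiLp 2 (fun _ : Fin n => S)) 2 (riemannianVolume g)) :=
  WithLp.toLp 2 (J.mulL2 F (H1.incl θ c ψ), J.mulDeriv F ψ)

/-- For smooth `F` and `ψ` the pair comes from the smooth section `Fψ` by the Leibniz rule. Both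
components are continuous in `F` and in `ψ` by the embeddings, and `H¹` is closed, so the claim
extends to one variable after the other. -/
theorem mulPair_mem (F : WeightSpace θ c p) (ψ : H1 θ c) : J.mulPair F ψ ∈ H1 θ c := by
  have hE := endFramed_isGeometric (θ := θ) c
  have hS := spinorFramed_isGeometric (θ := θ) c
  have hcl : IsClosed (H1 θ c : Set (WithLp 2 (Lp S 2 (riemannianVolume g) ×
    Lp (PiLp 2 (fun _ : Fin n => S)) 2 (riemannianVolume g)))) :=
    Submodule.isClosed_topologicalClosure _
  refine hE.sobolev_induction (p := fun F => J.mulPair F ψ ∈ H1 θ c)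
    (hcl.preimage ((WithLp.prod_continuous_toLp 2 _ _).comp
      ((J.mulL2.continuous.clm_apply continuous_const).prodMk
        (J.mulDeriv.continuous.clm_apply continuous_const)))) (fun F hF => ?_) F
  refine hS.sobolev_induction (p := fun ψ => J.mulPair (hE.toSobolev hF 1 p) ψ ∈ H1 θ c)
    (hcl.preimage ((WithLp.prod_continuous_toLp 2 _ _).comp
      (((J.mulL2 _).continuous.comp (H1.incl θ c).continuous).prodMk
        (J.mulDeriv _).continuous))) (fun σ hσ => ?_) ψ
  have hFσ := isSmooth_apply c hF hσ
  have h1 : weightField (hE.toSobolev hF 1 p) =ᵐ[riemannianVolume g] F :=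
    sobFst_toSobolev 1 p hE hF
  have h2 : H1.incl θ c (hS.toSobolev hσ 2 2) =ᵐ[riemannianVolume g] σ :=
    sobFst_toSobolev 2 2 hS hσ
  have e : J.mulPair (hE.toSobolev hF 1 p) (hS.toSobolev hσ 2 2) = (hS.toSobolev hFσ 2 2).1 := by
    refine congrArg (WithLp.toLp 2) (Prod.ext (Lp.ext ?_) (Lp.ext ?_))
    · refine (J.mulL2_ae _ _).trans (Filter.EventuallyEq.trans ?_
        (sobFst_toSobolev 2 2 hS hFσ).symm)
      filter_upwards [h1, h2] with x e1 e2
      rw [e1, e2]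
    · refine (J.mulDeriv_ae _ _).trans (Filter.EventuallyEq.trans ?_
        (sobSnd_toSobolev 2 2 hS hFσ).symm)
      filter_upwards [h1, h2, sobSnd_toSobolev 1 p hE hF, sobSnd_toSobolev 2 2 hS hσ]
        with x e1 e2 e3 e4
      rw [e1, e2, e3, e4]
      ext l
      rw [covDeriv_apply c hF hσ, PiLp.add_apply, applyDeriv_apply, derivApply_apply, add_comm]
  rw [e]
  exact (hS.toSobolev hFσ 2 2).2

/-- Multiplication operators on `H¹`. -/
def mulH1 : WeightSpace θ c p →L[𝕜] H1 θ c →L[𝕜] H1 θ c :=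
  bilinearPair (J.mulL2.bilinearComp (ContinuousLinearMap.id 𝕜 _) (H1.incl θ c)) J.mulDeriv
    (H1 θ c) J.mulPair_mem

theorem incl_mulH1 (F : WeightSpace θ c p) (ψ : H1 θ c) :
    H1.incl θ c (J.mulH1 F ψ) = J.mulL2 F (H1.incl θ c ψ) :=
  rfl

theorem sobSnd_mulH1 (F : WeightSpace θ c p) (ψ : H1 θ c) :
    sobSnd (spinorFramed θ c) 2 2 (J.mulH1 F ψ) = J.mulDeriv F ψ :=
  rfl

end Embeddings

end Multiplication

end

end WeightedDirac

namespace WeightedDirac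

noncomputable section

/-! ### Inverse square roots of the weights as multiplication operators -/

/-! ### Operator series, their intertwining relations and pointwise multiplication. -/

section Abstract

variable {𝕜 : Type*} [RCLike 𝕜] {H X Y Z : Type*} [NormedAddCommGroup H] [NormedSpace 𝕜 H]
  [NormedAddCommGroup X] [NormedSpace 𝕜 X] [NormedAddCommGroup Y] [NormedSpace 𝕜 Y]
  [NormedAddCommGroup Z] [NormedSpace 𝕜 Z]

/-- Powers of an operator that is a contraction up to lower order terms. -/
theorem norm_pow_le_of_contraction {N : H →L[𝕜] H} {f : H →L[𝕜] X} {d : H →L[𝕜] Y}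
    {j : H →L[𝕜] Z} {q D : ℝ} (hq : 1 / 2 ≤ q) (hD : 0 ≤ D) (hf : ∀ v, ‖f (N v)‖ ≤ q * ‖f v‖)
    (hj : ∀ v, ‖j (N v)‖ ≤ q * ‖j v‖) (hd : ∀ v, ‖d (N v)‖ ≤ q * ‖d v‖ + D * ‖j v‖)
    (hn : ∀ v, ‖v‖ ≤ ‖f v‖ + ‖d v‖) (hfn : ∀ v, ‖f v‖ ≤ ‖v‖) (hdn : ∀ v, ‖d v‖ ≤ ‖v‖) (k : ℕ) :
    -- In the application `f` is the section in `L²`, `d` its covariant derivative and `j` the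
    -- embedding in `L^q`. Each application of `N` contracts all three and adds one error term, so
    -- after `k` steps the derivative has collected `k` of them.
    ‖N ^ k‖ ≤ q ^ k * (2 + k * (2 * D * ‖j‖)) := by
  have hq0 : 0 ≤ q := le_trans (by norm_num) hq
  have key : ∀ (k : ℕ) (v : H), ‖f ((N ^ k) v)‖ ≤ q ^ k * ‖f v‖ ∧ ‖j ((N ^ k) v)‖ ≤ q ^ k * ‖j v‖ ∧
      ‖d ((N ^ k) v)‖ ≤ q ^ k * (‖d v‖ + k * (2 * D) * ‖j v‖) := by
    intro k v
    induction k with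
    | zero => simp
    | succ k ih =>
      obtain ⟨h1, h2, h3⟩ := ih
      rw [pow_succ', mul_apply_eq_comp]
      refine ⟨(hf _).trans ?_, (hj _).trans ?_, (hd _).trans ?_⟩
      · rw [pow_succ', mul_assoc]
        exact mul_le_mul_of_nonneg_left h1 hq0
      · rw [pow_succ', mul_assoc]
        exact mul_le_mul_of_nonneg_left h2 hq0
      · have h4 := mul_le_mul_of_nonneg_left h3 hq0
        have h5 := mul_le_mul_of_nonneg_left h2 hD
        -- Here `q ≥ 1/2` enters: the error carries `q ^ k`, and the factor `2q ≥ 1` raises it to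
        -- the power `k + 1`.
        have h6 : D * (q ^ k * ‖j v‖) ≤ 2 * q * (D * (q ^ k * ‖j v‖)) :=
          le_mul_of_one_le_left (by positivity) (by linarith)
        refine (add_le_add h4 (h5.trans h6)).trans_eq ?_
        push_cast
        ring
  refine ContinuousLinearMap.opNorm_le_bound _ (by positivity) fun v => (hn _).trans ?_
  obtain ⟨h1, -, h3⟩ := key k v
  have h4 : q ^ k * ‖f v‖ ≤ q ^ k * ‖v‖ := mul_le_mul_of_nonneg_left (hfn v) (by positivity)
  have h5 : q ^ k * (‖d v‖ + k * (2 * D) * ‖j v‖) ≤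
      q ^ k * (‖v‖ + k * (2 * D) * (‖j‖ * ‖v‖)) :=
    mul_le_mul_of_nonneg_left (add_le_add (hdn v) (mul_le_mul_of_nonneg_left (j.le_opNorm v)
      (by positivity))) (by positivity)
  calc _ ≤ q ^ k * ‖v‖ + q ^ k * (‖v‖ + k * (2 * D) * (‖j‖ * ‖v‖)) :=
        add_le_add (h1.trans h4) (h3.trans h5)
    _ = _ := by ring

theorem map_defect {T : H →L[𝕜] H} {i : H →L[𝕜] X} {Λ : ℝ} {v : H} {w : X} (h : i (T v) = w) :
    i (defect Λ T v) = i v - ((Λ⁻¹ : ℝ) : 𝕜) • w := by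
  rw [defect, sub_apply, smul_apply, map_sub, map_smul, h, one_apply_eq_self]

theorem summable_pow_of_bound {N : H →L[𝕜] H} {q r : ℝ} (hq0 : 0 ≤ q) (hq : q < 1)
    (h : ∀ k : ℕ, ‖N ^ k‖ ≤ q ^ k * (2 + k * r)) : Summable fun k => ‖N ^ k‖ := by
  have h1 := (summable_geometric_of_lt_one hq0 hq).mul_left 2
  have h2 := (summable_pow_mul_geometric_of_norm_lt_one 1
    (by rwa [Real.norm_of_nonneg hq0] : ‖q‖ < 1)).mul_left r
  refine (h1.add h2).of_nonneg_of_le (fun _ => norm_nonneg _) fun k => (h k).trans_eq ?_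
  ring

/-- An intertwiner of two operators intertwines the powers of their defects, hence the series. It
identifies the root on `H¹` with the restriction of the root on `L²`. -/
theorem map_invRoot [CompleteSpace H] [CompleteSpace X] {T : H →L[𝕜] H} {T' : X →L[𝕜] X}
    {i : H →L[𝕜] X} {Λ : ℝ} (h : ∀ v, i (T v) = T' (i v))
    (hs : Summable fun k => ‖defect Λ T ^ k‖) (hs' : Summable fun k => ‖defect Λ T' ^ k‖) (v : H) :
    i (invRoot Λ T v) = invRoot Λ T' (i v) := by
  have hk : ∀ (k : ℕ) v, i ((defect Λ T ^ k) v) = (defect Λ T' ^ k) (i v) := by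
    intro k
    induction k with
    | zero => simp
    | succ k ih =>
      intro v
      rw [pow_succ, pow_succ, mul_apply_eq_comp, mul_apply_eq_comp, ih]
      congr 1
      simp only [defect, sub_apply, smul_apply, one_apply_eq_self, map_sub, map_smul, h]
  have h1 := ((hasSum_invSqrtSeries (𝕜 := 𝕜) hs).mapL (ContinuousLinearMap.apply 𝕜 H v)).mapL i
  have h2 := (hasSum_invSqrtSeries (𝕜 := 𝕜) hs').mapL (ContinuousLinearMap.apply 𝕜 X (i v))
  have e : i (invSqrtSeries 𝕜 (defect Λ T) v) = invSqrtSeries 𝕜 (defect Λ T') (i v) := by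
    refine h1.unique (h2.congr_fun fun k => ?_)
    simp only [ContinuousLinearMap.apply_apply, map_smul, hk]
  rw [invRoot, invRoot, smul_apply, smul_apply, map_smul, e]

theorem continuous_invRoot [CompleteSpace H] {W : Type*} [TopologicalSpace W] {N : W → H →L[𝕜] H}
    (hN : Continuous N) {Λ q : ℝ} (hq0 : 0 ≤ q) (hq : q < 1) {r : W → ℝ} (hr : Continuous r)
    (hb : ∀ A (k : ℕ), ‖defect Λ (N A) ^ k‖ ≤ q ^ k * (2 + k * r A)) :
    Continuous fun A => invRoot Λ (N A) := by
  have hc : Continuous fun A => defect Λ (N A) := by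
    simp only [defect]
    fun_prop
  have h := continuous_invSqrtSeries (𝕜 := 𝕜) hc hq0 hq hr hb
  exact h.const_smul (((Real.sqrt Λ)⁻¹ : ℝ) : 𝕜)

theorem tsum_enorm_ne_top {T : H →L[𝕜] H} (hs : Summable fun k => ‖T ^ k‖) (v : H) :
    ∑' k, ‖(sqrtCoeff k : 𝕜) • (T ^ k) v‖ₑ ≠ ⊤ := by
  have hs : Summable fun k => ‖(sqrtCoeff k : 𝕜) • (T ^ k) v‖ := by
    refine (hs.mul_right ‖v‖).of_nonneg_of_le (fun _ => norm_nonneg _) fun k => ?_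
    refine le_trans ?_ ((T ^ k).le_opNorm v)
    rw [norm_smul, RCLike.norm_ofReal, abs_of_nonneg (sqrtCoeff_nonneg k)]
    exact mul_le_of_le_one_left (norm_nonneg _) (sqrtCoeff_le_one k)
  have := hs.tsum_ofReal_ne_top
  simpa only [ofReal_norm] using this

theorem defect_ae {α : Type*} [MeasurableSpace α] {μ : Measure α} {S : Type*}
    [NormedAddCommGroup S] [NormedSpace 𝕜 S] {Λ : ℝ} {K : Lp S 2 μ →L[𝕜] Lp S 2 μ}
    {T : α → S →L[𝕜] S} (h : ∀ ψ, K ψ =ᵐ[μ] fun x => T x (ψ x)) (ψ : Lp S 2 μ) :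
    defect Λ K ψ =ᵐ[μ] fun x => defect Λ (T x) (ψ x) := by
  refine (Lp.coeFn_sub ψ (((Λ⁻¹ : ℝ) : 𝕜) • K ψ)).trans ?_
  filter_upwards [Lp.coeFn_smul ((Λ⁻¹ : ℝ) : 𝕜) (K ψ), h ψ] with x h1 h2
  rw [Pi.sub_apply, h1, Pi.smul_apply, h2]
  rfl

/-- The inverse square root of a multiplication operator is the multiplication by the pointwise
inverse square roots. -/
theorem invRoot_ae {α : Type*} [MeasurableSpace α] {μ : Measure α} {S : Type*}
    [NormedAddCommGroup S] [InnerProductSpace 𝕜 S] [CompleteSpace S] {Λ₁ Λ₂ : ℝ} (h1 : 0 < Λ₁)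
    (h2 : Λ₁ ≤ Λ₂) {K : Lp S 2 μ →L[𝕜] Lp S 2 μ} (hK : IsBounded Λ₁ Λ₂ K) {T : α → S →L[𝕜] S}
    (hT : ∀ᵐ x ∂μ, IsBounded Λ₁ Λ₂ (T x)) (h : ∀ ψ, K ψ =ᵐ[μ] fun x => T x (ψ x)) (ψ : Lp S 2 μ) :
    invRoot Λ₂ K ψ =ᵐ[μ] fun x => invRoot Λ₂ (T x) (ψ x) := by
  have hpow : ∀ k, (defect Λ₂ K ^ k) ψ =ᵐ[μ] fun x => (defect Λ₂ (T x) ^ k) (ψ x) := fun k => by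
    induction k with
    | zero => simp
    | succ k ih =>
      simp only [pow_succ', mul_apply_eq_comp]
      filter_upwards [defect_ae h ((defect Λ₂ K ^ k) ψ), ih] with x h1 h2
      rw [h1, h2]
  -- A series that converges absolutely in `L²` also converges almost everywhere, to a
  -- representative of its sum. It can then be compared with the pointwise series.
  have hae := Lp.hasSum_coeFn_tsum (tsum_enorm_ne_top (𝕜 := 𝕜) (hK.summable h1 h2) ψ)
  rw [(hK.hasSum_invRoot_series h1 h2 ψ).tsum_eq] at hae
  have hk : ∀ᵐ x ∂μ, ∀ k, ((sqrtCoeff k : 𝕜) • (defect Λ₂ K ^ k) ψ : Lp S 2 μ) x =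
      (sqrtCoeff k : 𝕜) • (defect Λ₂ (T x) ^ k) (ψ x) := by
    refine ae_all_iff.2 fun k => ?_
    filter_upwards [Lp.coeFn_smul (sqrtCoeff k : 𝕜) ((defect Λ₂ K ^ k) ψ), hpow k] with x e1 e2
    rw [e1, Pi.smul_apply, e2]
  refine (Lp.coeFn_smul (((Real.sqrt Λ₂)⁻¹ : ℝ) : 𝕜) (invSqrtSeries 𝕜 (defect Λ₂ K) ψ)).trans ?_
  filter_upwards [hae, hk, hT] with x e1 e2 e3
  have e4 := e3.hasSum_invRoot_series h1 h2 (ψ x)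
  simp only [e2] at e1
  rw [Pi.smul_apply, e1.unique e4, invRoot, smul_apply]

theorem norm_sub_add_le {Ψ a b : X} {r s u : ℝ} (ha : ‖Ψ - (r : 𝕜) • a‖ ≤ s) (hb : ‖b‖ ≤ u)
    (hr : 0 ≤ r) : ‖Ψ - (r : 𝕜) • (a + b)‖ ≤ s + r * u := by
  rw [smul_add, ← sub_sub]
  refine (norm_sub_le _ _).trans (add_le_add ha ?_)
  rw [norm_smul, RCLike.norm_ofReal, abs_of_nonneg hr]
  exact mul_le_mul_of_nonneg_left hb hr

theorem norm_holder_le_of_le {α : Type*} [MeasurableSpace α] {μ : Measure α} {p q r : ℝ≥0∞}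
    [Fact (1 ≤ p)] [Fact (1 ≤ q)] [ENNReal.HolderTriple p q r] {B : X →L[𝕜] Y →L[𝕜] Z} {f : Lp X p μ}
    {v : Lp Y q μ} {u : ℝ}
    (h : ‖f‖ ≤ u) : ‖B.holder r f v‖ ≤ ‖B‖ * u * ‖v‖ :=
  (B.norm_holder_apply_apply_le f v).trans (by gcongr)

/-- The part of top order in the derivative of the defect: `1 - T(x)/Λ₂` contracts each component of
`Ψ(x)` by the ratio, hence the whole vector. -/
theorem norm_sub_smul_holder_le {α : Type*} [MeasurableSpace α] {μ : Measure α} {n : ℕ} {S : Type*}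
    [NormedAddCommGroup S] [InnerProductSpace 𝕜 S] [FiniteDimensional 𝕜 S] [CompleteSpace S]
    {Λ₁ Λ₂ : ℝ} (h1 : 0 < Λ₁) (h2 : Λ₁ ≤ Λ₂) {T : Lp (S →L[𝕜] S) ⊤ μ}
    (hT : ∀ᵐ x ∂μ, IsBounded Λ₁ Λ₂ (T x)) (Ψ : Lp (PiLp 2 (fun _ : Fin n => S)) 2 μ) :
    ‖Ψ - ((Λ₂⁻¹ : ℝ) : 𝕜) • (applyDeriv 𝕜 n S).holder 2 T Ψ‖ ≤ ratio Λ₁ Λ₂ * ‖Ψ‖ := by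
  refine Lp.norm_le_mul_norm_of_ae_le_mul ?_
  filter_upwards [Lp.coeFn_sub Ψ (((Λ₂⁻¹ : ℝ) : 𝕜) • (applyDeriv 𝕜 n S).holder 2 T Ψ),
    Lp.coeFn_smul ((Λ₂⁻¹ : ℝ) : 𝕜) ((applyDeriv 𝕜 n S).holder 2 T Ψ),
    (applyDeriv 𝕜 n S).coeFn_holder (r := 2) T Ψ, hT] with x e1 e2 e3 e4
  rw [e1, Pi.sub_apply, e2, Pi.smul_apply, e3]
  exact norm_piLp_le_of_forall ratio_pos.le fun l => e4.norm_defect_apply_le h1 h2 (Ψ x l)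

end Abstract

/-! ### The inverse square root of a weight on `L²` and on `H¹`. -/

section Weights

variable {𝕜 : Type*} [RCLike 𝕜] {n : ℕ} {M : Type*} [TopologicalSpace M] [T2Space M] [CompactSpace M]
  [ChartedSpace (EuclideanSpace ℝ (Fin n)) M] [IsManifold (𝓡 n) ∞ M]
  [MeasurableSpace M] [BorelSpace M] {g : RMetric n M} {θ : SpinStructure g}
  {S : Type*} [NormedAddCommGroup S] [InnerProductSpace 𝕜 S] [NormedSpace ℝ S]
  [IsScalarTower ℝ 𝕜 S] [FiniteDimensional 𝕜 S] [CompleteSpace S] {c : CliffordModule 𝕜 n S}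
  {p : ℝ≥0∞} [Fact (1 ≤ p)] {Λ₁ Λ₂ : ℝ}

theorem isBounded_weightField (A : admissible θ c p Λ₁ Λ₂) :
    ∀ᵐ x ∂(riemannianVolume g), IsBounded Λ₁ Λ₂ (weightField A.1 x) := by
  filter_upwards [A.2] with x hx
  exact ⟨hx.1, fun s => (hx.2 s).1, fun s => (hx.2 s).2⟩

namespace Embeddings

variable {q : ℝ≥0∞} [Fact (1 ≤ q)] (J : Embeddings θ c p q) [Fact (0 < Λ₁)]
  (A : admissible θ c p Λ₁ Λ₂)

theorem inner_mulL2 (ψ φ : L2 θ c) : inner 𝕜 (J.mulL2 A.1 ψ) φ = weightedInner A ψ φ := by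
  rw [L2.inner_def]
  refine integral_congr_ae ?_
  filter_upwards [J.mulL2_ae A.1 ψ] with x hx
  rw [hx]

theorem isBounded_mulL2 : IsBounded Λ₁ Λ₂ (J.mulL2 A.1) where
  symm ψ φ := (J.inner_mulL2 A ψ φ).trans ((weightedInner_conj A ψ φ).symm.trans
    ((congrArg (starRingEnd 𝕜) (J.inner_mulL2 A φ ψ).symm).trans (inner_conj_symm _ _)))
  lower ψ := (weightedInner_bounds A ψ).1.trans_eq (congrArg RCLike.re (J.inner_mulL2 A ψ ψ).symm)
  upper ψ := (congrArg RCLike.re (J.inner_mulL2 A ψ ψ)).trans_le (weightedInner_bounds A ψ).2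

/-- Multiplication by `A^{-1/2}` on `L²`. -/
def rootL2 : L2 θ c →L[𝕜] L2 θ c := invRoot Λ₂ (J.mulL2 A.1)

theorem rootL2_ae_invRoot (hΛ : Λ₁ ≤ Λ₂) (ψ : L2 θ c) : J.rootL2 A ψ =ᵐ[riemannianVolume g]
    fun x => invRoot Λ₂ (weightField A.1 x) (ψ x) :=
  invRoot_ae Fact.out hΛ (J.isBounded_mulL2 A) (isBounded_weightField A) (J.mulL2_ae A.1) ψ

theorem rootL2_ae (hΛ : Λ₁ ≤ Λ₂) (ψ : L2 θ c) : J.rootL2 A ψ =ᵐ[riemannianVolume g]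
    fun x => invSqrtField A x (ψ x) := by
  filter_upwards [J.rootL2_ae_invRoot A hΛ ψ, isBounded_weightField A] with x h1 h2
  exact h1.trans (congrArg (fun T : S →L[𝕜] S => T (ψ x)) (h2.inverse_posSqrt Fact.out hΛ).symm)

theorem rootL2_rootL2_ae (hΛ : Λ₁ ≤ Λ₂) (ψ : L2 θ c) :
    J.rootL2 A (J.rootL2 A ψ) =ᵐ[riemannianVolume g] fun x => invField A x (ψ x) := by
  filter_upwards [J.rootL2_ae_invRoot A hΛ (J.rootL2 A ψ), J.rootL2_ae_invRoot A hΛ ψ,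
    isBounded_weightField A] with x h1 h2 h3
  exact h1.trans ((congrArg (invRoot Λ₂ (weightField A.1 x)) h2).trans
    (congrArg (fun T : S →L[𝕜] S => T (ψ x)) (h3.inverse_eq Fact.out hΛ).symm))

theorem mulL2_rootL2_ae (hΛ : Λ₁ ≤ Λ₂) (ψ : L2 θ c) :
    J.mulL2 A.1 (J.rootL2 A ψ) =ᵐ[riemannianVolume g] fun x => sqrtField A x (ψ x) := by
  filter_upwards [J.mulL2_ae A.1 (J.rootL2 A ψ), J.rootL2_ae_invRoot A hΛ ψ,
    isBounded_weightField A] with x h1 h2 h3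
  exact h1.trans ((congrArg (weightField A.1 x) h2).trans
    (congrArg (fun T : S →L[𝕜] S => T (ψ x)) (h3.posSqrt_eq Fact.out hΛ).symm))

theorem mulL2_rootL2_rootL2 (hΛ : Λ₁ ≤ Λ₂) (ψ : L2 θ c) :
    J.mulL2 A.1 (J.rootL2 A (J.rootL2 A ψ)) = ψ := by
  have h1 : 0 < Λ₁ := Fact.out
  have h := mul_invRoot_mul_invRoot (h1.trans_le hΛ) ((J.isBounded_mulL2 A).summable h1 hΛ)
  exact congrArg (fun T : L2 θ c →L[𝕜] L2 θ c => T ψ) h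

theorem inner_rootL2 (hΛ : Λ₁ ≤ Λ₂) (ψ φ : L2 θ c) :
    inner 𝕜 (J.rootL2 A ψ) φ = inner 𝕜 ψ (J.rootL2 A φ) :=
  (J.isBounded_mulL2 A).symm_invRoot Fact.out hΛ ψ φ

theorem mulL2_rootL2_comm (ψ : L2 θ c) : J.mulL2 A.1 (J.rootL2 A ψ) = J.rootL2 A (J.mulL2 A.1 ψ) :=
  congrArg (fun T : L2 θ c →L[𝕜] L2 θ c => T ψ)
    (commute_invRoot (Λ₂ := Λ₂) (Commute.refl (J.mulL2 A.1))).eq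

variable [ENNReal.HolderTriple p q 2]

/-- Multiplication by `A^{-1/2}` on `H¹`. -/
def rootH1 : H1 θ c →L[𝕜] H1 θ c := invRoot Λ₂ (J.mulH1 A.1)

theorem incl_defect_mulH1 (ψ : H1 θ c) :
    H1.incl θ c (defect Λ₂ (J.mulH1 A.1) ψ) = defect Λ₂ (J.mulL2 A.1) (H1.incl θ c ψ) :=
  map_defect (J.incl_mulH1 A.1 ψ)

theorem norm_incl_defect_le (hΛ : Λ₁ ≤ Λ₂) (ψ : H1 θ c) :
    ‖H1.incl θ c (defect Λ₂ (J.mulH1 A.1) ψ)‖ ≤ ratio Λ₁ Λ₂ * ‖H1.incl θ c ψ‖ := by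
  rw [J.incl_defect_mulH1]
  exact (J.isBounded_mulL2 A).norm_defect_apply_le Fact.out hΛ _

theorem incl_defect_ae (ψ : H1 θ c) : H1.incl θ c (defect Λ₂ (J.mulH1 A.1) ψ)
    =ᵐ[riemannianVolume g] fun x => defect Λ₂ (weightField A.1 x) (H1.incl θ c ψ x) := by
  rw [J.incl_defect_mulH1]
  exact defect_ae (J.mulL2_ae A.1) (H1.incl θ c ψ)

theorem norm_lq_defect_le (hΛ : Λ₁ ≤ Λ₂) (ψ : H1 θ c) :
    ‖J.lq (defect Λ₂ (J.mulH1 A.1) ψ)‖ ≤ ratio Λ₁ Λ₂ * ‖J.lq ψ‖ := by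
  refine Lp.norm_le_mul_norm_of_ae_le_mul ?_
  filter_upwards [J.lq_ae (defect Λ₂ (J.mulH1 A.1) ψ), J.lq_ae ψ, J.incl_defect_ae A ψ,
    isBounded_weightField A] with x h1 h2 h3 h4
  exact (congrArg norm (h1.trans h3)).trans_le ((h4.norm_defect_apply_le Fact.out hΛ _).trans_eq
    (congrArg (fun s => ratio Λ₁ Λ₂ * ‖s‖) h2.symm))

theorem sobSnd_defect (ψ : H1 θ c) : sobSnd (spinorFramed θ c) 2 2 (defect Λ₂ (J.mulH1 A.1) ψ) =
    sobSnd (spinorFramed θ c) 2 2 ψ - ((Λ₂⁻¹ : ℝ) : 𝕜) •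
      ((applyDeriv 𝕜 n S).holder 2 (J.bdd A.1) (sobSnd (spinorFramed θ c) 2 2 ψ) +
        (derivApply 𝕜 n S).holder 2 (sobSnd (endFramed θ c) 1 p A.1) (J.lq ψ)) :=
  map_defect (J.sobSnd_mulH1 A.1 ψ)

theorem norm_derivApply_le (ψ : H1 θ c) :
    ‖(derivApply 𝕜 n S).holder 2 (sobSnd (endFramed θ c) 1 p A.1) (J.lq ψ)‖ ≤
      ‖derivApply 𝕜 n S‖ * ‖A.1‖ * ‖J.lq ψ‖ :=
  norm_holder_le_of_le (norm_sobSnd_le 1 p A.1)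

/-- The derivative of the defect is `(1 - A/Λ₂)∇ψ - Λ₂⁻¹ (∇A)ψ`. The first part contracts, and the
second is bounded by Hölder's inequality with `∇A` in `L^p` and `ψ` in `L^q`. -/
theorem norm_sobSnd_defect_le (hΛ : Λ₁ ≤ Λ₂) (ψ : H1 θ c) :
    ‖sobSnd (spinorFramed θ c) 2 2 (defect Λ₂ (J.mulH1 A.1) ψ)‖ ≤
      ratio Λ₁ Λ₂ * ‖sobSnd (spinorFramed θ c) 2 2 ψ‖ +
        Λ₂⁻¹ * ‖derivApply 𝕜 n S‖ * ‖A.1‖ * ‖J.lq ψ‖ := by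
  have hΛ₂ : 0 < Λ₂ := lt_of_lt_of_le Fact.out hΛ
  have hT : ∀ᵐ x ∂(riemannianVolume g), IsBounded Λ₁ Λ₂ (J.bdd A.1 x) := by
    filter_upwards [J.bdd_ae A.1, isBounded_weightField A] with x h1 h2
    exact h1 ▸ h2
  have h := norm_sub_add_le (norm_sub_smul_holder_le Fact.out hΛ hT
    (sobSnd (spinorFramed θ c) 2 2 ψ)) (J.norm_derivApply_le A ψ) (inv_pos.2 hΛ₂).le
  rw [J.sobSnd_defect A]
  refine h.trans_eq (congrArg _ ?_)
  ring

/-- The rate in the bound for the powers of the defect on `H¹`. -/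
def rate (F : WeightSpace θ c p) (Λ₂ : ℝ) : ℝ :=
  2 * (Λ₂⁻¹ * ‖derivApply 𝕜 n S‖ * ‖F‖) * ‖J.lq‖

/-- The central estimate. A factor that grows linearly in `k` does not destroy the geometric decay,
and the rate is proportional to the norm of `A`, hence locally bounded on the weights. -/
theorem norm_defect_pow_le (hΛ : Λ₁ ≤ Λ₂) (k : ℕ) :
    ‖defect Λ₂ (J.mulH1 A.1) ^ k‖ ≤ ratio Λ₁ Λ₂ ^ k * (2 + k * J.rate A.1 Λ₂) := by
  have hΛ₂ : 0 < Λ₂ := lt_of_lt_of_le Fact.out hΛ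
  exact norm_pow_le_of_contraction half_le_ratio (by positivity) (J.norm_incl_defect_le A hΛ)
    (J.norm_lq_defect_le A hΛ) (J.norm_sobSnd_defect_le A hΛ) (norm_H1_le c)
    (norm_sobFst_le 2 2) (norm_sobSnd_le 2 2) k

/-- Convergence of the series in the bounded operators on `H¹` shows that `A^{-1/2}` preserves `H¹`,
without differentiating a square root. -/
theorem incl_rootH1 (hΛ : Λ₁ ≤ Λ₂) (ψ : H1 θ c) :
    H1.incl θ c (J.rootH1 A ψ) = J.rootL2 A (H1.incl θ c ψ) := by
  have : CompleteSpace (H1 θ c) := (Submodule.isClosed_topologicalClosure _).completeSpace_coe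
  have h1 : 0 < Λ₁ := Fact.out
  exact map_invRoot (J.incl_mulH1 A.1) (summable_pow_of_bound ratio_pos.le (ratio_lt_one h1 hΛ)
    (J.norm_defect_pow_le A hΛ)) ((J.isBounded_mulL2 A).summable h1 hΛ) ψ

theorem continuous_rootH1 (hΛ : Λ₁ ≤ Λ₂) :
    Continuous fun A : admissible θ c p Λ₁ Λ₂ => J.rootH1 A := by
  have : CompleteSpace (H1 θ c) := (Submodule.isClosed_topologicalClosure _).completeSpace_coe
  refine continuous_invRoot (J.mulH1.continuous.comp continuous_subtype_val) ratio_pos.le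
    (ratio_lt_one Fact.out hΛ) (r := fun A => J.rate A.1 Λ₂) ?_
    fun A k => J.norm_defect_pow_le A hΛ k
  unfold rate
  fun_prop

theorem continuous_rootL2 (hΛ : Λ₁ ≤ Λ₂) :
    Continuous fun A : admissible θ c p Λ₁ Λ₂ => J.rootL2 A := by
  have h1 : 0 < Λ₁ := Fact.out
  refine continuous_invRoot (J.mulL2.continuous.comp continuous_subtype_val) ratio_pos.le
    (ratio_lt_one h1 hΛ) (r := fun _ => 0) continuous_const fun A k => ?_
  refine ((J.isBounded_mulL2 A).norm_defect_pow_le h1 hΛ k).trans ?_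
  have : 0 ≤ ratio Λ₁ Λ₂ ^ k := pow_nonneg ratio_pos.le k
  rw [mul_zero, add_zero]
  linarith

end Embeddings

end Weights

end

end WeightedDirac

namespace WeightedDirac

noncomputable section

/-! ### Unbounded operators given by their graphs -/

section Operators

variable {𝕜 : Type*} [RCLike 𝕜] {H : Type*} [NormedAddCommGroup H] [InnerProductSpace 𝕜 H]

/-- A symmetric densely defined operator is self-adjoint if its domain contains that of the
adjoint. -/
theorem isSelfAdjoint_of_graph [CompleteSpace H] {T : H →ₗ.[𝕜] H}
    (hd : Dense (T.domain : Set H))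
    (hs : ∀ a b a' b', (a, b) ∈ T.graph → (a', b') ∈ T.graph → inner 𝕜 b a' = inner 𝕜 a b')
    (hm : ∀ a' b', (∀ a b, (a, b) ∈ T.graph → inner 𝕜 b a' = inner 𝕜 a b') → a' ∈ T.domain) :
    IsSelfAdjoint T := by
  refine LinearPMap.isSelfAdjoint_def.2 (LinearPMap.eq_of_eq_graph ?_)
  rw [LinearPMap.adjoint_graph_eq_graph_adjoint hd]
  ext ⟨a', b'⟩
  rw [Submodule.mem_adjoint_iff]
  simp only [sub_eq_zero]
  refine ⟨fun h => ?_, fun h a b hab => hs a b a' b' hab h⟩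
  -- By symmetry the value `y` of `T` at `a'` and the value `b'` of the adjoint pair equally with
  -- the dense domain, so they coincide.
  obtain ⟨y, hy⟩ := LinearPMap.mem_domain_iff.1 (hm a' b' h)
  have h0 : b' - y = 0 := hd.eq_zero_of_inner_right 𝕜 fun v hv => by
    obtain ⟨w, hw⟩ := LinearPMap.mem_domain_iff.1 hv
    rw [inner_sub_right, ← h _ _ hw, hs _ _ _ _ hw hy, sub_self]
  rwa [sub_eq_zero.1 h0]

theorem dense_of_inner_eq_zero [CompleteSpace H] {W : Submodule 𝕜 H}
    (h : ∀ x, (∀ w ∈ W, inner 𝕜 x w = 0) → x = 0) : Dense (W : Set H) := by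
  rw [← Submodule.dense_iff_topologicalClosure_eq_top.symm.eq, Submodule.topologicalClosure_eq_top_iff,
    Submodule.eq_bot_iff]
  exact fun x hx => h x fun w hw => Submodule.inner_left_of_mem_orthogonal hw hx

/-- The identities between a weight `K` and its inverse square root `L`. -/
structure IsRoot (K L : H →L[𝕜] H) : Prop where
  symm : ∀ φ χ, inner 𝕜 (K φ) χ = inner 𝕜 φ (K χ)
  symm' : ∀ φ χ, inner 𝕜 (L φ) χ = inner 𝕜 φ (L χ)
  comm : ∀ φ, K (L φ) = L (K φ)
  inv : ∀ φ, K (L (L φ)) = φ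

theorem IsRoot.inv' {K L : H →L[𝕜] H} (h : IsRoot K L) (φ : H) : L (K (L φ)) = φ := by
  rw [← h.comm, h.inv]

theorem IsRoot.eq_zero {K L : H →L[𝕜] H} (h : IsRoot K L) {φ : H} (h0 : K φ = 0) : φ = 0 := by
  rw [← h.inv φ, h.comm, h.comm, h0, map_zero, map_zero]

theorem IsRoot.inner_apply {K L : H →L[𝕜] H} (h : IsRoot K L) (φ χ : H) :
    inner 𝕜 (K (L φ)) (K (L χ)) = inner 𝕜 (K φ) χ := by
  rw [h.comm φ, h.symm', h.inv']

theorem IsRoot.inner_left {K L : H →L[𝕜] H} (h : IsRoot K L) {a b d e : H}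
    (he : inner 𝕜 (L d) a = inner 𝕜 (K (L e)) b) : inner 𝕜 (L a) d = inner 𝕜 (K (L b)) e := by
  rw [h.symm', ← inner_conj_symm, he, inner_conj_symm, h.comm e, ← h.symm', h.symm]

theorem IsRoot.inner_weighted {K L : H →L[𝕜] H} (h : IsRoot K L) {a b d e : H}
    (he : inner 𝕜 (K (L (L d))) a = inner 𝕜 (K e) b) : inner 𝕜 a d = inner 𝕜 (K b) e := by
  rw [← inner_conj_symm, ← h.inv d, he, inner_conj_symm, h.symm]

theorem IsRoot.inner_weighted_symm {K L : H →L[𝕜] H} (h : IsRoot K L) {a b a' b' d e : H}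
    (hb : b = L (L d)) (hb' : b' = L (L e)) (he : inner 𝕜 d a' = inner 𝕜 a e) :
    inner 𝕜 (K b) a' = inner 𝕜 (K a) b' := by
  rw [hb, hb', h.inv, h.symm, h.inv, he]

theorem IsRoot.inner_symm {K L : H →L[𝕜] H} (h : IsRoot K L) {a b d e : H}
    (he : inner 𝕜 d (L b) = inner 𝕜 (L a) e) : inner 𝕜 (L d) b = inner 𝕜 a (L e) := by
  rw [h.symm', he, h.symm']

theorem mem_resolventSet_iff {T : H →ₗ.[𝕜] H} {z : 𝕜} : z ∈ resolventSet T ↔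
    ∃ R : H →L[𝕜] H, (∀ x y, (x, y) ∈ T.graph → R (y - z • x) = x) ∧
      ∀ y, (R y, y + z • R y) ∈ T.graph := by
  refine exists_congr fun R => and_congr ⟨fun h x y hxy => ?_, fun h x => h _ _ (T.mem_graph x)⟩
    ⟨fun h y => ?_, fun h y => ?_⟩
  · obtain ⟨w, rfl, rfl⟩ := T.mem_graph_iff.1 hxy
    exact h w
  · obtain ⟨x, h1, h2⟩ := h y
    refine T.mem_graph_iff.2 ⟨x, h1, ?_⟩
    change T x = y + z • R y
    rw [← h1, ← h2, sub_add_cancel]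
  · obtain ⟨x, h1, h2⟩ := T.mem_graph_iff.1 (h y)
    exact ⟨x, h1, by rw [h1, h2, add_sub_cancel_right]⟩

/-- The eigenspace as a subspace of `H`. -/
theorem map_pmapEigenspace (T : H →ₗ.[𝕜] H) (z : 𝕜) (x : H) :
    x ∈ (pmapEigenspace T z).map T.domain.subtype ↔ (x, z • x) ∈ T.graph := by
  rw [Submodule.mem_map, T.mem_graph_iff]
  refine exists_congr fun w => ?_
  rw [pmapEigenspace, LinearMap.mem_ker, LinearMap.sub_apply, sub_eq_zero, and_comm]
  refine and_congr_right fun h => ?_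
  rw [← show T.domain.subtype w = x from h]
  rfl

end Operators

/-! ### Unitary equivalence and isospectrality. -/

section Isospectral

variable {𝕜 : Type*} [RCLike 𝕜] {H H' : Type u} [NormedAddCommGroup H] [InnerProductSpace 𝕜 H]
  [NormedAddCommGroup H'] [InnerProductSpace 𝕜 H'] {T : H →ₗ.[𝕜] H} {T' : H' →ₗ.[𝕜] H'}

theorem resolventSet_subset_of_conj (U : H ≃ₗᵢ[𝕜] H')
    (h : ∀ x y, (x, y) ∈ T.graph ↔ (U x, U y) ∈ T'.graph) : resolventSet T ⊆ resolventSet T' := by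
  intro z hz
  obtain ⟨R, h1, h2⟩ := mem_resolventSet_iff.1 hz
  refine mem_resolventSet_iff.2 ⟨(U.toContinuousLinearEquiv.toContinuousLinearMap.comp R).comp
    U.symm.toContinuousLinearEquiv.toContinuousLinearMap, fun x y hxy => ?_, fun y => ?_⟩
  · have h3 := h1 (U.symm x) (U.symm y) ((h _ _).2 (by simpa using hxy))
    change U (R (U.symm (y - z • x))) = x
    rw [map_sub, map_smul, h3, LinearIsometryEquiv.apply_symm_apply]
  · have h3 := (h _ _).1 (h2 (U.symm y))
    rw [map_add, map_smul, LinearIsometryEquiv.apply_symm_apply] at h3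
    exact h3

/-- Unitarily equivalent operators are isospectral. -/
theorem isospectral_of_conj (U : H ≃ₗᵢ[𝕜] H')
    (h : ∀ x y, (x, y) ∈ T.graph ↔ (U x, U y) ∈ T'.graph) : Isospectral T T' := by
  have h' : ∀ x y, (x, y) ∈ T'.graph ↔ (U.symm x, U.symm y) ∈ T.graph := fun x y => by
    rw [h, LinearIsometryEquiv.apply_symm_apply, LinearIsometryEquiv.apply_symm_apply]
  refine ⟨congrArg compl ((resolventSet_subset_of_conj U h).antisymm
    (resolventSet_subset_of_conj U.symm h')), fun z => ?_⟩
  -- The eigenspaces live in different domains; embedded in the ambient spaces they correspond under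
  -- `U`, and injective maps preserve their dimension.
  have e : ((pmapEigenspace T z).map T.domain.subtype).map U.toLinearEquiv.toLinearMap =
      (pmapEigenspace T' z).map T'.domain.subtype := by
    ext y
    rw [map_pmapEigenspace, h', map_smul, Submodule.mem_map]
    constructor
    · rintro ⟨x, hx, rfl⟩
      rw [map_pmapEigenspace] at hx
      simpa using hx
    · intro hy
      exact ⟨U.symm y, (map_pmapEigenspace T z _).2 hy, by simp⟩
  have e1 := (Submodule.equivMapOfInjective T.domain.subtype (Submodule.injective_subtype _)
    (pmapEigenspace T z)).rank_eq
  have e2 := (Submodule.equivMapOfInjective T'.domain.subtype (Submodule.injective_subtype _)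
    (pmapEigenspace T' z)).rank_eq
  have e3 := (Submodule.equivMapOfInjective U.toLinearEquiv.toLinearMap U.injective
    ((pmapEigenspace T z).map T.domain.subtype)).rank_eq
  rw [e1, e2, e3, e]

end Isospectral

/-! ### The weighted Dirac operators -/

section WeightedOperators

variable {𝕜 : Type*} [RCLike 𝕜] {n : ℕ} {M : Type*} [TopologicalSpace M] [T2Space M] [CompactSpace M]
  [ChartedSpace (EuclideanSpace ℝ (Fin n)) M] [IsManifold (𝓡 n) ∞ M]
  [MeasurableSpace M] [BorelSpace M] {g : RMetric n M} {θ : SpinStructure g}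
  {S : Type*} [NormedAddCommGroup S] [InnerProductSpace 𝕜 S] [NormedSpace ℝ S]
  [IsScalarTower ℝ 𝕜 S] [FiniteDimensional 𝕜 S] [CompleteSpace S] {c : CliffordModule 𝕜 n S}
  {p : ℝ≥0∞} [Fact (1 ≤ p)] {Λ₁ Λ₂ : ℝ}

theorem mem_H1inL2_iff {φ : L2 θ c} : φ ∈ H1inL2 θ c ↔ ∃ η : H1 θ c, H1.incl θ c η = φ :=
  ⟨fun ⟨η, h1, h2⟩ => ⟨⟨η, h1⟩, h2⟩, fun ⟨η, h⟩ => ⟨η.1, η.2, h⟩⟩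

theorem eq_zero_of_inner_incl {φ : L2 θ c} (h : ∀ η : H1 θ c, inner 𝕜 φ (H1.incl θ c η) = 0) :
    φ = 0 :=
  (dense_range_incl c).eq_zero_of_inner_left 𝕜 fun _ ⟨η, hη⟩ => hη ▸ h η

/-- An element of `H¹` is a pair, so a derivative belonging to the zero section must be shown to
have no Dirac part. Symmetry and density do this, and they make `graphB` and `graphDTilde` single
valued. -/
theorem dirac_eq_zero {η : H1 θ c} (h : H1.incl θ c η = 0) : dirac θ c η = 0 :=
  eq_zero_of_inner_incl fun η' => by rw [← inner_dirac, h, inner_zero_left]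

namespace Embeddings

variable {q : ℝ≥0∞} [Fact (1 ≤ q)] [Fact (0 < Λ₁)]

theorem mem_graphDTilde_iff (J : Embeddings θ c p q)
    (A : admissible θ c p Λ₁ Λ₂) (hΛ : Λ₁ ≤ Λ₂) {φ χ : L2 θ c} : (φ, χ) ∈ graphDTilde A ↔
    ∃ η : H1 θ c, H1.incl θ c η = J.rootL2 A φ ∧ χ = J.rootL2 A (dirac θ c η) := by
  refine exists_congr fun η => and_congr ⟨fun h => Lp.ext (h.trans (J.rootL2_ae A hΛ φ).symm),
    fun h => ?_⟩ ⟨fun h => Lp.ext (h.trans (J.rootL2_ae A hΛ _).symm), fun h => ?_⟩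
  · exact h ▸ J.rootL2_ae A hΛ φ
  · exact h ▸ J.rootL2_ae A hΛ _

theorem mem_graphB_iff (J : Embeddings θ c p q)
    (A : admissible θ c p Λ₁ Λ₂) (hΛ : Λ₁ ≤ Λ₂) {φ χ : WeightedL2 A} : (φ, χ) ∈ graphB A ↔
    ∃ η : H1 θ c, H1.incl θ c η = WeightedL2.toL2 A φ ∧
      WeightedL2.toL2 A χ = J.rootL2 A (J.rootL2 A (dirac θ c η)) := by
  refine exists_congr fun η => and_congr_right fun _ =>
    ⟨fun h => Lp.ext (h.trans (J.rootL2_rootL2_ae A hΛ _).symm), fun h => ?_⟩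
  exact h ▸ J.rootL2_rootL2_ae A hΛ _

theorem isRoot (J : Embeddings θ c p q) (A : admissible θ c p Λ₁ Λ₂) (hΛ : Λ₁ ≤ Λ₂) :
    IsRoot (J.mulL2 A.1) (J.rootL2 A) where
  symm := (J.isBounded_mulL2 A).symm
  symm' := J.inner_rootL2 A hΛ
  comm := J.mulL2_rootL2_comm A
  inv := J.mulL2_rootL2_rootL2 A hΛ

theorem opDTilde_graph (J : Embeddings θ c p q)
    (A : admissible θ c p Λ₁ Λ₂) (hΛ : Λ₁ ≤ Λ₂) : (opDTilde A).graph = graphDTilde A := by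
  refine Submodule.toLinearPMap_graph_eq _ fun P hP h0 => ?_
  obtain ⟨η, h1, h2⟩ := (J.mem_graphDTilde_iff A hΛ).1 hP
  rw [h0, map_zero] at h1
  rw [h2, dirac_eq_zero h1, map_zero]

theorem opB_graph (J : Embeddings θ c p q)
    (A : admissible θ c p Λ₁ Λ₂) (hΛ : Λ₁ ≤ Λ₂) : (opB A).graph = graphB A := by
  refine Submodule.toLinearPMap_graph_eq _ fun P hP h0 => ?_
  obtain ⟨η, h1, h2⟩ := (J.mem_graphB_iff A hΛ).1 hP
  rw [h0, map_zero] at h1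
  rw [dirac_eq_zero h1, map_zero, map_zero] at h2
  exact (WeightedL2.toL2 A).map_eq_zero_iff.1 h2

theorem mem_domain_opB (J : Embeddings θ c p q)
    (A : admissible θ c p Λ₁ Λ₂) (hΛ : Λ₁ ≤ Λ₂) {φ : WeightedL2 A} :
    φ ∈ (opB A).domain ↔ ∃ η : H1 θ c, H1.incl θ c η = WeightedL2.toL2 A φ := by
  rw [LinearPMap.mem_domain_iff, J.opB_graph A hΛ]
  constructor
  · rintro ⟨χ, hχ⟩
    obtain ⟨η, h1, -⟩ := (J.mem_graphB_iff A hΛ).1 hχ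
    exact ⟨η, h1⟩
  · rintro ⟨η, h⟩
    exact ⟨(WeightedL2.toL2 A).symm (J.rootL2 A (J.rootL2 A (dirac θ c η))),
      (J.mem_graphB_iff A hΛ).2 ⟨η, h, LinearEquiv.apply_symm_apply _ _⟩⟩

theorem map_domain_opB (J : Embeddings θ c p q)
    (A : admissible θ c p Λ₁ Λ₂) (hΛ : Λ₁ ≤ Λ₂) :
    (opB A).domain.map (WeightedL2.toL2 A).toLinearMap = H1inL2 θ c := by
  ext φ
  rw [mem_H1inL2_iff, Submodule.mem_map]
  constructor
  · rintro ⟨ψ, hψ, rfl⟩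
    exact (J.mem_domain_opB A hΛ).1 hψ
  · intro h
    exact ⟨(WeightedL2.toL2 A).symm φ, (J.mem_domain_opB A hΛ).2 h, rfl⟩

theorem inner_weightedL2 (J : Embeddings θ c p q) (A : admissible θ c p Λ₁ Λ₂)
    (φ χ : WeightedL2 A) : inner 𝕜 φ χ =
      inner 𝕜 (J.mulL2 A.1 (WeightedL2.toL2 A φ)) (WeightedL2.toL2 A χ) :=
  (J.inner_mulL2 A _ _).symm

theorem dense_domain_opB (J : Embeddings θ c p q) (A : admissible θ c p Λ₁ Λ₂) (hΛ : Λ₁ ≤ Λ₂) :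
    Dense ((opB A).domain : Set (WeightedL2 A)) := by
  refine dense_of_inner_eq_zero fun x hx => ?_
  have h : J.mulL2 A.1 (WeightedL2.toL2 A x) = 0 := eq_zero_of_inner_incl fun η =>
    (J.inner_mulL2 A _ _).trans
      (hx ((WeightedL2.toL2 A).symm (H1.incl θ c η)) ((J.mem_domain_opB A hΛ).2 ⟨η, rfl⟩))
  exact (WeightedL2.toL2 A).map_eq_zero_iff.1 ((J.isRoot A hΛ).eq_zero h)

theorem opB_symm (J : Embeddings θ c p q) (A : admissible θ c p Λ₁ Λ₂) (hΛ : Λ₁ ≤ Λ₂)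
    (a b a' b' : WeightedL2 A) (h : (a, b) ∈ (opB A).graph) (h' : (a', b') ∈ (opB A).graph) :
    inner 𝕜 b a' = inner 𝕜 a b' := by
  rw [J.opB_graph A hΛ] at h h'
  obtain ⟨η, h1, h2⟩ := (J.mem_graphB_iff A hΛ).1 h
  obtain ⟨η', h1', h2'⟩ := (J.mem_graphB_iff A hΛ).1 h'
  have he : inner 𝕜 (dirac θ c η) (WeightedL2.toL2 A a') =
      inner 𝕜 (WeightedL2.toL2 A a) (dirac θ c η') :=
    h1 ▸ h1' ▸ (inner_dirac c η η').symm
  exact (J.inner_weightedL2 A b a').trans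
    (((J.isRoot A hΛ).inner_weighted_symm h2 h2' he).trans (J.inner_weightedL2 A a b').symm)

/-- A pair `(a', b')` in the adjoint graph for the weighted inner product says that `a'` is a weak
solution of `D a' = A b'`; regularity puts it in `H¹`. -/
theorem isSelfAdjoint_opB (J : Embeddings θ c p q)
    (A : admissible θ c p Λ₁ Λ₂) (hΛ : Λ₁ ≤ Λ₂) : IsSelfAdjoint (opB A) := by
  refine isSelfAdjoint_of_graph (J.dense_domain_opB A hΛ) (J.opB_symm A hΛ) fun a' b' h => ?_
  refine (J.mem_domain_opB A hΛ).2 ?_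
  refine mem_range_incl_of_weak c (χ := J.mulL2 A.1 (WeightedL2.toL2 A b')) fun η => ?_
  have h1 := h ((WeightedL2.toL2 A).symm (H1.incl θ c η))
    ((WeightedL2.toL2 A).symm (J.rootL2 A (J.rootL2 A (dirac θ c η))))
    ((J.opB_graph A hΛ).symm ▸ (J.mem_graphB_iff A hΛ).2 ⟨η, rfl, rfl⟩)
  exact (J.isRoot A hΛ).inner_weighted
    ((J.inner_weightedL2 A _ a').symm.trans (h1.trans (J.inner_weightedL2 A _ b')))

/-- The unitary map `ψ ↦ A^{1/2} ψ` from `ℋ_A` to `L²`. -/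
def conjugation (J : Embeddings θ c p q)
    (A : admissible θ c p Λ₁ Λ₂) (hΛ : Λ₁ ≤ Λ₂) : WeightedL2 A ≃ₗᵢ[𝕜] L2 θ c :=
  LinearEquiv.isometryOfInner
    (LinearEquiv.ofLinearMap
      ((J.mulL2 A.1).toLinearMap ∘ₗ (J.rootL2 A).toLinearMap ∘ₗ (WeightedL2.toL2 A).toLinearMap)
      ((WeightedL2.toL2 A).symm.toLinearMap ∘ₗ (J.rootL2 A).toLinearMap)
      (LinearMap.ext fun φ => J.mulL2_rootL2_rootL2 A hΛ φ)
      (LinearMap.ext fun φ => (J.isRoot A hΛ).inv' (WeightedL2.toL2 A φ)))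
    fun φ χ => ((J.isRoot A hΛ).inner_apply (WeightedL2.toL2 A φ) (WeightedL2.toL2 A χ)).trans
      (J.inner_mulL2 A _ _)

variable [ENNReal.HolderTriple p q 2]

theorem domain_opDTilde (J : Embeddings θ c p q)
    (A : admissible θ c p Λ₁ Λ₂) (hΛ : Λ₁ ≤ Λ₂) : (opDTilde A).domain = H1inL2 θ c := by
  ext φ
  rw [LinearPMap.mem_domain_iff, J.opDTilde_graph A hΛ, mem_H1inL2_iff]
  constructor
  · rintro ⟨χ, hχ⟩
    obtain ⟨η, h, -⟩ := (J.mem_graphDTilde_iff A hΛ).1 hχ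
    -- Since `η = A^{-1/2} φ`, the section `φ = A · A^{-1/2} η` lies in `H¹`, because both
    -- multiplications preserve it.
    refine ⟨J.mulH1 A.1 (J.rootH1 A η), ?_⟩
    rw [J.incl_mulH1, J.incl_rootH1 A hΛ, h, J.mulL2_rootL2_rootL2 A hΛ]
  · rintro ⟨η, rfl⟩
    exact ⟨_, (J.mem_graphDTilde_iff A hΛ).2 ⟨J.rootH1 A η, J.incl_rootH1 A hΛ η, rfl⟩⟩

theorem isSelfAdjoint_opDTilde (J : Embeddings θ c p q)
    (A : admissible θ c p Λ₁ Λ₂) (hΛ : Λ₁ ≤ Λ₂) : IsSelfAdjoint (opDTilde A) := by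
  refine isSelfAdjoint_of_graph (dense_of_inner_eq_zero fun x hx => ?_) ?_ ?_
  · rw [J.domain_opDTilde A hΛ] at hx
    exact eq_zero_of_inner_incl fun η => hx _ (mem_H1inL2_iff.2 ⟨η, rfl⟩)
  · intro a b a' b' h h'
    rw [J.opDTilde_graph A hΛ] at h h'
    obtain ⟨η, h1, rfl⟩ := (J.mem_graphDTilde_iff A hΛ).1 h
    obtain ⟨η', h1', rfl⟩ := (J.mem_graphDTilde_iff A hΛ).1 h'
    refine (J.isRoot A hΛ).inner_symm ?_
    rw [← h1, ← h1', inner_dirac]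
  · intro a' b' h
    -- Testing the adjoint relation with `A^{1/2} η` shows that `A^{-1/2} a'` is a weak solution
    -- with right-hand side `A^{1/2} b'`.
    have hw : J.rootL2 A a' ∈ LinearMap.range (H1.incl θ c).toLinearMap := by
      refine mem_range_incl_of_weak c (χ := J.mulL2 A.1 (J.rootL2 A b')) fun η => ?_
      have h1 := h (J.mulL2 A.1 (J.rootL2 A (H1.incl θ c η))) (J.rootL2 A (dirac θ c η)) (by
        rw [J.opDTilde_graph A hΛ]
        exact (J.mem_graphDTilde_iff A hΛ).2 ⟨η, ((J.isRoot A hΛ).inv' _).symm, rfl⟩)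
      exact (J.isRoot A hΛ).inner_left h1
    obtain ⟨η, hη⟩ := hw
    exact LinearPMap.mem_domain_iff.2 ⟨J.rootL2 A (dirac θ c η), by
      rw [J.opDTilde_graph A hΛ]
      exact (J.mem_graphDTilde_iff A hΛ).2 ⟨η, hη, rfl⟩⟩

theorem mem_graph_conj (J : Embeddings θ c p q)
    (A : admissible θ c p Λ₁ Λ₂) (hΛ : Λ₁ ≤ Λ₂) (φ χ : L2 θ c) : (φ, χ) ∈ (opDTilde A).graph ↔
    ((J.conjugation A hΛ).symm φ, (J.conjugation A hΛ).symm χ) ∈ (opB A).graph := by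
  rw [J.opDTilde_graph A hΛ, J.opB_graph A hΛ, J.mem_graphDTilde_iff A hΛ, J.mem_graphB_iff A hΛ]
  refine exists_congr fun η => and_congr_right fun _ => ?_
  change χ = _ ↔ J.rootL2 A χ = J.rootL2 A (J.rootL2 A (dirac θ c η))
  refine ⟨fun h => congrArg _ h, fun h => ?_⟩
  rw [← J.mulL2_rootL2_rootL2 A hΛ χ, h, J.mulL2_rootL2_comm, (J.isRoot A hΛ).inv']

/-- `A^{-1/2} D A^{-1/2}` as a bounded operator from `H¹` to `L²`. -/
def bounded (J : Embeddings θ c p q) (A : admissible θ c p Λ₁ Λ₂) : H1 θ c →L[𝕜] L2 θ c := ((J.rootL2 A).comp (dirac θ c)).comp (J.rootH1 A)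

theorem mem_graph_bounded (J : Embeddings θ c p q)
    (A : admissible θ c p Λ₁ Λ₂) (hΛ : Λ₁ ≤ Λ₂) (ψ : H1 θ c) :
    (H1.incl θ c ψ, J.bounded A ψ) ∈ (opDTilde A).graph := by
  rw [J.opDTilde_graph A hΛ]
  exact (J.mem_graphDTilde_iff A hΛ).2 ⟨J.rootH1 A ψ, J.incl_rootH1 A hΛ ψ, rfl⟩

theorem continuous_bounded (J : Embeddings θ c p q) (hΛ : Λ₁ ≤ Λ₂) :
    Continuous fun A : admissible θ c p Λ₁ Λ₂ => J.bounded A :=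
  ((J.continuous_rootL2 hΛ).clm_comp continuous_const).clm_comp (J.continuous_rootH1 hΛ)

end Embeddings

end WeightedOperators

end

end WeightedDirac

theorem mainTheorem4 {𝕜 : Type*} [RCLike 𝕜] {n : ℕ} (hn : 2 ≤ n)
    {M : Type*} [TopologicalSpace M] [T2Space M] [CompactSpace M]
    [ChartedSpace (EuclideanSpace ℝ (Fin n)) M] [IsManifold (𝓡 n) ∞ M]
    [MeasurableSpace M] [BorelSpace M] (g : RMetric n M) (θ : SpinStructure g)
    {S : Type*} [NormedAddCommGroup S] [InnerProductSpace 𝕜 S] [NormedSpace ℝ S]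
    [IsScalarTower ℝ 𝕜 S] [FiniteDimensional 𝕜 S] [CompleteSpace S] (c : CliffordModule 𝕜 n S)
    (p : ℝ≥0∞) [Fact (1 ≤ p)] (hnp : (n : ℝ≥0∞) < p) (hp : p ≠ ⊤)
    (Λ₁ Λ₂ : ℝ) [Fact (0 < Λ₁)] (hΛ : Λ₁ ≤ Λ₂) :
    (∀ A : admissible θ c p Λ₁ Λ₂,
      -- the conjugation by `A^{1/2}`
      ((opB A).graph = graphB A ∧ (opDTilde A).graph = graphDTilde A ∧
        (opB A).domain.map (WeightedL2.toL2 A).toLinearMap = H1inL2 θ c ∧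
        (opDTilde A).domain = H1inL2 θ c ∧
        ∃ U : WeightedL2 A ≃ₗᵢ[𝕜] L2 θ c,
          (∀ ψ : WeightedL2 A, U ψ =ᵐ[riemannianVolume g]
            fun x => sqrtField A x (WeightedL2.toL2 A ψ x)) ∧
          (∀ φ : L2 θ c, WeightedL2.toL2 A (U.symm φ) =ᵐ[riemannianVolume g]
            fun x => invSqrtField A x (φ x)) ∧
          ∀ φ χ : L2 θ c,
            (φ, χ) ∈ (opDTilde A).graph ↔ (U.symm φ, U.symm χ) ∈ (opB A).graph) ∧
      -- self-adjointness and isospectrality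
      (IsSelfAdjoint (opDTilde A) ∧ (opDTilde A).IsClosed ∧
        Dense ((opDTilde A).domain : Set (L2 θ c)) ∧
        IsSelfAdjoint (opB A) ∧ Isospectral (opB A) (opDTilde A))) ∧
    -- continuity in the operator norm
    ∃ T : admissible θ c p Λ₁ Λ₂ → (H1 θ c →L[𝕜] L2 θ c),
      (∀ A ψ, (H1.incl θ c ψ, T A ψ) ∈ (opDTilde A).graph) ∧
      (∀ (I : Set ℝ) (_ : I.OrdConnected) (A : I → admissible θ c p Λ₁ Λ₂),
        Continuous A → Continuous fun t => T (A t)) ∧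
      Continuous T := by
  -- The embeddings depend on the geometry and on `p` only, so a single choice serves all weights,
  -- which the continuity in `A` requires.
  obtain ⟨q, _, _, ⟨J⟩⟩ := exists_embeddings (θ := θ) c hn hnp hp
  refine ⟨fun A => ⟨⟨J.opB_graph A hΛ, J.opDTilde_graph A hΛ, J.map_domain_opB A hΛ,
    J.domain_opDTilde A hΛ, J.conjugation A hΛ, fun ψ => J.mulL2_rootL2_ae A hΛ _,
    fun φ => J.rootL2_ae A hΛ φ, J.mem_graph_conj A hΛ⟩, ?_⟩,
    fun A => J.bounded A, fun A ψ => J.mem_graph_bounded A hΛ ψ,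
    fun I _ A hA => (J.continuous_bounded hΛ).comp hA, J.continuous_bounded hΛ⟩
  have h := J.isSelfAdjoint_opDTilde A hΛ
  refine ⟨h, h.isClosed, h.dense_domain, J.isSelfAdjoint_opB A hΛ,
    isospectral_of_conj (J.conjugation A hΛ) fun x y => ?_⟩
  rw [J.mem_graph_conj A hΛ, LinearIsometryEquiv.symm_apply_apply,
    LinearIsometryEquiv.symm_apply_apply]
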